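/- **Setting.** All manifolds are smooth, finite-dimensional, Hausdorff and $\sigma$-compact, without boundary; all vector bundles are smooth, real, of finite constant rank. Let $(D;A,B;M)$ be a double vector bundle: vector bundles $A\to M$, $B\to M$, and one manifold $D$ with two vector bundle structures $D\to A$ and $D\to B$ such that the projection of $D\to B$ is a morphism from $D\to A$ to $B\to M$, the projection of $D\to A$ is a morphism from $D\to B$ to $A\to M$, and the additions $+_A,+_B$ and the scalar multiplications of the two structures satisfy the interchange laws. Its core is the vector bundle $C\to M$ of points $\bar c\in D$ projecting to zeros in both $A$ and $B$. Sections of $D\to A$: for $c\in\Gamma(C)$ the core section is $c^\dagger(a_m)=\tilde 0_{a_m}+_B\overline{c(m)}$, with $\tilde 0_{a}$ the zero of $D\to A$ over $a$; a section is linear over $b\in\Gamma(B)$ if it is a vector bundle morphism from $A\to M$ to $D\to B$ over $b\colon M\to B$. A *VB-algebroid structure* on $(D\to A;B\to M)$ consists of Lie algebroid structures on $D\to A$ and on $B\to M$ such that the anchor of $D\to A$ sends sections linear over $b$ to linear vector fields on $A$ over $\rho_B(b)$ and core sections to vertical lifts of sections of $A$, and such that the bracket of sections linear over $b_1,b_2$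 is linear over $[b_1,b_2]$, that of a linear and a core section is a core section, and that of two core sections is $0$. Exchange $A$ and $B$ for $(D\to B;A\to M)$. A *linear splitting* is a morphism of double vector bundles $\Sigma\colon A\times_MB\to D$ over the identities of $A$ and $B$; it defines the linear sections $\sigma_B(b)(a_m)=\Sigma(a_m,b(m))$ of $D\to A$ and $\sigma_A(a)(b_m)=\Sigma(a(m),b_m)$ of $D\to B$. A *2-representation* of a Lie algebroid $L$ on a complex $\partial\colon E_0\to E_1$ consists of $L$-connections $\nabla$ on $E_0$ and $E_1$ and $R\in\Omega^2(L,\operatorname{Hom}(E_1,E_0))$ with $\partial\nabla=\nabla\partial$, with curvatures $R\circ\partial$ on $E_0$ and $\partial\circ R$ on $E_1$, and with $d_{\nabla^{\mathrm{Hom}}}R=0$. It is *induced* by the VB-algebroid $(D\to A;B\to M)$ and $\Sigma$, with $L=B$ and $\partial=\partial_A\colon C\to A$, if, with $\rho$ the anchor of $D\to A$, $$\rho(c^\dagger)=(\partial_Ac)^\uparrow,\quad \rho(\sigma_B(b))=\widehat{\nabla_b},\quad [\sigma_B(b),c^\dagger]=(\nabla_bc)^\dagger,\quad [\sigma_B(b_1),\sigma_B(b_2)]=\sigma_B([b_1,b_2])-\widetilde{R_B(b_1,b_2)}.$$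 Here $s^\uparrow$ is the vertical lift of a section $s$ of a vector bundle $V$; $\widehat{\mathcal D}$ is the linear vector field on $V$ of a derivation $\mathcal D$ of $\Gamma(V)$ with symbol $Y$, given by $\widehat{\mathcal D}(q^*f)=q^*(Yf)$ and $\widehat{\mathcal D}(\ell_\varepsilon)=\ell_{\mathcal D^*\varepsilon}$ with $\langle\mathcal D^*\varepsilon,s\rangle=Y\langle\varepsilon,s\rangle-\langle\varepsilon,\mathcal Ds\rangle$; and $\tilde\phi(a)=\tilde0_a+_B\overline{\phi(a)}$ for $\phi\in\Gamma(\operatorname{Hom}(A,C))$. Exchanging the roles of $A$ and $B$, a 2-representation of $A$ on $\partial_B\colon C\to B$ is induced by $(D\to B;A\to M)$ and $\Sigma$. *Double Lie algebroids.* Let $D^*A$ be the dual of $D\to A$. It is also a vector bundle over $C^*$, with projection $\Phi\mapsto(c\mapsto\Phi(\tilde0_a+_B\bar c))$ for $\Phi$ over $a\in A$, and sum given by $(\Phi_1+\Phi_2)(d_1+_Bd_2)=\Phi_1(d_1)+\Phi_2(d_2)$ for $d_1,d_2$ over the same point of $B$; let $D^*A^*C^*\to C^*$ be its dual. Similarly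 for $D^*B$ and $D^*B^*C^*$, the core point then being added with $+_A$ to the zero of $D\to B$. The Lie–Poisson structure on $D^*A$ of the Lie algebroid $D\to A$ is also linear over $C^*$, so it makes $D^*A^*C^*\to C^*$ a Lie algebroid; likewise $D^*B^*C^*$. The pairing $\langle\langle\Phi,\Psi\rangle\rangle=\Phi(d)-\Psi(d)$ of $\Phi\in D^*A$ over $a$ and $\Psi\in D^*B$ over $b$, with the same projection to $C^*$, where $d\in D$ is any point over $a$ and $b$, puts $D^*A^*C^*$ and $D^*B^*C^*$ in duality: if $g=-\langle\langle\Phi,\cdot\rangle\rangle$ on the fibre of $D^*B$ over the projection of $\Phi$, then $f$ and $g$ pair to $f(\Phi)$. Given VB-algebroid structures on $(D\to A;B\to M)$ and $(D\to B;A\to M)$, $D$ is a *double Lie algebroid* if $(D^*A^*C^*,D^*B^*C^*)$ is a Lie bialgebroid. Here two Lie algebroids $(L,L^*)$ in duality form a Lie bialgebroid if $d_{L^*}[x,y]=[d_{L^*}x,y]+[x,d_{L^*}y]$ (Schouten brackets) for all $x,y\in\Gamma(L)$. **Theorem.** Let $(D;A,B;M)$ be a double vector bundle with core $C$, with $\operatorname{rank}A+\operatorname{rank}B\neq1$,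 and with VB-algebroid structures on both $(D\to A;B\to M)$ and $(D\to B;A\to M)$ (inducing the given Lie algebroid structures on $A$ and $B$), and let $\Sigma$ be a linear splitting. Then each of the two VB-algebroids, with $\Sigma$, induces exactly one 2-representation: $(\nabla,\nabla,R_A)$ of $A$ on $\partial_B\colon C\to B$ and $(\nabla,\nabla,R_B)$ of $B$ on $\partial_A\colon C\to A$. Moreover $D$ is a double Lie algebroid if and only if these form a matched pair, that is, for all $a,a_1,a_2\in\Gamma(A)$, $b,b_1,b_2\in\Gamma(B)$, $c,c_1,c_2\in\Gamma(C)$: * (M1) $\rho_A\circ\partial_A=\rho_B\circ\partial_B$; * (M2) $\nabla_{\partial_Ac_1}c_2-\nabla_{\partial_Bc_2}c_1=-\nabla_{\partial_Ac_2}c_1+\nabla_{\partial_Bc_1}c_2$; * (M3) $[a,\partial_Ac]=\partial_A(\nabla_ac)-\nabla_{\partial_Bc}a$; * (M4) $[b,\partial_Bc]=\partial_B(\nabla_bc)-\nabla_{\partial_Ac}b$; * (M5) $[\rho_A(a),\rho_B(b)]=\rho_B(\nabla_ab)-\rho_A(\nabla_ba)$; * (M6) $\nabla_b\nabla_ac-\nabla_a\nabla_bc-\nabla_{\nabla_ba}c+\nabla_{\nabla_ab}c=R_B(b,\partial_Bc)a-R_A(a,\partial_Ac)b$;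 * (M7) $\partial_A(R_A(a_1,a_2)b)=-\nabla_b[a_1,a_2]+[\nabla_ba_1,a_2]+[a_1,\nabla_ba_2]+\nabla_{\nabla_{a_2}b}a_1-\nabla_{\nabla_{a_1}b}a_2$; * (M8) $\partial_B(R_B(b_1,b_2)a)=-\nabla_a[b_1,b_2]+[\nabla_ab_1,b_2]+[b_1,\nabla_ab_2]+\nabla_{\nabla_{b_2}a}b_1-\nabla_{\nabla_{b_1}a}b_2$; * (M9) $d_{\nabla^A}R_B=d_{\nabla^B}R_A$ in $\Omega^2(A,\wedge^2B^*\otimes C)=\Omega^2(B,\wedge^2A^*\otimes C)$, where $R_B$ is seen in $\Omega^1(A,\wedge^2B^*\otimes C)$, $R_A$ in $\Omega^1(B,\wedge^2A^*\otimes C)$, and $\nabla^A$, $\nabla^B$ are the induced connections on $\wedge^2B^*\otimes C$, $\wedge^2A^*\otimes C$. Explicitly, with $(\nabla_{a_1}R_B)(b_1,b_2)a_2:=\nabla_{a_1}(R_B(b_1,b_2)a_2)-R_B(\nabla_{a_1}b_1,b_2)a_2-R_B(b_1,\nabla_{a_1}b_2)a_2$ and likewise for $(\nabla_{b_1}R_A)(a_1,a_2)b_2$,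 $$(\nabla_{a_1}R_B)(b_1,b_2)a_2-(\nabla_{a_2}R_B)(b_1,b_2)a_1-R_B(b_1,b_2)[a_1,a_2]=(\nabla_{b_1}R_A)(a_1,a_2)b_2-(\nabla_{b_2}R_A)(a_1,a_2)b_1-R_A(a_1,a_2)[b_1,b_2].$$ -/

import Mathlib

open Bundle
open scoped Manifold ContDiff

noncomputable section

namespace DoubleLie

/-! ## Lie algebroids, 2-representations, matched pairs, Lie bialgebroids, on modules of sections -/

/-- A Lie algebroid structure on a vector bundle `V → N`, where `R = C^∞(N)` and `X = Γ(V)`: a Lie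
bracket on sections, together with an anchor `Γ(V) → 𝔛(N)` (vector fields being derivations of
`C^∞(N)`) which is `C^∞(N)`-linear, i.e. comes from a bundle map `V → TN`, satisfying the Leibniz
rule. -/
structure LieAlgebroid (R X : Type*) [CommRing R] [Algebra ℝ R] [AddCommGroup X] [Module R X] where
  anchor : X →ₗ[R] Derivation ℝ R R
  bracket : X → X → X
  bracket_add : ∀ x y z, bracket x (y + z) = bracket x y + bracket x z
  add_bracket : ∀ x y z, bracket (x + y) z = bracket x z + bracket y z
  bracket_self : ∀ x, bracket x x = 0
  jacobi : ∀ x y z,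
    bracket x (bracket y z) + bracket y (bracket z x) + bracket z (bracket x y) = 0
  leibniz : ∀ x (f : R) y, bracket x (f • y) = f • bracket x y + anchor x f • y
  anchor_bracket : ∀ x y (f : R),
    anchor (bracket x y) f = anchor x (anchor y f) - anchor y (anchor x f)

section Algebra

variable {R : Type*} [CommRing R] [Algebra ℝ R]
  {X Y V W : Type*} [AddCommGroup X] [Module R X] [AddCommGroup Y] [Module R Y]
  [AddCommGroup V] [Module R V] [AddCommGroup W] [Module R W]

/-- A linear connection `∇ : Γ(A) × Γ(E) → Γ(E)` of a Lie algebroid `A` on a vector bundle `E`, with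
`X = Γ(A)` and `V = Γ(E)`. -/
structure Connection (L : LieAlgebroid R X) (V : Type*) [AddCommGroup V] [Module R V] where
  nabla : X → V → V
  add_left : ∀ x y v, nabla (x + y) v = nabla x v + nabla y v
  smul_left : ∀ (f : R) x v, nabla (f • x) v = f • nabla x v
  add_right : ∀ x v w, nabla x (v + w) = nabla x v + nabla x w
  leibniz : ∀ x (f : R) v, nabla x (f • v) = f • nabla x v + L.anchor x f • v

/-- A 2-representation (2-term representation up to homotopy) of a Lie algebroid `A` on a complex
`∂ : E₀ → E₁`, with `X = Γ(A)`, `V = Γ(E₀)`, `W = Γ(E₁)`. Bundle maps and forms are given by their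
action on sections: `curv` is the form `R ∈ Ω²(A, Hom(E₁, E₀))`. -/
structure TwoRep (L : LieAlgebroid R X) (V W : Type*) [AddCommGroup V] [Module R V]
    [AddCommGroup W] [Module R W] where
  bd : V →ₗ[R] W
  nabla₀ : Connection L V
  nabla₁ : Connection L W
  curv : X →ₗ[R] X →ₗ[R] W →ₗ[R] V
  curv_self : ∀ x, curv x x = 0
  bd_nabla : ∀ x v, bd (nabla₀.nabla x v) = nabla₁.nabla x (bd v)
  /-- the curvature of `∇⁰` is `R ∘ ∂` -/
  curvature₀ : ∀ x y v,
    nabla₀.nabla x (nabla₀.nabla y v) - nabla₀.nabla y (nabla₀.nabla x v)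
      - nabla₀.nabla (L.bracket x y) v = curv x y (bd v)
  /-- the curvature of `∇¹` is `∂ ∘ R` -/
  curvature₁ : ∀ x y w,
    nabla₁.nabla x (nabla₁.nabla y w) - nabla₁.nabla y (nabla₁.nabla x w)
      - nabla₁.nabla (L.bracket x y) w = bd (curv x y w)
  /-- `d_{∇^Hom} R = 0` (Koszul formula), where
  `(∇^Hom_x φ)(w) = ∇⁰_x (φ w) - φ (∇¹_x w)` -/
  bianchi : ∀ x y z w,
    - curv (L.bracket x y) z w + curv (L.bracket x z) y w - curv (L.bracket y z) x w
      + (nabla₀.nabla x (curv y z w) - curv y z (nabla₁.nabla x w))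
      - (nabla₀.nabla y (curv x z w) - curv x z (nabla₁.nabla y w))
      + (nabla₀.nabla z (curv x y w) - curv x y (nabla₁.nabla z w)) = 0

/-- Matched pairs of 2-representations: `X = Γ(A)`, `Y = Γ(B)`, `V = Γ(C)`; `S` is a
2-representation of `A` on `∂_B : C → B` and `T` is a 2-representation of `B` on `∂_A : C → A`. -/
structure IsMatchedPair {LA : LieAlgebroid R X} {LB : LieAlgebroid R Y}
    (S : TwoRep LA V Y) (T : TwoRep LB V X) : Prop where
  m1 : ∀ c, LA.anchor (T.bd c) = LB.anchor (S.bd c)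
  m2 : ∀ c₁ c₂,
    S.nabla₀.nabla (T.bd c₁) c₂ - T.nabla₀.nabla (S.bd c₂) c₁
      = - S.nabla₀.nabla (T.bd c₂) c₁ + T.nabla₀.nabla (S.bd c₁) c₂
  m3 : ∀ a c,
    LA.bracket a (T.bd c) = T.bd (S.nabla₀.nabla a c) - T.nabla₁.nabla (S.bd c) a
  m4 : ∀ b c,
    LB.bracket b (S.bd c) = S.bd (T.nabla₀.nabla b c) - S.nabla₁.nabla (T.bd c) b
  m5 : ∀ a b (f : R),
    LA.anchor a (LB.anchor b f) - LB.anchor b (LA.anchor a f)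
      = LB.anchor (S.nabla₁.nabla a b) f - LA.anchor (T.nabla₁.nabla b a) f
  m6 : ∀ a b c,
    T.nabla₀.nabla b (S.nabla₀.nabla a c) - S.nabla₀.nabla a (T.nabla₀.nabla b c)
      - S.nabla₀.nabla (T.nabla₁.nabla b a) c + T.nabla₀.nabla (S.nabla₁.nabla a b) c
      = T.curv b (S.bd c) a - S.curv a (T.bd c) b
  m7 : ∀ a₁ a₂ b,
    T.bd (S.curv a₁ a₂ b)
      = - T.nabla₁.nabla b (LA.bracket a₁ a₂) + LA.bracket (T.nabla₁.nabla b a₁) a₂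
        + LA.bracket a₁ (T.nabla₁.nabla b a₂)
        + T.nabla₁.nabla (S.nabla₁.nabla a₂ b) a₁ - T.nabla₁.nabla (S.nabla₁.nabla a₁ b) a₂
  m8 : ∀ b₁ b₂ a,
    S.bd (T.curv b₁ b₂ a)
      = - S.nabla₁.nabla a (LB.bracket b₁ b₂) + LB.bracket (S.nabla₁.nabla a b₁) b₂
        + LB.bracket b₁ (S.nabla₁.nabla a b₂)
        + S.nabla₁.nabla (T.nabla₁.nabla b₂ a) b₁ - S.nabla₁.nabla (T.nabla₁.nabla b₁ a) b₂
  /-- `d_{∇^A} R_B = d_{∇^B} R_A`, evaluated on `a₁, a₂, b₁, b₂` -/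
  m9 : ∀ a₁ a₂ b₁ b₂,
    (S.nabla₀.nabla a₁ (T.curv b₁ b₂ a₂) - T.curv (S.nabla₁.nabla a₁ b₁) b₂ a₂
        - T.curv b₁ (S.nabla₁.nabla a₁ b₂) a₂)
      - (S.nabla₀.nabla a₂ (T.curv b₁ b₂ a₁) - T.curv (S.nabla₁.nabla a₂ b₁) b₂ a₁
        - T.curv b₁ (S.nabla₁.nabla a₂ b₂) a₁)
      - T.curv b₁ b₂ (LA.bracket a₁ a₂)
      = (T.nabla₀.nabla b₁ (S.curv a₁ a₂ b₂) - S.curv (T.nabla₁.nabla b₁ a₁) a₂ b₂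
        - S.curv a₁ (T.nabla₁.nabla b₁ a₂) b₂)
      - (T.nabla₀.nabla b₂ (S.curv a₁ a₂ b₁) - S.curv (T.nabla₁.nabla b₂ a₁) a₂ b₁
        - S.curv a₁ (T.nabla₁.nabla b₂ a₂) b₁)
      - S.curv a₁ a₂ (LB.bracket b₁ b₂)

/-- A pair of vector bundles in duality is given by a perfect pairing `p` of their sections
`X = Γ(A)` and `Y = Γ(A^*)`. The Lie derivative `ℒ_a α ∈ Γ(A^*)` is determined by
`⟨ℒ_a α, a'⟩ = ρ(a)⟨α, a'⟩ - ⟨α, [a, a']⟩`. -/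
def IsLieDerivative (L : LieAlgebroid R X) (p : X →ₗ[R] Y →ₗ[R] R) (a : X) (α β : Y) : Prop :=
  ∀ a', p a' β = L.anchor a (p a' α) - p (L.bracket a a') α

theorem exists_lieDerivative (L : LieAlgebroid R X) (p : X →ₗ[R] Y →ₗ[R] R) (hp : p.IsPerfPair)
    (a : X) (α : Y) : ∃ β, IsLieDerivative L p a α β := by
  let φ : Module.Dual R X :=
    { toFun := fun a' => L.anchor a (p a' α) - p (L.bracket a a') α
      map_add' := by
        intro x y
        simp only [map_add, LinearMap.add_apply, L.bracket_add]
        abel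
      map_smul' := by
        intro f x
        simp only [map_smul, LinearMap.smul_apply, L.leibniz, map_add, LinearMap.add_apply,
          smul_eq_mul, Derivation.leibniz, RingHom.id_apply]
        ring }
  obtain ⟨β, hβ⟩ := hp.bijective_right.2 φ
  exact ⟨β, fun a' => congrArg (fun ψ : Module.Dual R X => ψ a') hβ⟩

/-- The Lie derivative `ℒ_a α ∈ Γ(A^*)`. -/
def lieDerivative (L : LieAlgebroid R X) (p : X →ₗ[R] Y →ₗ[R] R) (hp : p.IsPerfPair)
    (a : X) (α : Y) : Y :=
  (exists_lieDerivative L p hp a α).choose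

/-- The 2-form `d a` on `Γ(A^*)`, for `a ∈ Γ(A)` and `d` the differential of the Lie algebroid
`A^*`. -/
def dualDifferential (L' : LieAlgebroid R Y) (p : X →ₗ[R] Y →ₗ[R] R) (a : X) (α₁ α₂ : Y) : R :=
  L'.anchor α₁ (p a α₂) - L'.anchor α₂ (p a α₁) - p a (L'.bracket α₁ α₂)

/-- The Schouten bracket `[a, P]` of `a ∈ Γ(A)` with a bivector field `P ∈ Γ(Λ² A)`, the latter
seen as a 2-form on `Γ(A^*)`. -/
def schouten (L : LieAlgebroid R X) (p : X →ₗ[R] Y →ₗ[R] R) (hp : p.IsPerfPair)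
    (a : X) (P : Y → Y → R) (α₁ α₂ : Y) : R :=
  L.anchor a (P α₁ α₂) - P (lieDerivative L p hp a α₁) α₂ - P α₁ (lieDerivative L p hp a α₂)

/-- Lie bialgebroids `(A, A^*)`, with `X = Γ(A)`, `Y = Γ(A^*)` in duality through `p`:
`d[a₁, a₂] = [d a₁, a₂] + [a₁, d a₂]` for all `a₁, a₂ ∈ Γ(A)`, where `[d a₁, a₂] = -[a₂, d a₁]`. -/
def IsLieBialgebroid (L : LieAlgebroid R X) (L' : LieAlgebroid R Y)
    (p : X →ₗ[R] Y →ₗ[R] R) : Prop :=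
  ∃ hp : p.IsPerfPair, ∀ a₁ a₂ α₁ α₂,
    dualDifferential L' p (L.bracket a₁ a₂) α₁ α₂
      = - schouten L p hp a₂ (dualDifferential L' p a₁) α₁ α₂
        + schouten L p hp a₁ (dualDifferential L' p a₂) α₁ α₂

/-- A Poisson bracket on a manifold `N`, with `R = C^∞(N)`. -/
structure PoissonBracket (R : Type*) [CommRing R] [Algebra ℝ R] where
  bracket : R →ₗ[ℝ] R →ₗ[ℝ] R
  bracket_self : ∀ f, bracket f f = 0
  jacobi : ∀ f g h,
    bracket f (bracket g h) + bracket g (bracket h f) + bracket h (bracket f g) = 0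
  leibniz : ∀ f g h, bracket f (g * h) = bracket f g * h + g * bracket f h

end Algebra

/-! ## Smooth functions, sections and duals of a smooth vector bundle -/

section VectorBundle

variable {EN HN N : Type*} [NormedAddCommGroup EN] [NormedSpace ℝ EN] [TopologicalSpace HN]
  (J : ModelWithCorners ℝ EN HN) [TopologicalSpace N] [ChartedSpace HN N]
  (F : Type*) [NormedAddCommGroup F] [NormedSpace ℝ F]
  (V : N → Type*) [TopologicalSpace (TotalSpace F V)] [∀ x, TopologicalSpace (V x)]
  [FiberBundle F V]

/-- `C^∞(N)` -/
abbrev Fn (N : Type*) [TopologicalSpace N] [ChartedSpace HN N] : Type _ := C^∞⟮J, N; ℝ⟯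

/-- `Γ(V)` -/
abbrev Sec : Type _ := Cₛ^∞⟮J; F, V⟯

/-- `C^∞(V)`, the smooth functions on the total space of a vector bundle. -/
abbrev FnTot : Type _ := Fn (J.prod 𝓘(ℝ, F)) (TotalSpace F V)

variable {J F V}

/-- The pullback `q^* f` of a function along the projection `q : V → N`. -/
def pull (f : Fn J N) : FnTot J F V :=
  ⟨fun v => f v.proj, f.contMDiff.comp (contMDiff_proj V)⟩

/-- The function `F ∘ s` on `N`, for a function `F` on `V` and a section `s` of `V`. -/
def compSec (G : FnTot J F V) (s : Sec J F V) : Fn J N :=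
  ⟨fun x => G ⟨x, s x⟩, G.contMDiff.comp s.contMDiff⟩

variable [∀ x, AddCommGroup (V x)] [∀ x, Module ℝ (V x)] [VectorBundle ℝ F V]

/-- The `C^∞(N)`-module structure of `Γ(V)`. -/
instance : SMul (Fn J N) (Sec J F V) :=
  ⟨fun f s => ⟨fun x => f x • s x, ContMDiff.smul_section f.contMDiff s.contMDiff⟩⟩

@[simp] theorem Sec.smul_apply (f : Fn J N) (s : Sec J F V) (x : N) : (f • s) x = f x • s x := rfl

instance : Module (Fn J N) (Sec J F V) where
  one_smul s := by ext x; simp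
  mul_smul f g s := by ext x; simp [mul_smul]
  smul_zero f := by ext x; simp
  smul_add f s t := by ext x; simp
  add_smul f g s := by ext x; simp [add_smul]
  zero_smul s := by ext x; simp

/-- A function on `V` which is linear on the fibres; such functions are the `ℓ_ε`, `ε ∈ Γ(V^*)`. -/
def FibreLinear (G : FnTot J F V) : Prop :=
  ∀ x, IsLinearMap ℝ fun v : V x => G ⟨x, v⟩

/-- The vector field `X` on `V` is the vertical lift `s^↑` of the section `s`, i.e. the vector
field with flow `v ↦ v + t s(x)` for `v ∈ V x`. -/
def IsVerticalLift (X : Derivation ℝ (FnTot J F V) (FnTot J F V)) (s : Sec J F V) : Prop :=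
  ∀ (G : FnTot J F V) (x : N) (v : V x), HasDerivAt (fun t : ℝ => G ⟨x, v + t • s x⟩) (X G ⟨x, v⟩) 0

/-- The vector field `X` on `V` is a linear vector field over the vector field `Y` on `N`. -/
structure IsLinearVectorField (X : Derivation ℝ (FnTot J F V) (FnTot J F V))
    (Y : Derivation ℝ (Fn J N) (Fn J N)) : Prop where
  pull : ∀ f, X (pull f) = pull (Y f)
  fibreLinear : ∀ G, FibreLinear G → FibreLinear (X G)

/-- The vector field `X` on `V` is the linear vector field `D̂` of the derivation `D` of `Γ(V)` over
the vector field `Y` on `N`: `X(q^* f) = q^*(Y f)` and `X(ℓ_ε) = ℓ_{D^* ε}`, where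
`⟨D^* ε, s⟩ = Y⟨ε, s⟩ - ⟨ε, D s⟩`. -/
structure IsLinearVectorFieldOf (X : Derivation ℝ (FnTot J F V) (FnTot J F V))
    (Y : Derivation ℝ (Fn J N) (Fn J N)) (D : Sec J F V → Sec J F V) : Prop extends
    IsLinearVectorField X Y where
  apply : ∀ G, FibreLinear G → ∀ s, compSec (X G) s = Y (compSec G s) - compSec G (D s)

variable (F V) in
/-- The fibres of the dual bundle `V^* → N`. -/
abbrev DualFibre (x : N) : Type _ := V x →L[ℝ] Trivial N ℝ x

variable (F V) in
/-- The total space of the dual bundle `V^* → N`. -/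
abbrev DualTot : Type _ := TotalSpace (F →L[ℝ] ℝ) (DualFibre V)

variable (J F V) in
/-- `C^∞(V^*)`. -/
abbrev FnDual : Type _ := FnTot J (F →L[ℝ] ℝ) (DualFibre V)

/-- The fibrewise linear function `ℓ_s` on `V^*` given by a section `s` of `V`. -/
def ell (s : Sec J F V) : FnDual J F V :=
  ⟨fun φ => φ.snd (s φ.proj), by
    have h1 : ContMDiff (J.prod 𝓘(ℝ, F →L[ℝ] ℝ)) (J.prod 𝓘(ℝ, F →L[ℝ] ℝ)) ∞
        (fun φ : DualTot F V => TotalSpace.mk' (F →L[ℝ] ℝ) (E := DualFibre V) φ.proj φ.snd) :=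
      contMDiff_id
    have h2 : ContMDiff (J.prod 𝓘(ℝ, F →L[ℝ] ℝ)) (J.prod 𝓘(ℝ, F)) ∞
        (fun φ : DualTot F V => TotalSpace.mk' F φ.proj (s φ.proj)) :=
      s.contMDiff.comp (contMDiff_proj (DualFibre V))
    have h3 := h1.clm_bundle_apply h2
    intro φ
    exact (contMDiffAt_totalSpace.1 (h3 φ)).2⟩

/-- The Lie–Poisson (linear Poisson) structure on `V^*` of a Lie algebroid `V → N`. -/
structure IsLiePoisson (L : LieAlgebroid (Fn J N) (Sec J F V))
    (P : PoissonBracket (FnDual J F V)) : Prop where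
  ell_ell : ∀ s t, P.bracket (ell s) (ell t) = ell (L.bracket s t)
  ell_pull : ∀ s f, P.bracket (ell s) (pull f) = pull (L.anchor s f)
  pull_pull : ∀ f g, P.bracket (pull f) (pull g) = 0

end VectorBundle

/-! ## Double vector bundles

The manifold `D` of a double vector bundle `(D; A, B; M)` is described through its fibres over
`A ×_M B`: `D m a b` is the set of points of `D` over `a ∈ A_m` and `b ∈ B_m`. The fibre of `D → A`
over `a` is then `{(b, d) | d ∈ D m a b}`, and the fibre of `D → B` over `b` is
`{(a, d) | d ∈ D m a b}`. Exchanging the roles of `A` and `B` replaces `D` by `flipD D`. -/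

section DoubleVectorBundle

/-- `D` with the roles of `A` and `B` exchanged. -/
abbrev flipD {M : Type*} {A B : M → Type*} (D : ∀ m, A m → B m → Type*) :
    ∀ m, B m → A m → Type _ :=
  fun m b a => D m a b

/-- The fibres of `D → A`; those of `D → B` are `Over FB (flipD D)`. -/
structure Over {M : Type*} (FA : Type*) {A B : M → Type*} (D : ∀ m, A m → B m → Type*)
    (p : TotalSpace FA A) where
  /-- the projection to `B` -/
  base : B p.proj
  /-- the point of `D` -/
  pt : D p.proj p.snd base

variable {E H M : Type*} [NormedAddCommGroup E] [NormedSpace ℝ E] [TopologicalSpace H]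
  (I : ModelWithCorners ℝ E H) [TopologicalSpace M] [ChartedSpace H M]
  (FA : Type*) [NormedAddCommGroup FA] [NormedSpace ℝ FA]
  (FB : Type*) [NormedAddCommGroup FB] [NormedSpace ℝ FB]
  (FC : Type*) [NormedAddCommGroup FC] [NormedSpace ℝ FC]
  (GA : Type*) [NormedAddCommGroup GA] [NormedSpace ℝ GA]
  (GB : Type*) [NormedAddCommGroup GB] [NormedSpace ℝ GB]
  {A : M → Type*} [TopologicalSpace (TotalSpace FA A)] [∀ m, TopologicalSpace (A m)]
  [∀ m, AddCommGroup (A m)] [∀ m, Module ℝ (A m)] [FiberBundle FA A] [VectorBundle ℝ FA A]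
  {B : M → Type*} [TopologicalSpace (TotalSpace FB B)] [∀ m, TopologicalSpace (B m)]
  [∀ m, AddCommGroup (B m)] [∀ m, Module ℝ (B m)] [FiberBundle FB B] [VectorBundle ℝ FB B]
  (C : M → Type*) [TopologicalSpace (TotalSpace FC C)] [∀ m, TopologicalSpace (C m)]
  [∀ m, AddCommGroup (C m)] [∀ m, Module ℝ (C m)] [FiberBundle FC C] [VectorBundle ℝ FC C]
  (D : ∀ m, A m → B m → Type*)
  [TopologicalSpace (TotalSpace GA (Over FA D))] [∀ p, TopologicalSpace (Over FA D p)]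
  [∀ p, AddCommGroup (Over FA D p)] [∀ p, Module ℝ (Over FA D p)]
  [FiberBundle GA (Over FA D)] [VectorBundle ℝ GA (Over FA D)]
  [TopologicalSpace (TotalSpace GB (Over FB (flipD D)))]
  [∀ p, TopologicalSpace (Over FB (flipD D) p)]
  [∀ p, AddCommGroup (Over FB (flipD D) p)] [∀ p, Module ℝ (Over FB (flipD D) p)]
  [FiberBundle GB (Over FB (flipD D))] [VectorBundle ℝ GB (Over FB (flipD D))]

/-- A point `x` of the bundle `D → A` and a point `X` of the bundle `D → B` are the same point of
`D`. -/
inductive Same {M : Type*} {FA FB : Type*} {A B : M → Type*} {D : ∀ m, A m → B m → Type*} :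
    ∀ {p : TotalSpace FA A} {q : TotalSpace FB B}, Over FA D p → Over FB (flipD D) q → Prop
  | mk (m : M) (a : A m) (b : B m) (d : D m a b) :
    Same (p := ⟨m, a⟩) (q := ⟨m, b⟩) ⟨b, d⟩ ⟨a, d⟩

/-- A point of the bundle `D → A`, seen as a point of the bundle `D → B`. -/
def swap {FA FB GA GB : Type*} {A B : M → Type*} {D : ∀ m, A m → B m → Type*}
    (x : TotalSpace GA (Over FA D)) : TotalSpace GB (Over FB (flipD D)) :=
  ⟨⟨x.proj.proj, x.snd.base⟩, ⟨x.proj.snd, x.snd.pt⟩⟩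

/-- The compatibility conditions of a double vector bundle, as seen from `D → A`. We write `+_A`,
`•_A` for the operations of `D → A` and `+_B`, `•_B` for those of `D → B`. -/
structure IsDoubleVectorBundleSide : Prop where
  /-- `π_B : D → B` is a vector bundle morphism over `q_A : A → M` -/
  base_add : ∀ p (x y : Over FA D p), (x + y).base = x.base + y.base
  base_smul : ∀ p (r : ℝ) (x : Over FA D p), (r • x).base = r • x.base
  /-- `D → A` and `D → B` are bundle structures on the same manifold -/
  contMDiff_swap : ContMDiff ((I.prod 𝓘(ℝ, FA)).prod 𝓘(ℝ, GA)) ((I.prod 𝓘(ℝ, FB)).prod 𝓘(ℝ, GB)) ∞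
    (swap : TotalSpace GA (Over FA D) → TotalSpace GB (Over FB (flipD D)))
  /-- `(d₁ +_A d₂) +_B (e₁ +_A e₂) = (d₁ +_B e₁) +_A (d₂ +_B e₂)` -/
  add_add : ∀ {p p' p'' : TotalSpace FA A} {q q' q'' : TotalSpace FB B}
    {d₁ d₂ : Over FA D p} {e₁ e₂ : Over FA D p'} {s₁ s₂ : Over FA D p''}
    {d₁' e₁' : Over FB (flipD D) q} {d₂' e₂' : Over FB (flipD D) q'}
    {d e : Over FB (flipD D) q''},
    Same d₁ d₁' → Same d₂ d₂' → Same e₁ e₁' → Same e₂ e₂' →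
    Same s₁ (d₁' + e₁') → Same s₂ (d₂' + e₂') → Same (d₁ + d₂) d → Same (e₁ + e₂) e →
    Same (s₁ + s₂) (d + e)
  /-- `r •_A (d +_B e) = r •_A d +_B r •_A e` -/
  smul_add : ∀ {p p' p'' : TotalSpace FA A} {q q' : TotalSpace FB B} (r : ℝ)
    {d : Over FA D p} {e : Over FA D p'} {s : Over FA D p''}
    {d' e' : Over FB (flipD D) q} {d'' e'' : Over FB (flipD D) q'},
    Same d d' → Same e e' → Same s (d' + e') → Same (r • d) d'' → Same (r • e) e'' →
    Same (r • s) (d'' + e'')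
  /-- `r •_A (t •_B d) = t •_B (r •_A d)` -/
  smul_smul : ∀ {p p' : TotalSpace FA A} {q q' : TotalSpace FB B} (r t : ℝ)
    {d : Over FA D p} {s : Over FA D p'} {d' : Over FB (flipD D) q} {d'' : Over FB (flipD D) q'},
    Same d d' → Same s (t • d') → Same (r • d) d'' → Same (r • s) (t • d'')

variable {C} in
/-- The vector bundle structure of the core `C`, whose points are the points of `D` over the zeros
`0^A_m`, `0^B_m`, is the restriction of that of `D → A`. -/
structure IsCoreSide (core : ∀ m, C m → D m 0 0) : Prop where
  map_add : ∀ m (c c' : C m),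
    (⟨0, core m (c + c')⟩ : Over FA D ⟨m, 0⟩) = ⟨0, core m c⟩ + ⟨0, core m c'⟩
  map_smul : ∀ m (r : ℝ) (c : C m),
    (⟨0, core m (r • c)⟩ : Over FA D ⟨m, 0⟩) = r • ⟨0, core m c⟩
  contMDiff : ContMDiff (I.prod 𝓘(ℝ, FC)) ((I.prod 𝓘(ℝ, FA)).prod 𝓘(ℝ, GA)) ∞
    (fun c : TotalSpace FC C =>
      (⟨⟨c.proj, 0⟩, ⟨0, core c.proj c.snd⟩⟩ : TotalSpace GA (Over FA D)))

/-- A double vector bundle `(D; A, B; M)` with core `C`; `core m c` is the point `c̄` of `D`. -/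
structure DoubleVectorBundle where
  sideA : IsDoubleVectorBundleSide I FA FB GA GB D
  sideB : IsDoubleVectorBundleSide I FB FA GB GA (flipD D)
  core : ∀ m, C m → D m 0 0
  core_bijective : ∀ m, Function.Bijective (core m)
  coreA : IsCoreSide I FA FC GA D core
  coreB : IsCoreSide I FB FC GB (flipD D) core

end DoubleVectorBundle

set_option linter.unusedSectionVars false

namespace Same

variable {M : Type*} {FA FB GA GB : Type*} {A B : M → Type*} {D : ∀ m, A m → B m → Type*}

theorem symm {p : TotalSpace FA A} {q : TotalSpace FB B} {x : Over FA D p}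
    {X : Over FB (flipD D) q} (h : Same x X) : Same (D := flipD D) X x := by
  cases h; exact Same.mk (D := flipD D) _ _ _ _

theorem eq_left {p : TotalSpace FA A} {q : TotalSpace FB B} {x y : Over FA D p}
    {X : Over FB (flipD D) q} (h : Same x X) (h' : Same y X) : x = y := by
  cases h; cases h'; rfl

theorem eq_right {p : TotalSpace FA A} {q : TotalSpace FB B} {x : Over FA D p}
    {X Y : Over FB (flipD D) q} (h : Same x X) (h' : Same x Y) : X = Y := by
  cases h; cases h'; rfl

theorem swap_eq {p : TotalSpace FA A} {q : TotalSpace FB B} {x : Over FA D p}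
    {X : Over FB (flipD D) q} (h : Same x X) :
    swap (⟨p, x⟩ : TotalSpace GA (Over FA D)) = (⟨q, X⟩ : TotalSpace GB (Over FB (flipD D))) := by
  cases h; rfl

theorem exists_right {p : TotalSpace FA A} (x : Over FA D p) {b : B p.proj} (h : x.base = b) :
    ∃ X : Over FB (flipD D) ⟨p.proj, b⟩, Same x X ∧ X.base = p.snd := by
  subst h; exact ⟨⟨p.snd, x.pt⟩, Same.mk _ _ _ _, rfl⟩

end Same

section

variable {EN HN N N' EN' HN' : Type*} [NormedAddCommGroup EN] [NormedSpace ℝ EN]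
  [TopologicalSpace HN]
  {J : ModelWithCorners ℝ EN HN} [TopologicalSpace N] [ChartedSpace HN N]
  [NormedAddCommGroup EN'] [NormedSpace ℝ EN'] [TopologicalSpace HN']
  {J' : ModelWithCorners ℝ EN' HN'} [TopologicalSpace N'] [ChartedSpace HN' N']
  {F : Type*} [NormedAddCommGroup F] [NormedSpace ℝ F]
  {V : N → Type*} [TopologicalSpace (TotalSpace F V)] [∀ x, TopologicalSpace (V x)]
  [FiberBundle F V] [∀ x, AddCommGroup (V x)] [∀ x, Module ℝ (V x)] [VectorBundle ℝ F V]

theorem contMDiffAt_add_along {f : N' → N} {u v : ∀ x, V (f x)} {x₀ : N'}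
    (hu : ContMDiffAt J' (J.prod 𝓘(ℝ, F)) ∞ (fun x => TotalSpace.mk' F (f x) (u x)) x₀)
    (hv : ContMDiffAt J' (J.prod 𝓘(ℝ, F)) ∞ (fun x => TotalSpace.mk' F (f x) (v x)) x₀) :
    ContMDiffAt J' (J.prod 𝓘(ℝ, F)) ∞ (fun x => TotalSpace.mk' F (f x) (u x + v x)) x₀ := by
  rw [contMDiffAt_totalSpace] at hu hv ⊢
  refine ⟨hu.1, (hu.2.add hv.2).congr_of_eventuallyEq ?_⟩
  have hc : ContinuousAt f x₀ := hu.1.continuousAt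
  set e := trivializationAt F V (f x₀)
  filter_upwards [hc.preimage_mem_nhds
    (e.open_baseSet.mem_nhds (FiberBundle.mem_baseSet_trivializationAt' (f x₀)))] with x hx
  exact (e.linear ℝ hx).1 _ _

theorem contMDiffAt_clm_of_apply [FiniteDimensional ℝ F] {f : N' → F →L[ℝ] ℝ} {x₀ : N'}
    (h : ∀ v, ContMDiffAt J' 𝓘(ℝ, ℝ) ∞ (fun x => f x v) x₀) :
    ContMDiffAt J' 𝓘(ℝ, F →L[ℝ] ℝ) ∞ f x₀ := by
  let b := Module.finBasis ℝ F
  have : f = fun x => ∑ i, f x (b i) • LinearMap.toContinuousLinearMap (b.coord i) := by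
    ext x v
    conv_lhs => rw [← b.sum_repr v]
    simp only [map_sum, map_smul, smul_eq_mul, FunLike.coe_sum, Finset.sum_apply,
      FunLike.coe_smul, Pi.smul_apply, LinearMap.coe_toContinuousLinearMap',
      Module.Basis.coord_apply]
    exact Finset.sum_congr rfl fun i _ => mul_comm _ _
  rw [this]
  exact ContMDiffAt.sum fun i _ => (h (b i)).smul contMDiffAt_const

variable (F) in
theorem continuous_of_fibre [FiniteDimensional ℝ F] {x : N} (f : V x →ₗ[ℝ] ℝ) :
    Continuous f := by
  let e := (trivializationAt F V x).continuousLinearEquivAt ℝ x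
    (FiberBundle.mem_baseSet_trivializationAt' x)
  have h : Continuous (f ∘ₗ (e.symm : F →ₗ[ℝ] V x)) := LinearMap.continuous_of_finiteDimensional _
  have : ⇑f = (f ∘ₗ (e.symm : F →ₗ[ℝ] V x)) ∘ e := by
    ext c
    simp
  rw [this]
  exact h.comp e.continuous

end

section DoubleVectorBundle

variable {E H M : Type*} [NormedAddCommGroup E] [NormedSpace ℝ E] [TopologicalSpace H]
  {I : ModelWithCorners ℝ E H} [TopologicalSpace M] [ChartedSpace H M]
  {FA : Type*} [NormedAddCommGroup FA] [NormedSpace ℝ FA]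
  {FB : Type*} [NormedAddCommGroup FB] [NormedSpace ℝ FB]
  {FC : Type*} [NormedAddCommGroup FC] [NormedSpace ℝ FC]
  {GA : Type*} [NormedAddCommGroup GA] [NormedSpace ℝ GA]
  {GB : Type*} [NormedAddCommGroup GB] [NormedSpace ℝ GB]
  {A : M → Type*} [TopologicalSpace (TotalSpace FA A)] [∀ m, TopologicalSpace (A m)]
  [∀ m, AddCommGroup (A m)] [∀ m, Module ℝ (A m)] [FiberBundle FA A] [VectorBundle ℝ FA A]
  {B : M → Type*} [TopologicalSpace (TotalSpace FB B)] [∀ m, TopologicalSpace (B m)]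
  [∀ m, AddCommGroup (B m)] [∀ m, Module ℝ (B m)] [FiberBundle FB B] [VectorBundle ℝ FB B]
  {C : M → Type*} [TopologicalSpace (TotalSpace FC C)] [∀ m, TopologicalSpace (C m)]
  [∀ m, AddCommGroup (C m)] [∀ m, Module ℝ (C m)] [FiberBundle FC C] [VectorBundle ℝ FC C]
  {D : ∀ m, A m → B m → Type*}
  [TopologicalSpace (TotalSpace GA (Over FA D))] [∀ p, TopologicalSpace (Over FA D p)]
  [∀ p, AddCommGroup (Over FA D p)] [∀ p, Module ℝ (Over FA D p)]
  [FiberBundle GA (Over FA D)] [VectorBundle ℝ GA (Over FA D)]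
  [TopologicalSpace (TotalSpace GB (Over FB (flipD D)))]
  [∀ p, TopologicalSpace (Over FB (flipD D) p)]
  [∀ p, AddCommGroup (Over FB (flipD D) p)] [∀ p, Module ℝ (Over FB (flipD D) p)]
  [FiberBundle GB (Over FB (flipD D))] [VectorBundle ℝ GB (Over FB (flipD D))]

namespace DoubleVectorBundle

/-- The double vector bundle `(D; B, A; M)`. -/
def flip (𝔻 : DoubleVectorBundle I FA FB FC GA GB C D) :
    DoubleVectorBundle I FB FA FC GB GA C (flipD D) where
  sideA := 𝔻.sideB
  sideB := 𝔻.sideA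
  core := 𝔻.core
  core_bijective := 𝔻.core_bijective
  coreA := 𝔻.coreB
  coreB := 𝔻.coreA

variable (𝔻 : DoubleVectorBundle I FA FB FC GA GB C D)

theorem base_zero (𝔻 : DoubleVectorBundle I FA FB FC GA GB C D) (p : TotalSpace FA A) :
    (0 : Over FA D p).base = 0 := by
  have := 𝔻.sideA.base_smul p 0 0
  simpa using this

/-- The zero `0̃_a` of `D → A` over `a ∈ A_m`, as an element of the fibre of `D → B` over
`0^B_m`. -/
def zeroPt (p : TotalSpace FA A) : Over FB (flipD D) ⟨p.proj, 0⟩ :=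
  (Same.exists_right (0 : Over FA D p) (𝔻.base_zero p)).choose

theorem same_zeroPt (p : TotalSpace FA A) : Same (0 : Over FA D p) (𝔻.zeroPt p) :=
  (Same.exists_right (0 : Over FA D p) (𝔻.base_zero p)).choose_spec.1

theorem zeroPt_base (p : TotalSpace FA A) : (𝔻.zeroPt p).base = p.snd :=
  (Same.exists_right (0 : Over FA D p) (𝔻.base_zero p)).choose_spec.2

/-- The core point `c̄` as an element of the fibre of `D → A` over `0^A_m`. -/
def corePt (m : M) (c : C m) : Over FA D ⟨m, 0⟩ := ⟨0, 𝔻.core m c⟩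

theorem exists_coreAt (p : TotalSpace FA A) (c : C p.proj) :
    ∃ x : Over FA D p, Same x (𝔻.zeroPt p + 𝔻.flip.corePt p.proj c) := by
  have h : (𝔻.zeroPt p + 𝔻.flip.corePt p.proj c).base = p.snd := by
    rw [𝔻.sideB.base_add, zeroPt_base]
    exact add_zero _
  obtain ⟨x, hx, -⟩ := Same.exists_right (FB := FA) (D := flipD D) _ h
  exact ⟨x, hx.symm⟩

/-- The value `c†(a) = 0̃_a +_B c̄` at `a` of the core section `c† : A → D`, as an element of the
fibre of `D → A` over `a`. -/
def coreAt (p : TotalSpace FA A) (c : C p.proj) : Over FA D p := (𝔻.exists_coreAt p c).choose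

theorem same_coreAt (p : TotalSpace FA A) (c : C p.proj) :
    Same (𝔻.coreAt p c) (𝔻.zeroPt p + 𝔻.flip.corePt p.proj c) :=
  (𝔻.exists_coreAt p c).choose_spec

theorem coreAt_add (p : TotalSpace FA A) (c c' : C p.proj) :
    𝔻.coreAt p (c + c') = 𝔻.coreAt p c + 𝔻.coreAt p c' := by
  have h0 := 𝔻.same_zeroPt p
  have hc : ∀ c, Same (𝔻.corePt p.proj c) (𝔻.flip.corePt p.proj c) := fun c => Same.mk _ _ _ _
  have h0' : Same ((0 : Over FA D p) + 0) (𝔻.zeroPt p) := by rwa [add_zero]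
  have hc' : Same (𝔻.corePt p.proj c + 𝔻.corePt p.proj c') (𝔻.flip.corePt p.proj (c + c')) := by
    rw [show 𝔻.corePt p.proj c + 𝔻.corePt p.proj c' = 𝔻.corePt p.proj (c + c') from
      (𝔻.coreA.map_add _ c c').symm]
    exact hc _
  have := 𝔻.sideA.add_add h0 h0 (hc c) (hc c') (𝔻.same_coreAt p c) (𝔻.same_coreAt p c') h0' hc'
  exact (𝔻.same_coreAt p (c + c')).eq_left this

theorem coreAt_smul (p : TotalSpace FA A) (r : ℝ) (c : C p.proj) :
    𝔻.coreAt p (r • c) = r • 𝔻.coreAt p c := by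
  have h0 := 𝔻.same_zeroPt p
  have hc : ∀ c, Same (𝔻.corePt p.proj c) (𝔻.flip.corePt p.proj c) := fun c => Same.mk _ _ _ _
  have h0' : Same (r • (0 : Over FA D p)) (𝔻.zeroPt p) := by rwa [smul_zero]
  have hc' : Same (r • 𝔻.corePt p.proj c) (𝔻.flip.corePt p.proj (r • c)) := by
    rw [show r • 𝔻.corePt p.proj c = 𝔻.corePt p.proj (r • c) from
      (𝔻.coreA.map_smul _ r c).symm]
    exact hc _
  have := 𝔻.sideA.smul_add r h0 (hc c) (𝔻.same_coreAt p c) h0' hc'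
  exact (𝔻.same_coreAt p (r • c)).eq_left this

theorem contMDiffAt_coreAt {c : ∀ m, C m} {p₀ : TotalSpace FA A}
    (hc : ContMDiffAt I (I.prod 𝓘(ℝ, FC)) ∞ (fun m => TotalSpace.mk' FC m (c m)) p₀.proj) :
    ContMDiffAt (I.prod 𝓘(ℝ, FA)) ((I.prod 𝓘(ℝ, FA)).prod 𝓘(ℝ, GA)) ∞
      (fun p : TotalSpace FA A => TotalSpace.mk' GA p (𝔻.coreAt p (c p.proj))) p₀ := by
  have h1 : ContMDiffAt (I.prod 𝓘(ℝ, FA)) ((I.prod 𝓘(ℝ, FB)).prod 𝓘(ℝ, GB)) ∞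
      (fun p : TotalSpace FA A => TotalSpace.mk' GB (E := Over FB (flipD D)) ⟨p.proj, 0⟩
        (𝔻.zeroPt p)) p₀ := by
    have : ContMDiff (I.prod 𝓘(ℝ, FA)) ((I.prod 𝓘(ℝ, FB)).prod 𝓘(ℝ, GB)) ∞
        (fun p : TotalSpace FA A => swap (GB := GB) (zeroSection GA (Over FA D) p)) :=
      𝔻.sideA.contMDiff_swap.comp
        (contMDiff_zeroSection ℝ (Over FA D))
    refine (this p₀).congr_of_eventuallyEq (Filter.Eventually.of_forall fun p => ?_)
    exact (𝔻.same_zeroPt p).swap_eq.symm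
  have h2 : ContMDiffAt (I.prod 𝓘(ℝ, FA)) ((I.prod 𝓘(ℝ, FB)).prod 𝓘(ℝ, GB)) ∞
      (fun p : TotalSpace FA A => TotalSpace.mk' GB (E := Over FB (flipD D)) ⟨p.proj, 0⟩
        (𝔻.flip.corePt p.proj (c p.proj))) p₀ :=
    ContMDiffAt.comp p₀ (𝔻.coreB.contMDiff.contMDiffAt)
      (ContMDiffAt.comp p₀ hc (contMDiffAt_proj A))
  have h3 := contMDiffAt_add_along h1 h2
  have h4 := ContMDiffAt.comp p₀ (𝔻.sideB.contMDiff_swap.contMDiffAt) h3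
  refine h4.congr_of_eventuallyEq (Filter.Eventually.of_forall fun p => ?_)
  exact (𝔻.same_coreAt p (c p.proj)).symm.swap_eq.symm

/-- The core section `c† : A → D`. -/
def coreSection (c : Sec I FC C) : Sec (I.prod 𝓘(ℝ, FA)) GA (Over FA D) :=
  ⟨fun p => 𝔻.coreAt p (c p.proj), fun _ => 𝔻.contMDiffAt_coreAt c.contMDiff.contMDiffAt⟩

/-- The inclusion of `C_m` in the fibre of `D → A` over `a ∈ A_m`. -/
def coreAtL (p : TotalSpace FA A) : C p.proj →ₗ[ℝ] Over FA D p where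
  toFun := 𝔻.coreAt p
  map_add' := 𝔻.coreAt_add p
  map_smul' := 𝔻.coreAt_smul p

/-- The projection of the dual bundle of `D → A` to `C^*`:
`Φ ∈ (D_a)^*` is sent to `c ↦ Φ(0̃_a +_B c̄)`. -/
def toCoreDual [FiniteDimensional ℝ FC] (Φ : DualTot GA (Over FA D)) : DualTot FC C :=
  ⟨Φ.proj.proj, ⟨(Φ.snd : Over FA D Φ.proj →ₗ[ℝ] ℝ) ∘ₗ 𝔻.coreAtL Φ.proj, continuous_of_fibre FC _⟩⟩

theorem toCoreDual_apply [FiniteDimensional ℝ FC] (Φ : DualTot GA (Over FA D))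
    (c : C Φ.proj.proj) : (𝔻.toCoreDual Φ).snd c = Φ.snd (𝔻.coreAt Φ.proj c) := rfl

theorem contMDiff_toCoreDual [FiniteDimensional ℝ FC]
    (𝔻 : DoubleVectorBundle I FA FB FC GA GB C D) :
    ContMDiff ((I.prod 𝓘(ℝ, FA)).prod 𝓘(ℝ, GA →L[ℝ] ℝ)) (I.prod 𝓘(ℝ, FC →L[ℝ] ℝ)) ∞
      𝔻.toCoreDual := by
  intro Φ₀
  have hp : ContMDiffAt ((I.prod 𝓘(ℝ, FA)).prod 𝓘(ℝ, GA →L[ℝ] ℝ)) (I.prod 𝓘(ℝ, FA)) ∞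
      (fun Φ : DualTot GA (Over FA D) => Φ.proj) Φ₀ := contMDiffAt_proj (DualFibre (Over FA D))
  have hpp : ContMDiffAt ((I.prod 𝓘(ℝ, FA)).prod 𝓘(ℝ, GA →L[ℝ] ℝ)) I ∞
      (fun Φ : DualTot GA (Over FA D) => Φ.proj.proj) Φ₀ :=
    ContMDiffAt.comp Φ₀ (contMDiffAt_proj A) hp
  rw [contMDiffAt_hom_bundle]
  refine ⟨hpp, contMDiffAt_clm_of_apply fun v => ?_⟩
  set e := trivializationAt FC C Φ₀.proj.proj with he
  have hmem : e.baseSet ∈ nhds Φ₀.proj.proj :=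
    e.open_baseSet.mem_nhds (FiberBundle.mem_baseSet_trivializationAt' Φ₀.proj.proj)
  have hc : ContMDiffAt I (I.prod 𝓘(ℝ, FC)) ∞
      (fun m => TotalSpace.mk' FC m (e.symmL ℝ m v)) Φ₀.proj.proj := by
    rw [contMDiffAt_totalSpace]
    refine ⟨contMDiffAt_id, contMDiffAt_const (c := v) |>.congr_of_eventuallyEq ?_⟩
    filter_upwards [hmem] with m hm
    have := e.apply_mk_symm hm v
    rw [e.symmL_apply hm]
    exact congrArg Prod.snd this
  have hcore := ContMDiffAt.comp Φ₀ (𝔻.contMDiffAt_coreAt hc) hp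
  have h1 : ContMDiffAt ((I.prod 𝓘(ℝ, FA)).prod 𝓘(ℝ, GA →L[ℝ] ℝ))
      ((I.prod 𝓘(ℝ, FA)).prod 𝓘(ℝ, GA →L[ℝ] ℝ)) ∞
      (fun Φ : DualTot GA (Over FA D) =>
        TotalSpace.mk' (GA →L[ℝ] ℝ) (E := DualFibre (Over FA D)) Φ.proj Φ.snd) Φ₀ :=
    contMDiffAt_id
  have h2 := (contMDiffAt_totalSpace.1 (h1.clm_bundle_apply hcore)).2
  refine h2.congr_of_eventuallyEq ?_
  filter_upwards [hpp.continuousAt.preimage_mem_nhds hmem] with Φ hΦ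
  have hΦ' : (𝔻.toCoreDual Φ).proj ∈ (trivializationAt FC C (𝔻.toCoreDual Φ₀).proj).baseSet := hΦ
  rw [ContinuousLinearMap.inCoordinates_eq hΦ' (Set.mem_univ _)]
  have hs : (e.continuousLinearEquivAt ℝ Φ.proj.proj hΦ).symm v = e.symmL ℝ Φ.proj.proj v :=
    congrFun (e.symm_continuousLinearEquivAt_eq (R := ℝ) hΦ) v
  exact congrArg (fun c => Φ.snd (𝔻.coreAt Φ.proj c)) hs

section Dual

variable [FiniteDimensional ℝ FC]

/-- The pullback of a function along the projection of the dual of `D → A` to `C^*`. -/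
def pullCore (h : FnDual I FC C) : FnDual (I.prod 𝓘(ℝ, FA)) GA (Over FA D) :=
  ⟨fun Φ => h (𝔻.toCoreDual Φ), h.contMDiff.comp 𝔻.contMDiff_toCoreDual⟩

/-- `Φ₃` is the sum of `Φ₁` and `Φ₂` in the vector bundle `D^*A → C^*`: the three have the same
projection to `C^*`, and `Φ₃(d₁ +_B d₂) = Φ₁(d₁) + Φ₂(d₂)`. -/
structure IsDualSum {m : M} {a₁ a₂ a₃ : A m} (Φ₁ : DualFibre (Over FA D) ⟨m, a₁⟩)
    (Φ₂ : DualFibre (Over FA D) ⟨m, a₂⟩) (Φ₃ : DualFibre (Over FA D) ⟨m, a₃⟩) : Prop where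
  base : a₃ = a₁ + a₂
  core₂ : 𝔻.toCoreDual ⟨_, Φ₂⟩ = 𝔻.toCoreDual ⟨_, Φ₁⟩
  core₃ : 𝔻.toCoreDual ⟨_, Φ₃⟩ = 𝔻.toCoreDual ⟨_, Φ₁⟩
  apply : ∀ {q : TotalSpace FB B} {d₁ d₂ d₃} {d₁' d₂' : Over FB (flipD D) q},
    Same d₁ d₁' → Same d₂ d₂' → Same d₃ (d₁' + d₂') → Φ₃ d₃ = Φ₁ d₁ + Φ₂ d₂

/-- `Φ₂` is `r` times `Φ₁` in the vector bundle `D^*A → C^*`: they have the same projection to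
`C^*`, and `Φ₂(r •_B d) = r Φ₁(d)`. -/
structure IsDualSMul {m : M} {a₁ a₂ : A m} (r : ℝ) (Φ₁ : DualFibre (Over FA D) ⟨m, a₁⟩)
    (Φ₂ : DualFibre (Over FA D) ⟨m, a₂⟩) : Prop where
  base : a₂ = r • a₁
  core₂ : 𝔻.toCoreDual ⟨_, Φ₂⟩ = 𝔻.toCoreDual ⟨_, Φ₁⟩
  apply : ∀ {q : TotalSpace FB B} {d₁ d₂} {d₁' : Over FB (flipD D) q},
    Same d₁ d₁' → Same d₂ (r • d₁') → Φ₂ d₂ = r * Φ₁ d₁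

/-- The sections of the dual `D^*A^*C^*` of the vector bundle `D^*A → C^*`, where `D^*A` is the dual
of `D → A`: the smooth functions on `D^*A` which are linear on the fibres over `C^*`. -/
def dualSec : Submodule ℝ (FnDual (I.prod 𝓘(ℝ, FA)) GA (Over FA D)) where
  carrier := {f |
    (∀ {m} {a₁ a₂ a₃ : A m} {Φ₁ : DualFibre (Over FA D) ⟨m, a₁⟩}
      {Φ₂ : DualFibre (Over FA D) ⟨m, a₂⟩} {Φ₃ : DualFibre (Over FA D) ⟨m, a₃⟩},
      𝔻.IsDualSum Φ₁ Φ₂ Φ₃ → f ⟨_, Φ₃⟩ = f ⟨_, Φ₁⟩ + f ⟨_, Φ₂⟩) ∧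
    (∀ {m} {a₁ a₂ : A m} {r : ℝ} {Φ₁ : DualFibre (Over FA D) ⟨m, a₁⟩}
      {Φ₂ : DualFibre (Over FA D) ⟨m, a₂⟩},
      𝔻.IsDualSMul r Φ₁ Φ₂ → f ⟨_, Φ₂⟩ = r * f ⟨_, Φ₁⟩)}
  add_mem' := by
    rintro f g ⟨hf, hf'⟩ ⟨hg, hg'⟩
    refine ⟨fun h => ?_, fun h => ?_⟩
    · simp only [ContMDiffMap.coe_add, Pi.add_apply, hf h, hg h]; ring
    · simp only [ContMDiffMap.coe_add, Pi.add_apply, hf' h, hg' h]; ring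
  zero_mem' := by
    refine ⟨fun _ => ?_, fun _ => ?_⟩ <;> simp
  smul_mem' := by
    rintro c f ⟨hf, hf'⟩
    refine ⟨fun h => ?_, fun h => ?_⟩
    · simp only [ContMDiffMap.coe_smul, Pi.smul_apply, smul_eq_mul, hf h]; ring
    · simp only [ContMDiffMap.coe_smul, Pi.smul_apply, smul_eq_mul, hf' h]; ring

/-- The `C^∞(C^*)`-module structure on the sections of `D^*A^*C^* → C^*`. -/
instance : SMul (FnDual I FC C) 𝔻.dualSec :=
  ⟨fun h f => ⟨𝔻.pullCore h * f.1, by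
    obtain ⟨f, hf, hf'⟩ := f
    refine ⟨fun hs => ?_, fun hs => ?_⟩
    · change h (𝔻.toCoreDual _) * f _ = h (𝔻.toCoreDual _) * f _ + h (𝔻.toCoreDual _) * f _
      rw [hf hs, hs.core₂, hs.core₃]
      ring
    · change h (𝔻.toCoreDual _) * f _ = _ * (h (𝔻.toCoreDual _) * f _)
      rw [hf' hs, hs.core₂]
      ring⟩⟩

theorem dualSec_smul_apply (h : FnDual I FC C) (f : 𝔻.dualSec) (Φ : DualTot GA (Over FA D)) :
    (h • f).1 Φ = h (𝔻.toCoreDual Φ) * f.1 Φ := rfl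

instance : Module (FnDual I FC C) 𝔻.dualSec where
  one_smul f := by
    apply Subtype.ext; ext Φ; simp [dualSec_smul_apply]
  mul_smul g h f := by
    apply Subtype.ext; ext Φ; simp [dualSec_smul_apply, mul_assoc]
  smul_zero g := by
    apply Subtype.ext; ext Φ; simp [dualSec_smul_apply]
  smul_add g f f' := by
    apply Subtype.ext; ext Φ; simp [dualSec_smul_apply, mul_add]
  add_smul g h f := by
    apply Subtype.ext; ext Φ; simp [dualSec_smul_apply, add_mul]
  zero_smul f := by
    apply Subtype.ext; ext Φ; simp [dualSec_smul_apply]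

end Dual

end DoubleVectorBundle

/-- `(a, b) ↦ (b, a)` on `A ×_M B` is smooth. -/
theorem contMDiff_prod_swap :
    ContMDiff (I.prod 𝓘(ℝ, FB × FA)) (I.prod 𝓘(ℝ, FA × FB)) ∞
      (fun x : TotalSpace (FB × FA) (B ×ᵇ A) =>
        (⟨x.proj, (x.snd.2, x.snd.1)⟩ : TotalSpace (FA × FB) (A ×ᵇ B))) := by
  intro x₀
  have h := contMDiffAt_totalSpace.1
    (contMDiffAt_id (I := I.prod 𝓘(ℝ, FB × FA)) (n := ∞) (x := x₀))
  rw [contMDiffAt_totalSpace]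
  have h1 := ContMDiffAt.comp x₀ (contDiff_fst (𝕜 := ℝ) (E := FB) (F := FA)).contMDiff.contMDiffAt h.2
  have h2 := ContMDiffAt.comp x₀ (contDiff_snd (𝕜 := ℝ) (E := FB) (F := FA)).contMDiff.contMDiffAt h.2
  exact ⟨h.1, h2.prodMk_space h1⟩

variable (I FA FB GA D) in
/-- A linear splitting `Σ : A ×_M B → D` of a double vector bundle, i.e. a morphism of double vector
bundles over the identities of `A` and `B`. -/
structure LinearSplitting where
  toFun : ∀ m (a : A m) (b : B m), D m a b
  linearA : ∀ m a, IsLinearMap ℝ fun b => (⟨b, toFun m a b⟩ : Over FA D ⟨m, a⟩)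
  linearB : ∀ m b, IsLinearMap ℝ fun a => (⟨a, toFun m a b⟩ : Over FB (flipD D) ⟨m, b⟩)
  contMDiff : ContMDiff (I.prod 𝓘(ℝ, FA × FB)) ((I.prod 𝓘(ℝ, FA)).prod 𝓘(ℝ, GA)) ∞
    (fun x : TotalSpace (FA × FB) (A ×ᵇ B) =>
      (⟨⟨x.proj, x.snd.1⟩, ⟨x.snd.2, toFun x.proj x.snd.1 x.snd.2⟩⟩ : TotalSpace GA (Over FA D)))

namespace LinearSplitting

/-- A linear splitting of `(D; A, B; M)` is a linear splitting of `(D; B, A; M)`. -/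
def flip (S : LinearSplitting I FA FB GA D) (𝔻 : DoubleVectorBundle I FA FB FC GA GB C D) :
    LinearSplitting I FB FA GB (flipD D) where
  toFun m b a := S.toFun m a b
  linearA := S.linearB
  linearB := S.linearA
  contMDiff := 𝔻.sideA.contMDiff_swap.comp (S.contMDiff.comp contMDiff_prod_swap)

/-- The lift `b ↦ σ(b)` of sections of `B` to linear sections of `D → A`, `σ(b)(a) = Σ(a, b)`. -/
def lift (S : LinearSplitting I FA FB GA D) (b : Sec I FB B) :
    Sec (I.prod 𝓘(ℝ, FA)) GA (Over FA D) :=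
  ⟨fun p => ⟨b p.proj, S.toFun p.proj p.snd (b p.proj)⟩, by
    have h : ContMDiff (I.prod 𝓘(ℝ, FA)) (I.prod 𝓘(ℝ, FA × FB)) ∞
        (fun p : TotalSpace FA A =>
          (⟨p.proj, (p.snd, b p.proj)⟩ : TotalSpace (FA × FB) (A ×ᵇ B))) := by
      intro p
      have h1 := contMDiffAt_totalSpace.1
        (contMDiffAt_id (I := I.prod 𝓘(ℝ, FA)) (n := ∞) (x := p))
      have h2 := contMDiffAt_totalSpace.1
        ((b.contMDiff.comp (contMDiff_proj A)).contMDiffAt (x := p))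
      rw [contMDiffAt_totalSpace]
      exact ⟨h1.1, h1.2.prodMk_space h2.2⟩
    exact S.contMDiff.comp h⟩

end LinearSplitting

/-! ## VB-algebroids, the induced 2-representations, double Lie algebroids -/

variable (FA FB GA D) in
/-- The section `ξ` of `D → A` is linear over the section `b` of `B`: it is a vector bundle morphism
from `A → M` to `D → B` over `b : M → B`. -/
def IsLinearSection (ξ : Sec (I.prod 𝓘(ℝ, FA)) GA (Over FA D)) (b : Sec I FB B) : Prop :=
  ∀ m, ∃ φ : A m →ₗ[ℝ] Over FB (flipD D) ⟨m, b m⟩, ∀ a, Same (ξ ⟨m, a⟩) (φ a)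

namespace DoubleVectorBundle

variable (𝔻 : DoubleVectorBundle I FA FB FC GA GB C D)

/-- The Lie algebroid `LD` on `D → A` and the Lie algebroid `LB` on `B → M` form a VB-algebroid
`(D → A; B → M)`: the anchor `D → TA` is a morphism of double vector bundles over the anchor
`B → TM`, and the Lie bracket of two linear sections over `b₁`, `b₂` is linear over `[b₁, b₂]`, that
of a linear section and a core section is a core section, that of two core sections vanishes. -/
structure IsVBAlgebroid
    (LD : LieAlgebroid (Fn (I.prod 𝓘(ℝ, FA)) (TotalSpace FA A))
      (Sec (I.prod 𝓘(ℝ, FA)) GA (Over FA D)))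
    (LB : LieAlgebroid (Fn I M) (Sec I FB B)) : Prop where
  anchor_linear : ∀ ξ b, IsLinearSection FA FB GA D ξ b →
    IsLinearVectorField (LD.anchor ξ) (LB.anchor b)
  anchor_core : ∀ c, ∃ a : Sec I FA A, IsVerticalLift (LD.anchor (𝔻.coreSection c)) a
  linear_linear : ∀ ξ₁ ξ₂ b₁ b₂, IsLinearSection FA FB GA D ξ₁ b₁ →
    IsLinearSection FA FB GA D ξ₂ b₂ →
    IsLinearSection FA FB GA D (LD.bracket ξ₁ ξ₂) (LB.bracket b₁ b₂)
  linear_core : ∀ ξ b c, IsLinearSection FA FB GA D ξ b →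
    ∃ c', LD.bracket ξ (𝔻.coreSection c) = 𝔻.coreSection c'
  core_core : ∀ c₁ c₂, LD.bracket (𝔻.coreSection c₁) (𝔻.coreSection c₂) = 0

/-- The 2-representation `(∂_A : C → A, ∇, ∇, R)` of `B` is the one induced by the VB-algebroid
`(D → A; B → M)` and the linear splitting `S` with lift `σ`: the anchor sends `c†` to `(∂_A c)^↑`
and `σ(b)` to `∇̂_b`, `[σ(b), c†] = (∇_b c)†`, and
`[σ(b₁), σ(b₂)] = σ([b₁, b₂]) - R(b₁, b₂)~`, where `φ~(a) = 0̃_a +_B φ(a)` for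
`φ ∈ Γ(Hom(A, C))`. -/
structure IsInducedTwoRep (S : LinearSplitting I FA FB GA D)
    (LD : LieAlgebroid (Fn (I.prod 𝓘(ℝ, FA)) (TotalSpace FA A))
      (Sec (I.prod 𝓘(ℝ, FA)) GA (Over FA D)))
    {LB : LieAlgebroid (Fn I M) (Sec I FB B)} (T : TwoRep LB (Sec I FC C) (Sec I FA A)) :
    Prop where
  anchor_core : ∀ c, IsVerticalLift (LD.anchor (𝔻.coreSection c)) (T.bd c)
  anchor_lift : ∀ b,
    IsLinearVectorFieldOf (LD.anchor (S.lift b)) (LB.anchor b) (T.nabla₁.nabla b)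
  bracket_core : ∀ b c,
    LD.bracket (S.lift b) (𝔻.coreSection c) = 𝔻.coreSection (T.nabla₀.nabla b c)
  bracket_lift : ∀ b₁ b₂ (a : Sec I FA A) m,
    LD.bracket (S.lift b₁) (S.lift b₂) ⟨m, a m⟩
      = S.lift (LB.bracket b₁ b₂) ⟨m, a m⟩ - 𝔻.coreAt ⟨m, a m⟩ (T.curv b₁ b₂ a m)

section Dual

variable [FiniteDimensional ℝ FC]

/-- The Lie algebroid `L` on `D^*A^*C^* → C^*` is the one induced by the VB-algebroid
`(D → A; B → M)`: the Lie algebroid `D → A` defines a Lie–Poisson structure on `D^*A`, which is also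
linear over `C^*`, hence is the Lie–Poisson structure of a Lie algebroid structure on the dual
`D^*A^*C^*` of `D^*A → C^*`. -/
def IsDualLieAlgebroid
    (LD : LieAlgebroid (Fn (I.prod 𝓘(ℝ, FA)) (TotalSpace FA A))
      (Sec (I.prod 𝓘(ℝ, FA)) GA (Over FA D)))
    (L : LieAlgebroid (FnDual I FC C) 𝔻.dualSec) : Prop :=
  ∃ P : PoissonBracket (FnDual (I.prod 𝓘(ℝ, FA)) GA (Over FA D)), IsLiePoisson LD P ∧
    (∀ f g : 𝔻.dualSec, (L.bracket f g).1 = P.bracket f.1 g.1) ∧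
    ∀ (f : 𝔻.dualSec) (h : FnDual I FC C),
      P.bracket f.1 (𝔻.pullCore h) = 𝔻.pullCore (L.anchor f h)

/-- The duality of `D^*A^*C^*` and `D^*B^*C^*` induced by the nondegenerate pairing
`⟨⟨Φ, Ψ⟩⟩ = ⟨Φ, d⟩_A - ⟨Ψ, d⟩_B` of `D^*A` and `D^*B` over `C^*`, where `d` is any element of `D`
over the same points of `A` and `B` as `Φ` and `Ψ`. Namely, if the value of `g ∈ Γ(D^*B^*C^*)` at
`κ ∈ C^*` is `-⟨⟨Φ, ·⟩⟩`, with `Φ ∈ D^*A` over `κ`, then `p(f, g)(κ) = f(Φ)`. -/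
def IsDuality (p : 𝔻.dualSec →ₗ[FnDual I FC C] 𝔻.flip.dualSec →ₗ[FnDual I FC C] FnDual I FC C) :
    Prop :=
  ∀ f g (Φ : DualTot GA (Over FA D)),
    (∀ Ψ : DualTot GB (Over FB (flipD D)), 𝔻.flip.toCoreDual Ψ = 𝔻.toCoreDual Φ →
      ∀ d d', Same (p := Φ.proj) (q := Ψ.proj) d d' → g.1 Ψ = Ψ.snd d' - Φ.snd d) →
    p f g (𝔻.toCoreDual Φ) = f.1 Φ

/-- `(D; A, B; M)`, with Lie algebroid structures on `A → M`, `B → M`, `D → A`, `D → B`, is a double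
Lie algebroid: `(D → A; B → M)` and `(D → B; A → M)` are VB-algebroids, and the Lie algebroids
`D^*A^*C^*` and `D^*B^*C^*` over `C^*`, which are in duality, form a Lie bialgebroid. -/
structure IsDoubleLieAlgebroid
    (LA : LieAlgebroid (Fn I M) (Sec I FA A)) (LB : LieAlgebroid (Fn I M) (Sec I FB B))
    (LDA : LieAlgebroid (Fn (I.prod 𝓘(ℝ, FA)) (TotalSpace FA A))
      (Sec (I.prod 𝓘(ℝ, FA)) GA (Over FA D)))
    (LDB : LieAlgebroid (Fn (I.prod 𝓘(ℝ, FB)) (TotalSpace FB B))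
      (Sec (I.prod 𝓘(ℝ, FB)) GB (Over FB (flipD D)))) : Prop where
  vbA : 𝔻.IsVBAlgebroid LDA LB
  vbB : 𝔻.flip.IsVBAlgebroid LDB LA
  bialgebroid : ∃ (L : LieAlgebroid (FnDual I FC C) 𝔻.dualSec)
    (L' : LieAlgebroid (FnDual I FC C) 𝔻.flip.dualSec)
    (p : 𝔻.dualSec →ₗ[FnDual I FC C] 𝔻.flip.dualSec →ₗ[FnDual I FC C] FnDual I FC C),
    𝔻.IsDualLieAlgebroid LDA L ∧ 𝔻.flip.IsDualLieAlgebroid LDB L' ∧ 𝔻.IsDuality p ∧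
      IsLieBialgebroid L L' p

end Dual

end DoubleVectorBundle

end DoubleVectorBundle

end DoubleLie

end

/-! A linear splitting identifies the fibre of `D^*A` over a point `κ` of `C^*` with `A_m ⊕ B_m^*`,
and that of `D^*B` with `B_m ⊕ A_m^*`. Hence `Γ(D^*A^*C^*)` is locally generated over `C^∞(C^*)` by
`Γ(B)` (the linear functions of the lifts `σ_B(b)`, `linDual`) and by `Γ(A^*)` (the pullbacks of
fibrewise linear functions on `A`, `vertDual`). Symmetrically, `Γ(D^*B^*C^*)` is locally generated
by `Γ(A)` and `Γ(B^*)`. A derivation of `C^∞(C^*)` is determined by its values on pullbacks from `M`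
and on the functions `ℓ_c`. On all these generators the brackets, anchors and pairings are exactly
the data of the two induced 2-representations (`DualRelations`, `dualRelations`).

The Lie bialgebroid condition says that the defect `P(x₁, x₂)(y₁, y₂)` of `d` being a derivation of
the bracket (`bialgebroidDefect`) vanishes. It is tensorial in `y₁, y₂` but not in `x₁, x₂`: one has
`P(x₁, f x₂)(y₁, y₂) = f P(x₁, x₂)(y₁, y₂) + Q(x₁, y₁, f)⟨x₂, y₂⟩ - Q(x₁, y₂, f)⟨x₂, y₁⟩` with `Q`
the `mixedDefect`. In turn `Q(g x, y, f) = g Q(x, y, f) + ⟨x, y⟩ F(f, g)` with `F` the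
`functionDefect`, a symmetric biderivation. Also `Q` is tensorial in `y` and a derivation in `f`. So
if `F`, `Q` and `P` vanish on generators, then `P` vanishes identically
(`bialgebroidDefect_eq_zero`).

The values on generators are the conditions of a matched pair. `F` yields `m1` and `m2`; `Q` yields
`m3` (modulo `m1`), `m4`, `m5` and `m6`; `P` yields `m7` (modulo `m5`), `m8` and `m9`; all remaining
values are zero. This proves that matched pairs give double Lie algebroids.

Conversely, if `P = 0` then the formula above says that the linear form `Q(x, ·, f)` has zero wedge
product with every `x₂`. The fibres of `D^*A^*C^*` over `C^*` have dimension `rank A + rank B`. If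
this is at least 2, then `Q = 0` (`mixedDefect_eq_zero`), and then `F = 0`
(`functionDefect_eq_zero`), so the nine conditions follow. In rank 0 they hold trivially. In rank 1
every such wedge product is zero, so this step gives nothing.

Two ingredients make the argument applicable. First, the 2-representations exist: their structure
equations are the Jacobi identity and the compatibility of the anchor with brackets, applied to
lifts and core sections (`twoRep`). Second, the Lie algebroids over `C^*` and their duality exist. A
derivation of `C^∞(V^*)` is determined by, and can be prescribed on, pullbacks and fibrewise linear
functions, which rests on Hadamard's lemma. This gives the Lie–Poisson structure
(`exists_isLiePoisson`), whose restriction to functions linear over `C^*` is the required Lie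
algebroid (`exists_isDualLieAlgebroid`). The duality exists, is unique (`isDuality_iff`) and is
perfect on sections (`isPerfPair_dualPairing`). -/

noncomputable section

namespace DoubleLie

set_option linter.unusedSectionVars false
set_option linter.unusedFintypeInType false

/-! ### Hadamard's lemma. -/

section Hadamard

universe u

open Set in
-- Differentiation under the integral sign: the partial derivative is continuous, hence bounded on
-- the compact product of a closed ball around `y` and the unit interval.
theorem hasFDerivAt_integral_unitInterval {E W : Type u} [NormedAddCommGroup E] [NormedSpace ℝ E]
    [FiniteDimensional ℝ E] [NormedAddCommGroup W] [NormedSpace ℝ W] {f : E → ℝ → W}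
    (hf : ContDiff ℝ 1 (Function.uncurry f)) (y : E) :
    HasFDerivAt (fun y => ∫ t in (0:ℝ)..1, f y t)
      (∫ t in (0:ℝ)..1, fderiv ℝ (fun y => f y t) y) y := by
  have hd : ∀ y t, HasFDerivAt (fun y => f y t)
      ((fderiv ℝ (Function.uncurry f) (y, t)).comp (ContinuousLinearMap.inl ℝ E ℝ)) y := by
    intro y t
    have h1 := (hf.differentiable one_ne_zero (y, t)).hasFDerivAt
    have h2 : HasFDerivAt (fun y : E => (y, t)) (ContinuousLinearMap.inl ℝ E ℝ) y :=
      hasFDerivAt_prodMk_left y t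
    exact h1.comp y h2
  have hc : Continuous (fun q : E × ℝ =>
      (fderiv ℝ (Function.uncurry f) q).comp (ContinuousLinearMap.inl ℝ E ℝ)) :=
    (hf.continuous_fderiv one_ne_zero).clm_comp continuous_const
  have hcomp : IsCompact (Metric.closedBall y 1 ×ˢ Icc (0:ℝ) 1) :=
    (isCompact_closedBall y 1).prod isCompact_Icc
  obtain ⟨K, hK⟩ := hcomp.exists_bound_of_continuousOn hc.continuousOn
  have hdd : ∀ y t, fderiv ℝ (fun y => f y t) y =
      (fderiv ℝ (Function.uncurry f) (y, t)).comp (ContinuousLinearMap.inl ℝ E ℝ) :=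
    fun y t => (hd y t).fderiv
  simp only [hdd]
  have hcf : ∀ y, Continuous (f y) := fun y =>
    hf.continuous.comp (continuous_const.prodMk continuous_id)
  refine intervalIntegral.hasFDerivAt_integral_of_dominated_of_fderiv_le (𝕜 := ℝ) (F := f)
    (F' := fun y t => (fderiv ℝ (Function.uncurry f) (y, t)).comp (ContinuousLinearMap.inl ℝ E ℝ))
    (bound := fun _ => K)
    (Metric.ball_mem_nhds y one_pos) (Filter.Eventually.of_forall fun y => ?_) ?_ ?_ ?_ ?_ ?_
  · exact (hcf y).aestronglyMeasurable
  · exact (hcf y).intervalIntegrable _ _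
  · exact (hc.comp (continuous_const.prodMk continuous_id)).aestronglyMeasurable
  · refine Filter.Eventually.of_forall fun t ht x hx => hK (x, t) ⟨Metric.ball_subset_closedBall hx, ?_⟩
    rw [uIoc_of_le zero_le_one] at ht
    exact ⟨ht.1.le, ht.2⟩
  · exact intervalIntegrable_const
  · exact Filter.Eventually.of_forall fun t _ x _ => hd x t

/-- The derivative of the integral is the integral of the derivative, so induction on `n` works once
`W` is allowed to vary: the derivative takes values in `E →L[ℝ] W`. The common universe of `E` and
`W` keeps this space within the scope of the induction. -/
theorem contDiff_integral_unitInterval {E : Type u} [NormedAddCommGroup E] [NormedSpace ℝ E]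
    [FiniteDimensional ℝ E] (n : ℕ) : ∀ {W : Type u} [NormedAddCommGroup W] [NormedSpace ℝ W]
    {f : E → ℝ → W}, ContDiff ℝ ∞ (Function.uncurry f) →
    ContDiff ℝ n (fun y => ∫ t in (0:ℝ)..1, f y t) := by
  induction n with
  | zero =>
    intro W _ _ f hf
    exact contDiff_zero.2 (continuous_iff_continuousAt.2 fun y =>
      (hasFDerivAt_integral_unitInterval (hf.of_le (by simp)) y).continuousAt)
  | succ n ih =>
    intro W _ _ f hf
    refine (contDiff_succ_iff_fderiv (n := n)).2 ⟨fun y =>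
      (hasFDerivAt_integral_unitInterval (hf.of_le (by simp)) y).differentiableAt, by simp, ?_⟩
    have : fderiv ℝ (fun y => ∫ t in (0:ℝ)..1, f y t)
        = fun y => ∫ t in (0:ℝ)..1, fderiv ℝ (fun y => f y t) y :=
      funext fun y => (hasFDerivAt_integral_unitInterval (hf.of_le (by simp)) y).fderiv
    rw [this]
    apply ih
    have : Function.uncurry (fun (y : E) (t : ℝ) => fderiv ℝ (fun y => f y t) y)
        = fun q : E × ℝ => (fderiv ℝ (Function.uncurry f) q).comp
          (ContinuousLinearMap.inl ℝ E ℝ) := by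
      funext q
      have h1 := ((hf.differentiable (by simp)) q).hasFDerivAt
      have h2 : HasFDerivAt (fun y : E => (y, q.2)) (ContinuousLinearMap.inl ℝ E ℝ) q.1 :=
        hasFDerivAt_prodMk_left q.1 q.2
      exact (h1.comp q.1 h2).fderiv
    rw [this]
    exact (hf.fderiv_right (by simp)).clm_comp contDiff_const

/-- Hadamard's lemma. -/
theorem exists_hadamard {E : Type u} [NormedAddCommGroup E] [NormedSpace ℝ E]
    [FiniteDimensional ℝ E] {g : E → ℝ} (hg : ContDiff ℝ ∞ g) (y₀ : E) :
    ∃ h : E → E →L[ℝ] ℝ, ContDiff ℝ ∞ h ∧ h y₀ = fderiv ℝ g y₀ ∧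
      ∀ y, g y = g y₀ + h y (y - y₀) := by
  have hlin : ContDiff ℝ ∞ (fun q : E × ℝ => y₀ + q.2 • (q.1 - y₀)) := by fun_prop
  have hF : ContDiff ℝ ∞ (Function.uncurry fun (y : E) (t : ℝ) => fderiv ℝ g (y₀ + t • (y - y₀))) :=
    (hg.fderiv_right (m := ∞) (by simp)).comp hlin
  -- The mean of the derivative along the segment from `y₀` to `y`; the identity is the fundamental
  -- theorem of calculus on that segment.
  refine ⟨fun y => ∫ t in (0:ℝ)..1, fderiv ℝ g (y₀ + t • (y - y₀)),
    contDiff_infty.2 fun n => contDiff_integral_unitInterval n hF, by simp, fun y => ?_⟩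
  have hcont : Continuous fun t : ℝ => fderiv ℝ g (y₀ + t • (y - y₀)) :=
    hF.continuous.comp (continuous_const.prodMk continuous_id)
  rw [ContinuousLinearMap.intervalIntegral_apply (hcont.intervalIntegrable _ _)]
  have hder : ∀ t ∈ Set.uIcc (0:ℝ) 1, HasDerivAt (fun t : ℝ => g (y₀ + t • (y - y₀)))
      (fderiv ℝ g (y₀ + t • (y - y₀)) (y - y₀)) t := by
    intro t _
    have h1 := (hg.differentiable (by simp) (y₀ + t • (y - y₀))).hasFDerivAt
    have h2 : HasDerivAt (fun t : ℝ => y₀ + t • (y - y₀)) (y - y₀) t := by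
      simpa using ((hasDerivAt_id t).smul_const (y - y₀)).const_add y₀
    exact h1.comp_hasDerivAt t h2
  rw [intervalIntegral.integral_eq_sub_of_hasDerivAt hder
    ((hcont.clm_apply continuous_const).intervalIntegrable _ _)]
  simp

end Hadamard

/-! ### Derivations of smooth functions at a point. -/

section PointDerivation

open Filter Topology

variable {EN HN N : Type*} [NormedAddCommGroup EN] [NormedSpace ℝ EN] [FiniteDimensional ℝ EN]
  [TopologicalSpace HN] {J : ModelWithCorners ℝ EN HN} [TopologicalSpace N] [ChartedSpace HN N]

/-- The linear functional `δ` on `C^∞(N)` is a derivation at the point `x`. -/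
def IsPointDerivation (x : N) (δ : Fn J N →ₗ[ℝ] ℝ) : Prop :=
  ∀ f g, δ (f * g) = f x * δ g + g x * δ f

/-- The evaluation of a derivation of `C^∞(N)` at a point. -/
def derivationAt (D : Derivation ℝ (Fn J N) (Fn J N)) (x : N) : Fn J N →ₗ[ℝ] ℝ where
  toFun f := D f x
  map_add' f g := by simp
  map_smul' c f := by simp

theorem isPointDerivation_derivationAt (D : Derivation ℝ (Fn J N) (Fn J N)) (x : N) :
    IsPointDerivation x (derivationAt D x) := by
  intro f g
  simp [derivationAt]

theorem IsPointDerivation.one {x : N} {δ : Fn J N →ₗ[ℝ] ℝ} (h : IsPointDerivation x δ) :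
    δ 1 = 0 := by
  have := h 1 1
  simp at this
  exact this

variable [IsManifold J ∞ N] [T2Space N]

variable (J) in
theorem exists_bump (x : N) {U : Set N} (hU : U ∈ 𝓝 x) :
    ∃ χ : Fn J N, (∀ᶠ y in 𝓝 x, χ y = 1) ∧ tsupport χ ⊆ U := by
  obtain ⟨ρ, h, -⟩ := (SmoothBumpFunction.nhds_basis_support (I := J) hU).mem_iff.1
    (Filter.univ_mem (f := 𝓝 x))
  exact ⟨⟨ρ, ρ.contMDiff⟩, ρ.eventuallyEq_one, h⟩

/-- Point derivations are local: a bump function `χ` supported where `f = g` satisfies `χ (f - g) =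
0`, and the Leibniz rule at `x` turns this into `δ (f - g) = 0`. -/
theorem IsPointDerivation.congr {x : N} {δ : Fn J N →ₗ[ℝ] ℝ} (h : IsPointDerivation x δ)
    {f g : Fn J N} (hfg : ∀ᶠ y in 𝓝 x, f y = g y) : δ f = δ g := by
  obtain ⟨χ, h1, h2⟩ := exists_bump J x hfg
  have h0 : χ * (f - g) = 0 := by
    ext y
    by_cases hy : y ∈ tsupport χ
    · have : f y = g y := h2 hy
      simp [this]
    · have : χ y = 0 := image_eq_zero_of_notMem_tsupport hy
      simp [this]
  have h3 := h χ (f - g)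
  rw [h0, map_zero, h1.self_of_nhds] at h3
  have h4 : (f - g) x = 0 := by
    have : f x = g x := hfg.self_of_nhds
    simp [this]
  rw [h4, map_sub] at h3
  linarith

/-- The chain rule for a derivation at a point. -/
theorem IsPointDerivation.comp {W : Type*} [NormedAddCommGroup W] [NormedSpace ℝ W]
    [FiniteDimensional ℝ W] {ι : Type*} [Fintype ι] (b : Module.Basis ι ℝ W)
    {x : N} {δ : Fn J N →ₗ[ℝ] ℝ} (hδ : IsPointDerivation x δ) {y : ι → Fn J N} {g : W → ℝ}
    (hg : ContDiff ℝ ∞ g) {G : Fn J N} (hG : ∀ x, G x = g (∑ i, y i x • b i)) :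
    δ G = ∑ i, fderiv ℝ g (∑ i, y i x • b i) (b i) * δ (y i) := by
  obtain ⟨h, hs, h0, hh⟩ := exists_hadamard hg (∑ i, y i x • b i)
  let k : ι → Fn J N := fun i => ⟨fun x => h (∑ i, y i x • b i) (b i), by
    have h1 : ContMDiff J 𝓘(ℝ, W) ∞ (fun x => ∑ i, y i x • b i) :=
      contMDiff_finsetSum fun i _ => (y i).contMDiff.smul contMDiff_const
    have h2 : ContDiff ℝ ∞ (fun w => h w (b i)) := hs.clm_apply contDiff_const
    exact h2.contMDiff.comp h1⟩
  -- Hadamard's lemma at the value of the coordinates at `x`. The second factors vanish at `x`, so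
  -- the Leibniz rule retains only the values `k i x`, which are the partial derivatives of `g`.
  have hk : G = (G x) • 1 + ∑ i, k i * (y i - (y i x) • 1) := by
    ext z
    have hsum : (∑ i, k i * (y i - (y i x) • 1) : Fn J N) z
        = ∑ i, k i z * (y i z - y i x) := by
      have := map_sum (ContMDiffMap.evalRingHom (I := J) (n := ∞) (𝕜 := ℝ) z)
        (fun i => k i * (y i - (y i x) • 1)) Finset.univ
      refine this.trans (Finset.sum_congr rfl fun i _ => ?_)
      change k i z * (y i z - y i x * 1) = _
      rw [mul_one]
    change G z = G x * 1 + _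
    rw [hsum, hG z, hG x, mul_one, hh (∑ i, y i z • b i), ← Finset.sum_sub_distrib, map_sum]
    congr 1
    refine Finset.sum_congr rfl fun i _ => ?_
    rw [← sub_smul, map_smul, smul_eq_mul, mul_comm]
    rfl
  rw [hk, map_add, map_smul, hδ.one, smul_zero, zero_add, map_sum]
  refine Finset.sum_congr rfl fun i _ => ?_
  have hz : (y i - (y i x) • 1 : Fn J N) x = 0 := by
    change y i x - y i x * 1 = 0
    ring
  rw [hδ, hz, map_sub, map_smul, hδ.one, zero_mul, smul_zero, sub_zero, add_zero]
  congr 1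
  change h _ (b i) = _
  rw [h0]

variable [J.Boundaryless]

/-- If a smooth map `Y` to a vector space agrees near `x₀` with the preferred chart at `x₀`, then
each smooth function is, near `x₀`, a smooth function of `Y`. -/
theorem exists_contDiff_of_eventuallyEq_extChartAt (x₀ : N) {Y : N → EN}
    (hY : ∀ᶠ x in 𝓝 x₀, Y x = extChartAt J x₀ x) (G : Fn J N) :
    ∃ g : EN → ℝ, ContDiff ℝ ∞ g ∧ ∀ᶠ x in 𝓝 x₀, G x = g (Y x) := by
  have ht : (extChartAt J x₀).target ∈ 𝓝 (extChartAt J x₀ x₀) := extChartAt_target_mem_nhds x₀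
  obtain ⟨χ, h1, h2⟩ := exists_bump 𝓘(ℝ, EN) (extChartAt J x₀ x₀) ht
  -- The cutoff, supported in the target of the chart, makes the local expression of `G` smooth on
  -- the whole vector space.
  refine ⟨fun y => χ y • G ((extChartAt J x₀).symm y), ?_, ?_⟩
  · rw [← contMDiff_iff_contDiff]
    refine contMDiff_of_tsupport fun y hy => ?_
    have hy' : y ∈ (extChartAt J x₀).target := h2 (tsupport_smul_subset_left _ _ hy)
    have h3 : ContMDiffAt 𝓘(ℝ, EN) J ∞ (extChartAt J x₀).symm y :=
      (contMDiffOn_extChartAt_symm x₀).contMDiffAt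
        ((isOpen_extChartAt_target x₀).mem_nhds hy')
    exact χ.contMDiff.contMDiffAt.smul (ContMDiffAt.comp y G.contMDiff.contMDiffAt h3)
  · have hcont : ContinuousAt (extChartAt J x₀) x₀ := continuousAt_extChartAt x₀
    filter_upwards [hY, hcont.eventually h1, extChartAt_source_mem_nhds (I := J) x₀]
      with x hx hx1 hx2
    rw [hx, hx1, one_smul, (extChartAt J x₀).left_inv hx2]

/-- A finite family of smooth functions which are coordinates near a point. -/
theorem exists_eventually_pointDerivation_eq (x₀ : N) {ι : Type*} [Fintype ι]
    (b : Module.Basis ι ℝ EN) {y : ι → Fn J N}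
    (hy : ∀ᶠ x in 𝓝 x₀, ∑ i, y i x • b i = extChartAt J x₀ x) (G : Fn J N) :
    ∃ g : ι → Fn J N, ∀ᶠ x in 𝓝 x₀, ∀ δ : Fn J N →ₗ[ℝ] ℝ, IsPointDerivation x δ →
      δ G = ∑ i, g i x * δ (y i) := by
  obtain ⟨g, hg, hG⟩ := exists_contDiff_of_eventuallyEq_extChartAt x₀ hy G
  have h1 : ContMDiff J 𝓘(ℝ, EN) ∞ (fun x => ∑ i, y i x • b i) :=
    contMDiff_finsetSum fun i _ => (y i).contMDiff.smul contMDiff_const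
  -- The coefficients are the partial derivatives of the local expression. The same smooth functions
  -- serve all points near `x₀` and all derivations there, which later yields smooth dependence on
  -- the point.
  refine ⟨fun i => ⟨fun x => fderiv ℝ g (∑ i, y i x • b i) (b i), ?_⟩, ?_⟩
  · exact (((hg.fderiv_right (m := ∞) (by simp)).clm_apply contDiff_const).contMDiff).comp h1
  · filter_upwards [hG.eventually_nhds] with x hx δ hδ
    let G' : Fn J N := ⟨fun x => g (∑ i, y i x • b i), hg.contMDiff.comp h1⟩
    rw [hδ.congr (g := G') hx, hδ.comp b hg (G := G') fun _ => rfl]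
    rfl

/-- Each point has smooth functions which are coordinates near it. -/
theorem exists_coordinates (x₀ : N) {ι : Type*} [Fintype ι] (b : Module.Basis ι ℝ EN) :
    ∃ y : ι → Fn J N, ∀ᶠ x in 𝓝 x₀, ∑ i, y i x • b i = extChartAt J x₀ x := by
  obtain ⟨ρ⟩ : Nonempty (SmoothBumpFunction J x₀) := inferInstance
  have h : ∀ i, ContMDiff J 𝓘(ℝ, ℝ) ∞ fun x => ρ x • b.coord i (extChartAt J x₀ x) := by
    intro i
    refine ρ.contMDiff_smul ?_
    have h1 : ContMDiff 𝓘(ℝ, EN) 𝓘(ℝ, ℝ) ∞ (LinearMap.toContinuousLinearMap (b.coord i)) :=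
      (LinearMap.toContinuousLinearMap (b.coord i)).contDiff.contMDiff
    exact h1.comp_contMDiffOn (contMDiffOn_extChartAt (I := J))
  refine ⟨fun i => ⟨_, h i⟩, ?_⟩
  filter_upwards [ρ.eventuallyEq_one] with x hx
  change ∑ i, (ρ x • b.coord i (extChartAt J x₀ x)) • b i = _
  simp [hx, b.sum_repr]

end PointDerivation

set_option linter.unusedSectionVars false

/-! ### Local frames, and derivations of the functions on a dual bundle. -/

section VectorBundle

open Filter Topology

section

variable {N : Type*} [TopologicalSpace N] {F : Type*} [TopologicalSpace F]
  {V : N → Type*} [TopologicalSpace (TotalSpace F V)] [∀ x, TopologicalSpace (V x)]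
  [FiberBundle F V]

/-- Points over different base points are separated by the base; points of one fibre lie in the
domain of one trivialization and are separated there. -/
theorem t2Space_totalSpace [T2Space N] [T2Space F] : T2Space (TotalSpace F V) := by
  refine ⟨fun v w hvw => ?_⟩
  have hc : Continuous (TotalSpace.proj : TotalSpace F V → N) := FiberBundle.continuous_proj F V
  by_cases h : v.proj = w.proj
  · let e := trivializationAt F V v.proj
    have hv : v ∈ e.source := e.mem_source.2 (FiberBundle.mem_baseSet_trivializationAt' _)
    have hw : w ∈ e.source :=
      e.mem_source.2 (by rw [← h]; exact FiberBundle.mem_baseSet_trivializationAt' _)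
    have hne : e v ≠ e w := fun h' => hvw (e.injOn hv hw h')
    obtain ⟨U, U', hU, hU', h1, h2, h3⟩ := t2_separation hne
    refine ⟨e.source ∩ e ⁻¹' U, e.source ∩ e ⁻¹' U', ?_, ?_, ⟨hv, h1⟩, ⟨hw, h2⟩, ?_⟩
    · exact e.continuousOn_toFun.isOpen_inter_preimage e.open_source hU
    · exact e.continuousOn_toFun.isOpen_inter_preimage e.open_source hU'
    · exact Set.disjoint_left.2 fun z hz hz' => Set.disjoint_left.1 h3 hz.2 hz'.2
  · obtain ⟨U, U', hU, hU', h1, h2, h3⟩ := t2_separation h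
    exact ⟨_, _, hU.preimage hc, hU'.preimage hc, h1, h2, h3.preimage _⟩

end

variable {EN HN N : Type*} [NormedAddCommGroup EN] [NormedSpace ℝ EN] [FiniteDimensional ℝ EN]
  [TopologicalSpace HN] {J : ModelWithCorners ℝ EN HN} [TopologicalSpace N] [ChartedSpace HN N]
  {F : Type*} [NormedAddCommGroup F] [NormedSpace ℝ F] [FiniteDimensional ℝ F]
  {V : N → Type*} [TopologicalSpace (TotalSpace F V)] [∀ x, TopologicalSpace (V x)]
  [FiberBundle F V] [∀ x, AddCommGroup (V x)] [∀ x, Module ℝ (V x)] [VectorBundle ℝ F V]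

instance [T2Space N] : T2Space (TotalSpace F V) := t2Space_totalSpace

@[simp] theorem pull_apply (f : Fn J N) (v : TotalSpace F V) : (pull f : FnTot J F V) v = f v.proj :=
  rfl

@[simp] theorem compSec_apply (G : FnTot J F V) (s : Sec J F V) (x : N) :
    compSec G s x = G ⟨x, s x⟩ := rfl

@[simp] theorem ell_apply (s : Sec J F V) (φ : DualTot F V) : ell s φ = φ.snd (s φ.proj) := rfl

variable (J F V) in
/-- The pullback of functions along the projection of a vector bundle. -/
def pullHom : Fn J N →ₐ[ℝ] FnTot J F V where
  toFun := pull
  map_one' := rfl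
  map_mul' _ _ := rfl
  map_zero' := rfl
  map_add' _ _ := rfl
  commutes' _ := rfl

@[simp] theorem pullHom_apply (f : Fn J N) : pullHom J F V f = pull f := rfl

@[simp] theorem pull_add (f g : Fn J N) : (pull (f + g) : FnTot J F V) = pull f + pull g := rfl
@[simp] theorem pull_sub (f g : Fn J N) : (pull (f - g) : FnTot J F V) = pull f - pull g := rfl
@[simp] theorem pull_neg (f : Fn J N) : (pull (-f) : FnTot J F V) = -pull f := rfl
@[simp] theorem pull_mul (f g : Fn J N) : (pull (f * g) : FnTot J F V) = pull f * pull g := rfl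
@[simp] theorem pull_zero : (pull (0 : Fn J N) : FnTot J F V) = 0 := rfl

theorem pull_injective : Function.Injective (pull : Fn J N → FnTot J F V) := by
  intro f g h
  ext x
  exact congrArg (fun G : FnTot J F V => G ⟨x, 0⟩) h

@[simp] theorem compSec_pull (f : Fn J N) (s : Sec J F V) : compSec (pull f) s = f := by
  ext x; rfl

@[simp] theorem ell_add (s t : Sec J F V) : ell (s + t) = ell s + ell t := by
  ext φ
  exact map_add φ.snd _ _

@[simp] theorem ell_neg (s : Sec J F V) : ell (-s) = -ell s := by
  ext φ
  exact map_neg φ.snd _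

@[simp] theorem ell_sub (s t : Sec J F V) : ell (s - t) = ell s - ell t := by
  ext φ
  exact map_sub φ.snd _ _

@[simp] theorem ell_smul (f : Fn J N) (s : Sec J F V) : ell (f • s) = pull f * ell s := by
  ext φ
  exact map_smul φ.snd _ _

@[simp] theorem ell_zero : ell (0 : Sec J F V) = 0 := by
  ext φ
  exact map_zero φ.snd

theorem Fn.sum_apply {ι : Type*} [Fintype ι] (f : ι → Fn J N) (x : N) :
    (∑ i, f i) x = ∑ i, f i x :=
  map_sum (ContMDiffMap.evalRingHom (I := J) (n := ∞) (𝕜 := ℝ) x) f Finset.univ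

theorem Sec.sum_apply {ι : Type*} [Fintype ι] (s : ι → Sec J F V) (x : N) :
    (∑ i, s i) x = ∑ i, s i x := by
  have := map_sum (ContMDiffSection.coeAddHom J F ∞ V) s Finset.univ
  exact (congrFun this x).trans (Finset.sum_apply _ _ _)

theorem ell_sum {ι : Type*} [Fintype ι] (s : ι → Sec J F V) : ell (∑ i, s i) = ∑ i, ell (s i) := by
  ext φ
  rw [Fn.sum_apply, ell_apply, Sec.sum_apply, map_sum]
  rfl

variable [IsManifold J ∞ N] [T2Space N] [ContMDiffVectorBundle ∞ F V J]

/-- A smooth local resolution of the identity of a vector bundle: near each point there are dual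
frames of `V` and `V^*`, cut off by a bump function. -/
theorem exists_dual_frames (x₀ : N) {ι : Type*} [Fintype ι] (b : Module.Basis ι ℝ F) :
    ∃ (s : ι → Sec J F V) (ε : ι → FnTot J F V) (χ : Fn J N), (∀ i, FibreLinear (ε i)) ∧
      (∀ᶠ x in 𝓝 x₀, χ x = 1) ∧ (∀ x (v : V x), ∑ i, ε i ⟨x, v⟩ • s i x = χ x • v) ∧
      (∀ᶠ x in 𝓝 x₀, ∀ i, s i x = (trivializationAt F V x₀).symmL ℝ x (b i)) ∧
      (∀ᶠ x in 𝓝 x₀, ∀ i j, ε i ⟨x, s j x⟩ = b.coord i (b j)) := by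
  set e := trivializationAt F V x₀ with he
  have hx₀ : e.baseSet ∈ 𝓝 x₀ :=
    e.open_baseSet.mem_nhds (FiberBundle.mem_baseSet_trivializationAt' x₀)
  obtain ⟨χ, h1, h2⟩ := exists_bump J x₀ hx₀
  have hs : ∀ i, ContMDiffOn J (J.prod 𝓘(ℝ, F)) ∞
      (fun x => TotalSpace.mk' F x (e.symmL ℝ x (b i))) e.baseSet := by
    intro i
    rw [e.contMDiffOn_section_baseSet_iff]
    refine (contMDiffOn_const (c := b i)).congr fun x hx => ?_
    rw [e.symmL_apply hx]
    exact congrArg Prod.snd (e.apply_mk_symm hx (b i))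
  let s : ι → Sec J F V := fun i => ⟨(⇑χ) • fun x => e.symmL ℝ x (b i),
    ContMDiffOn.smul_section_of_tsupport χ.contMDiff.contMDiffOn e.open_baseSet h2 (hs i)⟩
  have hε : ∀ i, ContMDiff (J.prod 𝓘(ℝ, F)) 𝓘(ℝ, ℝ) ∞
      (fun v : TotalSpace F V => χ v.proj • b.coord i (e v).2) := by
    intro i
    refine contMDiff_of_tsupport fun v hv => ?_
    have hv' : v.proj ∈ e.baseSet := by
      apply h2
      have h3 : tsupport (fun v : TotalSpace F V => χ v.proj) ⊆ TotalSpace.proj ⁻¹' tsupport χ :=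
        closure_minimal (fun v hv => subset_tsupport χ hv)
          ((isClosed_tsupport χ).preimage (FiberBundle.continuous_proj F V))
      exact h3 (tsupport_smul_subset_left _ _ hv)
    have h4 : ContMDiffAt (J.prod 𝓘(ℝ, F)) (J.prod 𝓘(ℝ, F)) ∞ e v :=
      e.contMDiffOn.contMDiffAt (e.open_source.mem_nhds (e.mem_source.2 hv'))
    have h5 : ContDiff ℝ ∞ (LinearMap.toContinuousLinearMap (b.coord i)) :=
      ContinuousLinearMap.contDiff _
    exact ((χ.contMDiff.comp (contMDiff_proj V)).contMDiffAt).smul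
      (ContMDiffAt.comp v h5.contMDiff.contMDiffAt (contMDiffAt_snd.comp v h4))
  have hχ0 : ∀ x, x ∉ e.baseSet → χ x = 0 := fun x hx =>
    image_eq_zero_of_notMem_tsupport fun h => hx (h2 h)
  -- The square occurs because both the sections and the linear functions carry the cutoff.
  refine ⟨s, fun i => ⟨_, hε i⟩, χ * χ, fun i x => ?_, ?_, fun x v => ?_, ?_, ?_⟩
  · by_cases hx : x ∈ e.baseSet
    · have hl := e.linear ℝ hx
      refine ⟨fun v w => ?_, fun c v => ?_⟩
      · change χ x • b.coord i (e ⟨x, v + w⟩).2 = χ x • b.coord i (e ⟨x, v⟩).2 + χ x • b.coord i (e ⟨x, w⟩).2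
        rw [hl.1, map_add, smul_add]
      · change χ x • b.coord i (e ⟨x, c • v⟩).2 = c • (χ x • b.coord i (e ⟨x, v⟩).2)
        rw [hl.2, map_smul, smul_comm]
    · have h0 : ∀ v : V x, χ x • b.coord i (e ⟨x, v⟩).2 = 0 := fun v => by
        rw [hχ0 x hx, zero_smul]
      refine ⟨fun v w => ?_, fun c v => (h0 _).trans ((smul_zero c).symm.trans
        (congrArg (c • ·) (h0 v).symm))⟩
      exact (h0 _).trans ((add_zero 0).symm.trans (congrArg₂ (· + ·) (h0 v) (h0 w)).symm)
  · filter_upwards [h1] with x hx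
    change χ x * χ x = 1
    rw [hx, mul_one]
  · change ∑ i, (χ x • b.coord i (e ⟨x, v⟩).2) • (χ x • e.symmL ℝ x (b i)) = (χ x * χ x) • v
    by_cases hx : x ∈ e.baseSet
    · have h6 : e.symmL ℝ x (e ⟨x, v⟩).2 = v := by
        rw [e.symmL_apply hx]
        exact e.symm_proj_apply ⟨x, v⟩ hx
      conv_rhs => rw [← h6, ← b.sum_repr (e ⟨x, v⟩).2, map_sum, Finset.smul_sum]
      refine Finset.sum_congr rfl fun i _ => ?_
      rw [map_smul, smul_smul, smul_smul, Module.Basis.coord_apply]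
      congr 1
      simp only [smul_eq_mul]
      ring
    · simp [hχ0 x hx]
  · filter_upwards [h1] with x hx i
    change χ x • e.symmL ℝ x (b i) = _
    rw [hx, one_smul]
  · filter_upwards [h1, hx₀] with x hx hx' i j
    change χ x • b.coord i (e ⟨x, χ x • e.symmL ℝ x (b j)⟩).2 = _
    rw [hx, one_smul, one_smul, e.symmL_apply hx', e.apply_mk_symm hx']

/-- Two point derivations agreeing on coordinates are equal. -/
theorem IsPointDerivation.eq_of_coordinates [J.Boundaryless] {x : N} {δ δ' : Fn J N →ₗ[ℝ] ℝ}
    (h : IsPointDerivation x δ) (h' : IsPointDerivation x δ') {ι : Type*} [Fintype ι]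
    (b : Module.Basis ι ℝ EN) {y : ι → Fn J N}
    (hy : ∀ᶠ z in 𝓝 x, ∑ i, y i z • b i = extChartAt J x z) (hδ : ∀ i, δ (y i) = δ' (y i))
    (f : Fn J N) : δ f = δ' f := by
  obtain ⟨g, hg⟩ := exists_eventually_pointDerivation_eq x b hy f
  rw [hg.self_of_nhds δ h, hg.self_of_nhds δ' h']
  simp [hδ]

/-- The directional derivative in the preferred chart along `∑ i, c i • b i`: near `x` the functions
`y i` are the chart coordinates with respect to `b`. -/
theorem exists_isPointDerivation [J.Boundaryless] (x : N) {ι : Type*} [Fintype ι]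
    (b : Module.Basis ι ℝ EN) {y : ι → Fn J N}
    (hy : ∀ᶠ z in 𝓝 x, ∑ i, y i z • b i = extChartAt J x z) (c : ι → ℝ) :
    ∃ δ : Fn J N →ₗ[ℝ] ℝ, IsPointDerivation x δ ∧ ∀ i, δ (y i) = c i := by
  set φ := extChartAt J x with hφ
  have hmem : φ x ∈ φ.target := mem_extChartAt_target x
  have hd : ∀ f : Fn J N, DifferentiableAt ℝ (fun z => f (φ.symm z)) (φ x) := by
    intro f
    have h3 : ContMDiffAt 𝓘(ℝ, EN) J ∞ φ.symm (φ x) :=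
      (contMDiffOn_extChartAt_symm x).contMDiffAt ((isOpen_extChartAt_target x).mem_nhds hmem)
    exact ((ContMDiffAt.comp _ f.contMDiff.contMDiffAt h3).contDiffAt).differentiableAt (by simp)
  have hx : φ.symm (φ x) = x := extChartAt_to_inv x
  refine ⟨{ toFun := fun f => fderiv ℝ (fun z => f (φ.symm z)) (φ x) (∑ i, c i • b i)
            map_add' := fun f g => ?_
            map_smul' := fun r f => ?_ }, fun f g => ?_, fun i => ?_⟩
  · have := fderiv_fun_add (hd f) (hd g)
    exact congrArg (fun L : EN →L[ℝ] ℝ => L (∑ i, c i • b i)) this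
  · have := fderiv_fun_const_smul (hd f) r
    exact congrArg (fun L : EN →L[ℝ] ℝ => L (∑ i, c i • b i)) this
  · have := fderiv_fun_mul (hd f) (hd g)
    rw [hx] at this
    exact congrArg (fun L : EN →L[ℝ] ℝ => L (∑ i, c i • b i)) this
  · have h1 : (fun z => y i (φ.symm z)) =ᶠ[𝓝 (φ x)]
        fun z => LinearMap.toContinuousLinearMap (b.coord i) z := by
      have hc : ContinuousAt φ.symm (φ x) := continuousAt_extChartAt_symm x
      have ht : Tendsto φ.symm (𝓝 (φ x)) (𝓝 x) := by
        have := hc.tendsto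
        rwa [hx] at this
      filter_upwards [ht.eventually hy, extChartAt_target_mem_nhds (I := J) x] with z hz hz'
      rw [← φ.right_inv hz', ← hz, hz]
      rw [φ.right_inv hz']
      have h2 := congrArg (b.coord i) hz
      rw [φ.right_inv hz'] at h2
      rw [LinearMap.coe_toContinuousLinearMap', ← h2, Module.Basis.coord_apply, b.repr_sum_self]
    change fderiv ℝ (fun z => y i (φ.symm z)) (φ x) (∑ i, c i • b i) = c i
    rw [h1.fderiv_eq, ContinuousLinearMap.fderiv, LinearMap.coe_toContinuousLinearMap',
      Module.Basis.coord_apply, b.repr_sum_self]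

section Dual

variable [J.Boundaryless]

/-- Near each point, `C^∞(V^*)` has coordinates which are pullbacks or fibrewise linear. -/
theorem exists_coordinates_dual (φ₀ : DualTot F V) :
    ∃ (y : Fin (Module.finrank ℝ EN) → Fn J N) (s : Fin (Module.finrank ℝ F) → Sec J F V)
      (b : Module.Basis (Fin (Module.finrank ℝ EN) ⊕ Fin (Module.finrank ℝ F)) ℝ
        (EN × (F →L[ℝ] ℝ))),
      (∀ᶠ φ in 𝓝 φ₀, ∑ k, (Sum.elim (fun i => pull (y i)) (fun j => ell (s j)) k : FnDual J F V) φ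
        • b k = extChartAt (J.prod 𝓘(ℝ, F →L[ℝ] ℝ)) φ₀ φ) ∧
      (∀ᶠ x in 𝓝 φ₀.proj, ∑ i, y i x • Module.finBasis ℝ EN i = extChartAt J φ₀.proj x) ∧
      ∃ (χ : Fn J N) (ε : Fin (Module.finrank ℝ F) → FnTot J F V), χ φ₀.proj = 1 ∧
        ∀ x (v : V x), ∑ i, ε i ⟨x, v⟩ • s i x = χ x • v := by
  let b₁ := Module.finBasis ℝ EN
  let b₂ := Module.finBasis ℝ F
  let b₃ : Module.Basis _ ℝ (F →L[ℝ] ℝ) := b₂.dualBasis.map LinearMap.toContinuousLinearMap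
  obtain ⟨y, hy⟩ := exists_coordinates (J := J) φ₀.proj b₁
  obtain ⟨s, ε, χ, -, hχ, hε, hs, -⟩ := exists_dual_frames (J := J) (V := V) φ₀.proj b₂
  refine ⟨y, s, b₁.prod b₃, ?_, hy, χ, ε, hχ.self_of_nhds, hε⟩
  have hc : Tendsto (TotalSpace.proj : DualTot F V → N) (𝓝 φ₀) (𝓝 φ₀.proj) :=
    (FiberBundle.continuous_proj (F →L[ℝ] ℝ) (DualFibre V)).continuousAt
  have hbase := (trivializationAt F V φ₀.proj).open_baseSet.mem_nhds
    (FiberBundle.mem_baseSet_trivializationAt' φ₀.proj)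
  filter_upwards [hc.eventually hy, hc.eventually hs, hc.eventually hbase] with φ h1 h2 h3
  rw [FiberBundle.extChartAt, Fintype.sum_sum_type]
  refine Prod.ext ?_ ?_
  · simp only [Sum.elim_inl, Sum.elim_inr, Prod.fst_add, Prod.fst_sum, Prod.smul_fst,
      Module.Basis.prod_apply_inl_fst, Module.Basis.prod_apply_inr_fst, smul_zero,
      Finset.sum_const_zero, add_zero, pull_apply]
    exact h1
  · simp only [Sum.elim_inl, Sum.elim_inr, Prod.snd_add, Prod.snd_sum, Prod.smul_snd,
      Module.Basis.prod_apply_inl_snd, Module.Basis.prod_apply_inr_snd, smul_zero,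
      Finset.sum_const_zero, zero_add, ell_apply]
    change _ = (ContinuousLinearMap.inCoordinates F V ℝ (Trivial N ℝ) φ₀.proj φ.proj φ₀.proj φ.proj
      φ.snd)
    apply ContinuousLinearMap.coe_injective
    refine b₂.ext fun j => ?_
    have h4 : ((ContinuousLinearMap.inCoordinates F V ℝ (Trivial N ℝ) φ₀.proj φ.proj φ₀.proj φ.proj
        φ.snd) : F →ₗ[ℝ] ℝ) (b₂ j) = φ.snd (s j φ.proj) := by
      rw [h2, ContinuousLinearMap.inCoordinates_eq h3 (Set.mem_univ _)]
      have h5 := congrFun ((trivializationAt F V φ₀.proj).symm_continuousLinearEquivAt_eq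
        (R := ℝ) h3) (b₂ j)
      exact congrArg φ.snd h5
    rw [h4]
    simp [b₃, Finsupp.single_apply]

/-- A derivation at a point of `V^*` is determined by its values on pullbacks and on fibrewise
linear functions. -/
theorem IsPointDerivation.dual_ext {φ : DualTot F V} {δ δ' : FnDual J F V →ₗ[ℝ] ℝ}
    (h : IsPointDerivation φ δ) (h' : IsPointDerivation φ δ')
    (h₁ : ∀ f : Fn J N, δ (pull f) = δ' (pull f)) (h₂ : ∀ s, δ (ell s) = δ' (ell s))
    (G : FnDual J F V) : δ G = δ' G := by
  obtain ⟨y, s, b, hy, -⟩ := exists_coordinates_dual (J := J) φ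
  refine h.eq_of_coordinates h' b hy (fun k => ?_) G
  rcases k with i | j
  · exact h₁ _
  · exact h₂ _

/-- A derivation of `C^∞(V^*)` is determined by its values on pullbacks and on fibrewise linear
functions. -/
theorem derivation_dual_ext {X X' : Derivation ℝ (FnDual J F V) (FnDual J F V)}
    (h₁ : ∀ f : Fn J N, X (pull f) = X' (pull f)) (h₂ : ∀ s, X (ell s) = X' (ell s)) : X = X' := by
  ext G φ
  exact (isPointDerivation_derivationAt X φ).dual_ext (isPointDerivation_derivationAt X' φ)
    (fun f => congrArg (fun H : FnDual J F V => H φ) (h₁ f))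
    (fun s => congrArg (fun H : FnDual J F V => H φ) (h₂ s)) G

/-- A derivation of `C^∞(V^*)` may be prescribed on pullbacks and on fibrewise linear functions. -/
theorem exists_derivation_dual (u : Fn J N →ₗ[ℝ] FnDual J F V) (w : Sec J F V →+ FnDual J F V)
    (hu : ∀ f g, u (f * g) = pull f * u g + pull g * u f)
    (hw : ∀ (f : Fn J N) s, w (f • s) = pull f * w s + ell s * u f) :
    ∃ X : Derivation ℝ (FnDual J F V) (FnDual J F V),
      (∀ f, X (pull f) = u f) ∧ ∀ s, X (ell s) = w s := by
  -- At each point the values are imposed on finitely many coordinates only. The Leibniz rules `hu`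
  -- and `hw` then propagate them to all pullbacks and all fibrewise linear functions.
  have hpt : ∀ φ : DualTot F V, ∃ δ : FnDual J F V →ₗ[ℝ] ℝ, IsPointDerivation φ δ ∧
      (∀ f, δ (pull f) = u f φ) ∧ ∀ s, δ (ell s) = w s φ := by
    intro φ
    obtain ⟨y, s, b, hb, hy, χ, ε, hχ, hε⟩ := exists_coordinates_dual (J := J) φ
    obtain ⟨δ, hδ, hδ'⟩ := exists_isPointDerivation φ b hb
      (Sum.elim (fun i => u (y i) φ) fun j => w (s j) φ)
    have h1 : ∀ f, δ (pull f) = u f φ := by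
      let δ₁ : Fn J N →ₗ[ℝ] ℝ := δ ∘ₗ (pullHom J (F →L[ℝ] ℝ) (DualFibre V)).toLinearMap
      let δ₂ : Fn J N →ₗ[ℝ] ℝ :=
        { toFun := fun f => u f φ
          map_add' := fun f g => by rw [map_add]; rfl
          map_smul' := fun c f => by rw [map_smul]; rfl }
      have hδ₁ : IsPointDerivation φ.proj δ₁ := fun f g => hδ (pull f) (pull g)
      have hδ₂ : IsPointDerivation φ.proj δ₂ := fun f g =>
        congrArg (fun G : FnDual J F V => G φ) (hu f g)
      exact hδ₁.eq_of_coordinates hδ₂ (Module.finBasis ℝ EN) hy fun i => hδ' (Sum.inl i)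
    refine ⟨δ, hδ, h1, fun t => ?_⟩
    have h2 : ∀ (f : Fn J N) t, δ (ell (f • t)) = f φ.proj * δ (ell t) + φ.snd (t φ.proj) * u f φ := by
      intro f t
      rw [ell_smul, hδ, h1]
      rfl
    have h3 : ∀ (f : Fn J N) t, w (f • t) φ = f φ.proj * w t φ + φ.snd (t φ.proj) * u f φ :=
      fun f t => congrArg (fun G : FnDual J F V => G φ) (hw f t)
    -- Only a cut-off multiple of `t` is a combination of the frame. Both functionals obey the same
    -- rule for products with functions, so the factor `χ`, equal to 1 at the base point, can be
    -- removed at the end.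
    have h4 : χ • t = ∑ j, compSec (ε j) t • s j := by
      ext x
      rw [Sec.sum_apply]
      exact (hε x (t x)).symm
    have h5 : δ (ell (χ • t)) = w (χ • t) φ := by
      rw [h4, ell_sum, map_sum, map_sum, Fn.sum_apply]
      refine Finset.sum_congr rfl fun j _ => ?_
      rw [h2, h3]
      congr 2
      exact hδ' (Sum.inr j)
    rw [h2, h3, hχ, one_mul, one_mul] at h5
    exact add_right_cancel h5
  choose δ hδ hδu hδw using hpt
  -- Near each point `δ φ G` is a combination, with smooth coefficients independent of the
  -- derivation, of the prescribed smooth values on the coordinates.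
  have hsm : ∀ G : FnDual J F V, ContMDiff (J.prod 𝓘(ℝ, F →L[ℝ] ℝ)) 𝓘(ℝ, ℝ) ∞
      (fun φ => δ φ G) := by
    intro G φ₀
    obtain ⟨y, s, b, hb, -⟩ := exists_coordinates_dual (J := J) φ₀
    obtain ⟨g, hg⟩ := exists_eventually_pointDerivation_eq φ₀ b hb G
    refine ContMDiffAt.congr_of_eventuallyEq (f := ((∑ k, g k * Sum.elim (fun i => u (y i))
      (fun j => w (s j)) k : FnDual J F V) : DualTot F V → ℝ)) (ContMDiffMap.contMDiff _ _) ?_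
    filter_upwards [hg] with φ hφ
    rw [hφ _ (hδ φ), Fn.sum_apply]
    refine Finset.sum_congr rfl fun k _ => ?_
    rcases k with i | j
    · exact congrArg _ (hδu φ _)
    · exact congrArg _ (hδw φ _)
  refine ⟨Derivation.mk' { toFun := fun G => ⟨fun φ => δ φ G, hsm G⟩
                           map_add' := fun G G' => ?_
                           map_smul' := fun c G => ?_ } fun G G' => ?_, fun f => ?_, fun s => ?_⟩
  · ext φ
    exact map_add (δ φ) _ _
  · ext φ
    exact map_smul (δ φ) _ _
  · ext φ
    exact hδ φ G G'
  · ext φ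
    exact hδu φ f
  · ext φ
    exact hδw φ s

end Dual

end VectorBundle

/-! ### Formal rules for Lie algebroid brackets. -/

section LieAlgebroidLemmas

variable {R X : Type*} [CommRing R] [Algebra ℝ R] [AddCommGroup X] [Module R X]

namespace LieAlgebroid

variable (L : LieAlgebroid R X)

theorem bracket_zero (x : X) : L.bracket x 0 = 0 := by
  have := L.bracket_add x 0 0
  rw [add_zero] at this
  exact left_eq_add.1 this

theorem zero_bracket (x : X) : L.bracket 0 x = 0 := by
  have := L.add_bracket 0 0 x
  rw [add_zero] at this
  exact left_eq_add.1 this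

theorem bracket_skew (x y : X) : L.bracket y x = -L.bracket x y := by
  have := L.bracket_self (x + y)
  rw [L.bracket_add, L.add_bracket, L.add_bracket, L.bracket_self, L.bracket_self, zero_add,
    add_zero] at this
  exact eq_neg_of_add_eq_zero_left this

theorem bracket_neg (x y : X) : L.bracket x (-y) = -L.bracket x y := by
  have := L.bracket_add x y (-y)
  rw [add_neg_cancel, L.bracket_zero] at this
  exact (neg_eq_of_add_eq_zero_right this.symm).symm

theorem smul_bracket (f : R) (x y : X) :
    L.bracket (f • x) y = f • L.bracket x y - L.anchor y f • x := by
  rw [L.bracket_skew y, L.leibniz, L.bracket_skew x y, smul_neg]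
  abel

theorem bracket_sum {ι : Type*} (x : X) (s : Finset ι) (y : ι → X) :
    L.bracket x (∑ i ∈ s, y i) = ∑ i ∈ s, L.bracket x (y i) :=
  map_sum (⟨⟨L.bracket x, L.bracket_zero x⟩, L.bracket_add x⟩ : X →+ X) y s

end LieAlgebroid

end LieAlgebroidLemmas

/-! ### Poisson brackets from Hamiltonian vector fields of generators. -/

section PoissonGenerators

variable {K : Type*} [CommRing K] [Algebra ℝ K]

/-- A Poisson bracket can be constructed from Hamiltonian vector fields of generators. -/
theorem exists_poissonBracket {𝒢 : Set K}
    (hext : ∀ X : Derivation ℝ K K, (∀ g ∈ 𝒢, X g = 0) → X = 0) (X Y : K → Derivation ℝ K K)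
    (hY : ∀ g ∈ 𝒢, ∀ G, Y G g = X g G) (hX : ∀ g ∈ 𝒢, ∀ h ∈ 𝒢, X g h = -X h g)
    (hjac : ∀ g ∈ 𝒢, ∀ h ∈ 𝒢, ∀ k ∈ 𝒢, X g (X h k) + X h (X k g) + X k (X g h) = 0) :
    ∃ P : PoissonBracket K, ∀ g ∈ 𝒢, ∀ G, P.bracket g G = X g G := by
  have hext' : ∀ {X X' : Derivation ℝ K K}, (∀ g ∈ 𝒢, X g = X' g) → X = X' := fun h =>
    sub_eq_zero.1 (hext _ fun g hg => by rw [Derivation.sub_apply, h g hg, sub_self])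
  have hadd : ∀ G G', Y (G + G') = Y G + Y G' := fun G G' => hext' fun g hg => by
    rw [Derivation.add_apply, hY g hg, hY g hg, hY g hg, map_add]
  have hsmul : ∀ (c : ℝ) G, Y (c • G) = c • Y G := fun c G => hext' fun g hg => by
    rw [Derivation.smul_apply, hY g hg, hY g hg, Derivation.map_smul]
  have hmul : ∀ G G', Y (G * G') = G • Y G' + G' • Y G := fun G G' => hext' fun g hg => by
    rw [Derivation.add_apply, Derivation.smul_apply, Derivation.smul_apply, hY g hg, hY g hg,
      hY g hg, Derivation.leibniz]
  -- `Y G` is to be `{·, G}`, and `H G` is `{G, ·}`. Uniqueness on generators makes `Y`, and hence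
  -- `H`, a derivation in its index.
  let H : K → Derivation ℝ K K := fun G =>
    Derivation.mk' { toFun := fun G' => Y G' G
                     map_add' := fun _ _ => by rw [hadd]; rfl
                     map_smul' := fun _ _ => by rw [hsmul]; rfl }
      fun G' G'' => by
        change Y (G' * G'') G = _
        rw [hmul]; rfl
  have hXY : ∀ g ∈ 𝒢, Y g = -X g := fun g hg => hext' fun h hh => by
    rw [Derivation.neg_apply, hY h hh, hX g hg h hh, neg_neg]
  have hskew : ∀ G, H G = -Y G := fun G => hext' fun g hg => by
    change Y g G = _
    rw [Derivation.neg_apply, hXY g hg, hY g hg]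
    rfl
  have hHX : ∀ g ∈ 𝒢, H g = X g := fun g hg => by rw [hskew, hXY g hg, neg_neg]
  have hHs : ∀ G G', H G G' = -H G' G := fun G G' => by
    rw [hskew]
    rfl
  have hHadd : ∀ G G', H (G + G') = H G + H G' := fun G G' => by
    rw [hskew, hskew, hskew, hadd, neg_add]
  have hHsmul : ∀ (c : ℝ) G, H (c • G) = c • H G := fun c G => by
    rw [hskew, hskew, hsmul, smul_neg]
  have hjac : ∀ F G K, H F (H G K) + H G (H K F) + H K (H F G) = 0 := by
    -- For fixed `F` and `G` the Jacobiator is the derivation `⁅H F, H G⁆ - H (H F G)`, so it is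
    -- enough to test its last argument on generators. Cyclic permutations bring each argument in
    -- turn to the last place.
    have hext : ∀ F G, (∀ k ∈ 𝒢, H F (H G k) + H G (H k F) + H k (H F G) = 0) →
        ∀ k, H F (H G k) + H G (H k F) + H k (H F G) = 0 := by
      intro F G h k
      have e : ∀ k, H F (H G k) + H G (H k F) + H k (H F G) = (⁅H F, H G⁆ - H (H F G)) k := by
        intro k
        rw [Derivation.sub_apply, Derivation.commutator_apply, hHs k F, hHs k (H F G), map_neg]
        abel
      have h0 : ⁅H F, H G⁆ - H (H F G) = 0 := hext _ fun k hk => by rw [← e]; exact h k hk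
      rw [e, h0]
      rfl
    have hcyc : ∀ F G K, H F (H G K) + H G (H K F) + H K (H F G)
        = H K (H F G) + H F (H G K) + H G (H K F) := fun F G K => by abel
    have ggg : ∀ f ∈ 𝒢, ∀ g ∈ 𝒢, ∀ k ∈ 𝒢, H f (H g k) + H g (H k f) + H k (H f g) = 0 :=
      fun f hf g hg k hk => by
        rw [hHX f hf, hHX g hg, hHX k hk]
        exact hjac f hf g hg k hk
    have gg : ∀ f ∈ 𝒢, ∀ g ∈ 𝒢, ∀ K, H f (H g K) + H g (H K f) + H K (H f g) = 0 :=
      fun f hf g hg => hext f g fun k hk => ggg f hf g hg k hk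
    have g : ∀ f ∈ 𝒢, ∀ G K, H f (H G K) + H G (H K f) + H K (H f G) = 0 :=
      fun f hf G => hext f G fun k hk => by rw [hcyc]; exact gg k hk f hf G
    exact fun F G => hext F G fun k hk => by rw [hcyc]; exact g k hk F G
  refine ⟨{ bracket := LinearMap.mk₂ ℝ (fun G G' => H G G') ?_ ?_ ?_ ?_
            bracket_self := fun G => ?_
            jacobi := hjac
            leibniz := fun G G' G'' => ?_ }, fun g hg G => ?_⟩
  · intro G G' K
    rw [hHadd]; rfl
  · intro c G K
    rw [hHsmul]; rfl
  · intro G K K'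
    exact map_add _ _ _
  · intro c G K
    exact Derivation.map_smul _ _ _
  · have h1 : H G G + H G G = 0 := by
      nth_rewrite 1 [hHs G G]
      exact neg_add_cancel _
    have h2 : (2 : ℝ) • H G G = 0 := by rw [two_smul, h1]
    have h3 := congrArg (fun x => (2 : ℝ)⁻¹ • x) h2
    simpa using h3
  · change H G (G' * G'') = H G G' * G'' + G' * H G G''
    rw [Derivation.leibniz, smul_eq_mul, smul_eq_mul]
    ring
  · change H g G = _
    rw [hHX g hg]

end PoissonGenerators

/-! ### The Lie–Poisson structure of a Lie algebroid. -/

section LiePoisson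

variable {EN HN N : Type*} [NormedAddCommGroup EN] [NormedSpace ℝ EN] [FiniteDimensional ℝ EN]
  [TopologicalSpace HN] {J : ModelWithCorners ℝ EN HN} [TopologicalSpace N] [ChartedSpace HN N]
  {F : Type*} [NormedAddCommGroup F] [NormedSpace ℝ F] [FiniteDimensional ℝ F]
  {V : N → Type*} [TopologicalSpace (TotalSpace F V)] [∀ x, TopologicalSpace (V x)]
  [FiberBundle F V] [∀ x, AddCommGroup (V x)] [∀ x, Module ℝ (V x)] [VectorBundle ℝ F V]
  [IsManifold J ∞ N] [T2Space N] [ContMDiffVectorBundle ∞ F V J] [J.Boundaryless]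

/-- The Hamiltonian vector fields of pullbacks and of fibrewise linear functions on the dual of a
Lie algebroid. -/
theorem exists_hamiltonian_generators (L : LieAlgebroid (Fn J N) (Sec J F V)) :
    ∃ (X₀ : Fn J N →ₗ[ℝ] Derivation ℝ (FnDual J F V) (FnDual J F V))
      (X₁ : Sec J F V →+ Derivation ℝ (FnDual J F V) (FnDual J F V)),
      (∀ f g, X₀ f (pull g) = 0) ∧ (∀ f s, X₀ f (ell s) = -pull (L.anchor s f)) ∧
      (∀ s f, X₁ s (pull f) = pull (L.anchor s f)) ∧
      (∀ s t, X₁ s (ell t) = ell (L.bracket s t)) := by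
  have h0 : ∀ f : Fn J N, ∃ X : Derivation ℝ (FnDual J F V) (FnDual J F V),
      (∀ g : Fn J N, X (pull g) = 0) ∧ ∀ s, X (ell s) = -pull (L.anchor s f) := by
    intro f
    refine exists_derivation_dual 0 ⟨⟨fun s => -pull (L.anchor s f), ?_⟩, ?_⟩ ?_ ?_
    · simp
    · intro s t
      simp only [map_add, Derivation.add_apply, pull_add]
      abel
    · intro f g
      simp
    · intro g s
      simp
  have h1 : ∀ s : Sec J F V, ∃ X : Derivation ℝ (FnDual J F V) (FnDual J F V),
      (∀ g : Fn J N, X (pull g) = pull (L.anchor s g)) ∧ ∀ t, X (ell t) = ell (L.bracket s t) := by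
    intro s
    refine exists_derivation_dual
      ((pullHom J (F →L[ℝ] ℝ) (DualFibre V)).toLinearMap ∘ₗ (L.anchor s).toLinearMap)
      ⟨⟨fun t => ell (L.bracket s t), ?_⟩, ?_⟩ ?_ ?_
    · rw [L.bracket_zero, ell_zero]
    · intro t t'
      simp only [L.bracket_add, ell_add]
    · intro f g
      change pull (L.anchor s (f * g)) = pull f * pull (L.anchor s g) + pull g * pull (L.anchor s f)
      simp
    · intro g t
      change ell (L.bracket s (g • t)) = pull g * ell (L.bracket s t) + ell t * pull (L.anchor s g)
      rw [L.leibniz, ell_add, ell_smul, ell_smul, mul_comm (ell t)]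
  choose X₀ h00 h01 using h0
  choose X₁ h10 h11 using h1
  refine ⟨{ toFun := X₀, map_add' := fun f g => ?_, map_smul' := fun c f => ?_ },
    ⟨⟨X₁, ?_⟩, fun s t => ?_⟩, h00, h01, h10, h11⟩
  · refine derivation_dual_ext (fun g => ?_) fun s => ?_
    · rw [Derivation.add_apply, h00, h00, h00, add_zero]
    · rw [Derivation.add_apply, h01, h01, h01, map_add, pull_add, neg_add]
  · refine derivation_dual_ext (fun g => ?_) fun s => ?_
    · rw [RingHom.id_apply, Derivation.smul_apply, h00, h00, smul_zero]
    · rw [RingHom.id_apply, Derivation.smul_apply, h01, h01, Derivation.map_smul, smul_neg]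
      rfl
  · refine derivation_dual_ext (fun g => ?_) fun s => ?_
    · rw [h10, map_zero]
      rfl
    · rw [h11, L.zero_bracket, ell_zero]
      rfl
  · refine derivation_dual_ext (fun g => ?_) fun t' => ?_
    · rw [Derivation.add_apply]
      simp only [h10, map_add, Derivation.add_apply, pull_add]
    · rw [Derivation.add_apply]
      simp only [h11, L.add_bracket, ell_add]

/-- Together with `hamiltonian_ell_smul`, this is the Leibniz rule in the index of the Hamiltonian
vector field, which is what is needed to prescribe `{·, G}` as a derivation. -/
theorem hamiltonian_pull_mul {L : LieAlgebroid (Fn J N) (Sec J F V)}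
    {X₀ : Fn J N →ₗ[ℝ] Derivation ℝ (FnDual J F V) (FnDual J F V)}
    (h00 : ∀ f g, X₀ f (pull g) = 0) (h01 : ∀ f s, X₀ f (ell s) = -pull (L.anchor s f)) (f g) :
    X₀ (f * g) = (pull f : FnDual J F V) • X₀ g + (pull g : FnDual J F V) • X₀ f := by
  refine derivation_dual_ext (fun h => ?_) fun s => ?_
  · simp [h00]
  · simp only [Derivation.add_apply, Derivation.smul_apply, h01, Derivation.leibniz, smul_eq_mul,
      pull_add, pull_mul]
    ring

theorem hamiltonian_ell_smul {L : LieAlgebroid (Fn J N) (Sec J F V)}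
    {X₀ : Fn J N →ₗ[ℝ] Derivation ℝ (FnDual J F V) (FnDual J F V)}
    {X₁ : Sec J F V →+ Derivation ℝ (FnDual J F V) (FnDual J F V)}
    (h00 : ∀ f g, X₀ f (pull g) = 0) (h01 : ∀ f s, X₀ f (ell s) = -pull (L.anchor s f))
    (h10 : ∀ s f, X₁ s (pull f) = pull (L.anchor s f))
    (h11 : ∀ s t, X₁ s (ell t) = ell (L.bracket s t)) (f s) :
    X₁ (f • s) = (pull f : FnDual J F V) • X₁ s + ell s • X₀ f := by
  refine derivation_dual_ext (fun h => ?_) fun t => ?_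
  · simp [h00, h10]
  · simp only [Derivation.add_apply, Derivation.smul_apply, h01, h11, L.smul_bracket, smul_eq_mul,
      ell_sub, ell_smul]
    ring

/-- The derivation `{·, G}` for an arbitrary function `G`, obtained by reading the Hamiltonian
vector fields of the generators as functions of the generator. -/
theorem exists_derivation_of_hamiltonian
    (X₀ : Fn J N →ₗ[ℝ] Derivation ℝ (FnDual J F V) (FnDual J F V))
    (X₁ : Sec J F V →+ Derivation ℝ (FnDual J F V) (FnDual J F V))
    (hX₀ : ∀ f g, X₀ (f * g) = (pull f : FnDual J F V) • X₀ g + (pull g : FnDual J F V) • X₀ f)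
    (hX₁ : ∀ f s, X₁ (f • s) = (pull f : FnDual J F V) • X₁ s + ell s • X₀ f)
    (G : FnDual J F V) : ∃ Y : Derivation ℝ (FnDual J F V) (FnDual J F V),
      (∀ f, Y (pull f) = X₀ f G) ∧ ∀ s, Y (ell s) = X₁ s G := by
  let u : Fn J N →ₗ[ℝ] FnDual J F V :=
    { toFun := fun f => X₀ f G
      map_add' := fun f g => by rw [map_add]; rfl
      map_smul' := fun c f => by rw [map_smul]; rfl }
  let w : Sec J F V →+ FnDual J F V :=
    { toFun := fun s => X₁ s G
      map_zero' := by rw [map_zero]; rfl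
      map_add' := fun s t => by rw [map_add]; rfl }
  refine exists_derivation_dual u w (fun f g => ?_) fun f s => ?_
  · exact congrArg (fun X : Derivation ℝ (FnDual J F V) (FnDual J F V) => X G) (hX₀ f g)
  · exact congrArg (fun X : Derivation ℝ (FnDual J F V) (FnDual J F V) => X G) (hX₁ f s)

/-- The dual of a Lie algebroid has a Lie–Poisson structure. -/
theorem exists_isLiePoisson (L : LieAlgebroid (Fn J N) (Sec J F V)) :
    ∃ P : PoissonBracket (FnDual J F V), IsLiePoisson L P := by
  obtain ⟨X₀, X₁, h00, h01, h10, h11⟩ := exists_hamiltonian_generators L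
  have hY := exists_derivation_of_hamiltonian X₀ X₁ (hamiltonian_pull_mul h00 h01)
    (hamiltonian_ell_smul h00 h01 h10 h11)
  choose Y hY₀ hY₁ using hY
  let ind : Fn J N ⊕ Sec J F V → FnDual J F V := Sum.elim pull ell
  let X' : Fn J N ⊕ Sec J F V → Derivation ℝ (FnDual J F V) (FnDual J F V) := Sum.elim X₀ X₁
  have hYX : ∀ k G, Y G (ind k) = X' k G := by
    rintro (f | s) G
    · exact hY₀ G f
    · exact hY₁ G s
  have hX' : ∀ k l, X' k (ind l) = -X' l (ind k) := by
    rintro (f | s) (g | t)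
    · exact (h00 f g).trans (by rw [← neg_zero, ← h00 g f]; rfl)
    · exact (h01 f t).trans (congrArg _ (h10 t f).symm)
    · exact (h10 s g).trans (by rw [← neg_neg (pull _), ← h01 g s]; rfl)
    · exact (h11 s t).trans (by rw [L.bracket_skew t, ell_neg, ← h11 t s]; rfl)
  have hext : ∀ X : Derivation ℝ (FnDual J F V) (FnDual J F V),
      (∀ g ∈ Set.range ind, X g = 0) → X = 0 := fun X h =>
    derivation_dual_ext (fun f => h _ ⟨Sum.inl f, rfl⟩) fun s => h _ ⟨Sum.inr s, rfl⟩
  -- The vector fields are indexed by functions on `M` and sections, whereas `exists_poissonBracket`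
  -- indexes them by functions on `V^*`. Skew-symmetry shows that indices giving the same function
  -- give the same vector field.
  have hwd : ∀ k l, ind k = ind l → X' k = X' l := by
    intro k l h
    refine sub_eq_zero.1 (hext _ ?_)
    rintro _ ⟨r, rfl⟩
    rw [Derivation.sub_apply, hX' k r, hX' l r, h, sub_self]
  let X : FnDual J F V → Derivation ℝ (FnDual J F V) (FnDual J F V) :=
    fun G => open Classical in if h : ∃ k, ind k = G then X' h.choose else 0
  have hXX : ∀ k, X (ind k) = X' k := by
    intro k
    have h : ∃ l, ind l = ind k := ⟨k, rfl⟩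
    exact (dif_pos h).trans (hwd _ _ h.choose_spec)
  have hX0 : ∀ f, X (pull f) = X₀ f := fun f => hXX (Sum.inl f)
  have hX1 : ∀ s, X (ell s) = X₁ s := fun s => hXX (Sum.inr s)
  have eep : ∀ s t (f : Fn J N), X₁ s (X₁ t (pull f)) + X₁ t (X₀ f (ell s))
      + X₀ f (X₁ s (ell t)) = 0 := by
    intro s t f
    have hz : L.anchor s (L.anchor t f) + -(L.anchor t (L.anchor s f))
        + -(L.anchor (L.bracket s t) f) = 0 := by
      rw [L.anchor_bracket]
      abel
    rw [h10, h01, h11, map_neg, h10, h10, h01, ← pull_neg, ← pull_neg, ← pull_add, ← pull_add, hz,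
      pull_zero]
  have epp : ∀ s (f g : Fn J N), X₁ s (X₀ f (pull g)) + X₀ f (X₀ g (ell s))
      + X₀ g (X₁ s (pull f)) = 0 := by
    intro s f g
    rw [h00, h01, h10, map_neg, h00, h00, map_zero, neg_zero, add_zero, add_zero]
  obtain ⟨P, hP⟩ := exists_poissonBracket (𝒢 := Set.range ind) hext X Y
    (by rintro _ ⟨k, rfl⟩ G; rw [hXX]; exact hYX k G)
    (by rintro _ ⟨k, rfl⟩ _ ⟨l, rfl⟩; rw [hXX, hXX]; exact hX' k l) (by
      have hcyc : ∀ F G K, X F (X G K) + X G (X K F) + X K (X F G)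
        = X K (X F G) + X F (X G K) + X G (X K F) := fun F G K => by abel
      have eep' : ∀ s t (f : Fn J N), X (ell s) (X (ell t) (pull f)) + X (ell t) (X (pull f) (ell s))
          + X (pull f) (X (ell s) (ell t)) = 0 := fun s t f => by
        rw [hX1, hX1, hX0]; exact eep s t f
      have epp' : ∀ s (f g : Fn J N), X (ell s) (X (pull f) (pull g))
          + X (pull f) (X (pull g) (ell s)) + X (pull g) (X (ell s) (pull f)) = 0 := fun s f g => by
        rw [hX1, hX0, hX0]; exact epp s f g
      -- Up to cyclic permutation there are four cases. With at least two pullbacks every term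
      -- vanishes; one pullback gives the compatibility of the anchor with the bracket; none gives
      -- the Jacobi identity of `L`.
      rintro _ ⟨f | s, rfl⟩ _ ⟨g | t, rfl⟩ _ ⟨k | r, rfl⟩ <;> simp only [ind, Sum.elim_inl, Sum.elim_inr]
      · rw [hX0, hX0, hX0, h00, h00, h00, map_zero, map_zero, map_zero, add_zero, add_zero]
      · rw [hcyc]; exact epp' _ _ _
      · rw [hcyc, hcyc]; exact epp' _ _ _
      · rw [hcyc, hcyc]; exact eep' _ _ _
      · exact epp' _ _ _
      · rw [hcyc]; exact eep' _ _ _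
      · exact eep' _ _ _
      · rw [hX1, hX1, hX1, h11, h11, h11, h11, h11, h11, ← ell_add, ← ell_add, L.jacobi, ell_zero])
  refine ⟨P, fun s t => ?_, fun s f => ?_, fun f g => ?_⟩
  · rw [hP (ell s) ⟨Sum.inr s, rfl⟩, hX1, h11]
  · rw [hP (ell s) ⟨Sum.inr s, rfl⟩, hX1, h10]
  · rw [hP (pull f) ⟨Sum.inl f, rfl⟩, hX0, h00]

end LiePoisson

/-! ### Fibrewise linear functions and sections. -/

section FibreLinear

open Filter Topology

variable {EN HN N : Type*} [NormedAddCommGroup EN] [NormedSpace ℝ EN] [FiniteDimensional ℝ EN]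
  [TopologicalSpace HN] {J : ModelWithCorners ℝ EN HN} [TopologicalSpace N] [ChartedSpace HN N]
  {F : Type*} [NormedAddCommGroup F] [NormedSpace ℝ F] [FiniteDimensional ℝ F]
  {V : N → Type*} [TopologicalSpace (TotalSpace F V)] [∀ x, TopologicalSpace (V x)]
  [FiberBundle F V] [∀ x, AddCommGroup (V x)] [∀ x, Module ℝ (V x)] [VectorBundle ℝ F V]

namespace FibreLinear

variable {G G' : FnTot J F V}

theorem add (h : FibreLinear G) (h' : FibreLinear G') : FibreLinear (G + G') := fun x =>
  ⟨fun v w => by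
    change G _ + G' _ = G _ + G' _ + (G _ + G' _)
    rw [(h x).map_add, (h' x).map_add]; ring,
  fun c v => by
    change G _ + G' _ = c • (G _ + G' _)
    rw [(h x).map_smul, (h' x).map_smul, smul_add]⟩

theorem pull_mul (h : FibreLinear G) (f : Fn J N) : FibreLinear (pull f * G) := fun x =>
  ⟨fun v w => by
    change f x * G _ = f x * G _ + f x * G _
    rw [(h x).map_add, mul_add],
  fun c v => by
    change f x * G _ = c • (f x * G _)
    rw [(h x).map_smul, mul_smul_comm]⟩

theorem zero : FibreLinear (0 : FnTot J F V) := fun _ =>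
  ⟨fun _ _ => (add_zero (0 : ℝ)).symm, fun c _ => (smul_zero c).symm⟩

theorem sum {ι : Type*} [Fintype ι] {G : ι → FnTot J F V} (h : ∀ i, FibreLinear (G i)) :
    FibreLinear (∑ i, G i) :=
  Finset.sum_induction _ FibreLinear (fun _ _ => add) zero fun i _ => h i

/-- The restriction of a fibrewise linear function to a fibre. -/
def at_ (h : FibreLinear G) (x : N) : V x →ₗ[ℝ] ℝ := (h x).mk'

@[simp] theorem at_apply (h : FibreLinear G) (x : N) (v : V x) : h.at_ x v = G ⟨x, v⟩ := rfl

theorem compSec_add (h : FibreLinear G) (s t : Sec J F V) :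
    compSec G (s + t) = compSec G s + compSec G t := by
  ext x
  exact (h x).map_add _ _

theorem compSec_smul (h : FibreLinear G) (f : Fn J N) (s : Sec J F V) :
    compSec G (f • s) = f * compSec G s := by
  ext x
  exact (h x).map_smul _ _

theorem compSec_neg (h : FibreLinear G) (s : Sec J F V) : compSec G (-s) = -compSec G s := by
  ext x
  exact (h x).map_neg _

theorem compSec_sub (h : FibreLinear G) (s t : Sec J F V) :
    compSec G (s - t) = compSec G s - compSec G t := by
  ext x
  exact (h x).map_sub _ _

theorem compSec_zero (h : FibreLinear G) : compSec G (0 : Sec J F V) = 0 := by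
  ext x
  exact (h x).map_zero

end FibreLinear

@[simp] theorem compSec_add_left (G G' : FnTot J F V) (s : Sec J F V) :
    compSec (G + G') s = compSec G s + compSec G' s := rfl

@[simp] theorem compSec_mul (G G' : FnTot J F V) (s : Sec J F V) :
    compSec (G * G') s = compSec G s * compSec G' s := rfl

variable [IsManifold J ∞ N] [T2Space N] [ContMDiffVectorBundle ∞ F V J]

variable (J F) in
theorem exists_section_through {x : N} (v : V x) : ∃ s : Sec J F V, s x = v := by
  obtain ⟨s, ε, χ, -, h1, h2, -⟩ :=
    exists_dual_frames (J := J) (V := V) x (Module.finBasis ℝ F)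
  refine ⟨∑ i, ε i ⟨x, v⟩ • s i, ?_⟩
  rw [Sec.sum_apply]
  have := h2 x v
  rw [h1.self_of_nhds, one_smul] at this
  exact this

variable (J F) in
theorem exists_fibreLinear_through {x : N} (β : V x →ₗ[ℝ] ℝ) :
    ∃ G : FnTot J F V, FibreLinear G ∧ ∀ v, G ⟨x, v⟩ = β v := by
  obtain ⟨s, ε, χ, h0, h1, h2, -⟩ :=
    exists_dual_frames (J := J) (V := V) x (Module.finBasis ℝ F)
  refine ⟨∑ i, pull (β (s i x) • (1 : Fn J N)) * ε i,
    FibreLinear.sum fun i => (h0 i).pull_mul _, fun v => ?_⟩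
  rw [Fn.sum_apply]
  have := congrArg β (h2 x v)
  rw [h1.self_of_nhds, one_smul, map_sum] at this
  rw [← this]
  refine Finset.sum_congr rfl fun i _ => ?_
  change (β (s i x) * 1) * ε i ⟨x, v⟩ = _
  rw [map_smul, smul_eq_mul]
  ring

variable (J F) in
theorem eq_of_fibreLinear {x : N} {v w : V x}
    (h : ∀ G : FnTot J F V, FibreLinear G → G ⟨x, v⟩ = G ⟨x, w⟩) : v = w := by
  obtain ⟨s, ε, χ, h0, h1, h2, -⟩ :=
    exists_dual_frames (J := J) (V := V) x (Module.finBasis ℝ F)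
  have hv := h2 x v
  have hw := h2 x w
  rw [h1.self_of_nhds, one_smul] at hv hw
  rw [← hv, ← hw]
  exact Finset.sum_congr rfl fun i _ => by rw [h _ (h0 i)]

theorem Sec.ext_of_fibreLinear {s t : Sec J F V}
    (h : ∀ G : FnTot J F V, FibreLinear G → compSec G s = compSec G t) : s = t := by
  ext x
  exact eq_of_fibreLinear J F fun G hG => congrArg (fun f : Fn J N => f x) (h G hG)

/-- A `C^∞(N)`-linear functional on the fibrewise linear functions is the evaluation on a
section. -/
theorem exists_section_of_functional (l : FnTot J F V → Fn J N)
    (hadd : ∀ G G', FibreLinear G → FibreLinear G' → l (G + G') = l G + l G')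
    (hsmul : ∀ f G, FibreLinear G → l (pull f * G) = f * l G) :
    ∃ s : Sec J F V, ∀ G, FibreLinear G → compSec G s = l G := by
  have hl0 : l 0 = 0 := by
    have := hadd 0 0 FibreLinear.zero FibreLinear.zero
    rw [add_zero] at this
    exact left_eq_add.1 this
  have hsum : ∀ {n : ℕ} (G : Fin n → FnTot J F V), (∀ i, FibreLinear (G i)) →
      l (∑ i, G i) = ∑ i, l (G i) := by
    intro n
    induction n with
    | zero => intro G _; simp [hl0]
    | succ n ih =>
      intro G hG
      rw [Fin.sum_univ_succ, Fin.sum_univ_succ, hadd _ _ (hG 0) (FibreLinear.sum fun i => hG _),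
        ih _ fun i => hG _]
  -- Expanding `χ G` in the dual frame shows that the desired vector at `x` is `∑ i, l (ε i) x • s i
  -- x`. The same formula at all points near `x₀` gives smoothness of the section.
  have key : ∀ {n : ℕ} (s : Fin n → Sec J F V) (ε : Fin n → FnTot J F V) (χ : Fn J N),
      (∀ i, FibreLinear (ε i)) → (∀ x (v : V x), ∑ i, ε i ⟨x, v⟩ • s i x = χ x • v) →
      ∀ x, χ x = 1 → ∀ G, FibreLinear G → G ⟨x, ∑ i, l (ε i) x • s i x⟩ = l G x := by
    intro n s ε χ h0 h2 x hx G hG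
    have h3 : pull χ * G = ∑ i, pull (compSec G (s i)) * ε i := by
      ext ⟨y, v⟩
      rw [Fn.sum_apply]
      change χ y * G ⟨y, v⟩ = ∑ i, G ⟨y, s i y⟩ * ε i ⟨y, v⟩
      have := congrArg (hG.at_ y) (h2 y v)
      rw [map_smul, map_sum] at this
      refine (this.symm).trans (Finset.sum_congr rfl fun i _ => ?_)
      rw [map_smul, smul_eq_mul, mul_comm]
      rfl
    have h4 := congrArg (fun f : Fn J N => f x) (congrArg l h3)
    rw [hsmul _ _ hG, hsum _ fun i => (h0 i).pull_mul _] at h4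
    simp only [Fn.sum_apply] at h4
    change χ x * l G x = _ at h4
    rw [hx, one_mul] at h4
    rw [h4]
    refine (map_sum (hG.at_ x) _ _).trans (Finset.sum_congr rfl fun i _ => ?_)
    rw [map_smul, hsmul _ _ (h0 i), smul_eq_mul, mul_comm]
    rfl
  have hex : ∀ x, ∃ v : V x, ∀ G : FnTot J F V, FibreLinear G → G ⟨x, v⟩ = l G x := by
    intro x
    obtain ⟨s, ε, χ, h0, h1, h2, -⟩ :=
      exists_dual_frames (J := J) (V := V) x (Module.finBasis ℝ F)
    exact ⟨_, key s ε χ h0 h2 x h1.self_of_nhds⟩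
  choose v hv using hex
  refine ⟨⟨v, fun x₀ => ?_⟩, fun G hG => ?_⟩
  · obtain ⟨s, ε, χ, h0, h1, h2, -⟩ :=
      exists_dual_frames (J := J) (V := V) x₀ (Module.finBasis ℝ F)
    refine ((∑ i, l (ε i) • s i : Sec J F V).contMDiff x₀).congr_of_eventuallyEq ?_
    filter_upwards [h1] with x hx
    have : v x = (∑ i, l (ε i) • s i : Sec J F V) x := by
      refine eq_of_fibreLinear J F fun G hG => ?_
      rw [Sec.sum_apply, hv x G hG]
      exact (key s ε χ h0 h2 x hx G hG).symm
    rw [this]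
  · ext x
    exact hv x G hG

theorem IsVerticalLift.pull {X : Derivation ℝ (FnTot J F V) (FnTot J F V)} {s : Sec J F V}
    (h : IsVerticalLift X s) (f : Fn J N) : X (pull f) = 0 := by
  ext ⟨x, v⟩
  exact (h (DoubleLie.pull f) x v).unique (hasDerivAt_const (0 : ℝ) (f x))

theorem IsVerticalLift.fibreLinear {X : Derivation ℝ (FnTot J F V) (FnTot J F V)} {s : Sec J F V}
    (h : IsVerticalLift X s) {G : FnTot J F V} (hG : FibreLinear G) :
    X G = DoubleLie.pull (compSec G s) := by
  ext ⟨x, v⟩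
  refine (h G x v).unique ?_
  have h1 : (fun t : ℝ => G ⟨x, v + t • s x⟩) = fun t : ℝ => G ⟨x, v⟩ + t * G ⟨x, s x⟩ := by
    funext t
    rw [(hG x).map_add, (hG x).map_smul, smul_eq_mul]
  rw [h1]
  simpa using ((hasDerivAt_id (0 : ℝ)).mul_const (G ⟨x, s x⟩)).const_add (G ⟨x, v⟩)

theorem IsVerticalLift.unique {X : Derivation ℝ (FnTot J F V) (FnTot J F V)} {s t : Sec J F V}
    (h : IsVerticalLift X s) (h' : IsVerticalLift X t) : s = t :=
  Sec.ext_of_fibreLinear fun G hG => pull_injective ((h.fibreLinear hG).symm.trans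
    (h'.fibreLinear hG))

end FibreLinear

/-! ### The compatibility condition of Lie bialgebroids and its tensoriality. -/

section LieBialgebroid

variable {K X Y : Type*} [CommRing K] [Algebra ℝ K] [AddCommGroup X] [Module K X]
  [AddCommGroup Y] [Module K Y] (L : LieAlgebroid K X) (L' : LieAlgebroid K Y)
  (p : X →ₗ[K] Y →ₗ[K] K) (hp : p.IsPerfPair)

theorem pairing_ext_right {p : X →ₗ[K] Y →ₗ[K] K} (hp : p.IsPerfPair) {y y' : Y}
    (h : ∀ x, p x y = p x y') : y = y' :=
  hp.bijective_right.1 (LinearMap.ext h)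

theorem pairing_lieDerivative (x x' : X) (y : Y) :
    p x' (lieDerivative L p hp x y) = L.anchor x (p x' y) - p (L.bracket x x') y :=
  (exists_lieDerivative L p hp x y).choose_spec x'

theorem pairing_lieDerivative_flip (y y' : Y) (x : X) :
    p (lieDerivative L' p.flip hp.flip y x) y' = L'.anchor y (p x y') - p x (L'.bracket y y') :=
  pairing_lieDerivative L' p.flip hp.flip y y' x

theorem exists_differential (hp : p.IsPerfPair) (f : K) : ∃ y : Y, ∀ x, p x y = L.anchor x f := by
  let φ : Module.Dual K X :=
    { toFun := fun x => L.anchor x f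
      map_add' := fun x y => by rw [map_add, Derivation.add_apply]
      map_smul' := fun g x => by rw [map_smul, Derivation.smul_apply, RingHom.id_apply] }
  obtain ⟨y, hy⟩ := hp.bijective_right.2 φ
  exact ⟨y, fun x => congrArg (fun ψ : Module.Dual K X => ψ x) hy⟩

/-- The differential `d f` of a function, for the Lie algebroid `L`. -/
def differential (f : K) : Y := (exists_differential L p hp f).choose

theorem pairing_differential (x : X) (f : K) : p x (differential L p hp f) = L.anchor x f :=
  (exists_differential L p hp f).choose_spec x

theorem differential_add (f g : K) :
    differential L p hp (f + g) = differential L p hp f + differential L p hp g := by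
  refine pairing_ext_right hp fun x => ?_
  simp only [map_add, pairing_differential]

theorem differential_smul (r : ℝ) (f : K) :
    differential L p hp (r • f) = algebraMap ℝ K r • differential L p hp f := by
  refine pairing_ext_right hp fun x => ?_
  rw [map_smul, pairing_differential, pairing_differential, Derivation.map_smul, smul_eq_mul,
    Algebra.smul_def]

theorem differential_mul (f g : K) :
    differential L p hp (f * g) = f • differential L p hp g + g • differential L p hp f := by
  refine pairing_ext_right hp fun x => ?_
  simp only [map_add, map_smul, pairing_differential, Derivation.leibniz]

theorem lieDerivative_add_left (x x' : X) (y : Y) :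
    lieDerivative L p hp (x + x') y = lieDerivative L p hp x y + lieDerivative L p hp x' y := by
  refine pairing_ext_right hp fun z => ?_
  simp only [map_add, pairing_lieDerivative, Derivation.add_apply, L.add_bracket,
    LinearMap.add_apply]
  ring

theorem lieDerivative_add_right (x : X) (y y' : Y) :
    lieDerivative L p hp x (y + y') = lieDerivative L p hp x y + lieDerivative L p hp x y' := by
  refine pairing_ext_right hp fun z => ?_
  simp only [map_add, pairing_lieDerivative]
  ring

theorem lieDerivative_smul_left (f : K) (x : X) (y : Y) :
    lieDerivative L p hp (f • x) y =
      f • lieDerivative L p hp x y + p x y • differential L p hp f := by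
  refine pairing_ext_right hp fun z => ?_
  simp only [map_add, map_smul, pairing_lieDerivative, Derivation.smul_apply, L.smul_bracket,
    LinearMap.sub_apply, map_sub, LinearMap.smul_apply, smul_eq_mul, pairing_differential]
  ring

theorem lieDerivative_smul_right (f : K) (x : X) (y : Y) :
    lieDerivative L p hp x (f • y) = f • lieDerivative L p hp x y + L.anchor x f • y := by
  refine pairing_ext_right hp fun z => ?_
  simp only [map_add, map_smul, pairing_lieDerivative, Derivation.leibniz, smul_eq_mul]
  ring

/-! ### The differential of sections -/

theorem dualDifferential_skew (x : X) (y₁ y₂ : Y) :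
    dualDifferential L' p x y₂ y₁ = -dualDifferential L' p x y₁ y₂ := by
  simp only [dualDifferential, L'.bracket_skew y₁ y₂, map_neg]
  ring

theorem dualDifferential_add_left (x : X) (y₁ y₁' y₂ : Y) :
    dualDifferential L' p x (y₁ + y₁') y₂ =
      dualDifferential L' p x y₁ y₂ + dualDifferential L' p x y₁' y₂ := by
  simp only [dualDifferential, L'.add_bracket, map_add, Derivation.add_apply]
  ring

theorem dualDifferential_smul_left (f : K) (x : X) (y₁ y₂ : Y) :
    dualDifferential L' p x (f • y₁) y₂ = f * dualDifferential L' p x y₁ y₂ := by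
  simp only [dualDifferential, L'.smul_bracket, map_smul, Derivation.smul_apply, map_sub,
    Derivation.leibniz, smul_eq_mul]
  ring

theorem dualDifferential_smul_right (f : K) (x : X) (y₁ y₂ : Y) :
    dualDifferential L' p x y₁ (f • y₂) = f * dualDifferential L' p x y₁ y₂ := by
  rw [dualDifferential_skew, dualDifferential_smul_left, dualDifferential_skew]
  ring

theorem dualDifferential_add_right (x : X) (y₁ y₂ y₂' : Y) :
    dualDifferential L' p x y₁ (y₂ + y₂') =
      dualDifferential L' p x y₁ y₂ + dualDifferential L' p x y₁ y₂' := by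
  rw [dualDifferential_skew, dualDifferential_add_left, dualDifferential_skew L' p x y₂,
    dualDifferential_skew L' p x y₂']
  ring

theorem dualDifferential_add (x x' : X) (y₁ y₂ : Y) :
    dualDifferential L' p (x + x') y₁ y₂ =
      dualDifferential L' p x y₁ y₂ + dualDifferential L' p x' y₁ y₂ := by
  simp only [dualDifferential, map_add, LinearMap.add_apply]
  ring

theorem dualDifferential_smul (f : K) (x : X) (y₁ y₂ : Y) :
    dualDifferential L' p (f • x) y₁ y₂ =
      f * dualDifferential L' p x y₁ y₂ + L'.anchor y₁ f * p x y₂ - L'.anchor y₂ f * p x y₁ := by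
  simp only [dualDifferential, map_smul, LinearMap.smul_apply, Derivation.leibniz, smul_eq_mul]
  ring

/-- Cartan's formula `i_y d x = ℒ_y x - d⟨x, y⟩`, up to the sign from the order of the arguments. -/
theorem dualDifferential_eq_lieDerivative (hp : p.IsPerfPair) (x : X) (y₁ y₂ : Y) :
    dualDifferential L' p x y₁ y₂ =
      L'.anchor y₁ (p x y₂) - p (lieDerivative L' p.flip hp.flip y₂ x) y₁ := by
  rw [pairing_lieDerivative_flip L' p hp, dualDifferential, L'.bracket_skew y₁ y₂, map_neg]
  ring

/-! ### The defects of compatibility -/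

/-- `d[x₁, x₂] - [d x₁, x₂] - [x₁, d x₂]`. -/
def bialgebroidDefect (x₁ x₂ : X) (y₁ y₂ : Y) : K :=
  dualDifferential L' p (L.bracket x₁ x₂) y₁ y₂
    + schouten L p hp x₂ (dualDifferential L' p x₁) y₁ y₂
    - schouten L p hp x₁ (dualDifferential L' p x₂) y₁ y₂

theorem isLieBialgebroid_iff :
    IsLieBialgebroid L L' p ↔
      ∃ hp : p.IsPerfPair, ∀ x₁ x₂ y₁ y₂, bialgebroidDefect L L' p hp x₁ x₂ y₁ y₂ = 0 := by
  refine exists_congr fun hp => forall_congr' fun x₁ => forall_congr' fun x₂ =>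
    forall_congr' fun y₁ => forall_congr' fun y₂ => ?_
  rw [bialgebroidDefect, ← sub_eq_zero, neg_add_eq_sub, sub_sub_eq_add_sub]

/-- The failure of tensoriality of `bialgebroidDefect`. -/
def mixedDefect (x : X) (y : Y) (f : K) : K :=
  L'.anchor y (L.anchor x f) - L.anchor x (L'.anchor y f)
    + L'.anchor (lieDerivative L p hp x y) f
    - L.anchor (lieDerivative L' p.flip hp.flip y x) f
    + L'.anchor (differential L p hp f) (p x y)

/-- The failure of tensoriality of `mixedDefect`. -/
def functionDefect (f g : K) : K :=
  L'.anchor (differential L p hp f) g + L'.anchor (differential L p hp g) f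

theorem bialgebroidDefect_swap (x₁ x₂ : X) (y₁ y₂ : Y) :
    bialgebroidDefect L L' p hp x₂ x₁ y₁ y₂ = -bialgebroidDefect L L' p hp x₁ x₂ y₁ y₂ := by
  simp only [bialgebroidDefect, dualDifferential, L.bracket_skew x₁ x₂, map_neg,
    LinearMap.neg_apply]
  ring

theorem bialgebroidDefect_swap_right (x₁ x₂ : X) (y₁ y₂ : Y) :
    bialgebroidDefect L L' p hp x₁ x₂ y₂ y₁ = -bialgebroidDefect L L' p hp x₁ x₂ y₁ y₂ := by
  simp only [bialgebroidDefect, schouten]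
  rw [dualDifferential_skew L' p _ y₁ y₂, dualDifferential_skew L' p x₁ y₁ y₂,
    dualDifferential_skew L' p x₂ y₁ y₂,
    dualDifferential_skew L' p x₁ y₁ (lieDerivative L p hp x₂ y₂),
    dualDifferential_skew L' p x₂ y₁ (lieDerivative L p hp x₁ y₂),
    dualDifferential_skew L' p x₁ (lieDerivative L p hp x₂ y₁) y₂,
    dualDifferential_skew L' p x₂ (lieDerivative L p hp x₁ y₁) y₂, map_neg, map_neg]
  ring

theorem bialgebroidDefect_add (x₁ x₂ x₂' : X) (y₁ y₂ : Y) :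
    bialgebroidDefect L L' p hp x₁ (x₂ + x₂') y₁ y₂ =
      bialgebroidDefect L L' p hp x₁ x₂ y₁ y₂ + bialgebroidDefect L L' p hp x₁ x₂' y₁ y₂ := by
  simp only [bialgebroidDefect, schouten, L.bracket_add, dualDifferential_add, map_add,
    Derivation.add_apply, lieDerivative_add_left, dualDifferential_add_left,
    dualDifferential_add_right]
  ring

/-- The terms that obstruct linearity come from `d(f x) = f d x + d f ∧ x` and from the differential
of `f` in `ℒ_{f x} y`. The latter is contracted with `d x₁`, and Cartan's formula (`e`) expresses
the contraction by anchors; what remains assembles into `mixedDefect`, wedged with `x₂`. -/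
theorem bialgebroidDefect_smul (f : K) (x₁ x₂ : X) (y₁ y₂ : Y) :
    bialgebroidDefect L L' p hp x₁ (f • x₂) y₁ y₂ =
      f * bialgebroidDefect L L' p hp x₁ x₂ y₁ y₂
        + mixedDefect L L' p hp x₁ y₁ f * p x₂ y₂ - mixedDefect L L' p hp x₁ y₂ f * p x₂ y₁ := by
  have e : ∀ y, dualDifferential L' p x₁ y (differential L p hp f) =
      L.anchor (lieDerivative L' p.flip hp.flip y x₁) f
        - L'.anchor (differential L p hp f) (p x₁ y) := by
    intro y
    rw [dualDifferential_skew, dualDifferential_eq_lieDerivative L' p hp, pairing_differential]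
    ring
  have e' := dualDifferential_skew L' p x₁ y₂ (differential L p hp f)
  rw [e] at e'
  simp only [bialgebroidDefect, schouten, L.leibniz, dualDifferential_add, dualDifferential_smul,
    map_smul, Derivation.smul_apply, lieDerivative_smul_left, dualDifferential_add_left,
    dualDifferential_add_right, dualDifferential_smul_left, dualDifferential_smul_right,
    map_add, map_sub, Derivation.leibniz, smul_eq_mul, pairing_lieDerivative, e, e', mixedDefect]
  ring

theorem bialgebroidDefect_add_right (x₁ x₂ : X) (y₁ y₁' y₂ : Y) :
    bialgebroidDefect L L' p hp x₁ x₂ (y₁ + y₁') y₂ =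
      bialgebroidDefect L L' p hp x₁ x₂ y₁ y₂ + bialgebroidDefect L L' p hp x₁ x₂ y₁' y₂ := by
  simp only [bialgebroidDefect, schouten, map_add, lieDerivative_add_right,
    dualDifferential_add_left]
  ring

/-- All three terms are bivector fields, so the anchor terms from the Leibniz rules cancel in pairs.
-/
theorem bialgebroidDefect_smul_right (f : K) (x₁ x₂ : X) (y₁ y₂ : Y) :
    bialgebroidDefect L L' p hp x₁ x₂ (f • y₁) y₂ =
      f * bialgebroidDefect L L' p hp x₁ x₂ y₁ y₂ := by
  simp only [bialgebroidDefect, schouten, lieDerivative_smul_right,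
    dualDifferential_add_left, dualDifferential_smul_left, Derivation.leibniz, smul_eq_mul]
  ring

theorem mixedDefect_add_left (x x' : X) (y : Y) (f : K) :
    mixedDefect L L' p hp (x + x') y f = mixedDefect L L' p hp x y f
      + mixedDefect L L' p hp x' y f := by
  simp only [mixedDefect, map_add, Derivation.add_apply, lieDerivative_add_left,
    lieDerivative_add_right, LinearMap.add_apply]
  ring

theorem mixedDefect_add_right (x : X) (y y' : Y) (f : K) :
    mixedDefect L L' p hp x (y + y') f = mixedDefect L L' p hp x y f
      + mixedDefect L L' p hp x y' f := by
  simp only [mixedDefect, map_add, Derivation.add_apply, lieDerivative_add_left,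
    lieDerivative_add_right]
  ring

/-- The contributions of `d g` in the Lie derivatives and in the Leibniz rules reduce to `⟨x, y⟩`
times the symmetrised composition of one anchor with the dual of the other. -/
theorem mixedDefect_smul_left (g : K) (x : X) (y : Y) (f : K) :
    mixedDefect L L' p hp (g • x) y f = g * mixedDefect L L' p hp x y f
      + p x y * functionDefect L L' p hp f g := by
  simp only [mixedDefect, functionDefect, map_add, map_smul, Derivation.add_apply,
    Derivation.smul_apply, lieDerivative_smul_left, lieDerivative_smul_right, LinearMap.smul_apply,
    Derivation.leibniz, smul_eq_mul]
  ring

/-- In contrast to the other slot, the two terms with differentials cancel: by `e` both are the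
pairing of the two differentials of `g` and `f`. -/
theorem mixedDefect_smul_right (g : K) (x : X) (y : Y) (f : K) :
    mixedDefect L L' p hp x (g • y) f = g * mixedDefect L L' p hp x y f := by
  have e : L.anchor (differential L' p.flip hp.flip g) f =
      L'.anchor (differential L p hp f) g := by
    rw [← pairing_differential L p hp, ← pairing_differential L' p.flip hp.flip]
    rfl
  simp only [mixedDefect, map_add, map_smul, Derivation.add_apply,
    Derivation.smul_apply, lieDerivative_smul_left, lieDerivative_smul_right,
    LinearMap.flip_apply, Derivation.leibniz, smul_eq_mul, e]
  ring

/-- `mixedDefect` as a derivation. -/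
def mixedDefectDerivation (x : X) (y : Y) : Derivation ℝ K K :=
  Derivation.mk'
    { toFun := mixedDefect L L' p hp x y
      map_add' := fun f g => by
        simp only [mixedDefect, map_add, differential_add, Derivation.add_apply]
        ring
      map_smul' := fun r f => by
        simp only [mixedDefect, Derivation.map_smul, differential_smul, map_smul,
          Derivation.smul_apply, smul_eq_mul, RingHom.id_apply]
        simp only [Algebra.smul_def]
        ring }
    fun f g => by
      simp only [LinearMap.coe_mk, AddHom.coe_mk, mixedDefect, differential_mul, map_add, map_smul,
        Derivation.leibniz, Derivation.add_apply, Derivation.smul_apply, smul_eq_mul]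
      ring

/-- `functionDefect` as a derivation. -/
def functionDefectDerivation (f : K) : Derivation ℝ K K :=
  Derivation.mk'
    { toFun := functionDefect L L' p hp f
      map_add' := fun g g' => by
        simp only [functionDefect, map_add, differential_add, Derivation.add_apply]
        ring
      map_smul' := fun r g => by
        simp only [functionDefect, Derivation.map_smul, differential_smul, map_smul,
          Derivation.smul_apply, smul_eq_mul, RingHom.id_apply]
        simp only [Algebra.smul_def]
        ring }
    fun g g' => by
      simp only [LinearMap.coe_mk, AddHom.coe_mk, functionDefect, differential_mul, map_add,
        map_smul, Derivation.leibniz, Derivation.add_apply, Derivation.smul_apply, smul_eq_mul]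
      ring

theorem functionDefect_comm (f g : K) :
    functionDefect L L' p hp g f = functionDefect L L' p hp f g := by
  rw [functionDefect, functionDefect, add_comm]

/-- The compatibility of a Lie bialgebroid may be checked on generators. -/
theorem bialgebroidDefect_eq_zero {𝒢 : Set X} {𝒢' : Set Y} {𝒦 : Set K}
    (hX : ∀ φ : X →ₗ[K] K, (∀ x ∈ 𝒢, φ x = 0) → φ = 0)
    (hY : ∀ φ : Y →ₗ[K] K, (∀ y ∈ 𝒢', φ y = 0) → φ = 0)
    (hK : ∀ D : Derivation ℝ K K, (∀ f ∈ 𝒦, D f = 0) → D = 0)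
    (hf : ∀ f ∈ 𝒦, ∀ g ∈ 𝒦, functionDefect L L' p hp f g = 0)
    (hm : ∀ x ∈ 𝒢, ∀ y ∈ 𝒢', ∀ f ∈ 𝒦, mixedDefect L L' p hp x y f = 0)
    (hb : ∀ x₁ ∈ 𝒢, ∀ x₂ ∈ 𝒢, ∀ y₁ ∈ 𝒢', ∀ y₂ ∈ 𝒢', bialgebroidDefect L L' p hp x₁ x₂ y₁ y₂ = 0)
    (x₁ x₂ : X) (y₁ y₂ : Y) : bialgebroidDefect L L' p hp x₁ x₂ y₁ y₂ = 0 := by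
  -- The defects are treated in the order in which they obstruct each other: `functionDefect` is a
  -- biderivation, its vanishing makes `mixedDefect` linear in `x`, and the vanishing of the latter
  -- makes `bialgebroidDefect` linear in `x₁` and `x₂`. At each stage one slot at a time is extended
  -- from generators.
  have hf₁ : ∀ f ∈ 𝒦, ∀ g, functionDefect L L' p hp f g = 0 := fun f hf' g =>
    congrArg (fun D : Derivation ℝ K K => D g)
      (hK (functionDefectDerivation L L' p hp f) (hf f hf'))
  have hf₂ : ∀ f g, functionDefect L L' p hp f g = 0 := fun f g =>
    congrArg (fun D : Derivation ℝ K K => D g)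
      (hK (functionDefectDerivation L L' p hp f) fun g' hg =>
        (functionDefect_comm L L' p hp g' f).trans (hf₁ g' hg f))
  have hm₁ : ∀ x ∈ 𝒢, ∀ y ∈ 𝒢', ∀ f, mixedDefect L L' p hp x y f = 0 := fun x hx y hy f =>
    congrArg (fun D : Derivation ℝ K K => D f)
      (hK (mixedDefectDerivation L L' p hp x y) (hm x hx y hy))
  have hm₂ : ∀ x ∈ 𝒢, ∀ y f, mixedDefect L L' p hp x y f = 0 := by
    intro x hx y f
    let φ : Y →ₗ[K] K :=
      { toFun := fun y => mixedDefect L L' p hp x y f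
        map_add' := fun y y' => mixedDefect_add_right L L' p hp x y y' f
        map_smul' := fun g y => mixedDefect_smul_right L L' p hp g x y f }
    exact congrArg (fun φ : Y →ₗ[K] K => φ y) (hY φ fun y hy => hm₁ x hx y hy f)
  have hm₃ : ∀ x y f, mixedDefect L L' p hp x y f = 0 := by
    intro x y f
    let φ : X →ₗ[K] K :=
      { toFun := fun x => mixedDefect L L' p hp x y f
        map_add' := fun x x' => mixedDefect_add_left L L' p hp x x' y f
        map_smul' := fun g x => by
          rw [mixedDefect_smul_left, hf₂, mul_zero, add_zero]; rfl }
    exact congrArg (fun φ : X →ₗ[K] K => φ x) (hX φ fun x hx => hm₂ x hx y f)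
  let φ₁ (x₁ : X) (y₁ y₂ : Y) : X →ₗ[K] K :=
    { toFun := fun x => bialgebroidDefect L L' p hp x₁ x y₁ y₂
      map_add' := fun x x' => bialgebroidDefect_add L L' p hp x₁ x x' y₁ y₂
      map_smul' := fun g x => by
        rw [bialgebroidDefect_smul, hm₃, hm₃, zero_mul, zero_mul, add_zero, sub_zero]; rfl }
  let φ₂ (x₁ x₂ : X) (y₂ : Y) : Y →ₗ[K] K :=
    { toFun := fun y => bialgebroidDefect L L' p hp x₁ x₂ y y₂
      map_add' := fun y y' => bialgebroidDefect_add_right L L' p hp x₁ x₂ y y' y₂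
      map_smul' := fun g y => bialgebroidDefect_smul_right L L' p hp g x₁ x₂ y y₂ }
  have h1 : ∀ x₁ ∈ 𝒢, ∀ x₂ ∈ 𝒢, ∀ y₂ ∈ 𝒢', ∀ y₁, bialgebroidDefect L L' p hp x₁ x₂ y₁ y₂ = 0 :=
    fun x₁ h1 x₂ h2 y₂ h3 y₁ => congrArg (fun φ : Y →ₗ[K] K => φ y₁)
      (hY (φ₂ x₁ x₂ y₂) fun y hy => hb x₁ h1 x₂ h2 y hy y₂ h3)
  have h2 : ∀ x₁ ∈ 𝒢, ∀ x₂ ∈ 𝒢, ∀ y₁ y₂, bialgebroidDefect L L' p hp x₁ x₂ y₁ y₂ = 0 :=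
    fun x₁ h1' x₂ h2 y₁ y₂ => congrArg (fun φ : Y →ₗ[K] K => φ y₁)
      (hY (φ₂ x₁ x₂ y₂) fun y hy => by
        change bialgebroidDefect L L' p hp x₁ x₂ y y₂ = 0
        rw [bialgebroidDefect_swap_right, h1 x₁ h1' x₂ h2 y hy, neg_zero])
  have h3 : ∀ x₁ ∈ 𝒢, ∀ x₂ y₁ y₂, bialgebroidDefect L L' p hp x₁ x₂ y₁ y₂ = 0 :=
    fun x₁ h1 x₂ y₁ y₂ => congrArg (fun φ : X →ₗ[K] K => φ x₂)
      (hX (φ₁ x₁ y₁ y₂) fun x hx => h2 x₁ h1 x hx y₁ y₂)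
  exact congrArg (fun φ : X →ₗ[K] K => φ x₂)
    (hX (φ₁ x₁ y₁ y₂) fun x hx => by
      change bialgebroidDefect L L' p hp x₁ x y₁ y₂ = 0
      rw [bialgebroidDefect_swap, h3 x hx, neg_zero])

/-- Comparing the defect at `x₂` and at `f • x₂` leaves `t ∧ x₂ = 0` for the linear form `t =
mixedDefect x · f`. The hypothesis `hrank` states that this for all `x₂` forces `t = 0`, which needs
fibres of dimension at least 2 (or 0). -/
theorem mixedDefect_eq_zero
    (hb : ∀ x₁ x₂ y₁ y₂, bialgebroidDefect L L' p hp x₁ x₂ y₁ y₂ = 0)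
    (hrank : ∀ t : Y →ₗ[K] K, (∀ x y₁ y₂, t y₁ * p x y₂ = t y₂ * p x y₁) → t = 0)
    (x : X) (y : Y) (f : K) : mixedDefect L L' p hp x y f = 0 := by
  let t : Y →ₗ[K] K :=
    { toFun := fun y => mixedDefect L L' p hp x y f
      map_add' := fun y y' => mixedDefect_add_right L L' p hp x y y' f
      map_smul' := fun g y => mixedDefect_smul_right L L' p hp g x y f }
  refine congrArg (fun φ : Y →ₗ[K] K => φ y) (hrank t fun x₂ y₁ y₂ => ?_)
  have := bialgebroidDefect_smul L L' p hp f x x₂ y₁ y₂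
  rw [hb, hb, mul_zero, zero_add] at this
  exact sub_eq_zero.1 this.symm

/-- The failure of linearity of `mixedDefect` in `x` is `functionDefect` times a pairing, so at each
point one non-zero pairing suffices. -/
theorem functionDefect_eq_zero (hm : ∀ x y f, mixedDefect L L' p hp x y f = 0)
    (hrank : ∀ k : K, (∀ x y, p x y * k = 0) → k = 0)
    (f g : K) : functionDefect L L' p hp f g = 0 := by
  refine hrank _ fun x y => ?_
  have := mixedDefect_smul_left L L' p hp g x y f
  rw [hm, hm, mul_zero, zero_add] at this
  exact this.symm

end LieBialgebroid

/-! ### The duals over `C^*` in terms of generators: anchors, pairings, Lie derivatives. -/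

section DualModel

variable {R K U V W X Y ι ι' : Type*} [CommRing R] [Algebra ℝ R] [CommRing K] [Algebra ℝ K]
  [AddCommGroup U] [Module R U] [AddCommGroup V] [Module R V] [AddCommGroup W] [Module R W]
  [AddCommGroup X] [Module K X] [AddCommGroup Y] [Module K Y]
  {LA : LieAlgebroid R U} {LB : LieAlgebroid R W}

/-- The relations between the generators `sX b`, `iX α` of `Γ(D^*A^*C^*)` and the generators
`sY a`, `iY β` of `Γ(D^*B^*C^*)`, where `U = Γ(A)`, `W = Γ(B)`, `V = Γ(C)`, `K = C^∞(C^*)`, and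
`α`, `β` are sections of `A^*`, `B^*`. -/
structure DualRelations (T : TwoRep LB V U) (L : LieAlgebroid K X) (p : X →ₗ[K] Y →ₗ[K] K)
    (pl : R →ₐ[ℝ] K) (el : V →+ K) (evA : ι → U →ₗ[R] R) (evB : ι' → W →ₗ[R] R)
    (sX : W → X) (iX : ι → X) (sY : U → Y) (iY : ι' → Y) : Prop where
  pair_s_s : ∀ b a, p (sX b) (sY a) = 0
  pair_s_i : ∀ b β, p (sX b) (iY β) = -pl (evB β b)
  pair_i_s : ∀ α a, p (iX α) (sY a) = pl (evA α a)
  pair_i_i : ∀ α β, p (iX α) (iY β) = 0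
  anchor_s_pull : ∀ b f, L.anchor (sX b) (pl f) = pl (LB.anchor b f)
  anchor_s_ell : ∀ b c, L.anchor (sX b) (el c) = el (T.nabla₀.nabla b c)
  anchor_i_pull : ∀ α f, L.anchor (iX α) (pl f) = 0
  anchor_i_ell : ∀ α c, L.anchor (iX α) (el c) = -pl (evA α (T.bd c))
  bracket_s_i : ∀ b α, ∃ α', L.bracket (sX b) (iX α) = iX α' ∧
    ∀ a, evA α' a = LB.anchor b (evA α a) - evA α (T.nabla₁.nabla b a)
  bracket_i_i : ∀ α α', L.bracket (iX α) (iX α') = 0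
  pair_bracket_s : ∀ b₁ b₂ a, p (L.bracket (sX b₁) (sX b₂)) (sY a) = -el (T.curv b₁ b₂ a)
  pair_bracket_i : ∀ b₁ b₂ β,
    p (L.bracket (sX b₁) (sX b₂)) (iY β) = -pl (evB β (LB.bracket b₁ b₂))
  -- The sections pairing to zero with all `iY β` are those without component along `B`. They are
  -- locally combinations of the `iX α`, and this field expresses that without speaking of local
  -- combinations.
  eq_zero_of_vertical : ∀ φ : X →ₗ[K] K, (∀ α, φ (iX α) = 0) →
    ∀ x, (∀ β, p x (iY β) = 0) → φ x = 0
  eq_zero : ∀ φ : X →ₗ[K] K, (∀ α, φ (iX α) = 0) → (∀ b, φ (sX b) = 0) → φ = 0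

theorem Connection.nabla_zero_left {L : LieAlgebroid R U} (c : Connection L V) (v : V) :
    c.nabla 0 v = 0 := by
  have := c.add_left 0 0 v
  rw [add_zero] at this
  exact left_eq_add.1 this

theorem Connection.nabla_neg_left {L : LieAlgebroid R U} (c : Connection L V) (x : U) (v : V) :
    c.nabla (-x) v = -c.nabla x v :=
  map_neg (AddMonoidHom.mk' (fun x => c.nabla x v) (fun x y => c.add_left x y v)) x

namespace DualRelations

variable {T : TwoRep LB V U} {S : TwoRep LA V W} {L : LieAlgebroid K X} {L' : LieAlgebroid K Y}
  {p : X →ₗ[K] Y →ₗ[K] K} {pl : R →ₐ[ℝ] K} {el : V →+ K} {evA : ι → U →ₗ[R] R}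
  {evB : ι' → W →ₗ[R] R} {sX : W → X} {iX : ι → X} {sY : U → Y} {iY : ι' → Y}

section

variable (h : DualRelations T L p pl el evA evB sX iX sY iY)

/-- A section whose component along `B` is `b` differs from `sX b` by a section that pairs to zero
with every `iY β`. This evaluates anchors and pairings on brackets and Lie derivatives, which are
known only through their pairings with generators. -/
theorem apply_eq {φ : X →ₗ[K] K} (h : DualRelations T L p pl el evA evB sX iX sY iY)
    (hφ : ∀ α, φ (iX α) = 0) {x : X} {b : W}
    (hx : ∀ β, p x (iY β) = -pl (evB β b)) : φ x = φ (sX b) := by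
  rw [← sub_eq_zero, ← map_sub]
  refine h.eq_zero_of_vertical φ hφ _ fun β => ?_
  rw [map_sub, LinearMap.sub_apply, hx, h.pair_s_i, sub_self]

theorem anchor_pull (h : DualRelations T L p pl el evA evB sX iX sY iY) {x : X} {b : W}
    (hx : ∀ β, p x (iY β) = -pl (evB β b)) (f : R) :
    L.anchor x (pl f) = pl (LB.anchor b f) := by
  let φ : X →ₗ[K] K :=
    { toFun := fun x => L.anchor x (pl f)
      map_add' := fun x y => by rw [map_add, Derivation.add_apply]
      map_smul' := fun g x => by rw [map_smul, Derivation.smul_apply, RingHom.id_apply] }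
  exact (h.apply_eq (φ := φ) (fun α => h.anchor_i_pull α f) hx).trans (h.anchor_s_pull b f)

theorem anchor_ell (h : DualRelations T L p pl el evA evB sX iX sY iY) {x : X} {b : W}
    (hx : ∀ β, p x (iY β) = -pl (evB β b)) (c : V) :
    L.anchor x (el c) = el (T.nabla₀.nabla b c) - p x (sY (T.bd c)) := by
  -- The correction `p x (sY (T.bd c))` is chosen so that the functional vanishes on every `iX α`.
  let φ : X →ₗ[K] K :=
    { toFun := fun x => L.anchor x (el c) + p x (sY (T.bd c))
      map_add' := fun x y => by
        rw [map_add, Derivation.add_apply, map_add, LinearMap.add_apply]; ring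
      map_smul' := fun g x => by
        rw [map_smul, Derivation.smul_apply, RingHom.id_apply, map_smul, LinearMap.smul_apply,
          smul_add] }
  have := h.apply_eq (φ := φ) (fun α => by
    change L.anchor (iX α) (el c) + p (iX α) (sY (T.bd c)) = 0
    rw [h.anchor_i_ell, h.pair_i_s, neg_add_cancel]) hx
  change L.anchor x (el c) + p x (sY (T.bd c)) = L.anchor (sX b) (el c) + _ at this
  rw [h.pair_s_s, h.anchor_s_ell, add_zero] at this
  rw [← this, add_sub_cancel_right]

/-- With respect to the decomposition into horizontal generators and vertical remainders, horizontal
pairs to zero with horizontal and vertical with vertical; the two cross terms remain. -/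
theorem pair_eq (h : DualRelations T L p pl el evA evB sX iX sY iY) {x : X} {b : W} {y : Y} {a : U}
    (hx : ∀ β, p x (iY β) = -pl (evB β b)) (hy : ∀ α, p (iX α) y = pl (evA α a)) :
    p x y = p (sX b) y + p x (sY a) := by
  have := h.apply_eq (φ := p.flip (y - sY a)) (fun α => by
    rw [LinearMap.flip_apply, map_sub, hy, h.pair_i_s, sub_self]) hx
  rw [LinearMap.flip_apply, LinearMap.flip_apply, map_sub, map_sub, h.pair_s_s, sub_zero] at this
  rw [← this, sub_add_cancel]

/-- Additivity of `sX` is not among the relations, so the vanishing of this pairing is deduced from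
the pairings of `sX 0` with the generators. -/
theorem pair_s_zero (h : DualRelations T L p pl el evA evB sX iX sY iY) {y : Y}
    (hy : ∀ α, p (iX α) y = pl (evA α 0)) : p (sX 0) y = 0 := by
  have hx : ∀ β, p (sX 0) (iY β) = 0 := fun β => by rw [h.pair_s_i, map_zero, map_zero, neg_zero]
  have := h.eq_zero_of_vertical (p.flip y) (fun α => by
    rw [LinearMap.flip_apply, hy, map_zero, map_zero]) _ hx
  exact this

/-! Lie derivatives of generators -/

/-- A Lie derivative is described by its pairings with the two kinds of generators: its component
along `A`, here given by the connection on `A`, and its remaining component, here the curvature. The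
statement concerns any section satisfying the defining equation, so that it can be applied to
`-p.flip` as well. -/
theorem lie_s_s (h : DualRelations T L p pl el evA evB sX iX sY iY) {b : W} {a : U} {y : Y}
    (hy : IsLieDerivative L p (sX b) (sY a) y) :
    (∀ α, p (iX α) y = pl (evA α (T.nabla₁.nabla b a))) ∧
      ∀ b', p (sX b') y = el (T.curv b b' a) := by
  refine ⟨fun α => ?_, fun b' => ?_⟩
  · obtain ⟨α', e, h'⟩ := h.bracket_s_i b α
    rw [hy, h.pair_i_s, h.anchor_s_pull, e, h.pair_i_s, h', ← map_sub, sub_sub_cancel]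
  · rw [hy, h.pair_s_s, map_zero, zero_sub, h.pair_bracket_s, neg_neg]

theorem lie_s_i (h : DualRelations T L p pl el evA evB sX iX sY iY) {b : W} {β : ι'} {y : Y}
    (hy : IsLieDerivative L p (sX b) (iY β) y) :
    (∀ α, p (iX α) y = pl (evA α 0)) ∧
      ∀ b', p (sX b') y = -pl (LB.anchor b (evB β b') - evB β (LB.bracket b b')) := by
  refine ⟨fun α => ?_, fun b' => ?_⟩
  · obtain ⟨α', e, h'⟩ := h.bracket_s_i b α
    rw [hy, h.pair_i_i, e, h.pair_i_i, map_zero, sub_self, map_zero, map_zero]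
  · rw [hy, h.pair_s_i, map_neg, h.anchor_s_pull, h.pair_bracket_i, map_sub]
    ring

theorem lie_i_s (h : DualRelations T L p pl el evA evB sX iX sY iY) {α : ι} {a : U} {y : Y}
    (hy : IsLieDerivative L p (iX α) (sY a) y) :
    (∀ α', p (iX α') y = pl (evA α' 0)) ∧
      ∀ b', p (sX b') y = pl (LB.anchor b' (evA α a) - evA α (T.nabla₁.nabla b' a)) := by
  refine ⟨fun α' => ?_, fun b' => ?_⟩
  · rw [hy, h.pair_i_s, h.anchor_i_pull, h.bracket_i_i, map_zero, map_zero, map_zero, LinearMap.zero_apply, sub_zero]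
  · obtain ⟨α', e, h'⟩ := h.bracket_s_i b' α
    rw [hy, h.pair_s_s, map_zero, zero_sub, L.bracket_skew (sX b'), e, map_neg,
      LinearMap.neg_apply, neg_neg, h.pair_i_s, h']

theorem lie_i_i (h : DualRelations T L p pl el evA evB sX iX sY iY) {α : ι} {β : ι'} {y : Y}
    (hy : IsLieDerivative L p (iX α) (iY β) y) :
    (∀ α', p (iX α') y = pl (evA α' 0)) ∧ ∀ b', p (sX b') y = 0 := by
  refine ⟨fun α' => ?_, fun b' => ?_⟩
  · rw [hy, h.pair_i_i, h.bracket_i_i, map_zero, map_zero, map_zero, map_zero, LinearMap.zero_apply, sub_zero]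
  · obtain ⟨α', e, h'⟩ := h.bracket_s_i b' α
    rw [hy, h.pair_s_i, map_neg, h.anchor_i_pull, L.bracket_skew (sX b'), e, map_neg,
      LinearMap.neg_apply, h.pair_i_i, neg_zero, sub_self]

theorem differential_pull (h : DualRelations T L p pl el evA evB sX iX sY iY) {f : R} {y : Y}
    (hy : ∀ x, p x y = L.anchor x (pl f)) :
    (∀ α, p (iX α) y = pl (evA α 0)) ∧ ∀ b, p (sX b) y = pl (LB.anchor b f) := by
  refine ⟨fun α => ?_, fun b => ?_⟩
  · rw [hy, h.anchor_i_pull, map_zero, map_zero]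
  · rw [hy, h.anchor_s_pull]

theorem differential_ell (h : DualRelations T L p pl el evA evB sX iX sY iY) {c : V} {y : Y}
    (hy : ∀ x, p x y = L.anchor x (el c)) :
    (∀ α, p (iX α) y = pl (evA α (-T.bd c))) ∧ ∀ b, p (sX b) y = el (T.nabla₀.nabla b c) := by
  refine ⟨fun α => ?_, fun b => ?_⟩
  · rw [hy, h.anchor_i_ell, map_neg, map_neg]
  · rw [hy, h.anchor_s_ell]

end

/-! The mirror statements -/

variable (h : DualRelations T L p pl el evA evB sX iX sY iY)
  (h' : DualRelations S L' (-p.flip) pl el evB evA sY iY sX iX) (hp : p.IsPerfPair)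

/-- Exchanging the roles of `A` and `B` reverses the sign of the pairing. Hence the relations for
`D^*B^*C^*` are stated for `-p.flip`, and each mirror statement is the original one with that sign
removed. -/
theorem anchor_pull_flip (h' : DualRelations S L' (-p.flip) pl el evB evA sY iY sX iX)
    {y : Y} {a : U} (hy : ∀ α, p (iX α) y = pl (evA α a)) (f : R) :
    L'.anchor y (pl f) = pl (LA.anchor a f) :=
  h'.anchor_pull (x := y) (b := a) (fun α => congrArg Neg.neg (hy α)) f

theorem anchor_ell_flip (h' : DualRelations S L' (-p.flip) pl el evB evA sY iY sX iX)
    {y : Y} {a : U} (hy : ∀ α, p (iX α) y = pl (evA α a)) (c : V) :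
    L'.anchor y (el c) = el (S.nabla₀.nabla a c) + p (sX (S.bd c)) y := by
  rw [h'.anchor_ell (x := y) (b := a) (fun α => congrArg Neg.neg (hy α)) c]
  exact sub_neg_eq_add _ _

/-- The defining equation is homogeneous in the pairing, so a global sign does not matter. -/
theorem isLieDerivative_flip {y : Y} {x z : X} (hz : IsLieDerivative L' p.flip y x z) :
    IsLieDerivative L' (-p.flip) y x z := by
  intro y'
  change -p.flip y' z = L'.anchor y (-p.flip y' x) - -p.flip (L'.bracket y y') x
  rw [hz y', map_neg]
  ring

theorem lie_s_s_flip (h' : DualRelations S L' (-p.flip) pl el evB evA sY iY sX iX) {b : W} {a : U}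
    {x : X} (hx : IsLieDerivative L' p.flip (sY a) (sX b) x) :
    (∀ β, p x (iY β) = -pl (evB β (S.nabla₁.nabla a b))) ∧
      ∀ a', p x (sY a') = -el (S.curv a a' b) := by
  obtain ⟨h1, h2⟩ := h'.lie_s_s (isLieDerivative_flip hx)
  exact ⟨fun β => neg_eq_iff_eq_neg.1 (h1 β), fun a' => neg_eq_iff_eq_neg.1 (h2 a')⟩

theorem lie_s_i_flip (h' : DualRelations S L' (-p.flip) pl el evB evA sY iY sX iX) {a : U} {α : ι}
    {x : X} (hx : IsLieDerivative L' p.flip (sY a) (iX α) x) :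
    (∀ β, p x (iY β) = -pl (evB β 0)) ∧
      ∀ a', p x (sY a') = pl (LA.anchor a (evA α a') - evA α (LA.bracket a a')) := by
  obtain ⟨h1, h2⟩ := h'.lie_s_i (isLieDerivative_flip hx)
  exact ⟨fun β => neg_eq_iff_eq_neg.1 (h1 β), fun a' => neg_injective (h2 a')⟩

theorem lie_i_s_flip (h' : DualRelations S L' (-p.flip) pl el evB evA sY iY sX iX) {b : W} {β : ι'}
    {x : X} (hx : IsLieDerivative L' p.flip (iY β) (sX b) x) :
    (∀ β', p x (iY β') = -pl (evB β' 0)) ∧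
      ∀ a', p x (sY a') = -pl (LA.anchor a' (evB β b) - evB β (S.nabla₁.nabla a' b)) := by
  obtain ⟨h1, h2⟩ := h'.lie_i_s (isLieDerivative_flip hx)
  exact ⟨fun β => neg_eq_iff_eq_neg.1 (h1 β), fun a' => neg_eq_iff_eq_neg.1 (h2 a')⟩

theorem lie_i_i_flip (h' : DualRelations S L' (-p.flip) pl el evB evA sY iY sX iX) {α : ι} {β : ι'}
    {x : X} (hx : IsLieDerivative L' p.flip (iY β) (iX α) x) :
    (∀ β', p x (iY β') = -pl (evB β' 0)) ∧ ∀ a', p x (sY a') = 0 := by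
  obtain ⟨h1, h2⟩ := h'.lie_i_i (isLieDerivative_flip hx)
  exact ⟨fun β => neg_eq_iff_eq_neg.1 (h1 β), fun a' => neg_eq_zero.1 (h2 a')⟩

theorem pair_s_bracket (h' : DualRelations S L' (-p.flip) pl el evB evA sY iY sX iX)
    (a₁ a₂ : U) (b : W) : p (sX b) (L'.bracket (sY a₁) (sY a₂)) = el (S.curv a₁ a₂ b) :=
  neg_injective (h'.pair_bracket_s a₁ a₂ b)

theorem pair_i_bracket (h' : DualRelations S L' (-p.flip) pl el evB evA sY iY sX iX)
    (a₁ a₂ : U) (α : ι) :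
    p (iX α) (L'.bracket (sY a₁) (sY a₂)) = pl (evA α (LA.bracket a₁ a₂)) :=
  neg_injective (h'.pair_bracket_i a₁ a₂ α)

/-! Values of `functionDefect` on generators -/

theorem functionDefect_pull_pull (h : DualRelations T L p pl el evA evB sX iX sY iY)
    (h' : DualRelations S L' (-p.flip) pl el evB evA sY iY sX iX) (f g : R) :
    functionDefect L L' p hp (pl f) (pl g) = 0 := by
  have e := fun f => (h.differential_pull (fun x => pairing_differential L p hp x (pl f))).1
  rw [functionDefect, h'.anchor_pull_flip (e f), h'.anchor_pull_flip (e g), map_zero]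
  simp

/-- The differential of `ℓ_c` has component `-∂_A c` along `A`, and pairing it with the differential
of a pulled-back function brings in `∂_B c`; this is the source of `m1`. -/
theorem functionDefect_ell_pull (h : DualRelations T L p pl el evA evB sX iX sY iY)
    (h' : DualRelations S L' (-p.flip) pl el evB evA sY iY sX iX) (c : V) (f : R) :
    functionDefect L L' p hp (el c) (pl f) =
      pl (LB.anchor (S.bd c) f - LA.anchor (T.bd c) f) := by
  obtain ⟨e1, e2⟩ := h.differential_pull (fun x => pairing_differential L p hp x (pl f))
  obtain ⟨e3, e4⟩ := h.differential_ell (fun x => pairing_differential L p hp x (el c))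
  rw [functionDefect, h'.anchor_pull_flip e3, h'.anchor_ell_flip e1, e2,
    S.nabla₀.nabla_zero_left, map_neg, Derivation.neg_apply, map_neg, map_zero, map_sub]
  ring

/-- The source of `m2`: each order contributes one derivative for either connection on `C`. -/
theorem functionDefect_ell_ell (h : DualRelations T L p pl el evA evB sX iX sY iY)
    (h' : DualRelations S L' (-p.flip) pl el evB evA sY iY sX iX) (c₁ c₂ : V) :
    functionDefect L L' p hp (el c₁) (el c₂) =
      -el (S.nabla₀.nabla (T.bd c₁) c₂ - T.nabla₀.nabla (S.bd c₂) c₁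
        + S.nabla₀.nabla (T.bd c₂) c₁ - T.nabla₀.nabla (S.bd c₁) c₂) := by
  obtain ⟨e1, e2⟩ := h.differential_ell (fun x => pairing_differential L p hp x (el c₁))
  obtain ⟨e3, e4⟩ := h.differential_ell (fun x => pairing_differential L p hp x (el c₂))
  rw [functionDefect, h'.anchor_ell_flip e1, h'.anchor_ell_flip e3, e2, e4,
    S.nabla₀.nabla_neg_left, S.nabla₀.nabla_neg_left]
  simp only [map_add, map_sub, map_neg]
  ring

end DualRelations

end DualModel

/-! ### The defects evaluated on generators. -/

section DualModel

variable {R K U V W X Y ι ι' : Type*} [CommRing R] [Algebra ℝ R] [CommRing K] [Algebra ℝ K]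
  [AddCommGroup U] [Module R U] [AddCommGroup V] [Module R V] [AddCommGroup W] [Module R W]
  [AddCommGroup X] [Module K X] [AddCommGroup Y] [Module K Y]
  {LA : LieAlgebroid R U} {LB : LieAlgebroid R W}

namespace DualRelations

variable {T : TwoRep LB V U} {S : TwoRep LA V W} {L : LieAlgebroid K X} {L' : LieAlgebroid K Y}
  {p : X →ₗ[K] Y →ₗ[K] K} {pl : R →ₐ[ℝ] K} {el : V →+ K} {evA : ι → U →ₗ[R] R}
  {evB : ι' → W →ₗ[R] R} {sX : W → X} {iX : ι → X} {sY : U → Y} {iY : ι' → Y}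
  (hp : p.IsPerfPair)

theorem isLieDerivative_lieDerivative (x : X) (y : Y) :
    IsLieDerivative L p x y (lieDerivative L p hp x y) :=
  (exists_lieDerivative L p hp x y).choose_spec

/-! Values of `mixedDefect` on generators -/

theorem mixedDefect_s_s_pull (h : DualRelations T L p pl el evA evB sX iX sY iY)
    (h' : DualRelations S L' (-p.flip) pl el evB evA sY iY sX iX) (b : W) (a : U) (f : R) :
    mixedDefect L L' p hp (sX b) (sY a) (pl f) =
      pl (LA.anchor a (LB.anchor b f) - LB.anchor b (LA.anchor a f)
        + LA.anchor (T.nabla₁.nabla b a) f - LB.anchor (S.nabla₁.nabla a b) f) := by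
  obtain ⟨e1, -⟩ := h.lie_s_s (isLieDerivative_lieDerivative hp (sX b) (sY a))
  obtain ⟨e2, -⟩ := h'.lie_s_s_flip (isLieDerivative_lieDerivative hp.flip (sY a) (sX b))
  rw [mixedDefect, h.anchor_s_pull, h'.anchor_s_pull, h'.anchor_s_pull, h.anchor_s_pull,
    h'.anchor_pull_flip e1, h.anchor_pull e2, h.pair_s_s, map_zero, add_zero]
  simp only [map_add, map_sub]

/-- The source of `m6`: the compositions of anchors give the commutator of the two connections on
`C`, and the Lie derivatives give the mixed connection terms and, through their second components,
the curvatures. -/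
theorem mixedDefect_s_s_ell (h : DualRelations T L p pl el evA evB sX iX sY iY)
    (h' : DualRelations S L' (-p.flip) pl el evB evA sY iY sX iX) (b : W) (a : U) (c : V) :
    mixedDefect L L' p hp (sX b) (sY a) (el c) =
      el (S.nabla₀.nabla a (T.nabla₀.nabla b c) - T.nabla₀.nabla b (S.nabla₀.nabla a c)
        + S.nabla₀.nabla (T.nabla₁.nabla b a) c - T.nabla₀.nabla (S.nabla₁.nabla a b) c
        + T.curv b (S.bd c) a - S.curv a (T.bd c) b) := by
  obtain ⟨e1, e1'⟩ := h.lie_s_s (isLieDerivative_lieDerivative hp (sX b) (sY a))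
  obtain ⟨e2, e2'⟩ := h'.lie_s_s_flip (isLieDerivative_lieDerivative hp.flip (sY a) (sX b))
  rw [mixedDefect, h.anchor_s_ell, h'.anchor_s_ell, h'.anchor_s_ell, h.anchor_s_ell,
    h'.anchor_ell_flip e1, h.anchor_ell e2, h.pair_s_s, map_zero, add_zero, e1', e2']
  simp only [map_add, map_sub]
  ring

theorem mixedDefect_i_s_pull (h : DualRelations T L p pl el evA evB sX iX sY iY)
    (h' : DualRelations S L' (-p.flip) pl el evB evA sY iY sX iX) (α : ι) (a : U) (f : R) :
    mixedDefect L L' p hp (iX α) (sY a) (pl f) = 0 := by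
  obtain ⟨e1, -⟩ := h.lie_i_s (isLieDerivative_lieDerivative hp (iX α) (sY a))
  obtain ⟨e2, -⟩ := h'.lie_s_i_flip (isLieDerivative_lieDerivative hp.flip (sY a) (iX α))
  obtain ⟨e3, -⟩ := h.differential_pull (fun x => pairing_differential L p hp x (pl f))
  rw [mixedDefect, h.anchor_i_pull, h'.anchor_s_pull, h.anchor_i_pull, h.pair_i_s,
    h'.anchor_pull_flip e1, h.anchor_pull e2, h'.anchor_pull_flip e3]
  simp

/-- The source of `m3`. The last term of `mixedDefect` leaves the discrepancy of `m1`, applied to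
the function `⟨α, a⟩`. -/
theorem mixedDefect_i_s_ell (h : DualRelations T L p pl el evA evB sX iX sY iY)
    (h' : DualRelations S L' (-p.flip) pl el evB evA sY iY sX iX) (α : ι) (a : U) (c : V) :
    mixedDefect L L' p hp (iX α) (sY a) (el c) =
      pl (evA α (T.bd (S.nabla₀.nabla a c) - T.nabla₁.nabla (S.bd c) a
        - LA.bracket a (T.bd c)) + (LB.anchor (S.bd c) (evA α a) -
        LA.anchor (T.bd c) (evA α a))) := by
  obtain ⟨e1, e1'⟩ := h.lie_i_s (isLieDerivative_lieDerivative hp (iX α) (sY a))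
  obtain ⟨e2, e2'⟩ := h'.lie_s_i_flip (isLieDerivative_lieDerivative hp.flip (sY a) (iX α))
  obtain ⟨e3, -⟩ := h.differential_ell (fun x => pairing_differential L p hp x (el c))
  rw [mixedDefect, h.anchor_i_ell, map_neg, h'.anchor_s_pull, h'.anchor_s_ell, h.anchor_i_ell,
    h.pair_i_s, h'.anchor_ell_flip e1, h.anchor_ell e2, h'.anchor_pull_flip e3, e1', e2',
    S.nabla₀.nabla_zero_left, T.nabla₀.nabla_zero_left]
  simp only [map_add, map_sub, map_neg, map_zero, Derivation.neg_apply]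
  ring

theorem mixedDefect_s_i_pull (h : DualRelations T L p pl el evA evB sX iX sY iY)
    (h' : DualRelations S L' (-p.flip) pl el evB evA sY iY sX iX) (b : W) (β : ι') (f : R) :
    mixedDefect L L' p hp (sX b) (iY β) (pl f) = 0 := by
  obtain ⟨e1, -⟩ := h.lie_s_i (isLieDerivative_lieDerivative hp (sX b) (iY β))
  obtain ⟨e2, -⟩ := h'.lie_i_s_flip (isLieDerivative_lieDerivative hp.flip (iY β) (sX b))
  obtain ⟨e3, -⟩ := h.differential_pull (fun x => pairing_differential L p hp x (pl f))
  rw [mixedDefect, h.anchor_s_pull, h'.anchor_i_pull, h'.anchor_i_pull, h.pair_s_i, map_neg,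
    h'.anchor_pull_flip e1, h.anchor_pull e2, h'.anchor_pull_flip e3]
  simp

/-- The source of `m4`. Here the last term of `mixedDefect` cancels, so `m1` is not involved. -/
theorem mixedDefect_s_i_ell (h : DualRelations T L p pl el evA evB sX iX sY iY)
    (h' : DualRelations S L' (-p.flip) pl el evB evA sY iY sX iX) (b : W) (β : ι') (c : V) :
    mixedDefect L L' p hp (sX b) (iY β) (el c) =
      pl (evB β (LB.bracket b (S.bd c) - S.bd (T.nabla₀.nabla b c)
        + S.nabla₁.nabla (T.bd c) b)) := by
  obtain ⟨e1, e1'⟩ := h.lie_s_i (isLieDerivative_lieDerivative hp (sX b) (iY β))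
  obtain ⟨e2, e2'⟩ := h'.lie_i_s_flip (isLieDerivative_lieDerivative hp.flip (iY β) (sX b))
  obtain ⟨e3, -⟩ := h.differential_ell (fun x => pairing_differential L p hp x (el c))
  rw [mixedDefect, h.anchor_s_ell, h'.anchor_i_ell, h'.anchor_i_ell, map_neg, h.anchor_s_pull,
    h.pair_s_i, map_neg, h'.anchor_ell_flip e1, h.anchor_ell e2, h'.anchor_pull_flip e3, e1', e2',
    S.nabla₀.nabla_zero_left, T.nabla₀.nabla_zero_left]
  simp only [map_add, map_sub, map_neg, map_zero, Derivation.neg_apply]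
  ring

theorem mixedDefect_i_i_pull (h : DualRelations T L p pl el evA evB sX iX sY iY)
    (h' : DualRelations S L' (-p.flip) pl el evB evA sY iY sX iX) (α : ι) (β : ι') (f : R) :
    mixedDefect L L' p hp (iX α) (iY β) (pl f) = 0 := by
  obtain ⟨e1, -⟩ := h.lie_i_i (isLieDerivative_lieDerivative hp (iX α) (iY β))
  obtain ⟨e2, -⟩ := h'.lie_i_i_flip (isLieDerivative_lieDerivative hp.flip (iY β) (iX α))
  rw [mixedDefect, h.anchor_i_pull, h'.anchor_i_pull, h.pair_i_i,
    h'.anchor_pull_flip e1, h.anchor_pull e2]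
  simp

theorem mixedDefect_i_i_ell (h : DualRelations T L p pl el evA evB sX iX sY iY)
    (h' : DualRelations S L' (-p.flip) pl el evB evA sY iY sX iX) (α : ι) (β : ι') (c : V) :
    mixedDefect L L' p hp (iX α) (iY β) (el c) = 0 := by
  obtain ⟨e1, e1'⟩ := h.lie_i_i (isLieDerivative_lieDerivative hp (iX α) (iY β))
  obtain ⟨e2, e2'⟩ := h'.lie_i_i_flip (isLieDerivative_lieDerivative hp.flip (iY β) (iX α))
  rw [mixedDefect, h.anchor_i_ell, h'.anchor_i_ell, map_neg, map_neg, h.anchor_i_pull,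
    h'.anchor_i_pull, h.pair_i_i, h'.anchor_ell_flip e1, h.anchor_ell e2, e1', e2',
    S.nabla₀.nabla_zero_left, T.nabla₀.nabla_zero_left]
  simp

/-! The differentials of generators -/

theorem d_s_s_s (h : DualRelations T L p pl el evA evB sX iX sY iY)
    (h' : DualRelations S L' (-p.flip) pl el evB evA sY iY sX iX) (b : W) (a₁ a₂ : U) :
    dualDifferential L' p (sX b) (sY a₁) (sY a₂) = -el (S.curv a₁ a₂ b) := by
  rw [dualDifferential, h.pair_s_s, h.pair_s_s, h'.pair_s_bracket, map_zero, map_zero, sub_self,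
    zero_sub]

theorem d_s_s_i (h : DualRelations T L p pl el evA evB sX iX sY iY)
    (h' : DualRelations S L' (-p.flip) pl el evB evA sY iY sX iX) (b : W) (a : U) (β : ι') :
    dualDifferential L' p (sX b) (sY a) (iY β) = -pl (evB β (S.nabla₁.nabla a b)) := by
  obtain ⟨β', e, e'⟩ := h'.bracket_s_i a β
  rw [dualDifferential, h.pair_s_s, h.pair_s_i, e, h.pair_s_i, e', map_zero, map_neg,
    h'.anchor_s_pull, map_sub]
  ring

theorem d_s_i_i (h : DualRelations T L p pl el evA evB sX iX sY iY)
    (h' : DualRelations S L' (-p.flip) pl el evB evA sY iY sX iX) (b : W) (β β' : ι') :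
    dualDifferential L' p (sX b) (iY β) (iY β') = 0 := by
  rw [dualDifferential, h.pair_s_i, h.pair_s_i, h'.bracket_i_i, map_zero, map_neg, map_neg,
    h'.anchor_i_pull, h'.anchor_i_pull]
  simp

theorem d_i_s_s (h : DualRelations T L p pl el evA evB sX iX sY iY)
    (h' : DualRelations S L' (-p.flip) pl el evB evA sY iY sX iX) (α : ι) (a₁ a₂ : U) :
    dualDifferential L' p (iX α) (sY a₁) (sY a₂) =
      pl (LA.anchor a₁ (evA α a₂) - LA.anchor a₂ (evA α a₁) - evA α (LA.bracket a₁ a₂)) := by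
  rw [dualDifferential, h.pair_i_s, h.pair_i_s, h'.pair_i_bracket, h'.anchor_s_pull,
    h'.anchor_s_pull, map_sub, map_sub]

theorem d_i_s_i (h : DualRelations T L p pl el evA evB sX iX sY iY)
    (h' : DualRelations S L' (-p.flip) pl el evB evA sY iY sX iX) (α : ι) (a : U) (β : ι') :
    dualDifferential L' p (iX α) (sY a) (iY β) = 0 := by
  obtain ⟨β', e, -⟩ := h'.bracket_s_i a β
  rw [dualDifferential, h.pair_i_i, h.pair_i_s, e, h.pair_i_i, map_zero, h'.anchor_i_pull]
  simp

theorem d_i_i_i (h : DualRelations T L p pl el evA evB sX iX sY iY)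
    (h' : DualRelations S L' (-p.flip) pl el evB evA sY iY sX iX) (α : ι) (β β' : ι') :
    dualDifferential L' p (iX α) (iY β) (iY β') = 0 := by
  rw [dualDifferential, h.pair_i_i, h.pair_i_i, h'.bracket_i_i, map_zero, map_zero, map_zero]
  simp

/-! Values of `bialgebroidDefect` on generators -/

/-- The Lie derivatives are moved to the first slot of the 2-forms, the position required by
`dualDifferential_mixed`. -/
theorem bialgebroidDefect_eq (x₁ x₂ : X) (y₁ y₂ : Y) :
    bialgebroidDefect L L' p hp x₁ x₂ y₁ y₂ =
      dualDifferential L' p (L.bracket x₁ x₂) y₁ y₂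
      + (L.anchor x₂ (dualDifferential L' p x₁ y₁ y₂)
        - dualDifferential L' p x₁ (lieDerivative L p hp x₂ y₁) y₂
        + dualDifferential L' p x₁ (lieDerivative L p hp x₂ y₂) y₁)
      - (L.anchor x₁ (dualDifferential L' p x₂ y₁ y₂)
        - dualDifferential L' p x₂ (lieDerivative L p hp x₁ y₁) y₂
        + dualDifferential L' p x₂ (lieDerivative L p hp x₁ y₂) y₁) := by
  rw [bialgebroidDefect, schouten, schouten,
    dualDifferential_skew L' p x₁ (lieDerivative L p hp x₂ y₂),
    dualDifferential_skew L' p x₂ (lieDerivative L p hp x₁ y₂)]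
  ring

/-- Cartan's formula replaces `d x` by a Lie derivative of `x`. The pairing of this Lie derivative
with `w` is then split by `pair_eq`, so that only the components of `w` and of the Lie derivative
are needed. -/
theorem dualDifferential_mixed (h : DualRelations T L p pl el evA evB sX iX sY iY)
    {x : X} {y w : Y} {b : W} {a : U}
    (hx : ∀ β, p (lieDerivative L' p.flip hp.flip y x) (iY β) = -pl (evB β b))
    (hw : ∀ α, p (iX α) w = pl (evA α a)) :
    dualDifferential L' p x w y =
      L'.anchor w (p x y) - p (sX b) w - p (lieDerivative L' p.flip hp.flip y x) (sY a) := by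
  rw [dualDifferential_eq_lieDerivative L' p hp, h.pair_eq hx hw]
  ring

/-- The source of `m9`. `S.curv` enters as the value of `d (sX b)` on two generators `sY`, and
`T.curv` as a component of the bracket of two generators `sX`; both enter again through the second
components of Lie derivatives. -/
theorem bialgebroidDefect_s_s_s_s (h : DualRelations T L p pl el evA evB sX iX sY iY)
    (h' : DualRelations S L' (-p.flip) pl el evB evA sY iY sX iX) (b₁ b₂ : W) (a₁ a₂ : U) :
    bialgebroidDefect L L' p hp (sX b₁) (sX b₂) (sY a₁) (sY a₂) =
      el ((T.nabla₀.nabla b₁ (S.curv a₁ a₂ b₂) - S.curv (T.nabla₁.nabla b₁ a₁) a₂ b₂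
        - S.curv a₁ (T.nabla₁.nabla b₁ a₂) b₂)
      - (T.nabla₀.nabla b₂ (S.curv a₁ a₂ b₁) - S.curv (T.nabla₁.nabla b₂ a₁) a₂ b₁
        - S.curv a₁ (T.nabla₁.nabla b₂ a₂) b₁)
      - S.curv a₁ a₂ (LB.bracket b₁ b₂)
      - ((S.nabla₀.nabla a₁ (T.curv b₁ b₂ a₂) - T.curv (S.nabla₁.nabla a₁ b₁) b₂ a₂
        - T.curv b₁ (S.nabla₁.nabla a₁ b₂) a₂)
      - (S.nabla₀.nabla a₂ (T.curv b₁ b₂ a₁) - T.curv (S.nabla₁.nabla a₂ b₁) b₂ a₁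
        - T.curv b₁ (S.nabla₁.nabla a₂ b₂) a₁)
      - T.curv b₁ b₂ (LA.bracket a₁ a₂))) := by
  have l := fun b a => h.lie_s_s (isLieDerivative_lieDerivative hp (sX b) (sY a))
  have l' := fun a b => h'.lie_s_s_flip (isLieDerivative_lieDerivative hp.flip (sY a) (sX b))
  have e1 : dualDifferential L' p (L.bracket (sX b₁) (sX b₂)) (sY a₁) (sY a₂) =
      -el (S.nabla₀.nabla a₁ (T.curv b₁ b₂ a₂)) + el (S.nabla₀.nabla a₂ (T.curv b₁ b₂ a₁))
      - (el (S.curv a₁ a₂ (LB.bracket b₁ b₂)) - el (T.curv b₁ b₂ (LA.bracket a₁ a₂))) := by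
    rw [dualDifferential, h.pair_bracket_s, h.pair_bracket_s, map_neg, map_neg, h'.anchor_s_ell,
      h'.anchor_s_ell, h.pair_eq (h.pair_bracket_i b₁ b₂) (fun α => h'.pair_i_bracket a₁ a₂ α),
      h'.pair_s_bracket, h.pair_bracket_s]
    ring
  have skS : ∀ x y b, S.curv x y b = -S.curv y x b := by
    intro x y b
    have := congrArg (fun φ : W →ₗ[R] V => φ b) (S.curv_self (x + y))
    simp only [map_add, LinearMap.add_apply, S.curv_self, LinearMap.zero_apply, zero_add,
      add_zero] at this
    exact eq_neg_of_add_eq_zero_right this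
  have skT : ∀ x y b, T.curv x y b = -T.curv y x b := by
    intro x y b
    have := congrArg (fun φ : U →ₗ[R] V => φ b) (T.curv_self (x + y))
    simp only [map_add, LinearMap.add_apply, T.curv_self, LinearMap.zero_apply, zero_add,
      add_zero] at this
    exact eq_neg_of_add_eq_zero_right this
  rw [bialgebroidDefect_eq, e1,
    h.dualDifferential_mixed hp (l' a₂ b₁).1 (l b₂ a₁).1,
    h.dualDifferential_mixed hp (l' a₁ b₁).1 (l b₂ a₂).1,
    h.dualDifferential_mixed hp (l' a₂ b₂).1 (l b₁ a₁).1,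
    h.dualDifferential_mixed hp (l' a₁ b₂).1 (l b₁ a₂).1]
  simp only [(l _ _).2, (l' _ _).2, h.pair_s_s, d_s_s_s h h', map_neg, h.anchor_s_ell, map_zero]
  -- The Lie derivatives produce these curvatures with their two form arguments in the opposite
  -- order to the one in the statement.
  rw [skS (T.nabla₁.nabla b₁ a₁) a₂, skS (T.nabla₁.nabla b₂ a₁) a₂,
    skT (S.nabla₁.nabla a₁ b₁) b₂, skT (S.nabla₁.nabla a₂ b₁) b₂]
  simp only [map_add, map_sub, map_neg]
  ring

/-- The source of `m7`. The functions `⟨α, a₁⟩` and `⟨α, a₂⟩` are differentiated along `A` and `B`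
in both orders; `m5` converts these commutators, and all derivatives of functions cancel. -/
theorem bialgebroidDefect_i_s_s_s (h : DualRelations T L p pl el evA evB sX iX sY iY)
    (h' : DualRelations S L' (-p.flip) pl el evB evA sY iY sX iX)
    (m5 : ∀ a b (f : R), LA.anchor a (LB.anchor b f) - LB.anchor b (LA.anchor a f)
      = LB.anchor (S.nabla₁.nabla a b) f - LA.anchor (T.nabla₁.nabla b a) f)
    (α : ι) (b : W) (a₁ a₂ : U) :
    bialgebroidDefect L L' p hp (iX α) (sX b) (sY a₁) (sY a₂) =
      pl (evA α (- T.nabla₁.nabla b (LA.bracket a₁ a₂) + LA.bracket (T.nabla₁.nabla b a₁) a₂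
        + LA.bracket a₁ (T.nabla₁.nabla b a₂)
        + T.nabla₁.nabla (S.nabla₁.nabla a₂ b) a₁ - T.nabla₁.nabla (S.nabla₁.nabla a₁ b) a₂
        - T.bd (S.curv a₁ a₂ b))) := by
  have l := fun b a => h.lie_s_s (isLieDerivative_lieDerivative hp (sX b) (sY a))
  have l' := fun a b => h'.lie_s_s_flip (isLieDerivative_lieDerivative hp.flip (sY a) (sX b))
  have k := fun a => h.lie_i_s (isLieDerivative_lieDerivative hp (iX α) (sY a))
  have k' := fun a => h'.lie_s_i_flip (isLieDerivative_lieDerivative hp.flip (sY a) (iX α))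
  obtain ⟨α', e, e'⟩ := h.bracket_s_i b α
  have e1 : dualDifferential L' p (L.bracket (iX α) (sX b)) (sY a₁) (sY a₂) =
      -pl (LA.anchor a₁ (evA α' a₂) - LA.anchor a₂ (evA α' a₁) - evA α' (LA.bracket a₁ a₂)) := by
    rw [L.bracket_skew (sX b), e, ← d_i_s_s h h', ← neg_one_smul K, dualDifferential_smul]
    simp
  have z1 : ∀ y : Y, (∀ α, p (iX α) y = pl (evA α 0)) → p (sX 0) y = 0 := fun y hy =>
    h.pair_s_zero hy
  have z2 : ∀ b' a, p (sX 0) (lieDerivative L p hp (sX b') (sY a)) = 0 := by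
    intro b' a
    rw [(l b' a).2, map_zero, LinearMap.zero_apply, map_zero]
  have z3 : ∀ a, p (lieDerivative L' p.flip hp.flip (sY a) (sX b)) (sY 0) = 0 := by
    intro a
    rw [(l' a b).2, map_zero, LinearMap.zero_apply, map_zero, neg_zero]
  rw [bialgebroidDefect_eq, e1,
    h.dualDifferential_mixed hp (k' a₂).1 (l b a₁).1,
    h.dualDifferential_mixed hp (k' a₁).1 (l b a₂).1,
    h.dualDifferential_mixed hp (l' a₂ b).1 (k a₁).1,
    h.dualDifferential_mixed hp (l' a₁ b).1 (k a₂).1,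
    h.pair_i_s, h.pair_i_s, h.pair_s_s, h.pair_s_s, d_i_s_s h h', d_s_s_s h h', h.anchor_s_pull,
    map_neg, h.anchor_i_ell, z2, z2, z3, z3, (k _).2, (k _).2, (k' _).2, (k' _).2,
    h'.anchor_pull_flip (l b a₁).1, h'.anchor_pull_flip (l b a₂).1, e', e', e',
    LA.bracket_skew a₂ (T.nabla₁.nabla b a₁)]
  have f1 := congrArg pl (m5 a₁ b (evA α a₂))
  have f2 := congrArg pl (m5 a₂ b (evA α a₁))
  simp only [map_add, map_sub, map_neg, map_zero] at f1 f2 ⊢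
  linear_combination f2 - f1

/-- The source of `m8`. The second derivatives cancel by themselves in this case. -/
theorem bialgebroidDefect_s_s_s_i (h : DualRelations T L p pl el evA evB sX iX sY iY)
    (h' : DualRelations S L' (-p.flip) pl el evB evA sY iY sX iX)
    (b₁ b₂ : W) (a : U) (β : ι') :
    bialgebroidDefect L L' p hp (sX b₁) (sX b₂) (sY a) (iY β) =
      pl (evB β (- S.nabla₁.nabla a (LB.bracket b₁ b₂) + LB.bracket (S.nabla₁.nabla a b₁) b₂
        + LB.bracket b₁ (S.nabla₁.nabla a b₂)
        + S.nabla₁.nabla (T.nabla₁.nabla b₂ a) b₁ - S.nabla₁.nabla (T.nabla₁.nabla b₁ a) b₂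
        - S.bd (T.curv b₁ b₂ a))) := by
  have l := fun b a => h.lie_s_s (isLieDerivative_lieDerivative hp (sX b) (sY a))
  have l' := fun a b => h'.lie_s_s_flip (isLieDerivative_lieDerivative hp.flip (sY a) (sX b))
  have k := fun b => h.lie_s_i (isLieDerivative_lieDerivative hp (sX b) (iY β))
  have k' := fun b => h'.lie_i_s_flip (isLieDerivative_lieDerivative hp.flip (iY β) (sX b))
  obtain ⟨β', e, e'⟩ := h'.bracket_s_i a β
  have e1 : dualDifferential L' p (L.bracket (sX b₁) (sX b₂)) (sY a) (iY β) =
      -pl (LA.anchor a (evB β (LB.bracket b₁ b₂))) - pl (evB β (S.bd (T.curv b₁ b₂ a)))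
      + pl (evB β' (LB.bracket b₁ b₂)) := by
    rw [dualDifferential, h.pair_bracket_s, h.pair_bracket_i, map_neg, map_neg, h'.anchor_s_pull,
      h'.anchor_i_ell, e, h.pair_bracket_i]
    ring
  have z2 : ∀ b' a, p (sX 0) (lieDerivative L p hp (sX b') (sY a)) = 0 := by
    intro b' a
    rw [(l b' a).2, map_zero, LinearMap.zero_apply, map_zero]
  have z3 : ∀ b, p (lieDerivative L' p.flip hp.flip (sY a) (sX b)) (sY 0) = 0 := by
    intro b
    rw [(l' a b).2, map_zero, LinearMap.zero_apply, map_zero, neg_zero]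
  rw [bialgebroidDefect_eq, e1,
    h.dualDifferential_mixed hp (k' b₁).1 (l b₂ a).1,
    h.dualDifferential_mixed hp (l' a b₁).1 (k b₂).1,
    h.dualDifferential_mixed hp (k' b₂).1 (l b₁ a).1,
    h.dualDifferential_mixed hp (l' a b₂).1 (k b₁).1,
    h.pair_s_i, h.pair_s_i, h.pair_s_s, h.pair_s_s, d_s_s_i h h', d_s_s_i h h', z2, z2, z3, z3,
    map_neg, map_neg, map_neg, map_neg, h.anchor_s_pull, h.anchor_s_pull,
    (k _).2, (k _).2, (k' _).2, (k' _).2,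
    h'.anchor_pull_flip (l b₂ a).1, h'.anchor_pull_flip (l b₁ a).1, e',
    LB.bracket_skew (S.nabla₁.nabla a b₁) b₂]
  simp only [map_add, map_sub, map_neg, map_zero]
  ring

end DualRelations

end DualModel

/-! ### The remaining values, and the equivalence with matched pairs. -/

section DualModel

variable {R K U V W X Y ι ι' : Type*} [CommRing R] [Algebra ℝ R] [CommRing K] [Algebra ℝ K]
  [AddCommGroup U] [Module R U] [AddCommGroup V] [Module R V] [AddCommGroup W] [Module R W]
  [AddCommGroup X] [Module K X] [AddCommGroup Y] [Module K Y]
  {LA : LieAlgebroid R U} {LB : LieAlgebroid R W}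

namespace DualRelations

variable {T : TwoRep LB V U} {S : TwoRep LA V W} {L : LieAlgebroid K X} {L' : LieAlgebroid K Y}
  {p : X →ₗ[K] Y →ₗ[K] K} {pl : R →ₐ[ℝ] K} {el : V →+ K} {evA : ι → U →ₗ[R] R}
  {evB : ι' → W →ₗ[R] R} {sX : W → X} {iX : ι → X} {sY : U → Y} {iY : ι' → Y}
  (hp : p.IsPerfPair)

/-- When `w` has no component along `A` and the Lie derivative of `x` has none along `B`, both
pairings in `dualDifferential_mixed` vanish. The anchor of such a `w` annihilates pulled-back
functions. This disposes of most generator values that carry no condition. -/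
theorem dualDifferential_vertical (h : DualRelations T L p pl el evA evB sX iX sY iY)
    (h' : DualRelations S L' (-p.flip) pl el evB evA sY iY sX iX) {x : X} {y w : Y} {f : R}
    (hf : p x y = pl f)
    (hx : ∀ β, p (lieDerivative L' p.flip hp.flip y x) (iY β) = -pl (evB β 0))
    (hw : ∀ α, p (iX α) w = pl (evA α 0)) : dualDifferential L' p x w y = 0 := by
  have e : p (lieDerivative L' p.flip hp.flip y x) (sY 0) = 0 :=
    neg_eq_zero.1 (h'.pair_s_zero (fun β => neg_eq_iff_eq_neg.2 (hx β)))
  rw [h.dualDifferential_mixed hp hx hw, h.pair_s_zero hw, e, hf, h'.anchor_pull_flip hw]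
  simp

theorem dualDifferential_zero (y₁ y₂ : Y) : dualDifferential L' p 0 y₁ y₂ = 0 := by
  simp [dualDifferential]

theorem bialgebroidDefect_i_i_s_s (h : DualRelations T L p pl el evA evB sX iX sY iY)
    (h' : DualRelations S L' (-p.flip) pl el evB evA sY iY sX iX) (α α' : ι) (a₁ a₂ : U) :
    bialgebroidDefect L L' p hp (iX α) (iX α') (sY a₁) (sY a₂) = 0 := by
  have k := fun α a => (h.lie_i_s (isLieDerivative_lieDerivative hp (iX α) (sY a))).1
  have k' := fun a α =>
    (h'.lie_s_i_flip (isLieDerivative_lieDerivative hp.flip (sY a) (iX α))).1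
  rw [bialgebroidDefect_eq, h.bracket_i_i, dualDifferential_zero,
    h.dualDifferential_vertical hp h' (h.pair_i_s _ _) (k' _ _) (k _ _),
    h.dualDifferential_vertical hp h' (h.pair_i_s _ _) (k' _ _) (k _ _),
    h.dualDifferential_vertical hp h' (h.pair_i_s _ _) (k' _ _) (k _ _),
    h.dualDifferential_vertical hp h' (h.pair_i_s _ _) (k' _ _) (k _ _),
    d_i_s_s h h', d_i_s_s h h', h.anchor_i_pull, h.anchor_i_pull]
  simp

/-- Two of the four Lie derivative terms, `e2` and `e3`, do not fall under
`dualDifferential_vertical`, because a Lie derivative of a horizontal generator or the differential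
of one is involved. -/
theorem bialgebroidDefect_i_s_s_i (h : DualRelations T L p pl el evA evB sX iX sY iY)
    (h' : DualRelations S L' (-p.flip) pl el evB evA sY iY sX iX) (α : ι) (b : W) (a : U)
    (β : ι') :
    bialgebroidDefect L L' p hp (iX α) (sX b) (sY a) (iY β) = 0 := by
  obtain ⟨α', e, -⟩ := h.bracket_s_i b α
  have e1 : dualDifferential L' p (L.bracket (iX α) (sX b)) (sY a) (iY β) = 0 := by
    rw [L.bracket_skew (sX b), e, ← neg_one_smul K, dualDifferential_smul, d_i_s_i h h']
    simp
  have z := h'.lie_i_i_flip (isLieDerivative_lieDerivative hp.flip (iY β) (iX α))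
  have w := h.lie_i_i (isLieDerivative_lieDerivative hp (iX α) (iY β))
  have e2 : dualDifferential L' p (iX α) (lieDerivative L p hp (sX b) (sY a)) (iY β) = 0 := by
    have w' := h.lie_s_s (isLieDerivative_lieDerivative hp (sX b) (sY a))
    rw [h.dualDifferential_mixed hp z.1 w'.1, h.pair_i_i, z.2, w'.2]
    simp
  have e3 : dualDifferential L' p (sX b) (lieDerivative L p hp (iX α) (iY β)) (sY a) = 0 := by
    have z' := h'.lie_s_s_flip (isLieDerivative_lieDerivative hp.flip (sY a) (sX b))
    rw [h.dualDifferential_mixed hp z'.1 w.1, h.pair_s_s, z'.2, w.2]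
    simp
  rw [bialgebroidDefect_eq, e1, e2, e3,
    h.dualDifferential_vertical hp h' (h.pair_i_s _ _)
      (h'.lie_s_i_flip (isLieDerivative_lieDerivative hp.flip (sY a) (iX α))).1
      (h.lie_s_i (isLieDerivative_lieDerivative hp (sX b) (iY β))).1,
    h.dualDifferential_vertical hp h' ((h.pair_s_i _ _).trans (map_neg _ _).symm)
      (h'.lie_i_s_flip (isLieDerivative_lieDerivative hp.flip (iY β) (sX b))).1
      (h.lie_i_s (isLieDerivative_lieDerivative hp (iX α) (sY a))).1,
    d_i_s_i h h', d_s_s_i h h', map_neg, h.anchor_i_pull]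
  simp

theorem bialgebroidDefect_i_i_s_i (h : DualRelations T L p pl el evA evB sX iX sY iY)
    (h' : DualRelations S L' (-p.flip) pl el evB evA sY iY sX iX) (α α' : ι) (a : U) (β : ι') :
    bialgebroidDefect L L' p hp (iX α) (iX α') (sY a) (iY β) = 0 := by
  have hi : ∀ α, p (iX α) (iY β) = pl 0 := fun α => by rw [h.pair_i_i, map_zero]
  have k := fun α a => (h.lie_i_s (isLieDerivative_lieDerivative hp (iX α) (sY a))).1
  have k' := fun a α =>
    (h'.lie_s_i_flip (isLieDerivative_lieDerivative hp.flip (sY a) (iX α))).1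
  have l := fun α β => (h.lie_i_i (isLieDerivative_lieDerivative hp (iX α) (iY β))).1
  have l' := fun β α =>
    (h'.lie_i_i_flip (isLieDerivative_lieDerivative hp.flip (iY β) (iX α))).1
  rw [bialgebroidDefect_eq, h.bracket_i_i, dualDifferential_zero,
    h.dualDifferential_vertical hp h' (hi _) (l' _ _) (k _ _),
    h.dualDifferential_vertical hp h' (h.pair_i_s _ _) (k' _ _) (l _ _),
    h.dualDifferential_vertical hp h' (hi _) (l' _ _) (k _ _),
    h.dualDifferential_vertical hp h' (h.pair_i_s _ _) (k' _ _) (l _ _),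
    d_i_s_i h h', d_i_s_i h h']
  simp

theorem bialgebroidDefect_s_s_i_i (h : DualRelations T L p pl el evA evB sX iX sY iY)
    (h' : DualRelations S L' (-p.flip) pl el evB evA sY iY sX iX) (b₁ b₂ : W) (β β' : ι') :
    bialgebroidDefect L L' p hp (sX b₁) (sX b₂) (iY β) (iY β') = 0 := by
  have hi : ∀ b β, p (sX b) (iY β) = pl (-evB β b) := fun b β => by rw [h.pair_s_i, map_neg]
  have k := fun b β => (h.lie_s_i (isLieDerivative_lieDerivative hp (sX b) (iY β))).1
  have k' := fun β b =>
    (h'.lie_i_s_flip (isLieDerivative_lieDerivative hp.flip (iY β) (sX b))).1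
  rw [bialgebroidDefect_eq,
    h.dualDifferential_vertical hp h' (hi _ _) (k' _ _) (k _ _),
    h.dualDifferential_vertical hp h' (hi _ _) (k' _ _) (k _ _),
    h.dualDifferential_vertical hp h' (hi _ _) (k' _ _) (k _ _),
    h.dualDifferential_vertical hp h' (hi _ _) (k' _ _) (k _ _),
    d_s_i_i h h', d_s_i_i h h', dualDifferential, h.pair_bracket_i, h.pair_bracket_i,
    h'.bracket_i_i, map_neg, map_neg, h'.anchor_i_pull, h'.anchor_i_pull]
  simp

theorem bialgebroidDefect_i_s_i_i (h : DualRelations T L p pl el evA evB sX iX sY iY)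
    (h' : DualRelations S L' (-p.flip) pl el evB evA sY iY sX iX) (α : ι) (b : W) (β β' : ι') :
    bialgebroidDefect L L' p hp (iX α) (sX b) (iY β) (iY β') = 0 := by
  have hi : ∀ b β, p (sX b) (iY β) = pl (-evB β b) := fun b β => by rw [h.pair_s_i, map_neg]
  have hi' : ∀ α β, p (iX α) (iY β) = pl 0 := fun α β => by rw [h.pair_i_i, map_zero]
  have k := fun b β => (h.lie_s_i (isLieDerivative_lieDerivative hp (sX b) (iY β))).1
  have k' := fun β b =>
    (h'.lie_i_s_flip (isLieDerivative_lieDerivative hp.flip (iY β) (sX b))).1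
  have l := fun α β => (h.lie_i_i (isLieDerivative_lieDerivative hp (iX α) (iY β))).1
  have l' := fun β α =>
    (h'.lie_i_i_flip (isLieDerivative_lieDerivative hp.flip (iY β) (iX α))).1
  obtain ⟨α', e, -⟩ := h.bracket_s_i b α
  have e1 : dualDifferential L' p (L.bracket (iX α) (sX b)) (iY β) (iY β') = 0 := by
    rw [L.bracket_skew (sX b), e, ← neg_one_smul K, dualDifferential_smul, d_i_i_i h h']
    simp
  rw [bialgebroidDefect_eq, e1,
    h.dualDifferential_vertical hp h' (hi' _ _) (l' _ _) (k _ _),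
    h.dualDifferential_vertical hp h' (hi' _ _) (l' _ _) (k _ _),
    h.dualDifferential_vertical hp h' (hi _ _) (k' _ _) (l _ _),
    h.dualDifferential_vertical hp h' (hi _ _) (k' _ _) (l _ _),
    d_s_i_i h h', d_i_i_i h h']
  simp

theorem bialgebroidDefect_i_i_i_i (h : DualRelations T L p pl el evA evB sX iX sY iY)
    (h' : DualRelations S L' (-p.flip) pl el evB evA sY iY sX iX) (α α' : ι) (β β' : ι') :
    bialgebroidDefect L L' p hp (iX α) (iX α') (iY β) (iY β') = 0 := by
  have hi' : ∀ α β, p (iX α) (iY β) = pl 0 := fun α β => by rw [h.pair_i_i, map_zero]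
  have l := fun α β => (h.lie_i_i (isLieDerivative_lieDerivative hp (iX α) (iY β))).1
  have l' := fun β α =>
    (h'.lie_i_i_flip (isLieDerivative_lieDerivative hp.flip (iY β) (iX α))).1
  rw [bialgebroidDefect_eq, h.bracket_i_i, dualDifferential_zero,
    h.dualDifferential_vertical hp h' (hi' _ _) (l' _ _) (l _ _),
    h.dualDifferential_vertical hp h' (hi' _ _) (l' _ _) (l _ _),
    h.dualDifferential_vertical hp h' (hi' _ _) (l' _ _) (l _ _),
    h.dualDifferential_vertical hp h' (hi' _ _) (l' _ _) (l _ _),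
    d_i_i_i h h', d_i_i_i h h']
  simp

/-- A matched pair of 2-representations gives a Lie bialgebroid. -/
theorem isLieBialgebroid_of_isMatchedPair (h : DualRelations T L p pl el evA evB sX iX sY iY)
    (h' : DualRelations S L' (-p.flip) pl el evB evA sY iY sX iX) (hp : p.IsPerfPair)
    (hK : ∀ D : Derivation ℝ K K, (∀ f, D (pl f) = 0) → (∀ c, D (el c) = 0) → D = 0)
    (hm : IsMatchedPair S T) : IsLieBialgebroid L L' p := by
  refine (isLieBialgebroid_iff L L' p).2 ⟨hp, bialgebroidDefect_eq_zero L L' p hp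
    (𝒢 := Set.range iX ∪ Set.range sX) (𝒢' := Set.range iY ∪ Set.range sY)
    (𝒦 := Set.range pl ∪ Set.range el) ?_ ?_ ?_ ?_ ?_ ?_⟩
  · exact fun φ hφ => h.eq_zero φ (fun α => hφ _ (Or.inl ⟨α, rfl⟩)) fun b => hφ _ (Or.inr ⟨b, rfl⟩)
  · exact fun φ hφ => h'.eq_zero φ (fun α => hφ _ (Or.inl ⟨α, rfl⟩)) fun b =>
      hφ _ (Or.inr ⟨b, rfl⟩)
  · exact fun D hD => hK D (fun f => hD _ (Or.inl ⟨f, rfl⟩)) fun c => hD _ (Or.inr ⟨c, rfl⟩)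
  · have key : ∀ c f, functionDefect L L' p hp (el c) (pl f) = 0 := by
      intro c f
      rw [h.functionDefect_ell_pull hp h', hm.m1, sub_self, map_zero]
    rintro _ (⟨f, rfl⟩ | ⟨c, rfl⟩) _ (⟨g, rfl⟩ | ⟨c', rfl⟩)
    · exact h.functionDefect_pull_pull hp h' f g
    · exact (functionDefect_comm L L' p hp _ _).trans (key c' f)
    · exact key c g
    · rw [h.functionDefect_ell_ell hp h', hm.m2]
      refine neg_eq_zero.2 ((congrArg el ?_).trans (map_zero el))
      abel
  · rintro _ (⟨α, rfl⟩ | ⟨b, rfl⟩) _ (⟨β, rfl⟩ | ⟨a, rfl⟩) _ (⟨f, rfl⟩ | ⟨c, rfl⟩)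
    · exact h.mixedDefect_i_i_pull hp h' α β f
    · exact h.mixedDefect_i_i_ell hp h' α β c
    · exact h.mixedDefect_i_s_pull hp h' α a f
    · rw [h.mixedDefect_i_s_ell hp h', hm.m3, hm.m1, sub_self, sub_self, map_zero, add_zero,
        map_zero]
    · exact h.mixedDefect_s_i_pull hp h' b β f
    · rw [h.mixedDefect_s_i_ell hp h', hm.m4, sub_sub_cancel_left, neg_add_cancel, map_zero,
        map_zero]
    · have := hm.m5 a b f
      rw [h.mixedDefect_s_s_pull hp h', this, sub_add_cancel, sub_self, map_zero]
    · rw [h.mixedDefect_s_s_ell hp h']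
      refine (congrArg el ?_).trans (map_zero el)
      have := hm.m6 a b c
      rw [add_sub_assoc, ← this]
      abel
  -- Skew-symmetry in each pair of arguments reduces the sixteen types of generators to nine.
  · have sw := bialgebroidDefect_swap L L' p hp
    have swr := bialgebroidDefect_swap_right L L' p hp
    have m7 : ∀ α b a₁ a₂, bialgebroidDefect L L' p hp (iX α) (sX b) (sY a₁) (sY a₂) = 0 := by
      intro α b a₁ a₂
      rw [h.bialgebroidDefect_i_s_s_s hp h' hm.m5, hm.m7, sub_self, map_zero, map_zero]
    have m8 : ∀ b₁ b₂ a β, bialgebroidDefect L L' p hp (sX b₁) (sX b₂) (sY a) (iY β) = 0 := by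
      intro b₁ b₂ a β
      rw [h.bialgebroidDefect_s_s_s_i hp h', hm.m8, sub_self, map_zero, map_zero]
    rintro _ (⟨α, rfl⟩ | ⟨b, rfl⟩) _ (⟨α', rfl⟩ | ⟨b', rfl⟩) _ (⟨β, rfl⟩ | ⟨a, rfl⟩) _
      (⟨β', rfl⟩ | ⟨a', rfl⟩)
    · exact h.bialgebroidDefect_i_i_i_i hp h' α α' β β'
    · rw [swr, h.bialgebroidDefect_i_i_s_i hp h', neg_zero]
    · exact h.bialgebroidDefect_i_i_s_i hp h' α α' a β'
    · exact h.bialgebroidDefect_i_i_s_s hp h' α α' a a'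
    · exact h.bialgebroidDefect_i_s_i_i hp h' α b' β β'
    · rw [swr, h.bialgebroidDefect_i_s_s_i hp h', neg_zero]
    · exact h.bialgebroidDefect_i_s_s_i hp h' α b' a β'
    · exact m7 _ _ _ _
    · rw [sw, h.bialgebroidDefect_i_s_i_i hp h', neg_zero]
    · rw [sw, swr, h.bialgebroidDefect_i_s_s_i hp h', neg_zero, neg_zero]
    · rw [sw, h.bialgebroidDefect_i_s_s_i hp h', neg_zero]
    · rw [sw, m7, neg_zero]
    · exact h.bialgebroidDefect_s_s_i_i hp h' b b' β β'
    · rw [swr, m8, neg_zero]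
    · exact m8 _ _ _ _
    · rw [h.bialgebroidDefect_s_s_s_s hp h', hm.m9, sub_self, map_zero]

/-- The conditions of a matched pair follow from those of a Lie bialgebroid. -/
theorem isMatchedPair_of_isLieBialgebroid (h : DualRelations T L p pl el evA evB sX iX sY iY)
    (h' : DualRelations S L' (-p.flip) pl el evB evA sY iY sX iX)
    (hpl : Function.Injective pl) (hel : Function.Injective el)
    (hA : ∀ a, (∀ α, evA α a = 0) → a = 0) (hB : ∀ b, (∀ β, evB β b = 0) → b = 0)
    (hrank₁ : ∀ k : K, (∀ x y, p x y * k = 0) → k = 0)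
    (hrank₂ : ∀ t : Y →ₗ[K] K, (∀ x y₁ y₂, t y₁ * p x y₂ = t y₂ * p x y₁) → t = 0)
    (hL : IsLieBialgebroid L L' p) : IsMatchedPair S T := by
  obtain ⟨hp, hb⟩ := (isLieBialgebroid_iff L L' p).1 hL
  -- The ladder is descended: vanishing of the full defect gives that of the mixed one, hence of the
  -- one on functions, and all three may then be evaluated on generators.
  have hm := mixedDefect_eq_zero L L' p hp hb hrank₂
  have hf := functionDefect_eq_zero L L' p hp hm hrank₁
  have pl0 : ∀ f, pl f = 0 → f = 0 := fun f hf => hpl (hf.trans (map_zero pl).symm)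
  have el0 : ∀ f, el f = 0 → f = 0 := fun f hf => hel (hf.trans (map_zero el).symm)
  -- `m1` and `m5` come first because they remove the additional terms in the values that give `m3`
  -- and `m7`.
  have m1 : ∀ c f, LA.anchor (T.bd c) f = LB.anchor (S.bd c) f := by
    intro c f
    have := hf (el c) (pl f)
    rw [h.functionDefect_ell_pull hp h'] at this
    exact (sub_eq_zero.1 (pl0 _ this)).symm
  have m5 : ∀ a b (f : R), LA.anchor a (LB.anchor b f) - LB.anchor b (LA.anchor a f)
      = LB.anchor (S.nabla₁.nabla a b) f - LA.anchor (T.nabla₁.nabla b a) f := by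
    intro a b f
    have := hm (sX b) (sY a) (pl f)
    rw [h.mixedDefect_s_s_pull hp h'] at this
    have := pl0 _ this
    linear_combination this
  exact
  { m1 := fun c => Derivation.ext (m1 c)
    m2 := fun c₁ c₂ => by
      have := hf (el c₁) (el c₂)
      rw [h.functionDefect_ell_ell hp h'] at this
      have := el0 _ (neg_eq_zero.1 this)
      rw [← sub_eq_zero, ← this]
      abel
    m3 := fun a c => by
      refine (sub_eq_zero.1 (hA _ fun α => ?_)).symm
      have := hm (iX α) (sY a) (el c)
      rw [h.mixedDefect_i_s_ell hp h', m1, sub_self, add_zero] at this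
      exact pl0 _ this
    m4 := fun b c => by
      refine sub_eq_zero.1 (hB _ fun β => ?_)
      have := hm (sX b) (iY β) (el c)
      rw [h.mixedDefect_s_i_ell hp h'] at this
      rw [← pl0 _ this]
      congr 1
      abel
    m5 := m5
    m6 := fun a b c => by
      have := hm (sX b) (sY a) (el c)
      rw [h.mixedDefect_s_s_ell hp h'] at this
      have := el0 _ this
      rw [← sub_eq_zero, ← neg_eq_zero, ← this]
      abel
    m7 := fun a₁ a₂ b => by
      refine (sub_eq_zero.1 (hA _ fun α => ?_)).symm
      have := hb (iX α) (sX b) (sY a₁) (sY a₂)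
      rw [h.bialgebroidDefect_i_s_s_s hp h' m5] at this
      exact pl0 _ this
    m8 := fun b₁ b₂ a => by
      refine (sub_eq_zero.1 (hB _ fun β => ?_)).symm
      have := hb (sX b₁) (sX b₂) (sY a) (iY β)
      rw [h.bialgebroidDefect_s_s_s_i hp h'] at this
      exact pl0 _ this
    m9 := fun a₁ a₂ b₁ b₂ => by
      have := hb (sX b₁) (sX b₂) (sY a₁) (sY a₂)
      rw [h.bialgebroidDefect_s_s_s_s hp h'] at this
      exact (sub_eq_zero.1 (el0 _ this)).symm }

end DualRelations

end DualModel

theorem PoissonBracket.skew {K : Type*} [CommRing K] [Algebra ℝ K] (P : PoissonBracket K)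
    (f g : K) : P.bracket f g = -P.bracket g f := by
  have := P.bracket_self (f + g)
  simp only [map_add, LinearMap.add_apply, P.bracket_self, zero_add, add_zero] at this
  rw [add_comm] at this
  exact eq_neg_of_add_eq_zero_left this

theorem PoissonBracket.bracket_bracket {K : Type*} [CommRing K] [Algebra ℝ K]
    (P : PoissonBracket K) (f g h : K) :
    P.bracket (P.bracket f g) h
      = P.bracket f (P.bracket g h) - P.bracket g (P.bracket f h) := by
  have j := P.jacobi f g h
  rw [P.skew h f, map_neg, P.skew h] at j
  rw [← sub_eq_zero, ← neg_eq_zero, ← j]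
  abel

/-- The case where `A` and `B` have rank 0. The core may be non-zero, but each term with values in
`Γ(C)` contains an argument from `Γ(A)` or `Γ(B)`. -/
theorem IsMatchedPair.of_subsingleton {R X Y V : Type*} [CommRing R] [Algebra ℝ R]
    [AddCommGroup X] [Module R X] [AddCommGroup Y] [Module R Y] [AddCommGroup V] [Module R V]
    [Subsingleton X] [Subsingleton Y] {LA : LieAlgebroid R X} {LB : LieAlgebroid R Y}
    (S : TwoRep LA V Y) (T : TwoRep LB V X) : IsMatchedPair S T := by
  have hX : ∀ x : X, x = 0 := fun x => Subsingleton.elim x 0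
  have hY : ∀ y : Y, y = 0 := fun y => Subsingleton.elim y 0
  refine ⟨fun c => ?_, fun c c' => ?_, fun _ _ => Subsingleton.elim _ _,
    fun _ _ => Subsingleton.elim _ _, fun a b f => ?_, fun a b c => ?_,
    fun _ _ _ => Subsingleton.elim _ _, fun _ _ _ => Subsingleton.elim _ _, fun a a' b b' => ?_⟩
  · rw [hX (T.bd c), hY (S.bd c), map_zero, map_zero]
  · simp only [hX (T.bd _), hY (S.bd _), Connection.nabla_zero_left, sub_zero, neg_zero, zero_add]
  · rw [hX a, hY b, hX (T.nabla₁.nabla 0 0), hY (S.nabla₁.nabla 0 0)]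
    simp only [map_zero, Derivation.zero_apply, Derivation.coe_zero, Pi.zero_apply, sub_zero]
  · rw [hX a, hY b, hX (T.nabla₁.nabla 0 0), hY (S.nabla₁.nabla 0 0)]
    simp only [map_zero, LinearMap.zero_apply, Connection.nabla_zero_left, sub_zero, add_zero]
  · rw [hX a, hX a', hY b, hY b', hX (LA.bracket _ _), hY (LB.bracket _ _)]
    simp only [map_zero, LinearMap.zero_apply, Connection.nabla_zero_left, sub_zero]

/-! ### Decomposition of a double vector bundle and of its dual by a linear splitting. -/

section DoubleVectorBundle

open Filter Topology

variable {E H M : Type*} [NormedAddCommGroup E] [NormedSpace ℝ E] [FiniteDimensional ℝ E]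
  [TopologicalSpace H] {I : ModelWithCorners ℝ E H} [I.Boundaryless]
  [TopologicalSpace M] [ChartedSpace H M] [IsManifold I ∞ M] [T2Space M]
  {FA : Type*} [NormedAddCommGroup FA] [NormedSpace ℝ FA] [FiniteDimensional ℝ FA]
  {FB : Type*} [NormedAddCommGroup FB] [NormedSpace ℝ FB] [FiniteDimensional ℝ FB]
  {FC : Type*} [NormedAddCommGroup FC] [NormedSpace ℝ FC] [FiniteDimensional ℝ FC]
  {GA : Type*} [NormedAddCommGroup GA] [NormedSpace ℝ GA] [FiniteDimensional ℝ GA]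
  {GB : Type*} [NormedAddCommGroup GB] [NormedSpace ℝ GB] [FiniteDimensional ℝ GB]
  {A : M → Type*} [TopologicalSpace (TotalSpace FA A)] [∀ m, TopologicalSpace (A m)]
  [∀ m, AddCommGroup (A m)] [∀ m, Module ℝ (A m)] [FiberBundle FA A] [VectorBundle ℝ FA A]
  [ContMDiffVectorBundle ∞ FA A I]
  {B : M → Type*} [TopologicalSpace (TotalSpace FB B)] [∀ m, TopologicalSpace (B m)]
  [∀ m, AddCommGroup (B m)] [∀ m, Module ℝ (B m)] [FiberBundle FB B] [VectorBundle ℝ FB B]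
  [ContMDiffVectorBundle ∞ FB B I]
  {C : M → Type*} [TopologicalSpace (TotalSpace FC C)] [∀ m, TopologicalSpace (C m)]
  [∀ m, AddCommGroup (C m)] [∀ m, Module ℝ (C m)] [FiberBundle FC C] [VectorBundle ℝ FC C]
  [ContMDiffVectorBundle ∞ FC C I]
  {D : ∀ m, A m → B m → Type*}
  [TopologicalSpace (TotalSpace GA (Over FA D))] [∀ p, TopologicalSpace (Over FA D p)]
  [∀ p, AddCommGroup (Over FA D p)] [∀ p, Module ℝ (Over FA D p)]
  [FiberBundle GA (Over FA D)] [VectorBundle ℝ GA (Over FA D)]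
  [ContMDiffVectorBundle ∞ GA (Over FA D) (I.prod 𝓘(ℝ, FA))]
  [TopologicalSpace (TotalSpace GB (Over FB (flipD D)))]
  [∀ p, TopologicalSpace (Over FB (flipD D) p)]
  [∀ p, AddCommGroup (Over FB (flipD D) p)] [∀ p, Module ℝ (Over FB (flipD D) p)]
  [FiberBundle GB (Over FB (flipD D))] [VectorBundle ℝ GB (Over FB (flipD D))]
  [ContMDiffVectorBundle ∞ GB (Over FB (flipD D)) (I.prod 𝓘(ℝ, FB))]

namespace DoubleVectorBundle

variable (𝔻 : DoubleVectorBundle I FA FB FC GA GB C D) (S : LinearSplitting I FA FB GA D)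

theorem corePt_injective (m : M) : Function.Injective (𝔻.corePt m) := by
  intro c c' h
  refine (𝔻.core_bijective m).1 ?_
  injection h

theorem exists_corePt_eq {m : M} (y : Over FA D ⟨m, 0⟩) (h : y.base = 0) :
    ∃ c, 𝔻.corePt m c = y := by
  obtain ⟨b, d⟩ := y
  change b = 0 at h
  subst h
  obtain ⟨c, hc⟩ := (𝔻.core_bijective m).2 d
  exact ⟨c, by rw [← hc]; rfl⟩

theorem coreAt_injective (p : TotalSpace FA A) : Function.Injective (𝔻.coreAt p) := by
  intro c c' h
  have h1 := 𝔻.same_coreAt p c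
  rw [h] at h1
  exact 𝔻.flip.corePt_injective _ (add_left_cancel (h1.eq_right (𝔻.same_coreAt p c')))

/-- A point over `a` that projects to zero in `B` can be seen in the fibre of `D → B` over zero.
Subtracting `0̃_a` there makes its projection to `A` vanish too, so the difference is a core point.
-/
theorem exists_coreAt_eq {p : TotalSpace FA A} (x : Over FA D p) (h : x.base = 0) :
    ∃ c, 𝔻.coreAt p c = x := by
  obtain ⟨X, hX, hb⟩ := Same.exists_right x h
  have h1 : (X - 𝔻.zeroPt p).base = 0 := by
    have := 𝔻.sideB.base_add _ (X - 𝔻.zeroPt p) (𝔻.zeroPt p)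
    rw [sub_add_cancel, hb, 𝔻.zeroPt_base] at this
    exact right_eq_add.1 this
  obtain ⟨c, hc⟩ := 𝔻.flip.exists_corePt_eq _ h1
  have h2 := 𝔻.same_coreAt p c
  have h3 : 𝔻.zeroPt p + 𝔻.flip.corePt p.proj c = X :=
    (congrArg (𝔻.zeroPt p + ·) hc).trans (add_sub_cancel _ _)
  rw [h3] at h2
  exact ⟨c, h2.eq_left hX⟩

theorem coreAt_base (p : TotalSpace FA A) (c : C p.proj) : (𝔻.coreAt p c).base = 0 := by
  have h := 𝔻.same_coreAt p c
  -- The two points must be variables before the relation `Same`, whose indices are dependent, can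
  -- be inverted.
  generalize 𝔻.zeroPt p + 𝔻.flip.corePt p.proj c = X at h
  generalize 𝔻.coreAt p c = x at h
  revert h
  obtain ⟨m, a⟩ := p
  intro h
  cases h
  rfl

/-- The projection of the fibres of `D → A` to `B`. -/
def baseL (𝔻 : DoubleVectorBundle I FA FB FC GA GB C D) (p : TotalSpace FA A) :
    Over FA D p →ₗ[ℝ] B p.proj where
  toFun := Over.base
  map_add' := 𝔻.sideA.base_add p
  map_smul' := 𝔻.sideA.base_smul p

end DoubleVectorBundle

/-- The restriction of a linear splitting to `{a} × B_m`. -/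
def LinearSplitting.atL (S : LinearSplitting I FA FB GA D) (p : TotalSpace FA A) :
    B p.proj →ₗ[ℝ] Over FA D p :=
  (S.linearA p.proj p.snd).mk'

theorem LinearSplitting.same_atL (S : LinearSplitting I FA FB GA D)
    (𝔻 : DoubleVectorBundle I FA FB FC GA GB C D) {m : M} (a : A m) (b : B m) :
    Same (S.atL ⟨m, a⟩ b) ((S.flip 𝔻).atL ⟨m, b⟩ a) :=
  Same.mk _ _ _ _

@[simp] theorem LinearSplitting.atL_base (S : LinearSplitting I FA FB GA D) (p : TotalSpace FA A)
    (b : B p.proj) : (S.atL p b).base = b := rfl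

theorem LinearSplitting.lift_apply (S : LinearSplitting I FA FB GA D) (b : Sec I FB B)
    (p : TotalSpace FA A) : S.lift b p = S.atL p (b p.proj) := rfl

namespace DoubleVectorBundle

variable (𝔻 : DoubleVectorBundle I FA FB FC GA GB C D) (S : LinearSplitting I FA FB GA D)

/-- The sequence `0 → C_m → D_a → B_m → 0` is exact, and the linear splitting provides a section of
it. -/
theorem bijective_split (p : TotalSpace FA A) :
    Function.Bijective ((S.atL p).coprod (𝔻.coreAtL p)) := by
  constructor
  · intro x y h
    obtain ⟨b, c⟩ := x
    obtain ⟨b', c'⟩ := y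
    have hb := congrArg (𝔻.baseL p) h
    simp only [LinearMap.coprod_apply, map_add] at hb
    have h0 : ∀ c, 𝔻.baseL p (𝔻.coreAtL p c) = 0 := 𝔻.coreAt_base p
    have h1 : ∀ b, 𝔻.baseL p (S.atL p b) = b := fun b => rfl
    rw [h0, h0, h1, h1, add_zero, add_zero] at hb
    subst hb
    have h2 : 𝔻.coreAt p c = 𝔻.coreAt p c' := add_left_cancel h
    rw [𝔻.coreAt_injective p h2]
  · intro x
    have h : (x - S.atL p x.base).base = 0 := by
      change 𝔻.baseL p (x - S.atL p x.base) = 0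
      rw [map_sub]
      exact sub_self _
    obtain ⟨c, hc⟩ := 𝔻.exists_coreAt_eq _ h
    refine ⟨(x.base, c), ?_⟩
    change S.atL p x.base + 𝔻.coreAt p c = x
    rw [hc, add_sub_cancel]

/-- The isomorphism of `B_m × C_m` with the fibre of `D → A` over `a ∈ A_m` given by a linear
splitting. -/
def splitL (p : TotalSpace FA A) : (B p.proj × C p.proj) ≃ₗ[ℝ] Over FA D p :=
  LinearEquiv.ofBijective _ (𝔻.bijective_split S p)

theorem splitL_apply (p : TotalSpace FA A) (x : B p.proj × C p.proj) :
    𝔻.splitL S p x = S.atL p x.1 + 𝔻.coreAt p x.2 := rfl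

/-- The core component of a point of `D`, with respect to a linear splitting. -/
def corePart (p : TotalSpace FA A) : Over FA D p →ₗ[ℝ] C p.proj :=
  LinearMap.snd ℝ _ _ ∘ₗ ((𝔻.splitL S p).symm : Over FA D p →ₗ[ℝ] B p.proj × C p.proj)

theorem corePart_splitL (p : TotalSpace FA A) (b : B p.proj) (c : C p.proj) :
    𝔻.corePart S p (S.atL p b + 𝔻.coreAt p c) = c := by
  change ((𝔻.splitL S p).symm (𝔻.splitL S p (b, c))).2 = c
  rw [LinearEquiv.symm_apply_apply]

@[simp] theorem corePart_atL (p : TotalSpace FA A) (b : B p.proj) :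
    𝔻.corePart S p (S.atL p b) = 0 := by
  have := 𝔻.corePart_splitL S p b 0
  rwa [map_add, show 𝔻.coreAt p 0 = 0 from map_zero (𝔻.coreAtL p), map_zero, add_zero] at this

@[simp] theorem corePart_coreAt (p : TotalSpace FA A) (c : C p.proj) :
    𝔻.corePart S p (𝔻.coreAt p c) = c := by
  have := 𝔻.corePart_splitL S p 0 c
  rwa [map_zero, zero_add] at this

theorem atL_add_coreAt (p : TotalSpace FA A) (x : Over FA D p) :
    S.atL p x.base + 𝔻.coreAt p (𝔻.corePart S p x) = x := by
  obtain ⟨⟨b, c⟩, rfl⟩ := (𝔻.splitL S p).surjective x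
  rw [splitL_apply, corePart_splitL]
  congr 2
  change 𝔻.baseL p (S.atL p b + 𝔻.coreAt p c) = b
  rw [map_add]
  change b + (𝔻.coreAt p c).base = b
  rw [coreAt_base, add_zero]

/-- The core component does not depend on the side from which `D` is seen. -/
theorem corePart_flip {m : M} {a : A m} {b : B m} {x : Over FA D ⟨m, a⟩}
    {X : Over FB (flipD D) ⟨m, b⟩} (h : Same x X) :
    𝔻.corePart S ⟨m, a⟩ x = 𝔻.flip.corePart (S.flip 𝔻) ⟨m, b⟩ X := by
  have hb : x.base = b := by cases h; rfl
  set c := 𝔻.corePart S ⟨m, a⟩ x with hc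
  have hx := 𝔻.atL_add_coreAt S ⟨m, a⟩ x
  rw [hb, ← hc] at hx
  have h1 : Same (S.atL ⟨m, a⟩ b) ((S.flip 𝔻).atL ⟨m, b⟩ a) := S.same_atL 𝔻 a b
  have h2 : Same (0 : Over FA D ⟨m, a⟩) (𝔻.zeroPt ⟨m, a⟩) := 𝔻.same_zeroPt ⟨m, a⟩
  have h3 : Same (𝔻.flip.zeroPt ⟨m, b⟩ : Over FA D ⟨m, 0⟩) (0 : Over FB (flipD D) ⟨m, b⟩) :=
    (𝔻.flip.same_zeroPt ⟨m, b⟩).symm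
  have h4 : Same (𝔻.corePt m c) (𝔻.flip.corePt m c) := Same.mk _ _ _ _
  have h5 := (𝔻.flip.same_coreAt ⟨m, b⟩ c).symm
  have h6 : Same (S.atL ⟨m, a⟩ b) ((S.flip 𝔻).atL ⟨m, b⟩ a + 0) := by rwa [add_zero]
  have h7 : Same (S.atL ⟨m, a⟩ b + 0) ((S.flip 𝔻).atL ⟨m, b⟩ a) := by rwa [add_zero]
  -- The interchange law for the four points `Σ(a, b)`, `0̃_a`, `0̃_b` and `c̄` reads `Σ(a, b) +_A
  -- (0̃_a +_B c̄) = Σ(a, b) +_B (0̃_b +_A c̄)`.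
  have h8 := 𝔻.sideA.add_add h1 h2 h3 h4 h6 (𝔻.same_coreAt ⟨m, a⟩ c) h7 h5
  change Same (S.atL ⟨m, a⟩ b + 𝔻.coreAt ⟨m, a⟩ c) _ at h8
  rw [hx] at h8
  rw [h.eq_right h8]
  exact (𝔻.flip.corePart_splitL (S.flip 𝔻) ⟨m, b⟩ a c).symm

section Dual

/-- The element `d ↦ β(d) + κ(d)` of the dual of the fibre of `D → A` over `a`, the points `d`
being decomposed by a linear splitting. -/
def dualPt (p : TotalSpace FA A) (β : B p.proj →ₗ[ℝ] ℝ) (κ : DualFibre C p.proj) :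
    DualFibre (Over FA D) p :=
  ⟨β ∘ₗ 𝔻.baseL p + (κ : C p.proj →ₗ[ℝ] ℝ) ∘ₗ 𝔻.corePart S p, continuous_of_fibre GA _⟩

theorem dualPt_apply (p : TotalSpace FA A) (β : B p.proj →ₗ[ℝ] ℝ) (κ : DualFibre C p.proj)
    (x : Over FA D p) : 𝔻.dualPt S p β κ x = β x.base + κ (𝔻.corePart S p x) := rfl

theorem toCoreDual_dualPt (p : TotalSpace FA A) (β : B p.proj →ₗ[ℝ] ℝ) (κ : DualFibre C p.proj) :
    𝔻.toCoreDual ⟨p, 𝔻.dualPt S p β κ⟩ = ⟨p.proj, κ⟩ := by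
  refine congrArg (TotalSpace.mk p.proj) (ContinuousLinearMap.ext fun c => ?_)
  change β (𝔻.coreAt p c).base + κ (𝔻.corePart S p (𝔻.coreAt p c)) = κ c
  rw [coreAt_base, map_zero, zero_add, corePart_coreAt]

/-- Over `C^*` the bundle `D^*A` is therefore the sum of the pullbacks of `A` and `B^*`; the
component in `B^*` is the restriction of the form to the image of the splitting. -/
theorem eq_dualPt (Φ : DualTot GA (Over FA D)) :
    Φ = ⟨Φ.proj, 𝔻.dualPt S Φ.proj ((Φ.snd : Over FA D Φ.proj →ₗ[ℝ] ℝ) ∘ₗ S.atL Φ.proj)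
      (𝔻.toCoreDual Φ).snd⟩ := by
  obtain ⟨p, φ⟩ := Φ
  refine congrArg (TotalSpace.mk p) (ContinuousLinearMap.ext fun x => ?_)
  change φ x = φ (S.atL p x.base) + φ (𝔻.coreAt p (𝔻.corePart S p x))
  rw [← map_add, atL_add_coreAt]

theorem exists_dualPt_eq {m : M} (Φ : DualTot GA (Over FA D)) (κ : DualFibre C m)
    (h : 𝔻.toCoreDual Φ = ⟨m, κ⟩) :
    ∃ (a : A m) (β : B m →ₗ[ℝ] ℝ), Φ = ⟨⟨m, a⟩, 𝔻.dualPt S ⟨m, a⟩ β κ⟩ := by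
  have h1 := 𝔻.eq_dualPt S Φ
  obtain ⟨⟨m', a⟩, φ⟩ := Φ
  -- The base points `m'` and `m` are equal only by hypothesis, so the form on `C` is generalised
  -- before this equality is eliminated.
  have key : ∀ κ' : DualFibre C m', (⟨m', κ'⟩ : DualTot FC C) = ⟨m, κ⟩ →
      (∃ β, (⟨⟨m', a⟩, φ⟩ : DualTot GA (Over FA D)) = ⟨⟨m', a⟩, 𝔻.dualPt S ⟨m', a⟩ β κ'⟩) →
      ∃ (a' : A m) (β : B m →ₗ[ℝ] ℝ),
        (⟨⟨m', a⟩, φ⟩ : DualTot GA (Over FA D)) = ⟨⟨m, a'⟩, 𝔻.dualPt S ⟨m, a'⟩ β κ⟩ := by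
    intro κ' hκ ⟨β, hβ⟩
    cases hκ
    exact ⟨a, β, hβ⟩
  exact key _ h ⟨_, h1⟩

/-- By `corePart_flip` the core component is also additive for `+_B`. Hence, for fixed `κ`, the
addition of `D^*A → C^*` is that of `A_m ⊕ B_m^*`. -/
theorem isDualSum_dualPt {m : M} (a₁ a₂ : A m) (β₁ β₂ : B m →ₗ[ℝ] ℝ) (κ : DualFibre C m) :
    𝔻.IsDualSum (𝔻.dualPt S ⟨m, a₁⟩ β₁ κ) (𝔻.dualPt S ⟨m, a₂⟩ β₂ κ)
      (𝔻.dualPt S ⟨m, a₁ + a₂⟩ (β₁ + β₂) κ) where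
  base := rfl
  core₂ := by rw [toCoreDual_dualPt, toCoreDual_dualPt]
  core₃ := by rw [toCoreDual_dualPt, toCoreDual_dualPt]
  apply := by
    intro q d₁ d₂ d₃ d₁' d₂' h₁ h₂ h₃
    have hq : ∃ b : B m, q = ⟨m, b⟩ := by cases h₁; exact ⟨_, rfl⟩
    obtain ⟨b, rfl⟩ := hq
    have e₁ : d₁.base = b := by cases h₁; rfl
    have e₂ : d₂.base = b := by cases h₂; rfl
    have e₃ : d₃.base = b := by
      revert h₃
      generalize d₁' + d₂' = X
      intro h
      cases h
      rfl
    rw [dualPt_apply, dualPt_apply, dualPt_apply, e₁, e₂, e₃, 𝔻.corePart_flip S h₁,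
      𝔻.corePart_flip S h₂, 𝔻.corePart_flip S h₃, map_add, LinearMap.add_apply]
    erw [map_add κ]
    ring

theorem isDualSMul_dualPt {m : M} (r : ℝ) (a : A m) (β : B m →ₗ[ℝ] ℝ) (κ : DualFibre C m) :
    𝔻.IsDualSMul r (𝔻.dualPt S ⟨m, a⟩ β κ) (𝔻.dualPt S ⟨m, r • a⟩ (r • β) κ) where
  base := rfl
  core₂ := by rw [toCoreDual_dualPt, toCoreDual_dualPt]
  apply := by
    intro q d₁ d₂ d₁' h₁ h₂
    have hq : ∃ b : B m, q = ⟨m, b⟩ := by cases h₁; exact ⟨_, rfl⟩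
    obtain ⟨b, rfl⟩ := hq
    have e₁ : d₁.base = b := by cases h₁; rfl
    have e₂ : d₂.base = b := by
      revert h₂
      generalize r • d₁' = X
      intro h
      cases h
      rfl
    rw [dualPt_apply, dualPt_apply, e₁, e₂, 𝔻.corePart_flip S h₁,
      𝔻.corePart_flip S h₂, map_smul, LinearMap.smul_apply]
    erw [map_smul κ]
    simp only [smul_eq_mul]
    ring

end Dual

end DoubleVectorBundle

/-! ### Smoothness of the decomposition. -/

section Model

variable {EN HN N : Type*} [NormedAddCommGroup EN] [NormedSpace ℝ EN]
  [TopologicalSpace HN] {J : ModelWithCorners ℝ EN HN} [TopologicalSpace N] [ChartedSpace HN N]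
  {F : Type*} [NormedAddCommGroup F] [NormedSpace ℝ F] [FiniteDimensional ℝ F]
  {F' : Type*} [NormedAddCommGroup F'] [NormedSpace ℝ F'] [FiniteDimensional ℝ F']

theorem contMDiffAt_clm_of_apply_right {f : N → F →L[ℝ] F'} {x₀ : N}
    (h : ∀ v, ContMDiffAt J 𝓘(ℝ, F') ∞ (fun x => f x v) x₀) :
    ContMDiffAt J 𝓘(ℝ, F →L[ℝ] F') ∞ f x₀ := by
  let b := Module.finBasis ℝ F
  -- In finite dimension a linear map is the sum of its values on a basis times the dual basis, so
  -- smoothness of all its values is enough.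
  have : f = fun x => ∑ i, ContinuousLinearMap.smulRightL ℝ F F'
      (LinearMap.toContinuousLinearMap (b.coord i)) (f x (b i)) := by
    ext x v
    conv_lhs => rw [← b.sum_repr v]
    simp only [map_sum, map_smul, FunLike.coe_sum, Finset.sum_apply,
      ContinuousLinearMap.smulRightL_apply_apply, ContinuousLinearMap.smulRight_apply,
      LinearMap.coe_toContinuousLinearMap', Module.Basis.coord_apply]
  rw [this]
  exact ContMDiffAt.sum fun i _ =>
    (ContinuousLinearMap.contDiff _).contMDiff.contMDiffAt.comp x₀ (h (b i))

/-- The solution of a smooth family of invertible linear equations is smooth. -/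
theorem contMDiffAt_of_clm_apply {T : N → F →L[ℝ] F'} {u : N → F} {x₀ : N}
    (hT : ∀ v, ContMDiffAt J 𝓘(ℝ, F') ∞ (fun x => T x v) x₀)
    (hinv : Function.Bijective (T x₀))
    (hu : ContMDiffAt J 𝓘(ℝ, F') ∞ (fun x => T x (u x)) x₀) :
    ContMDiffAt J 𝓘(ℝ, F) ∞ u x₀ := by
  let e : F ≃L[ℝ] F' := (LinearEquiv.ofBijective (T x₀ : F →ₗ[ℝ] F') hinv).toContinuousLinearEquiv
  have he : (e : F →L[ℝ] F') = T x₀ := by ext; rfl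
  have hT' := contMDiffAt_clm_of_apply_right hT
  have h1 : ContMDiffAt J 𝓘(ℝ, F' →L[ℝ] F) ∞ (fun x => ContinuousLinearMap.inverse (T x)) x₀ := by
    have := contDiffAt_map_inverse (𝕜 := ℝ) (n := ∞) e
    rw [he] at this
    exact this.contMDiffAt.comp x₀ hT'
  refine (h1.clm_apply hu).congr_of_eventuallyEq ?_
  have hnhds : Set.range ((↑) : (F ≃L[ℝ] F') → F →L[ℝ] F') ∈ 𝓝 (T x₀) := by
    rw [← he]; exact ContinuousLinearEquiv.nhds e
  filter_upwards [hT'.continuousAt.preimage_mem_nhds hnhds] with x hx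
  obtain ⟨e', he'⟩ := hx
  rw [← he', ContinuousLinearMap.inverse_equiv]
  simp

end Model

section Frames

variable {EN HN N : Type*} [NormedAddCommGroup EN] [NormedSpace ℝ EN]
  [TopologicalSpace HN] {J : ModelWithCorners ℝ EN HN} [TopologicalSpace N] [ChartedSpace HN N]
  {F : Type*} [NormedAddCommGroup F] [NormedSpace ℝ F]
  {V : N → Type*} [TopologicalSpace (TotalSpace F V)] [∀ x, TopologicalSpace (V x)]
  [FiberBundle F V] [∀ x, AddCommGroup (V x)] [∀ x, Module ℝ (V x)] [VectorBundle ℝ F V]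

theorem contMDiffAt_symmL (x₀ : N) (v : F) :
    ContMDiffAt J (J.prod 𝓘(ℝ, F)) ∞
      (fun x => TotalSpace.mk' F x ((trivializationAt F V x₀).symmL ℝ x v)) x₀ := by
  rw [contMDiffAt_totalSpace]
  refine ⟨contMDiffAt_id, contMDiffAt_const (c := v) |>.congr_of_eventuallyEq ?_⟩
  filter_upwards [(trivializationAt F V x₀).open_baseSet.mem_nhds
    (FiberBundle.mem_baseSet_trivializationAt' x₀)] with x hx
  rw [(trivializationAt F V x₀).symmL_apply hx]
  exact congrArg Prod.snd ((trivializationAt F V x₀).apply_mk_symm hx v)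

end Frames

theorem LinearSplitting.contMDiffAt_atL (S : LinearSplitting I FA FB GA D) {b : ∀ m, B m}
    {p₀ : TotalSpace FA A}
    (hb : ContMDiffAt I (I.prod 𝓘(ℝ, FB)) ∞ (fun m => TotalSpace.mk' FB m (b m)) p₀.proj) :
    ContMDiffAt (I.prod 𝓘(ℝ, FA)) ((I.prod 𝓘(ℝ, FA)).prod 𝓘(ℝ, GA)) ∞
      (fun p : TotalSpace FA A => TotalSpace.mk' GA p (S.atL p (b p.proj))) p₀ := by
  have h : ContMDiffAt (I.prod 𝓘(ℝ, FA)) (I.prod 𝓘(ℝ, FA × FB)) ∞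
      (fun p : TotalSpace FA A =>
        (⟨p.proj, (p.snd, b p.proj)⟩ : TotalSpace (FA × FB) (A ×ᵇ B))) p₀ := by
    have h1 := contMDiffAt_totalSpace.1
      (contMDiffAt_id (I := I.prod 𝓘(ℝ, FA)) (n := ∞) (x := p₀))
    have h2 := contMDiffAt_totalSpace.1 (ContMDiffAt.comp p₀ hb (contMDiffAt_proj A))
    rw [contMDiffAt_totalSpace]
    exact ⟨h1.1, h1.2.prodMk_space h2.2⟩
  exact ContMDiffAt.comp p₀ S.contMDiff.contMDiffAt h

namespace DoubleVectorBundle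

variable (𝔻 : DoubleVectorBundle I FA FB FC GA GB C D) (S : LinearSplitting I FA FB GA D)

theorem contMDiff_base (𝔻 : DoubleVectorBundle I FA FB FC GA GB C D) :
    ContMDiff ((I.prod 𝓘(ℝ, FA)).prod 𝓘(ℝ, GA)) (I.prod 𝓘(ℝ, FB)) ∞
    (fun d : TotalSpace GA (Over FA D) => TotalSpace.mk' FB d.proj.proj d.snd.base) :=
  (contMDiff_proj (Over FB (flipD D))).comp 𝔻.sideA.contMDiff_swap

/-- In trivializations, `T` is the smooth family of isomorphisms `B ⊕ C → D_a` given by the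
splitting, and the pair `u` of the projection to `B` and the core component solves `T d (u d) = d`.
Smoothness of the inverse of a linear map concludes. -/
theorem contMDiff_corePart : ContMDiff ((I.prod 𝓘(ℝ, FA)).prod 𝓘(ℝ, GA)) (I.prod 𝓘(ℝ, FC)) ∞
    (fun d : TotalSpace GA (Over FA D) =>
      TotalSpace.mk' FC d.proj.proj (𝔻.corePart S d.proj d.snd)) := by
  intro d₀
  have hp : ContMDiffAt ((I.prod 𝓘(ℝ, FA)).prod 𝓘(ℝ, GA)) (I.prod 𝓘(ℝ, FA)) ∞
      (fun d : TotalSpace GA (Over FA D) => d.proj) d₀ := contMDiffAt_proj (Over FA D)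
  have hpp : ContMDiffAt ((I.prod 𝓘(ℝ, FA)).prod 𝓘(ℝ, GA)) I ∞
      (fun d : TotalSpace GA (Over FA D) => d.proj.proj) d₀ :=
    ContMDiffAt.comp d₀ (contMDiffAt_proj A) hp
  rw [contMDiffAt_totalSpace]
  refine ⟨hpp, ?_⟩
  set eB := trivializationAt FB B d₀.proj.proj with heB
  set eC := trivializationAt FC C d₀.proj.proj with heC
  set eD := trivializationAt GA (Over FA D) d₀.proj with heD
  let T : TotalSpace GA (Over FA D) → FB × FC →L[ℝ] GA := fun d =>
    LinearMap.toContinuousLinearMap ((eD.continuousLinearMapAt ℝ d.proj : _ →ₗ[ℝ] GA) ∘ₗ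
      ((S.atL d.proj ∘ₗ (eB.symmL ℝ d.proj.proj : FB →ₗ[ℝ] B d.proj.proj)).coprod
      (𝔻.coreAtL d.proj ∘ₗ (eC.symmL ℝ d.proj.proj : FC →ₗ[ℝ] C d.proj.proj))))
  let u : TotalSpace GA (Over FA D) → FB × FC := fun d =>
    ((eB ⟨d.proj.proj, d.snd.base⟩).2, (eC ⟨d.proj.proj, 𝔻.corePart S d.proj d.snd⟩).2)
  have hBm : eB.baseSet ∈ 𝓝 d₀.proj.proj :=
    eB.open_baseSet.mem_nhds (FiberBundle.mem_baseSet_trivializationAt' _)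
  have hCm : eC.baseSet ∈ 𝓝 d₀.proj.proj :=
    eC.open_baseSet.mem_nhds (FiberBundle.mem_baseSet_trivializationAt' _)
  have hDm : eD.baseSet ∈ 𝓝 d₀.proj :=
    eD.open_baseSet.mem_nhds (FiberBundle.mem_baseSet_trivializationAt' _)
  have hev : ∀ᶠ d : TotalSpace GA (Over FA D) in 𝓝 d₀, d.proj.proj ∈ eB.baseSet ∧
      d.proj.proj ∈ eC.baseSet ∧ d.proj ∈ eD.baseSet := by
    filter_upwards [hpp.continuousAt.preimage_mem_nhds hBm,
      hpp.continuousAt.preimage_mem_nhds hCm, hp.continuousAt.preimage_mem_nhds hDm]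
      with d h1 h2 h3
    exact ⟨h1, h2, h3⟩
  have hTu : ∀ᶠ d in 𝓝 d₀, T d (u d) = (eD d).2 := by
    filter_upwards [hev] with d ⟨h1, h2, h3⟩
    have e1 : eB.symmL ℝ d.proj.proj (eB ⟨d.proj.proj, d.snd.base⟩).2 = d.snd.base := by
      rw [eB.symmL_apply h1]
      exact eB.symm_apply_apply_mk h1 _
    have e2 : eC.symmL ℝ d.proj.proj (eC ⟨d.proj.proj, 𝔻.corePart S d.proj d.snd⟩).2
        = 𝔻.corePart S d.proj d.snd := by
      rw [eC.symmL_apply h2]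
      exact eC.symm_apply_apply_mk h2 _
    change eD.continuousLinearMapAt ℝ d.proj
      (S.atL d.proj (eB.symmL ℝ d.proj.proj (eB ⟨d.proj.proj, d.snd.base⟩).2) +
      𝔻.coreAt d.proj (eC.symmL ℝ d.proj.proj (eC ⟨d.proj.proj, 𝔻.corePart S d.proj d.snd⟩).2)) = _
    rw [e1, e2, atL_add_coreAt]
    exact congrFun (eD.coe_linearMapAt_of_mem (R := ℝ) h3) _
  have hTsm : ∀ v, ContMDiffAt ((I.prod 𝓘(ℝ, FA)).prod 𝓘(ℝ, GA)) 𝓘(ℝ, GA) ∞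
      (fun d => T d v) d₀ := by
    intro v
    have h1 := S.contMDiffAt_atL (contMDiffAt_symmL (J := I) (V := B) d₀.proj.proj v.1)
    have h2 := 𝔻.contMDiffAt_coreAt (contMDiffAt_symmL (J := I) (V := C) d₀.proj.proj v.2)
    have h3 := (contMDiffAt_totalSpace.1
      (ContMDiffAt.comp d₀ (contMDiffAt_add_along h1 h2) hp)).2
    refine h3.congr_of_eventuallyEq ?_
    filter_upwards [hev] with d ⟨_, _, h⟩
    exact congrFun (eD.coe_linearMapAt_of_mem (R := ℝ) h) _
  have hbij : Function.Bijective (T d₀) := by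
    obtain ⟨h1, h2, h3⟩ := hev.self_of_nhds
    have := (eD.continuousLinearEquivAt ℝ d₀.proj h3).bijective.comp
      ((𝔻.splitL S d₀.proj).bijective.comp
      ((eB.continuousLinearEquivAt ℝ d₀.proj.proj h1).symm.bijective.prodMap
      (eC.continuousLinearEquivAt ℝ d₀.proj.proj h2).symm.bijective))
    convert this using 1
    funext v
    have e1 := congrFun (eB.symm_continuousLinearEquivAt_eq (R := ℝ) h1) v.1
    have e2 := congrFun (eC.symm_continuousLinearEquivAt_eq (R := ℝ) h2) v.2
    have e3 := congrFun (eD.coe_linearMapAt_of_mem (R := ℝ) h3)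
      (S.atL d₀.proj (eB.symmL ℝ d₀.proj.proj v.1) + 𝔻.coreAt d₀.proj (eC.symmL ℝ d₀.proj.proj v.2))
    refine e3.trans ?_
    change _ = (eD ⟨d₀.proj, S.atL d₀.proj ((eB.continuousLinearEquivAt ℝ d₀.proj.proj h1).symm v.1)
      + 𝔻.coreAt d₀.proj ((eC.continuousLinearEquivAt ℝ d₀.proj.proj h2).symm v.2)⟩).2
    exact congrArg (fun x : Over FA D d₀.proj => (eD ⟨d₀.proj, x⟩).2)
      (congrArg₂ (fun b c => S.atL d₀.proj b + 𝔻.coreAt d₀.proj c) e1.symm e2.symm)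
  have hDsm : ContMDiffAt ((I.prod 𝓘(ℝ, FA)).prod 𝓘(ℝ, GA)) 𝓘(ℝ, GA) ∞ (fun d => (eD d).2) d₀ :=
    (contMDiffAt_totalSpace.1 (contMDiffAt_id
      (I := (I.prod 𝓘(ℝ, FA)).prod 𝓘(ℝ, GA)) (n := ∞) (x := d₀))).2
  have hu : ContMDiffAt ((I.prod 𝓘(ℝ, FA)).prod 𝓘(ℝ, GA)) 𝓘(ℝ, FB × FC) ∞ u d₀ :=
    contMDiffAt_of_clm_apply hTsm hbij (hDsm.congr_of_eventuallyEq hTu)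
  have hsnd : ContMDiffAt 𝓘(ℝ, FB × FC) 𝓘(ℝ, FC) ∞ (Prod.snd : FB × FC → FC) (u d₀) :=
    (contDiff_snd (𝕜 := ℝ) (E := FB) (F := FC)).contMDiff.contMDiffAt
  exact ContMDiffAt.comp (g := Prod.snd) (f := u) d₀ hsnd hu

section Dual

/-- These are sections of `D^*A → C^*`, along which the sections of its dual are evaluated. A family
of linear forms is smooth once its values on the vectors of a local frame are. -/
theorem contMDiff_dualPt (a : Sec I FA A) {G : FnTot I FB B} (hG : FibreLinear G) :
    ContMDiff (I.prod 𝓘(ℝ, FC →L[ℝ] ℝ)) ((I.prod 𝓘(ℝ, FA)).prod 𝓘(ℝ, GA →L[ℝ] ℝ)) ∞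
      (fun κ : DualTot FC C => (⟨⟨κ.proj, a κ.proj⟩,
        𝔻.dualPt S ⟨κ.proj, a κ.proj⟩ (hG.at_ κ.proj) κ.snd⟩ : DualTot GA (Over FA D))) := by
  intro κ₀
  have hp : ContMDiffAt (I.prod 𝓘(ℝ, FC →L[ℝ] ℝ)) (I.prod 𝓘(ℝ, FA)) ∞
      (fun κ : DualTot FC C => (⟨κ.proj, a κ.proj⟩ : TotalSpace FA A)) κ₀ :=
    ContMDiffAt.comp κ₀ a.contMDiff.contMDiffAt (contMDiffAt_proj (DualFibre C))
  rw [contMDiffAt_hom_bundle]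
  refine ⟨hp, contMDiffAt_clm_of_apply fun v => ?_⟩
  set e := trivializationAt GA (Over FA D) ⟨κ₀.proj, a κ₀.proj⟩ with he
  have hmem : e.baseSet ∈ 𝓝 (⟨κ₀.proj, a κ₀.proj⟩ : TotalSpace FA A) :=
    e.open_baseSet.mem_nhds (FiberBundle.mem_baseSet_trivializationAt' _)
  have hw := ContMDiffAt.comp κ₀
    (contMDiffAt_symmL (J := I.prod 𝓘(ℝ, FA)) (V := Over FA D) ⟨κ₀.proj, a κ₀.proj⟩ v) hp
  have hb := ContMDiffAt.comp κ₀ (ContMDiffAt.comp _ G.contMDiff.contMDiffAt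
    𝔻.contMDiff_base.contMDiffAt) hw
  have hc := ContMDiffAt.comp κ₀ (𝔻.contMDiff_corePart S).contMDiffAt hw
  have h1 : ContMDiffAt (I.prod 𝓘(ℝ, FC →L[ℝ] ℝ)) (I.prod 𝓘(ℝ, FC →L[ℝ] ℝ)) ∞
      (fun κ : DualTot FC C =>
        TotalSpace.mk' (FC →L[ℝ] ℝ) (E := DualFibre C) κ.proj κ.snd) κ₀ :=
    contMDiffAt_id
  have h2 := (contMDiffAt_totalSpace.1 (h1.clm_bundle_apply hc)).2
  refine (hb.add h2).congr_of_eventuallyEq ?_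
  filter_upwards [hp.continuousAt.preimage_mem_nhds hmem] with κ hκ
  have hκ' : (⟨κ.proj, a κ.proj⟩ : TotalSpace FA A) ∈
    (trivializationAt GA (Over FA D) ⟨κ₀.proj, a κ₀.proj⟩).baseSet := hκ
  rw [ContinuousLinearMap.inCoordinates_eq hκ' (Set.mem_univ _)]
  have hs : (e.continuousLinearEquivAt ℝ ⟨κ.proj, a κ.proj⟩ hκ).symm v
      = e.symmL ℝ ⟨κ.proj, a κ.proj⟩ v :=
    congrFun (e.symm_continuousLinearEquivAt_eq (R := ℝ) hκ) v
  exact congrArg (fun x => 𝔻.dualPt S ⟨κ.proj, a κ.proj⟩ (hG.at_ κ.proj) κ.snd x) hs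

end Dual

end DoubleVectorBundle

/-! ### The 2-representation induced by a VB-algebroid. -/

theorem TwoRep.ext_fields {R X V W : Type*} [CommRing R] [Algebra ℝ R] [AddCommGroup X] [Module R X]
    [AddCommGroup V] [Module R V] [AddCommGroup W] [Module R W] {L : LieAlgebroid R X}
    {T T' : TwoRep L V W} (h1 : T.bd = T'.bd) (h2 : T.nabla₀.nabla = T'.nabla₀.nabla)
    (h3 : T.nabla₁.nabla = T'.nabla₁.nabla) (h4 : T.curv = T'.curv) : T = T' := by
  obtain ⟨b, ⟨n0, _, _, _, _⟩, ⟨n1, _, _, _, _⟩, c, _, _, _, _, _⟩ := T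
  obtain ⟨b', ⟨n0', _, _, _, _⟩, ⟨n1', _, _, _, _⟩, c', _, _, _, _, _⟩ := T'
  cases h1; cases h2; cases h3; cases h4
  rfl

namespace LinearSplitting

variable (S : LinearSplitting I FA FB GA D)

theorem lift_add (b b' : Sec I FB B) : S.lift (b + b') = S.lift b + S.lift b' := by
  ext p
  exact (S.atL p).map_add _ _

theorem lift_smul (f : Fn I M) (b : Sec I FB B) :
    S.lift (f • b) = (pull f : Fn (I.prod 𝓘(ℝ, FA)) (TotalSpace FA A)) • S.lift b := by
  ext p
  exact (S.atL p).map_smul _ _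

theorem isLinearSection_lift (𝔻 : DoubleVectorBundle I FA FB FC GA GB C D) (b : Sec I FB B) :
    IsLinearSection FA FB GA D (S.lift b) b :=
  fun m => ⟨(S.flip 𝔻).atL ⟨m, b m⟩, fun a => S.same_atL 𝔻 a (b m)⟩

end LinearSplitting

namespace DoubleVectorBundle

variable {𝔻 : DoubleVectorBundle I FA FB FC GA GB C D} {S : LinearSplitting I FA FB GA D}

theorem coreSection_add (c c' : Sec I FC C) :
    𝔻.coreSection (c + c') = 𝔻.coreSection c + 𝔻.coreSection c' := by
  ext p
  exact 𝔻.coreAt_add p _ _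

theorem coreSection_smul (f : Fn I M) (c : Sec I FC C) :
    𝔻.coreSection (f • c) =
      (pull f : Fn (I.prod 𝓘(ℝ, FA)) (TotalSpace FA A)) • 𝔻.coreSection c := by
  ext p
  exact 𝔻.coreAt_smul p _ _

theorem coreSection_zero : 𝔻.coreSection 0 = 0 := by
  ext p
  exact map_zero (𝔻.coreAtL p)

theorem coreSection_neg (c : Sec I FC C) : 𝔻.coreSection (-c) = -𝔻.coreSection c := by
  ext p
  exact map_neg (𝔻.coreAtL p) _

theorem coreSection_injective : Function.Injective 𝔻.coreSection := by
  intro c c' h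
  ext m
  exact 𝔻.coreAt_injective ⟨m, 0⟩
    (congrArg (fun s : Sec (I.prod 𝓘(ℝ, FA)) GA (Over FA D) => s ⟨m, 0⟩) h)

variable (𝔻) in
/-- The section `ξ` of `D → A` is `φ~`, where `φ~(a) = 0̃_a +_B φ(a)`. -/
def IsTilde (ξ : Sec (I.prod 𝓘(ℝ, FA)) GA (Over FA D)) (φ : Sec I FA A → Sec I FC C) : Prop :=
  ∀ a m, ξ ⟨m, a m⟩ = 𝔻.coreAt ⟨m, a m⟩ (φ a m)

/-- A section `φ~` is locally a combination of core sections. -/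
theorem IsTilde.exists_eq_sum (S : LinearSplitting I FA FB GA D) {ξ : Sec (I.prod 𝓘(ℝ, FA)) GA (Over FA D)}
    {φ : Sec I FA A →ₗ[Fn I M] Sec I FC C} (h : 𝔻.IsTilde ξ φ) (m₀ : M) :
    ∃ (n : ℕ) (c : Fin n → Sec I FC C) (γ : Fin n → FnTot I FC C) (G : Fin n → FnTot I FA A)
      (χ : Fn I M), χ m₀ = 1 ∧ (∀ c', ∑ i, compSec (γ i) c' • c i = χ • c') ∧
      (∀ i, FibreLinear (G i)) ∧ (∀ i a, compSec (G i) a = compSec (γ i) (φ a)) ∧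
      (pull χ : FnTot I FA A) • ξ = ∑ i, G i • 𝔻.coreSection (c i) := by
  obtain ⟨c, γ, χ, h0, h1, h2, -⟩ :=
    exists_dual_frames (J := I) (V := C) m₀ (Module.finBasis ℝ FC)
  -- The coefficients are the coordinates, in a local frame of `C`, of the core component of `ξ`.
  -- They are fibrewise linear on `A` because `φ` is linear and each vector is the value of a
  -- section.
  have hG : ∀ i, ContMDiff (I.prod 𝓘(ℝ, FA)) 𝓘(ℝ, ℝ) ∞
      (fun p : TotalSpace FA A => γ i ⟨p.proj, 𝔻.corePart S p (ξ p)⟩) := fun i =>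
    (γ i).contMDiff.comp ((𝔻.contMDiff_corePart S).comp ξ.contMDiff)
  have hξ : ∀ a m, 𝔻.corePart S ⟨m, a m⟩ (ξ ⟨m, a m⟩) = φ a m := by
    intro a m
    rw [h a m, corePart_coreAt]
  refine ⟨_, c, γ, fun i => ⟨_, hG i⟩, χ, h1.self_of_nhds, fun c' => ?_, fun i m => ?_,
    fun i a => ?_, ?_⟩
  · ext m
    rw [Sec.sum_apply]
    exact h2 m (c' m)
  · have key : ∀ a : Sec I FA A, 𝔻.corePart S ⟨m, a m⟩ (ξ ⟨m, a m⟩) = φ a m := fun a => hξ a m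
    refine ⟨fun v w => ?_, fun r v => ?_⟩
    · obtain ⟨a, rfl⟩ := exists_section_through I FA v
      obtain ⟨a', rfl⟩ := exists_section_through I FA w
      change γ i ⟨m, 𝔻.corePart S ⟨m, (a + a') m⟩ (ξ ⟨m, (a + a') m⟩)⟩ =
        γ i ⟨m, 𝔻.corePart S ⟨m, a m⟩ (ξ ⟨m, a m⟩)⟩ +
        γ i ⟨m, 𝔻.corePart S ⟨m, a' m⟩ (ξ ⟨m, a' m⟩)⟩
      rw [key, key, key, map_add]
      exact (h0 i m).map_add _ _
    · obtain ⟨a, rfl⟩ := exists_section_through I FA v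
      have e : r • a m = (((r • (1 : Fn I M)) : Fn I M) • a) m := by
        change r • a m = (r * 1) • a m
        rw [mul_one]
      change γ i ⟨m, 𝔻.corePart S ⟨m, r • a m⟩ (ξ ⟨m, r • a m⟩)⟩ =
        r • γ i ⟨m, 𝔻.corePart S ⟨m, a m⟩ (ξ ⟨m, a m⟩)⟩
      rw [e, key, key, map_smul]
      refine Eq.trans ?_ ((h0 i m).map_smul _ _)
      change γ i ⟨m, (r * 1) • φ a m⟩ = _
      rw [mul_one]
  · ext m
    change γ i ⟨m, 𝔻.corePart S ⟨m, a m⟩ (ξ ⟨m, a m⟩)⟩ = γ i ⟨m, φ a m⟩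
    rw [hξ]
  · ext ⟨m, v⟩
    obtain ⟨a, rfl⟩ := exists_section_through I FA v
    rw [Sec.sum_apply]
    change χ m • ξ ⟨m, a m⟩ = ∑ i, γ i ⟨m, 𝔻.corePart S ⟨m, a m⟩ (ξ ⟨m, a m⟩)⟩ •
      𝔻.coreAtL ⟨m, a m⟩ (c i m)
    rw [hξ]
    have := congrArg (𝔻.coreAtL ⟨m, a m⟩) (h2 m (φ a m))
    rw [map_sum, map_smul] at this
    rw [h a m]
    refine this.symm.trans (Finset.sum_congr rfl fun i _ => ?_)
    rw [map_smul]

end DoubleVectorBundle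

theorem Same.base_eq {m : M} {a : A m} {b : B m} {x : Over FA D ⟨m, a⟩}
    {X : Over FB (flipD D) ⟨m, b⟩} (h : Same x X) : x.base = b := by
  cases h; rfl

namespace DoubleVectorBundle

variable {𝔻 : DoubleVectorBundle I FA FB FC GA GB C D}
  {LD : LieAlgebroid (Fn (I.prod 𝓘(ℝ, FA)) (TotalSpace FA A))
    (Sec (I.prod 𝓘(ℝ, FA)) GA (Over FA D))}
  {LB : LieAlgebroid (Fn I M) (Sec I FB B)}

namespace IsVBAlgebroid

/-- The anchor of core sections, as a map `Γ(C) → Γ(A)`. -/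
def bd (h : 𝔻.IsVBAlgebroid LD LB) : Sec I FC C →ₗ[Fn I M] Sec I FA A where
  toFun c := (h.anchor_core c).choose
  map_add' c c' := by
    refine Sec.ext_of_fibreLinear fun G hG => pull_injective (F := FA) (V := A) ?_
    rw [hG.compSec_add, pull_add, ← (h.anchor_core (c + c')).choose_spec.fibreLinear hG,
      ← (h.anchor_core c).choose_spec.fibreLinear hG,
      ← (h.anchor_core c').choose_spec.fibreLinear hG, coreSection_add, map_add,
      Derivation.add_apply]
  map_smul' f c := by
    refine Sec.ext_of_fibreLinear fun G hG => pull_injective (F := FA) (V := A) ?_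
    rw [RingHom.id_apply, hG.compSec_smul, pull_mul,
      ← (h.anchor_core (f • c)).choose_spec.fibreLinear hG,
      ← (h.anchor_core c).choose_spec.fibreLinear hG, coreSection_smul, map_smul,
      Derivation.smul_apply, smul_eq_mul]

theorem isVerticalLift (h : 𝔻.IsVBAlgebroid LD LB) (c : Sec I FC C) :
    IsVerticalLift (LD.anchor (𝔻.coreSection c)) (h.bd c) :=
  (h.anchor_core c).choose_spec

theorem anchor_pull (h : 𝔻.IsVBAlgebroid LD LB) (S : LinearSplitting I FA FB GA D) (b : Sec I FB B)
    (f : Fn I M) :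
    LD.anchor (S.lift b) (pull f) = pull (LB.anchor b f) :=
  (h.anchor_linear _ _ (S.isLinearSection_lift 𝔻 b)).pull f

theorem anchor_fibreLinear (h : 𝔻.IsVBAlgebroid LD LB) (S : LinearSplitting I FA FB GA D)
    (b : Sec I FB B) {G : FnTot I FA A} (hG : FibreLinear G) :
    FibreLinear (LD.anchor (S.lift b) G) :=
  (h.anchor_linear _ _ (S.isLinearSection_lift 𝔻 b)).fibreLinear G hG

/-- The formula defining the linear vector field of a derivation, solved for the derivation. Its
right side is function-linear in `G`, because the two terms in the derivative of the coefficient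
cancel, so it is the evaluation on a section. -/
theorem exists_nablaSide (h : 𝔻.IsVBAlgebroid LD LB) (S : LinearSplitting I FA FB GA D)
    (b : Sec I FB B) (a : Sec I FA A) :
    ∃ a' : Sec I FA A, ∀ G, FibreLinear G →
      compSec G a' = LB.anchor b (compSec G a) - compSec (LD.anchor (S.lift b) G) a := by
  refine exists_section_of_functional _ (fun G G' _ _ => ?_) fun f G _ => ?_
  · rw [compSec_add_left, map_add, map_add, compSec_add_left]
    abel
  · rw [compSec_mul, Derivation.leibniz, compSec_pull, Derivation.leibniz, compSec_add_left,
      smul_eq_mul, smul_eq_mul, smul_eq_mul, smul_eq_mul, compSec_mul, compSec_mul, h.anchor_pull,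
      compSec_pull, compSec_pull]
    ring

/-- The connection on `A`. -/
def nablaSide (h : 𝔻.IsVBAlgebroid LD LB) (S : LinearSplitting I FA FB GA D)
    (b : Sec I FB B) (a : Sec I FA A) : Sec I FA A := (h.exists_nablaSide S b a).choose

theorem compSec_nablaSide (h : 𝔻.IsVBAlgebroid LD LB) (S : LinearSplitting I FA FB GA D)
    (b : Sec I FB B) (a : Sec I FA A) {G : FnTot I FA A} (hG : FibreLinear G) :
    compSec G (h.nablaSide S b a) =
      LB.anchor b (compSec G a) - compSec (LD.anchor (S.lift b) G) a :=
  (h.exists_nablaSide S b a).choose_spec G hG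

/-- The connection on `A`. -/
def connectionSide (h : 𝔻.IsVBAlgebroid LD LB) (S : LinearSplitting I FA FB GA D) :
    Connection LB (Sec I FA A) where
  nabla := h.nablaSide S
  add_left b b' a := by
    refine Sec.ext_of_fibreLinear fun G hG => ?_
    rw [hG.compSec_add, h.compSec_nablaSide S _ _ hG, h.compSec_nablaSide S _ _ hG,
      h.compSec_nablaSide S _ _ hG, S.lift_add, map_add, map_add, Derivation.add_apply,
      Derivation.add_apply, compSec_add_left]
    abel
  smul_left f b a := by
    refine Sec.ext_of_fibreLinear fun G hG => ?_
    rw [hG.compSec_smul, h.compSec_nablaSide S _ _ hG, h.compSec_nablaSide S _ _ hG,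
      S.lift_smul, map_smul, map_smul, Derivation.smul_apply,
      Derivation.smul_apply, smul_eq_mul, smul_eq_mul, compSec_mul, compSec_pull]
    ring
  add_right b a a' := by
    refine Sec.ext_of_fibreLinear fun G hG => ?_
    rw [hG.compSec_add, h.compSec_nablaSide S _ _ hG, h.compSec_nablaSide S _ _ hG,
      h.compSec_nablaSide S _ _ hG, hG.compSec_add, map_add,
      (h.anchor_fibreLinear S b hG).compSec_add]
    abel
  leibniz b f a := by
    refine Sec.ext_of_fibreLinear fun G hG => ?_
    rw [hG.compSec_add, hG.compSec_smul, hG.compSec_smul, h.compSec_nablaSide S _ _ hG,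
      h.compSec_nablaSide S _ _ hG, hG.compSec_smul, Derivation.leibniz,
      (h.anchor_fibreLinear S b hG).compSec_smul, smul_eq_mul, smul_eq_mul]
    ring

/-- The connection on `C`. -/
def nablaCore (h : 𝔻.IsVBAlgebroid LD LB) (S : LinearSplitting I FA FB GA D)
    (b : Sec I FB B) (c : Sec I FC C) : Sec I FC C :=
  (h.linear_core _ b c (S.isLinearSection_lift 𝔻 b)).choose

theorem bracket_lift_core (h : 𝔻.IsVBAlgebroid LD LB) (S : LinearSplitting I FA FB GA D)
    (b : Sec I FB B) (c : Sec I FC C) :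
    LD.bracket (S.lift b) (𝔻.coreSection c) = 𝔻.coreSection (h.nablaCore S b c) :=
  (h.linear_core _ b c (S.isLinearSection_lift 𝔻 b)).choose_spec

/-- The connection on `C`. -/
def connectionCore (h : 𝔻.IsVBAlgebroid LD LB) (S : LinearSplitting I FA FB GA D) :
    Connection LB (Sec I FC C) where
  nabla := h.nablaCore S
  add_left b b' c := by
    refine 𝔻.coreSection_injective ?_
    rw [coreSection_add, ← h.bracket_lift_core, ← h.bracket_lift_core, ← h.bracket_lift_core,
      S.lift_add, LD.add_bracket]
  smul_left f b c := by
    refine 𝔻.coreSection_injective ?_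
    -- The extra Leibniz term contains the anchor of a core section applied to a pullback, which
    -- vanishes as this anchor is a vertical lift.
    rw [coreSection_smul, ← h.bracket_lift_core, ← h.bracket_lift_core,
      S.lift_smul, LD.smul_bracket, (h.isVerticalLift c).pull, zero_smul, sub_zero]
  add_right b c c' := by
    refine 𝔻.coreSection_injective ?_
    rw [coreSection_add, ← h.bracket_lift_core, ← h.bracket_lift_core, ← h.bracket_lift_core,
      coreSection_add, LD.bracket_add]
  leibniz b f c := by
    refine 𝔻.coreSection_injective ?_
    rw [coreSection_add, coreSection_smul, coreSection_smul, ← h.bracket_lift_core,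
      ← h.bracket_lift_core, coreSection_smul, LD.leibniz, h.anchor_pull]

theorem isLinearSection_bracket (h : 𝔻.IsVBAlgebroid LD LB) (S : LinearSplitting I FA FB GA D)
    (b₁ b₂ : Sec I FB B) :
    IsLinearSection FA FB GA D (LD.bracket (S.lift b₁) (S.lift b₂)) (LB.bracket b₁ b₂) :=
  h.linear_linear _ _ _ _ (S.isLinearSection_lift 𝔻 b₁) (S.isLinearSection_lift 𝔻 b₂)

/-- `R(b₁, b₂)a`. -/
def curvFn (_h : 𝔻.IsVBAlgebroid LD LB) (S : LinearSplitting I FA FB GA D)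
    (b₁ b₂ : Sec I FB B) (a : Sec I FA A) : Sec I FC C :=
  -⟨fun m => 𝔻.corePart S ⟨m, a m⟩ (LD.bracket (S.lift b₁) (S.lift b₂) ⟨m, a m⟩),
    (𝔻.contMDiff_corePart S).comp
      ((LD.bracket (S.lift b₁) (S.lift b₂)).contMDiff.comp a.contMDiff)⟩

/-- The curvature `R ∈ Ω²(B, Hom(A, C))`. -/
def curv (h : 𝔻.IsVBAlgebroid LD LB) (S : LinearSplitting I FA FB GA D) :
    Sec I FB B →ₗ[Fn I M] Sec I FB B →ₗ[Fn I M] Sec I FA A →ₗ[Fn I M] Sec I FC C := by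
  -- Linearity in `a` is visible from `D → B`: the bracket is a linear section, and by
  -- `corePart_flip` its core component can be taken on that side.
  have key : ∀ b₁ b₂ m, ∃ l : A m →ₗ[ℝ] C m, ∀ a : A m,
      𝔻.corePart S ⟨m, a⟩ (LD.bracket (S.lift b₁) (S.lift b₂) ⟨m, a⟩) = l a := by
    intro b₁ b₂ m
    obtain ⟨φ, hφ⟩ := h.isLinearSection_bracket S b₁ b₂ m
    exact ⟨𝔻.flip.corePart (S.flip 𝔻) ⟨m, _⟩ ∘ₗ φ, fun a => 𝔻.corePart_flip S (hφ a)⟩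
  have add_right : ∀ b₁ b₂ b₂' a, h.curvFn S b₁ (b₂ + b₂') a =
      h.curvFn S b₁ b₂ a + h.curvFn S b₁ b₂' a := by
    intro b₁ b₂ b₂' a
    ext m
    change -𝔻.corePart S ⟨m, a m⟩ (LD.bracket (S.lift b₁) (S.lift (b₂ + b₂')) ⟨m, a m⟩) =
      -𝔻.corePart S ⟨m, a m⟩ (LD.bracket (S.lift b₁) (S.lift b₂) ⟨m, a m⟩) +
      -𝔻.corePart S ⟨m, a m⟩ (LD.bracket (S.lift b₁) (S.lift b₂') ⟨m, a m⟩)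
    rw [S.lift_add, LD.bracket_add, ContMDiffSection.coe_add, Pi.add_apply, map_add, neg_add]
  have smul_right : ∀ (f : Fn I M) b₁ b₂ a, h.curvFn S b₁ (f • b₂) a =
      f • h.curvFn S b₁ b₂ a := by
    intro f b₁ b₂ a
    ext m
    change -𝔻.corePart S ⟨m, a m⟩ (LD.bracket (S.lift b₁) (S.lift (f • b₂)) ⟨m, a m⟩) =
      f m • -𝔻.corePart S ⟨m, a m⟩ (LD.bracket (S.lift b₁) (S.lift b₂) ⟨m, a m⟩)
    -- The Leibniz term is a multiple of the lift of `b₂`, whose core component is zero; this makes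
    -- the curvature tensorial.
    rw [S.lift_smul, LD.leibniz, ContMDiffSection.coe_add, Pi.add_apply, map_add,
      Sec.smul_apply, Sec.smul_apply, map_smul, map_smul, S.lift_apply, corePart_atL, smul_zero,
      add_zero, smul_neg, pull_apply]
  have skew : ∀ b₁ b₂ a, h.curvFn S b₁ b₂ a = -h.curvFn S b₂ b₁ a := by
    intro b₁ b₂ a
    ext m
    change -𝔻.corePart S ⟨m, a m⟩ (LD.bracket (S.lift b₁) (S.lift b₂) ⟨m, a m⟩) =
      - -𝔻.corePart S ⟨m, a m⟩ (LD.bracket (S.lift b₂) (S.lift b₁) ⟨m, a m⟩)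
    rw [LD.bracket_skew (S.lift b₂), ContMDiffSection.coe_neg, Pi.neg_apply, map_neg]
  exact
  { toFun := fun b₁ =>
    { toFun := fun b₂ =>
      { toFun := h.curvFn S b₁ b₂
        map_add' := fun a a' => by
          ext m
          obtain ⟨l, hl⟩ := key b₁ b₂ m
          refine (congrArg Neg.neg (hl (a m + a' m))).trans ?_
          rw [map_add, neg_add, ← hl, ← hl]
          rfl
        map_smul' := fun f a => by
          ext m
          obtain ⟨l, hl⟩ := key b₁ b₂ m
          refine (congrArg Neg.neg (hl (f m • a m))).trans ?_
          rw [map_smul, ← smul_neg, ← hl]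
          rfl }
      map_add' := fun b₂ b₂' => LinearMap.ext fun a => add_right b₁ b₂ b₂' a
      map_smul' := fun f b₂ => LinearMap.ext fun a => smul_right f b₁ b₂ a }
    map_add' := fun b₁ b₁' => LinearMap.ext fun b₂ => LinearMap.ext fun a => by
      change h.curvFn S (b₁ + b₁') b₂ a = h.curvFn S b₁ b₂ a + h.curvFn S b₁' b₂ a
      rw [skew, add_right, neg_add, ← skew, ← skew]
    map_smul' := fun f b₁ => LinearMap.ext fun b₂ => LinearMap.ext fun a => by
      change h.curvFn S (f • b₁) b₂ a = f • h.curvFn S b₁ b₂ a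
      rw [skew, smul_right, ← smul_neg, ← skew] }

/-- Both sections are linear over `[b₁, b₂]`, so their difference projects to zero in `B` and takes
values in the core directions. -/
theorem isTilde_bracket_sub (h : 𝔻.IsVBAlgebroid LD LB) (S : LinearSplitting I FA FB GA D)
    (b₁ b₂ : Sec I FB B) :
    𝔻.IsTilde (LD.bracket (S.lift b₁) (S.lift b₂) - S.lift (LB.bracket b₁ b₂))
      ⇑(-h.curv S b₁ b₂) := by
  intro a m
  change LD.bracket (S.lift b₁) (S.lift b₂) ⟨m, a m⟩ - S.lift (LB.bracket b₁ b₂) ⟨m, a m⟩ =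
    𝔻.coreAt ⟨m, a m⟩ (- -𝔻.corePart S ⟨m, a m⟩ (LD.bracket (S.lift b₁) (S.lift b₂) ⟨m, a m⟩))
  rw [neg_neg, S.lift_apply]
  have hb : (LD.bracket (S.lift b₁) (S.lift b₂) ⟨m, a m⟩).base = LB.bracket b₁ b₂ m := by
    obtain ⟨φ, hφ⟩ := h.isLinearSection_bracket S b₁ b₂ m
    exact (hφ (a m)).base_eq
  have := 𝔻.atL_add_coreAt S ⟨m, a m⟩ (LD.bracket (S.lift b₁) (S.lift b₂) ⟨m, a m⟩)
  rw [hb] at this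
  exact sub_eq_of_eq_add' this.symm

end IsVBAlgebroid

end DoubleVectorBundle

theorem compSec_sum_left {ι : Type*} [Fintype ι] (G : ι → FnTot I FA A) (s : Sec I FA A) :
    compSec (∑ i, G i) s = ∑ i, compSec (G i) s := by
  ext x
  rw [Fn.sum_apply, compSec_apply, Fn.sum_apply]
  rfl

namespace DoubleVectorBundle

variable {𝔻 : DoubleVectorBundle I FA FB FC GA GB C D}
  {LD : LieAlgebroid (Fn (I.prod 𝓘(ℝ, FA)) (TotalSpace FA A))
    (Sec (I.prod 𝓘(ℝ, FA)) GA (Over FA D))}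
  {LB : LieAlgebroid (Fn I M) (Sec I FB B)}

theorem coreSection_sum {ι : Type*} [Fintype ι] (c : ι → Sec I FC C) :
    𝔻.coreSection (∑ i, c i) = ∑ i, 𝔻.coreSection (c i) :=
  map_sum (⟨⟨𝔻.coreSection, coreSection_zero⟩, coreSection_add⟩ :
    Sec I FC C →+ Sec (I.prod 𝓘(ℝ, FA)) GA (Over FA D)) _ _

namespace IsVBAlgebroid

/-- With `φ~` written locally as `∑ G_i c_i†`, only the derivatives of the coefficients survive,
since core sections commute; the derivative of `G_i` along `(∂c)^↑` is the pullback of `G_i ∘ ∂c`.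
-/
theorem bracket_core_tilde (h : 𝔻.IsVBAlgebroid LD LB) (S : LinearSplitting I FA FB GA D)
    {ξ : Sec (I.prod 𝓘(ℝ, FA)) GA (Over FA D)} {φ : Sec I FA A →ₗ[Fn I M] Sec I FC C}
    (hξ : 𝔻.IsTilde ξ φ) (c : Sec I FC C) :
    LD.bracket (𝔻.coreSection c) ξ = 𝔻.coreSection (φ (h.bd c)) := by
  ext ⟨m, v⟩
  obtain ⟨n, cc, γ, G, χ, h0, h1, h2, h3, h4⟩ := hξ.exists_eq_sum S m
  have e := congrArg (LD.bracket (𝔻.coreSection c)) h4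
  have e1 : LD.bracket (𝔻.coreSection c) (∑ i, G i • 𝔻.coreSection (cc i)) =
      𝔻.coreSection (χ • φ (h.bd c)) := by
    rw [LD.bracket_sum, ← h1, coreSection_sum]
    refine Finset.sum_congr rfl fun i _ => ?_
    rw [LD.leibniz, h.core_core, smul_zero, zero_add, (h.isVerticalLift c).fibreLinear (h2 i),
      coreSection_smul, h3]
  rw [LD.leibniz, (h.isVerticalLift c).pull, zero_smul, add_zero, e1, coreSection_smul] at e
  have e' := congrArg (fun s : Sec (I.prod 𝓘(ℝ, FA)) GA (Over FA D) => s ⟨m, v⟩) e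
  simpa only [Sec.smul_apply, pull_apply, h0, one_smul] using e'

/-- The anchor is function-linear, so it is read off from the local expression `∑ G_i c_i†` and the
vertical lifts of the `∂ c_i`. -/
theorem compSec_anchor_tilde (h : 𝔻.IsVBAlgebroid LD LB) (S : LinearSplitting I FA FB GA D)
    {ξ : Sec (I.prod 𝓘(ℝ, FA)) GA (Over FA D)} {φ : Sec I FA A →ₗ[Fn I M] Sec I FC C}
    (hξ : 𝔻.IsTilde ξ φ) {F : FnTot I FA A} (hF : FibreLinear F) (a : Sec I FA A) :
    compSec (LD.anchor ξ F) a = compSec F (h.bd (φ a)) := by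
  ext m
  obtain ⟨n, cc, γ, G, χ, h0, h1, h2, h3, h4⟩ := hξ.exists_eq_sum S m
  have e : pull χ * LD.anchor ξ F = ∑ i, G i * pull (compSec F (h.bd (cc i))) := by
    have := congrArg (fun X : Derivation ℝ (FnTot I FA A) (FnTot I FA A) => X F)
      (congrArg LD.anchor h4)
    rw [map_smul, map_sum] at this
    refine this.trans ?_
    rw [← Derivation.coeFnAddMonoidHom_apply, map_sum, Finset.sum_apply]
    refine Finset.sum_congr rfl fun i _ => ?_
    rw [Derivation.coeFnAddMonoidHom_apply, map_smul, Derivation.smul_apply,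
      (h.isVerticalLift (cc i)).fibreLinear hF]
    rfl
  have e1 := congrArg (fun g : FnTot I FA A => compSec g a) e
  have e2 : compSec (∑ i, G i * pull (compSec F (h.bd (cc i)))) a =
      χ * compSec F (h.bd (φ a)) := by
    rw [compSec_sum_left, ← hF.compSec_smul, ← map_smul, ← h1, map_sum]
    ext m
    rw [Fn.sum_apply]
    change _ = hF.at_ m ((∑ i, h.bd (compSec (γ i) (φ a) • cc i)) m)
    rw [Sec.sum_apply, map_sum]
    refine Finset.sum_congr rfl fun i _ => ?_
    rw [map_smul, Sec.smul_apply, map_smul, ← h3]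
    rfl
  rw [e2] at e1
  have e3 := congrArg (fun f : Fn I M => f m) e1
  change χ m * _ = χ m * _ at e3
  rwa [h0, one_mul, one_mul] at e3

/-- The derivative of `φ` for the connection on `Hom(A, C)`: differentiating the coefficients of `∑
G_i c_i†` uses the connection on `A`, and bracketing with the `c_i†` uses the connection on `C`. -/
theorem bracket_lift_tilde (h : 𝔻.IsVBAlgebroid LD LB) (S : LinearSplitting I FA FB GA D)
    {ξ : Sec (I.prod 𝓘(ℝ, FA)) GA (Over FA D)} {φ : Sec I FA A →ₗ[Fn I M] Sec I FC C}
    (hξ : 𝔻.IsTilde ξ φ) (b : Sec I FB B) :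
    𝔻.IsTilde (LD.bracket (S.lift b) ξ)
      fun a => h.nablaCore S b (φ a) - φ (h.nablaSide S b a) := by
  intro a m
  obtain ⟨n, cc, γ, G, χ, h0, h1, h2, h3, h4⟩ := hξ.exists_eq_sum S m
  have e := congrArg (LD.bracket (S.lift b)) h4
  rw [LD.leibniz, h.anchor_pull, LD.bracket_sum] at e
  have e1 : ∀ i, LD.bracket (S.lift b) (G i • 𝔻.coreSection (cc i)) ⟨m, a m⟩ =
      𝔻.coreAtL ⟨m, a m⟩ ((compSec (γ i) (φ a) • h.nablaCore S b (cc i) +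
        LB.anchor b (compSec (γ i) (φ a)) • cc i -
        compSec (γ i) (φ (h.nablaSide S b a)) • cc i) m) := by
    intro i
    have e2 := h.compSec_nablaSide S b a (h2 i)
    rw [h3, h3] at e2
    rw [e2, sub_smul, LD.leibniz, h.bracket_lift_core]
    have e3 : ∀ x y z : C m, x + y - (y - z) = x + z := fun x y z => by abel
    change _ = 𝔻.coreAtL ⟨m, a m⟩ ((_ : C m) + (_ : C m) - ((_ : C m) - (_ : C m)))
    rw [e3, map_add]
    change (_ : Over FA D ⟨m, a m⟩) + (_ : Over FA D ⟨m, a m⟩) = _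
    refine congrArg₂ (fun x y : Over FA D ⟨m, a m⟩ => x + y) ?_ ?_
    · refine Eq.trans ?_ (map_smul (𝔻.coreAtL ⟨m, a m⟩) _ _).symm
      rw [← h3]
      rfl
    · exact (map_smul (𝔻.coreAtL ⟨m, a m⟩) _ _).symm
  have e4 : ∑ i, (compSec (γ i) (φ a) • h.nablaCore S b (cc i) +
        LB.anchor b (compSec (γ i) (φ a)) • cc i -
        compSec (γ i) (φ (h.nablaSide S b a)) • cc i) =
      χ • h.nablaCore S b (φ a) + LB.anchor b χ • φ a - χ • φ (h.nablaSide S b a) := by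
    rw [Finset.sum_sub_distrib, h1]
    congr 1
    -- The local expression describes only `χ ξ`. The derivative of the cutoff occurs on both sides
    -- and cancels at the end.
    have e5 := (h.connectionCore S).leibniz b χ (φ a)
    refine Eq.trans ?_ e5
    rw [← h1]
    let N : Sec I FC C →+ Sec I FC C :=
      AddMonoidHom.mk' ((h.connectionCore S).nabla b) ((h.connectionCore S).add_right b)
    refine Eq.trans ?_ (map_sum N _ _).symm
    exact Finset.sum_congr rfl fun i _ => ((h.connectionCore S).leibniz b _ _).symm
  have e6 := congrArg (fun s : Sec (I.prod 𝓘(ℝ, FA)) GA (Over FA D) => s ⟨m, a m⟩) e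
  change _ = (∑ i, LD.bracket (S.lift b) (G i • 𝔻.coreSection (cc i)) :
    Sec (I.prod 𝓘(ℝ, FA)) GA (Over FA D)) ⟨m, a m⟩ at e6
  rw [Sec.sum_apply, Finset.sum_congr rfl fun i _ => e1 i, ← map_sum, ← Sec.sum_apply, e4] at e6
  change χ m • LD.bracket (S.lift b) ξ ⟨m, a m⟩ + LB.anchor b χ m • ξ ⟨m, a m⟩ =
    𝔻.coreAtL ⟨m, a m⟩ (χ m • h.nablaCore S b (φ a) m + LB.anchor b χ m • φ a m -
      χ m • φ (h.nablaSide S b a) m) at e6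
  rw [h0, one_smul, one_smul, one_smul, hξ a m, add_sub_right_comm, map_add, map_smul] at e6
  exact add_right_cancel e6

end IsVBAlgebroid

end DoubleVectorBundle

namespace DoubleVectorBundle

variable {𝔻 : DoubleVectorBundle I FA FB FC GA GB C D}
  {LD : LieAlgebroid (Fn (I.prod 𝓘(ℝ, FA)) (TotalSpace FA A))
    (Sec (I.prod 𝓘(ℝ, FA)) GA (Over FA D))}
  {LB : LieAlgebroid (Fn I M) (Sec I FB B)}

namespace IsVBAlgebroid

/-- The compatibility of the anchor with `[σ(b), c†]`, tested on fibrewise linear functions. -/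
theorem bd_nablaCore (h : 𝔻.IsVBAlgebroid LD LB) (S : LinearSplitting I FA FB GA D)
    (b : Sec I FB B) (c : Sec I FC C) :
    h.bd (h.nablaCore S b c) = h.nablaSide S b (h.bd c) := by
  refine Sec.ext_of_fibreLinear fun G hG => pull_injective (F := FA) (V := A) ?_
  have e := LD.anchor_bracket (S.lift b) (𝔻.coreSection c) G
  rw [h.bracket_lift_core, (h.isVerticalLift _).fibreLinear hG,
    (h.isVerticalLift _).fibreLinear hG, h.anchor_pull,
    (h.isVerticalLift _).fibreLinear (h.anchor_fibreLinear S b hG)] at e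
  rw [e, h.compSec_nablaSide S _ _ hG, pull_sub]

theorem bracket_lift_eq (h : 𝔻.IsVBAlgebroid LD LB) (S : LinearSplitting I FA FB GA D)
    (b₁ b₂ : Sec I FB B) :
    ∃ ξ, 𝔻.IsTilde ξ ⇑(-h.curv S b₁ b₂) ∧
      LD.bracket (S.lift b₁) (S.lift b₂) = S.lift (LB.bracket b₁ b₂) + ξ :=
  ⟨_, h.isTilde_bracket_sub S b₁ b₂, (add_sub_cancel _ _).symm⟩

/-- The Jacobi identity for two lifts and a core section; the curvature appears through
`bracket_core_tilde`. -/
theorem curvature_core (h : 𝔻.IsVBAlgebroid LD LB) (S : LinearSplitting I FA FB GA D)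
    (b₁ b₂ : Sec I FB B) (c : Sec I FC C) :
    h.nablaCore S b₁ (h.nablaCore S b₂ c) - h.nablaCore S b₂ (h.nablaCore S b₁ c)
      - h.nablaCore S (LB.bracket b₁ b₂) c = h.curv S b₁ b₂ (h.bd c) := by
  refine 𝔻.coreSection_injective ?_
  obtain ⟨ξ, hξ, e⟩ := h.bracket_lift_eq S b₁ b₂
  have j := LD.jacobi (S.lift b₁) (S.lift b₂) (𝔻.coreSection c)
  rw [e, LD.bracket_add, h.bracket_core_tilde S hξ,
    LD.bracket_skew (S.lift b₁) (𝔻.coreSection c),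
    LD.bracket_skew (S.lift (LB.bracket b₁ b₂)) (𝔻.coreSection c), LD.bracket_neg,
    h.bracket_lift_core, h.bracket_lift_core, h.bracket_lift_core, h.bracket_lift_core,
    h.bracket_lift_core, ← coreSection_neg, ← coreSection_neg, ← coreSection_add,
    ← coreSection_add, ← coreSection_add, LinearMap.neg_apply] at j
  have j' := 𝔻.coreSection_injective (j.trans coreSection_zero.symm)
  refine congrArg 𝔻.coreSection (sub_eq_zero.1 (Eq.trans ?_ j'))
  abel

/-- The compatibility of the anchor with the bracket of two lifts, tested on fibrewise linear
functions. -/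
theorem curvature_side (h : 𝔻.IsVBAlgebroid LD LB) (S : LinearSplitting I FA FB GA D)
    (b₁ b₂ : Sec I FB B) (a : Sec I FA A) :
    h.nablaSide S b₁ (h.nablaSide S b₂ a) - h.nablaSide S b₂ (h.nablaSide S b₁ a)
      - h.nablaSide S (LB.bracket b₁ b₂) a = h.bd (h.curv S b₁ b₂ a) := by
  refine Sec.ext_of_fibreLinear fun G hG => ?_
  obtain ⟨ξ, hξ, e⟩ := h.bracket_lift_eq S b₁ b₂
  have j := congrArg (fun g : FnTot I FA A => compSec g a)
    (LD.anchor_bracket (S.lift b₁) (S.lift b₂) G)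
  have e1 := h.compSec_anchor_tilde S hξ hG a
  rw [LinearMap.neg_apply, map_neg, hG.compSec_neg] at e1
  have hG₁ := h.anchor_fibreLinear S b₁ hG
  have hG₂ := h.anchor_fibreLinear S b₂ hG
  have e2 := h.compSec_nablaSide S b₁ a hG₂
  have e3 := h.compSec_nablaSide S b₂ a hG₁
  have e4 := h.compSec_nablaSide S (LB.bracket b₁ b₂) a hG
  have e5 := h.compSec_nablaSide S b₁ (h.nablaSide S b₂ a) hG
  have e6 := h.compSec_nablaSide S b₂ (h.nablaSide S b₁ a) hG
  have e7 := h.compSec_nablaSide S b₂ a hG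
  have e8 := h.compSec_nablaSide S b₁ a hG
  have e9 := LB.anchor_bracket b₁ b₂ (compSec G a)
  have e10 := congrArg (LB.anchor b₁) e7
  have e11 := congrArg (LB.anchor b₂) e8
  rw [map_sub] at e10 e11
  have e12 : compSec (LD.anchor (LD.bracket (S.lift b₁) (S.lift b₂)) G) a =
      compSec (LD.anchor (S.lift (LB.bracket b₁ b₂)) G) a + compSec (LD.anchor ξ G) a := by
    rw [e, map_add]
    rfl
  have e13 : ∀ g g' : FnTot I FA A, compSec (g - g') a = compSec g a - compSec g' a :=
    fun _ _ => rfl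
  change compSec _ a = compSec _ a at j
  rw [e12, e13] at j
  rw [hG.compSec_sub, hG.compSec_sub]
  linear_combination e5 - e6 - e4 + e10 - e11 - e9 + e2 - e3 + j - e1

/-- The core component of the Jacobi identity for three lifts. -/
theorem bianchi (h : 𝔻.IsVBAlgebroid LD LB) (S : LinearSplitting I FA FB GA D)
    (x y z : Sec I FB B) (w : Sec I FA A) :
    - h.curv S (LB.bracket x y) z w + h.curv S (LB.bracket x z) y w
      - h.curv S (LB.bracket y z) x w
      + (h.nablaCore S x (h.curv S y z w) - h.curv S y z (h.nablaSide S x w))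
      - (h.nablaCore S y (h.curv S x z w) - h.curv S x z (h.nablaSide S y w))
      + (h.nablaCore S z (h.curv S x y w) - h.curv S x y (h.nablaSide S z w)) = 0 := by
  ext m
  have skew : ∀ b₁ b₂ a, h.curv S b₁ b₂ a = -h.curv S b₂ b₁ a := by
    intro b₁ b₂ a
    ext m
    change -𝔻.corePart S ⟨m, a m⟩ (LD.bracket (S.lift b₁) (S.lift b₂) ⟨m, a m⟩) =
      - -𝔻.corePart S ⟨m, a m⟩ (LD.bracket (S.lift b₂) (S.lift b₁) ⟨m, a m⟩)
    rw [LD.bracket_skew (S.lift b₂), ContMDiffSection.coe_neg, Pi.neg_apply, map_neg]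
  have nabla_neg : ∀ b c, h.nablaCore S b (-c) = -h.nablaCore S b c := fun b c =>
    map_neg (AddMonoidHom.mk' ((h.connectionCore S).nabla b) ((h.connectionCore S).add_right b)) c
  -- An inner bracket is a lift plus a section `ξ` of the form `φ~`: the lift gives one more
  -- curvature, and `ξ` the covariant derivative of a curvature.
  have key : ∀ b₁ b₂ b₃, 𝔻.corePart S ⟨m, w m⟩
      (LD.bracket (S.lift b₁) (LD.bracket (S.lift b₂) (S.lift b₃)) ⟨m, w m⟩) =
      (-h.curv S b₁ (LB.bracket b₂ b₃) w - (h.nablaCore S b₁ (h.curv S b₂ b₃ w) -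
        h.curv S b₂ b₃ (h.nablaSide S b₁ w))) m := by
    intro b₁ b₂ b₃
    obtain ⟨ξ, hξ, e⟩ := h.bracket_lift_eq S b₂ b₃
    have e1 := h.bracket_lift_tilde S hξ b₁ w m
    rw [e, LD.bracket_add, ContMDiffSection.coe_add, Pi.add_apply, map_add, e1, corePart_coreAt]
    simp only [LinearMap.neg_apply, nabla_neg]
    rw [← neg_sub']
    generalize h.nablaCore S b₁ (h.curv S b₂ b₃ w) - h.curv S b₂ b₃ (h.nablaSide S b₁ w) = Z
    change _ + -(Z m) = -(-𝔻.corePart S ⟨m, w m⟩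
      (LD.bracket (S.lift b₁) (S.lift (LB.bracket b₂ b₃)) ⟨m, w m⟩)) - Z m
    rw [neg_neg, sub_eq_add_neg]
  have j := congrArg (fun s : Sec (I.prod 𝓘(ℝ, FA)) GA (Over FA D) =>
    𝔻.corePart S ⟨m, w m⟩ (s ⟨m, w m⟩)) (LD.jacobi (S.lift x) (S.lift y) (S.lift z))
  change 𝔻.corePart S ⟨m, w m⟩ (_ + _ + _) = 𝔻.corePart S ⟨m, w m⟩ 0 at j
  rw [map_add, map_add, map_zero, key, key, key, skew x, skew y (LB.bracket z x),
    skew z (LB.bracket x y), LB.bracket_skew x z, skew z x w, skew z x, nabla_neg, map_neg,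
    LinearMap.neg_apply, LinearMap.neg_apply] at j
  have aux : ∀ s₁ s₂ s₃ s : Sec I FC C, s = -(s₁ + s₂ + s₃) → s₁ m + s₂ m + s₃ m = 0 →
      s m = 0 := by
    rintro s₁ s₂ s₃ _ rfl h
    exact neg_eq_zero.2 h
  refine aux _ _ _ _ ?_ j
  abel

/-- The 2-representation of `B` induced by a VB-algebroid and a linear splitting. -/
def twoRep (h : 𝔻.IsVBAlgebroid LD LB) (S : LinearSplitting I FA FB GA D) :
    TwoRep LB (Sec I FC C) (Sec I FA A) where
  bd := h.bd
  nabla₀ := h.connectionCore S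
  nabla₁ := h.connectionSide S
  curv := h.curv S
  curv_self b := by
    ext a m
    change -𝔻.corePart S ⟨m, a m⟩ (LD.bracket (S.lift b) (S.lift b) ⟨m, a m⟩) = 0
    rw [LD.bracket_self]
    exact neg_eq_zero.2 (map_zero _)
  bd_nabla := h.bd_nablaCore S
  curvature₀ := h.curvature_core S
  curvature₁ := h.curvature_side S
  bianchi := h.bianchi S

theorem isInducedTwoRep (h : 𝔻.IsVBAlgebroid LD LB) (S : LinearSplitting I FA FB GA D) :
    𝔻.IsInducedTwoRep S LD (h.twoRep S) where
  anchor_core := h.isVerticalLift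
  anchor_lift b :=
    { pull := h.anchor_pull S b
      fibreLinear := fun _ => h.anchor_fibreLinear S b
      apply := fun G hG a => by
        have := h.compSec_nablaSide S b a hG
        change _ = _ - compSec G (h.nablaSide S b a)
        rw [this, sub_sub_cancel] }
  bracket_core := h.bracket_lift_core S
  bracket_lift b₁ b₂ a m := by
    have := h.isTilde_bracket_sub S b₁ b₂ a m
    change LD.bracket (S.lift b₁) (S.lift b₂) ⟨m, a m⟩ - S.lift (LB.bracket b₁ b₂) ⟨m, a m⟩ =
      𝔻.coreAtL ⟨m, a m⟩ (-(h.curv S b₁ b₂ a m)) at this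
    rw [map_neg, sub_eq_iff_eq_add'] at this
    exact this.trans (sub_eq_add_neg _ _).symm

theorem isInducedTwoRep_unique {S : LinearSplitting I FA FB GA D}
    {T T' : TwoRep LB (Sec I FC C) (Sec I FA A)} (h : 𝔻.IsInducedTwoRep S LD T)
    (h' : 𝔻.IsInducedTwoRep S LD T') : T = T' := by
  refine TwoRep.ext_fields ?_ ?_ ?_ ?_
  · exact LinearMap.ext fun c => (h.anchor_core c).unique (h'.anchor_core c)
  · funext b c
    exact 𝔻.coreSection_injective ((h.bracket_core b c).symm.trans (h'.bracket_core b c))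
  · funext b a
    refine Sec.ext_of_fibreLinear fun G hG => ?_
    exact sub_right_injective (((h.anchor_lift b).apply G hG a).symm.trans
      ((h'.anchor_lift b).apply G hG a))
  · refine LinearMap.ext fun b₁ => LinearMap.ext fun b₂ => LinearMap.ext fun a => ?_
    ext m
    exact 𝔻.coreAt_injective ⟨m, a m⟩ (sub_right_injective
      ((h.bracket_lift b₁ b₂ a m).symm.trans (h'.bracket_lift b₁ b₂ a m)))

theorem existsUnique_twoRep (h : 𝔻.IsVBAlgebroid LD LB) (S : LinearSplitting I FA FB GA D) :
    ∃! T : TwoRep LB (Sec I FC C) (Sec I FA A), 𝔻.IsInducedTwoRep S LD T :=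
  ⟨_, h.isInducedTwoRep S, fun _ hT => isInducedTwoRep_unique hT (h.isInducedTwoRep S)⟩

end IsVBAlgebroid

end DoubleVectorBundle

/-! ### Sections of `D^*A^*C^*` and their local generators. -/

variable (I FA A) in
/-- The fibrewise linear functions on a vector bundle, i.e. the sections of its dual. -/
abbrev LinFn : Type _ := {G : FnTot I FA A // FibreLinear G}

/-- The pairing of a fibrewise linear function with sections. -/
def LinFn.ev (G : LinFn I FA A) : Sec I FA A →ₗ[Fn I M] Fn I M where
  toFun := compSec G.1
  map_add' := G.2.compSec_add
  map_smul' := G.2.compSec_smul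

/-- The map `s ↦ ℓ_s`. -/
def ellHom : Sec I FC C →+ FnDual I FC C where
  toFun := ell
  map_zero' := ell_zero
  map_add' := ell_add

namespace DoubleVectorBundle

variable (𝔻 : DoubleVectorBundle I FA FB FC GA GB C D) (S : LinearSplitting I FA FB GA D)

/-- The addition and the scalar multiplication of `D^*A → C^*` are defined through those of `D → B`,
and a linear section is additive and homogeneous precisely for the latter. -/
theorem ell_mem_dualSec {ξ : Sec (I.prod 𝓘(ℝ, FA)) GA (Over FA D)} {b : Sec I FB B}
    (hξ : IsLinearSection FA FB GA D ξ b) : ell ξ ∈ 𝔻.dualSec := by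
  constructor
  · intro m a₁ a₂ a₃ Φ₁ Φ₂ Φ₃ h
    obtain ⟨φ, hφ⟩ := hξ m
    have ha := h.base
    subst ha
    refine h.apply (hφ a₁) (hφ a₂) ?_
    rw [← map_add]
    exact hφ _
  · intro m a₁ a₂ r Φ₁ Φ₂ h
    obtain ⟨φ, hφ⟩ := hξ m
    have ha := h.base
    subst ha
    refine h.apply (hφ a₁) ?_
    rw [← map_smul]
    exact hφ _

/-- The section of `D^*A^*C^*` given by the linear section of `D → A` over `b`. -/
def linDual (b : Sec I FB B) : 𝔻.dualSec :=
  ⟨ell (S.lift b), 𝔻.ell_mem_dualSec (S.isLinearSection_lift 𝔻 b)⟩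

/-- The section of `D^*A^*C^*` given by a fibrewise linear function on `A`. -/
def vertDual (G : LinFn I FA A) : 𝔻.dualSec :=
  ⟨pull G.1, by
    constructor
    · intro m a₁ a₂ a₃ Φ₁ Φ₂ Φ₃ h
      have ha := h.base
      subst ha
      exact (G.2 m).map_add a₁ a₂
    · intro m a₁ a₂ r Φ₁ Φ₂ h
      have ha := h.base
      subst ha
      exact (G.2 m).map_smul r a₁⟩

/-- The values of a section of `D^*A^*C^*` on the fibre of `D^*A` over `κ ∈ C^*`, which is identified
with `A ⊕ B^*` by means of a linear splitting. -/
def fibreVal (f : 𝔻.dualSec) (κ : DualTot FC C) :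
    A κ.proj × (B κ.proj →ₗ[ℝ] ℝ) →ₗ[ℝ] ℝ where
  toFun x := f.1 ⟨⟨κ.proj, x.1⟩, 𝔻.dualPt S ⟨κ.proj, x.1⟩ x.2 κ.snd⟩
  map_add' x y := f.2.1 (𝔻.isDualSum_dualPt S x.1 y.1 x.2 y.2 κ.snd)
  map_smul' r x := f.2.2 (𝔻.isDualSMul_dualPt S r x.1 x.2 κ.snd)

theorem fibreVal_apply (f : 𝔻.dualSec) (κ : DualTot FC C) (a : A κ.proj) (β : B κ.proj →ₗ[ℝ] ℝ) :
    𝔻.fibreVal S f κ (a, β) = f.1 ⟨⟨κ.proj, a⟩, 𝔻.dualPt S ⟨κ.proj, a⟩ β κ.snd⟩ := rfl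

theorem fibreVal_add (f g : 𝔻.dualSec) (κ : DualTot FC C) :
    𝔻.fibreVal S (f + g) κ = 𝔻.fibreVal S f κ + 𝔻.fibreVal S g κ := rfl

theorem fibreVal_smul (k : FnDual I FC C) (f : 𝔻.dualSec) (κ : DualTot FC C) :
    𝔻.fibreVal S (k • f) κ = k κ • 𝔻.fibreVal S f κ := by
  refine LinearMap.ext fun x => ?_
  obtain ⟨a, β⟩ := x
  rw [LinearMap.smul_apply, fibreVal_apply, fibreVal_apply, dualSec_smul_apply, toCoreDual_dualPt]
  rfl

theorem fibreVal_sum {ι : Type*} (s : Finset ι) (f : ι → 𝔻.dualSec) (κ : DualTot FC C) :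
    𝔻.fibreVal S (∑ i ∈ s, f i) κ = ∑ i ∈ s, 𝔻.fibreVal S (f i) κ :=
  map_sum (AddMonoidHom.mk' (fun f => 𝔻.fibreVal S f κ) fun f g => 𝔻.fibreVal_add S f g κ) f s

theorem dualPt_atL {m : M} (a : A m) (b : B m) (β : B m →ₗ[ℝ] ℝ) (κ : DualFibre C m) :
    𝔻.dualPt S ⟨m, a⟩ β κ (S.atL ⟨m, a⟩ b) = β b := by
  rw [dualPt_apply, corePart_atL, LinearSplitting.atL_base]
  exact (congrArg (β b + ·) (map_zero κ)).trans (add_zero _)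

theorem fibreVal_linDual (b : Sec I FB B) (κ : DualTot FC C) (a : A κ.proj)
    (β : B κ.proj →ₗ[ℝ] ℝ) : 𝔻.fibreVal S (𝔻.linDual S b) κ (a, β) = β (b κ.proj) :=
  𝔻.dualPt_atL S a (b κ.proj) β κ.snd

theorem fibreVal_vertDual (G : LinFn I FA A) (κ : DualTot FC C) (a : A κ.proj)
    (β : B κ.proj →ₗ[ℝ] ℝ) : 𝔻.fibreVal S (𝔻.vertDual G) κ (a, β) = G.1 ⟨κ.proj, a⟩ := rfl

theorem dualSec_ext {f g : 𝔻.dualSec} (S : LinearSplitting I FA FB GA D)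
    (h : ∀ κ, 𝔻.fibreVal S f κ = 𝔻.fibreVal S g κ) : f = g := by
  refine Subtype.ext (ContMDiffMap.ext fun Φ => ?_)
  obtain ⟨κ, hκ⟩ : ∃ κ, 𝔻.toCoreDual Φ = κ := ⟨_, rfl⟩
  obtain ⟨a, β, rfl⟩ := 𝔻.exists_dualPt_eq S Φ κ.snd hκ
  exact congrArg (fun l => l (a, β)) (h κ)

/-- The value of a section of `D^*A^*C^*` on a section of `D^*A → C^*` with components in `Γ(A)`
and `Γ(B^*)`. -/
def evalDual (f : 𝔻.dualSec) (a : Sec I FA A) (G : LinFn I FB B) : FnDual I FC C :=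
  ⟨fun κ => 𝔻.fibreVal S f κ (a κ.proj, G.2.at_ κ.proj),
    f.1.contMDiff.comp (𝔻.contMDiff_dualPt S a G.2)⟩

end DoubleVectorBundle

variable (FA FB) in
/-- A resolution of the identities of two vector bundles near a point. -/
theorem exists_common_frames (m : M) : ∃ (n n' : ℕ) (s : Fin n → Sec I FA A)
    (ε : Fin n → LinFn I FA A) (t : Fin n' → Sec I FB B) (η : Fin n' → LinFn I FB B)
    (χ : Fn I M), (∀ᶠ x in 𝓝 m, χ x = 1) ∧
      (∀ x (v : A x), ∑ i, (ε i).1 ⟨x, v⟩ • s i x = χ x • v) ∧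
      (∀ x (v : B x), ∑ i, (η i).1 ⟨x, v⟩ • t i x = χ x • v) := by
  obtain ⟨s, ε, χ, h0, h1, h2, -⟩ :=
    exists_dual_frames (J := I) (V := A) m (Module.finBasis ℝ FA)
  obtain ⟨t, η, χ', h0', h1', h2', -⟩ :=
    exists_dual_frames (J := I) (V := B) m (Module.finBasis ℝ FB)
  -- Each frame is multiplied by the cutoff of the other bundle, so that both resolve the same
  -- function `χ * χ'`.
  refine ⟨_, _, fun i => χ' • s i, fun i => ⟨ε i, h0 i⟩, fun i => χ • t i,
    fun i => ⟨η i, h0' i⟩, χ * χ', ?_, ?_, ?_⟩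
  · filter_upwards [h1, h1'] with x hx hx'
    change χ x * χ' x = 1
    rw [hx, hx', one_mul]
  · intro x v
    change ∑ i, ε i ⟨x, v⟩ • (χ' x • s i x) = (χ x * χ' x) • v
    rw [mul_comm, mul_smul, ← h2, Finset.smul_sum]
    exact Finset.sum_congr rfl fun i _ => smul_comm _ _ _
  · intro x v
    change ∑ i, η i ⟨x, v⟩ • (χ x • t i x) = (χ x * χ' x) • v
    rw [mul_smul, ← h2', Finset.smul_sum]
    exact Finset.sum_congr rfl fun i _ => smul_comm _ _ _

namespace DoubleVectorBundle

variable (𝔻 : DoubleVectorBundle I FA FB FC GA GB C D) (S : LinearSplitting I FA FB GA D)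

/-- Local generation over `C^∞(C^*)`: a linear form on `A_m ⊕ B_m^*` is expanded in frames, and its
coefficients are its values on sections of `A` and of `B^*`. -/
theorem pull_smul_eq_sum {n n' : ℕ} {s : Fin n → Sec I FA A}
    {ε : Fin n → LinFn I FA A} {t : Fin n' → Sec I FB B} {η : Fin n' → LinFn I FB B}
    {χ : Fn I M} (hs : ∀ x (v : A x), ∑ i, (ε i).1 ⟨x, v⟩ • s i x = χ x • v)
    (ht : ∀ x (v : B x), ∑ i, (η i).1 ⟨x, v⟩ • t i x = χ x • v) (f : 𝔻.dualSec) :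
    (pull χ : FnDual I FC C) • f
      = ∑ i, 𝔻.evalDual S f (s i) ⟨0, FibreLinear.zero⟩ • 𝔻.vertDual (ε i)
        + ∑ i, 𝔻.evalDual S f 0 (η i) • 𝔻.linDual S (t i) := by
  refine 𝔻.dualSec_ext S fun κ => LinearMap.ext fun x => ?_
  obtain ⟨a, β⟩ := x
  rw [fibreVal_smul, fibreVal_add, fibreVal_sum, fibreVal_sum, LinearMap.add_apply,
    LinearMap.sum_apply, LinearMap.sum_apply, LinearMap.smul_apply]
  have h1 : (χ κ.proj) • (a, β) = ∑ i, (ε i).1 ⟨κ.proj, a⟩ • (s i κ.proj, (0 : B κ.proj →ₗ[ℝ] ℝ))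
      + ∑ i, β (t i κ.proj) • ((0 : A κ.proj), (η i).2.at_ κ.proj) := by
    refine Prod.ext ?_ (LinearMap.ext fun v => ?_)
    · simp only [Prod.fst_add, Prod.fst_sum, Prod.smul_mk, smul_zero, Finset.sum_const_zero,
        add_zero]
      exact (hs _ _).symm
    · simp only [Prod.snd_add, Prod.snd_sum, Prod.smul_mk, smul_zero, Finset.sum_const_zero,
        zero_add, LinearMap.smul_apply, LinearMap.sum_apply, FibreLinear.at_apply, smul_eq_mul]
      have := congrArg β (ht κ.proj v)
      rw [map_smul, map_sum, smul_eq_mul] at this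
      rw [← this]
      refine Finset.sum_congr rfl fun i _ => ?_
      rw [map_smul, smul_eq_mul, mul_comm]
  have h2 := congrArg (𝔻.fibreVal S f κ) h1
  rw [map_smul, map_add, map_sum, map_sum] at h2
  refine h2.trans (congrArg₂ (· + ·) ?_ ?_)
  · refine Finset.sum_congr rfl fun i _ => ?_
    rw [map_smul, fibreVal_smul, LinearMap.smul_apply, fibreVal_vertDual, smul_eq_mul, smul_eq_mul,
      mul_comm]
    rfl
  · refine Finset.sum_congr rfl fun i _ => ?_
    rw [map_smul, fibreVal_smul, LinearMap.smul_apply, fibreVal_linDual, smul_eq_mul, smul_eq_mul,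
      mul_comm]
    rfl

end DoubleVectorBundle

/-! ### The duality of `D^*A^*C^*` and `D^*B^*C^*`. -/

namespace DoubleVectorBundle

variable (𝔻 : DoubleVectorBundle I FA FB FC GA GB C D) (S : LinearSplitting I FA FB GA D)

/-- The pairing of `D^*A^*C^*` and `D^*B^*C^*` over `κ ∈ C^*`: the fibres of `D^*A` and `D^*B` over
`κ` are identified with `A ⊕ B^*` and `B ⊕ A^*`. -/
def fibrePair (f : 𝔻.dualSec) (g : 𝔻.flip.dualSec) (κ : DualTot FC C) : ℝ :=
  -- If `g(b, α) = α(a) - β(b)`, the first term is `f(a, 0)` and the second subtracts `f(0, -β)`, so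
  -- the difference is `f(a, β)`. In this form the pair `(a, β)` need not be extracted from `g`.
  𝔻.flip.fibreVal (S.flip 𝔻) g κ (0, 𝔻.fibreVal S f κ ∘ₗ LinearMap.inl ℝ _ _)
    - 𝔻.fibreVal S f κ (0, 𝔻.flip.fibreVal (S.flip 𝔻) g κ ∘ₗ LinearMap.inl ℝ _ _)

theorem fibrePair_flip (f : 𝔻.dualSec) (g : 𝔻.flip.dualSec) (κ : DualTot FC C) :
    𝔻.flip.fibrePair (S.flip 𝔻) g f κ = -𝔻.fibrePair S f g κ :=
  (neg_sub _ _).symm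

theorem fibrePair_add_left (f f' : 𝔻.dualSec) (g : 𝔻.flip.dualSec) (κ : DualTot FC C) :
    𝔻.fibrePair S (f + f') g κ = 𝔻.fibrePair S f g κ + 𝔻.fibrePair S f' g κ := by
  have h : ((0 : B κ.proj), 𝔻.fibreVal S (f + f') κ ∘ₗ LinearMap.inl ℝ _ _)
      = (0, 𝔻.fibreVal S f κ ∘ₗ LinearMap.inl ℝ _ _)
        + (0, 𝔻.fibreVal S f' κ ∘ₗ LinearMap.inl ℝ _ _) :=
    Prod.ext (add_zero 0).symm rfl
  rw [fibrePair, h]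
  erw [map_add]
  rw [fibreVal_add, LinearMap.add_apply, fibrePair, fibrePair]
  ring

theorem fibrePair_smul_left (k : FnDual I FC C) (f : 𝔻.dualSec) (g : 𝔻.flip.dualSec)
    (κ : DualTot FC C) : 𝔻.fibrePair S (k • f) g κ = k κ * 𝔻.fibrePair S f g κ := by
  have h : ((0 : B κ.proj), 𝔻.fibreVal S (k • f) κ ∘ₗ LinearMap.inl ℝ _ _)
      = k κ • (0, 𝔻.fibreVal S f κ ∘ₗ LinearMap.inl ℝ _ _) := by
    rw [fibreVal_smul]
    exact Prod.ext (smul_zero _).symm rfl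
  rw [fibrePair, h]
  erw [map_smul]
  rw [fibreVal_smul, LinearMap.smul_apply, fibrePair, smul_eq_mul, smul_eq_mul]
  ring

theorem fibrePair_add_right (f : 𝔻.dualSec) (g g' : 𝔻.flip.dualSec) (κ : DualTot FC C) :
    𝔻.fibrePair S f (g + g') κ = 𝔻.fibrePair S f g κ + 𝔻.fibrePair S f g' κ := by
  have := 𝔻.flip.fibrePair_add_left (S.flip 𝔻) g g' f κ
  rw [fibrePair_flip, fibrePair_flip, fibrePair_flip] at this
  linarith

theorem fibrePair_smul_right (k : FnDual I FC C) (f : 𝔻.dualSec) (g : 𝔻.flip.dualSec)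
    (κ : DualTot FC C) : 𝔻.fibrePair S f (k • g) κ = k κ * 𝔻.fibrePair S f g κ := by
  have := 𝔻.flip.fibrePair_smul_left (S.flip 𝔻) k g f κ
  rw [fibrePair_flip, fibrePair_flip] at this
  linarith

theorem fibrePair_vertDual (G : LinFn I FA A) (g : 𝔻.flip.dualSec) (κ : DualTot FC C) :
    𝔻.fibrePair S (𝔻.vertDual G) g κ
      = 𝔻.flip.evalDual (S.flip 𝔻) g 0 G κ := by
  rw [fibrePair, fibreVal_vertDual, (G.2 κ.proj).map_zero, sub_zero]
  rfl

theorem fibrePair_linDual (b : Sec I FB B) (g : 𝔻.flip.dualSec) (κ : DualTot FC C) :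
    𝔻.fibrePair S (𝔻.linDual S b) g κ
      = -𝔻.flip.evalDual (S.flip 𝔻) g b ⟨0, FibreLinear.zero⟩ κ := by
  have h : ((0 : B κ.proj), 𝔻.fibreVal S (𝔻.linDual S b) κ ∘ₗ LinearMap.inl ℝ _ _) = 0 := by
    refine Prod.ext rfl (LinearMap.ext fun a => ?_)
    exact 𝔻.fibreVal_linDual S b κ a 0
  rw [fibrePair, h, fibreVal_linDual]
  erw [map_zero]
  rw [zero_sub]
  rfl

theorem fibrePair_vertDual_right (f : 𝔻.dualSec) (G : LinFn I FB B) (κ : DualTot FC C) :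
    𝔻.fibrePair S f (𝔻.flip.vertDual G) κ = -𝔻.evalDual S f 0 G κ := by
  have := 𝔻.flip.fibrePair_vertDual (S.flip 𝔻) G f κ
  rw [fibrePair_flip] at this
  exact neg_eq_iff_eq_neg.1 this

theorem fibrePair_linDual_right (f : 𝔻.dualSec) (a : Sec I FA A) (κ : DualTot FC C) :
    𝔻.fibrePair S f (𝔻.flip.linDual (S.flip 𝔻) a) κ
      = 𝔻.evalDual S f a ⟨0, FibreLinear.zero⟩ κ := by
  have := 𝔻.flip.fibrePair_linDual (S.flip 𝔻) a f κ
  rw [fibrePair_flip] at this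
  exact neg_injective this

theorem fibrePair_sum_left {ι : Type*} (s : Finset ι) (f : ι → 𝔻.dualSec) (g : 𝔻.flip.dualSec)
    (κ : DualTot FC C) : 𝔻.fibrePair S (∑ i ∈ s, f i) g κ = ∑ i ∈ s, 𝔻.fibrePair S (f i) g κ :=
  map_sum (AddMonoidHom.mk' (fun f => 𝔻.fibrePair S f g κ)
    fun f f' => 𝔻.fibrePair_add_left S f f' g κ) f s

/-- Near each point `f` is a combination of generators, and the pairing of `g` with a generator is,
up to sign, an evaluation of `g` along a smooth section. -/
theorem contMDiff_fibrePair (f : 𝔻.dualSec) (g : 𝔻.flip.dualSec) :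
    ContMDiff (I.prod 𝓘(ℝ, FC →L[ℝ] ℝ)) 𝓘(ℝ, ℝ) ∞ (𝔻.fibrePair S f g) := by
  intro κ₀
  obtain ⟨n, n', s, ε, t, η, χ, hχ, hs, ht⟩ :=
    exists_common_frames (I := I) FA FB (A := A) (B := B) κ₀.proj
  let k : FnDual I FC C :=
    ∑ i, 𝔻.evalDual S f (s i) ⟨0, FibreLinear.zero⟩ * 𝔻.flip.evalDual (S.flip 𝔻) g 0 (ε i)
      + ∑ i, 𝔻.evalDual S f 0 (η i)
        * -𝔻.flip.evalDual (S.flip 𝔻) g (t i) ⟨0, FibreLinear.zero⟩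
  have hk : ∀ κ : DualTot FC C, χ κ.proj = 1 → 𝔻.fibrePair S f g κ = k κ := by
    intro κ hκ
    have h1 := 𝔻.fibrePair_smul_left S (pull χ) f g κ
    rw [𝔻.pull_smul_eq_sum S hs ht, fibrePair_add_left, fibrePair_sum_left,
      fibrePair_sum_left] at h1
    have h2 : (pull χ : FnDual I FC C) κ = 1 := hκ
    rw [h2, one_mul] at h1
    rw [← h1]
    change _ = (∑ i, _ : FnDual I FC C) κ + (∑ i, _ : FnDual I FC C) κ
    rw [Fn.sum_apply, Fn.sum_apply]
    refine congrArg₂ (· + ·) (Finset.sum_congr rfl fun i _ => ?_)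
      (Finset.sum_congr rfl fun i _ => ?_)
    · rw [fibrePair_smul_left, fibrePair_vertDual]
      rfl
    · rw [fibrePair_smul_left, fibrePair_linDual]
      rfl
  refine k.contMDiff.contMDiffAt.congr_of_eventuallyEq ?_
  have hc : ContinuousAt (fun κ : DualTot FC C => κ.proj) κ₀ :=
    (contMDiffAt_proj (IB := I) (n := ∞) (DualFibre C)).continuousAt
  filter_upwards [hc.eventually hχ] with κ hκ
  exact hk κ hκ

/-- The pairing of the sections of `D^*A^*C^*` and `D^*B^*C^*`. -/
def dualPairing : 𝔻.dualSec →ₗ[FnDual I FC C] 𝔻.flip.dualSec →ₗ[FnDual I FC C] FnDual I FC C :=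
  LinearMap.mk₂ _ (fun f g => ⟨𝔻.fibrePair S f g, 𝔻.contMDiff_fibrePair S f g⟩)
    (fun f f' g => ContMDiffMap.ext fun κ => 𝔻.fibrePair_add_left S f f' g κ)
    (fun k f g => ContMDiffMap.ext fun κ => 𝔻.fibrePair_smul_left S k f g κ)
    (fun f g g' => ContMDiffMap.ext fun κ => 𝔻.fibrePair_add_right S f g g' κ)
    (fun k f g => ContMDiffMap.ext fun κ => 𝔻.fibrePair_smul_right S k f g κ)

/-- The forms of both sides restrict to the same `κ` on the core and the core component is common,
so these contributions cancel and only `α(a) - β(b)` remains. -/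
theorem forall_eq_pairing_iff (g : 𝔻.flip.dualSec) {m : M} (a : A m) (β : B m →ₗ[ℝ] ℝ)
    (κ : DualFibre C m) :
    (∀ Ψ : DualTot GB (Over FB (flipD D)),
      𝔻.flip.toCoreDual Ψ = 𝔻.toCoreDual ⟨⟨m, a⟩, 𝔻.dualPt S ⟨m, a⟩ β κ⟩ →
      ∀ (d : Over FA D ⟨m, a⟩) d', Same (q := Ψ.proj) d d' →
        g.1 Ψ = Ψ.snd d' - 𝔻.dualPt S ⟨m, a⟩ β κ d)
      ↔ ∀ b α, 𝔻.flip.fibreVal (S.flip 𝔻) g ⟨m, κ⟩ (b, α) = α a - β b := by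
  rw [toCoreDual_dualPt]
  constructor
  · intro h b α
    have h1 := h ⟨⟨m, b⟩, 𝔻.flip.dualPt (S.flip 𝔻) ⟨m, b⟩ α κ⟩
      (𝔻.flip.toCoreDual_dualPt (S.flip 𝔻) ⟨m, b⟩ α κ) _ _ (S.same_atL 𝔻 a b)
    refine h1.trans (congrArg₂ (· - ·) ?_ ?_)
    · exact 𝔻.flip.dualPt_atL (S.flip 𝔻) b a α κ
    · exact 𝔻.dualPt_atL S a b β κ
  · intro h Ψ hΨ d d' hd
    obtain ⟨b, α, rfl⟩ := 𝔻.flip.exists_dualPt_eq (S.flip 𝔻) Ψ κ hΨ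
    refine (h b α).trans ?_
    change _ = 𝔻.flip.dualPt (S.flip 𝔻) ⟨m, b⟩ α κ d' - _
    have e1 : d.base = b := by cases hd; rfl
    have e2 : d'.base = a := by cases hd; rfl
    rw [dualPt_apply, dualPt_apply, e1, e2, 𝔻.corePart_flip S hd]
    ring

/-- The defining property prescribes the pairing at each `κ`, because each value of `g` is of the
form `-⟨⟨Φ, ·⟩⟩`. It also shows that `dualPairing` does not depend on the splitting. -/
theorem isDuality_iff
    (p : 𝔻.dualSec →ₗ[FnDual I FC C] 𝔻.flip.dualSec →ₗ[FnDual I FC C] FnDual I FC C) :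
    𝔻.IsDuality p ↔ p = 𝔻.dualPairing S := by
  have key : ∀ (f : 𝔻.dualSec) (g : 𝔻.flip.dualSec) (κ : DualTot FC C) (a : A κ.proj)
      (β : B κ.proj →ₗ[ℝ] ℝ),
      (∀ b α, 𝔻.flip.fibreVal (S.flip 𝔻) g κ (b, α) = α a - β b) →
      𝔻.fibreVal S f κ (a, β) = 𝔻.fibrePair S f g κ := by
    intro f g κ a β h
    have h1 : 𝔻.flip.fibreVal (S.flip 𝔻) g κ ∘ₗ LinearMap.inl ℝ _ _ = -β :=
      LinearMap.ext fun b => (h b 0).trans (zero_sub _)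
    have h2 : (a, β) = (a, (0 : B κ.proj →ₗ[ℝ] ℝ)) - (0, -β) := by
      simp
    rw [fibrePair, h, h1, h2, map_sub, map_zero, sub_zero]
    rfl
  constructor
  · intro h
    refine LinearMap.ext fun f => LinearMap.ext fun g => ContMDiffMap.ext fun κ => ?_
    have : Module.Finite ℝ (A κ.proj) :=
      Module.Finite.equiv ((trivializationAt FA A κ.proj).continuousLinearEquivAt ℝ κ.proj
        (FiberBundle.mem_baseSet_trivializationAt' κ.proj)).symm.toLinearEquiv
    -- Reflexivity of the finite-dimensional fibre of `A` turns the restriction of `g` to `A_m^*`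
    -- into a vector `a`.
    obtain ⟨a, ha⟩ := (Module.evalEquiv ℝ (A κ.proj)).surjective
      (𝔻.flip.fibreVal (S.flip 𝔻) g κ ∘ₗ LinearMap.inr ℝ (B κ.proj) _)
    let β : B κ.proj →ₗ[ℝ] ℝ := -(𝔻.flip.fibreVal (S.flip 𝔻) g κ ∘ₗ LinearMap.inl ℝ _ _)
    have h1 : ∀ b α, 𝔻.flip.fibreVal (S.flip 𝔻) g κ (b, α) = α a - β b := by
      intro b α
      have h2 : (b, α) = (b, (0 : A κ.proj →ₗ[ℝ] ℝ)) + (0, α) := by simp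
      have h3 : α a = 𝔻.flip.fibreVal (S.flip 𝔻) g κ (0, α) := congrArg (fun l => l α) ha
      rw [h3, h2]
      erw [map_add]
      rw [add_comm]
      exact (sub_neg_eq_add _ _).symm
    have h2 := h f g ⟨⟨κ.proj, a⟩, 𝔻.dualPt S ⟨κ.proj, a⟩ β κ.snd⟩
      ((𝔻.forall_eq_pairing_iff S g a β κ.snd).2 h1)
    rw [toCoreDual_dualPt] at h2
    exact h2.trans (key f g κ a β h1)
  · rintro rfl f g Φ h
    obtain ⟨κ, hκ⟩ : ∃ κ, 𝔻.toCoreDual Φ = κ := ⟨_, rfl⟩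
    obtain ⟨a, β, rfl⟩ := 𝔻.exists_dualPt_eq S Φ κ.snd hκ
    rw [hκ]
    exact (key f g κ a β ((𝔻.forall_eq_pairing_iff S g a β κ.snd).1 h)).symm

theorem isDuality_dualPairing : 𝔻.IsDuality (𝔻.dualPairing S) := (𝔻.isDuality_iff S _).2 rfl

theorem dualPairing_flip : 𝔻.flip.dualPairing (S.flip 𝔻) = -(𝔻.dualPairing S).flip :=
  LinearMap.ext fun g => LinearMap.ext fun f => ContMDiffMap.ext fun κ => 𝔻.fibrePair_flip S f g κ

end DoubleVectorBundle

namespace DoubleVectorBundle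

variable (𝔻 : DoubleVectorBundle I FA FB FC GA GB C D) (S : LinearSplitting I FA FB GA D)

theorem dualPairing_vertDual (G : LinFn I FA A) (g : 𝔻.flip.dualSec) :
    𝔻.dualPairing S (𝔻.vertDual G) g = 𝔻.flip.evalDual (S.flip 𝔻) g 0 G :=
  ContMDiffMap.ext fun κ => 𝔻.fibrePair_vertDual S G g κ

theorem dualPairing_linDual (b : Sec I FB B) (g : 𝔻.flip.dualSec) :
    𝔻.dualPairing S (𝔻.linDual S b) g
      = -𝔻.flip.evalDual (S.flip 𝔻) g b ⟨0, FibreLinear.zero⟩ :=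
  ContMDiffMap.ext fun κ => 𝔻.fibrePair_linDual S b g κ

theorem dualPairing_vertDual_right (f : 𝔻.dualSec) (G : LinFn I FB B) :
    𝔻.dualPairing S f (𝔻.flip.vertDual G) = -𝔻.evalDual S f 0 G :=
  ContMDiffMap.ext fun κ => 𝔻.fibrePair_vertDual_right S f G κ

theorem dualPairing_linDual_right (f : 𝔻.dualSec) (a : Sec I FA A) :
    𝔻.dualPairing S f (𝔻.flip.linDual (S.flip 𝔻) a)
      = 𝔻.evalDual S f a ⟨0, FibreLinear.zero⟩ :=
  ContMDiffMap.ext fun κ => 𝔻.fibrePair_linDual_right S f a κ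

theorem dualPairing_injective : Function.Injective (𝔻.dualPairing S) := by
  refine (injective_iff_map_eq_zero _).2 fun f hf => 𝔻.dualSec_ext S fun κ =>
    LinearMap.ext fun x => ?_
  obtain ⟨a, β⟩ := x
  obtain ⟨s, rfl⟩ := exists_section_through I FA a
  obtain ⟨G, hG, hβ⟩ := exists_fibreLinear_through I FB β
  have e1 := congrArg (fun l => l (𝔻.flip.linDual (S.flip 𝔻) s)) hf
  have e2 := congrArg (fun l => l (𝔻.flip.vertDual ⟨G, hG⟩)) hf
  have h1 : 𝔻.evalDual S f s ⟨0, FibreLinear.zero⟩ = 0 :=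
    (𝔻.dualPairing_linDual_right S f s).symm.trans e1
  have h2 : 𝔻.evalDual S f 0 ⟨G, hG⟩ = 0 :=
    neg_eq_zero.1 ((𝔻.dualPairing_vertDual_right S f ⟨G, hG⟩).symm.trans e2)
  have h3 : (s κ.proj, β) = (s κ.proj, 0) + (0, β) := by simp
  have h4 : hG.at_ κ.proj = β := LinearMap.ext hβ
  rw [h3, map_add, ← h4]
  exact (congrArg₂ (· + ·) (congrArg (fun k : FnDual I FC C => k κ) h1)
    (congrArg (fun k : FnDual I FC C => k κ) h2)).trans (add_zero 0)

/-- The local expansion of `g` in generators expresses `φ g` by the values of `φ` on generators;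
these values are the coefficients of `x`, with the sign coming from the pairing. -/
theorem exists_local_dual (φ : 𝔻.flip.dualSec →ₗ[FnDual I FC C] FnDual I FC C) (m : M) :
    ∃ (χ : Fn I M) (x : 𝔻.dualSec), (∀ᶠ y in 𝓝 m, χ y = 1) ∧
      ∀ g, 𝔻.dualPairing S x g = pull χ * φ g := by
  obtain ⟨n, n', s, ε, t, η, χ, hχ, hs, ht⟩ :=
    exists_common_frames (I := I) FA FB (A := A) (B := B) m
  refine ⟨χ, ∑ i, φ (𝔻.flip.linDual (S.flip 𝔻) (s i)) • 𝔻.vertDual (ε i)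
    - ∑ i, φ (𝔻.flip.vertDual (η i)) • 𝔻.linDual S (t i), hχ, fun g => ?_⟩
  have h1 : pull χ * φ g = φ ((pull χ : FnDual I FC C) • g) := (map_smul φ _ g).symm
  rw [h1, 𝔻.flip.pull_smul_eq_sum (S.flip 𝔻) ht hs, map_add, map_sum, map_sum, map_sub,
    LinearMap.sub_apply, map_sum, map_sum, LinearMap.sum_apply, LinearMap.sum_apply, sub_eq_add_neg,
    add_comm, ← Finset.sum_neg_distrib]
  refine congrArg₂ (· + ·) (Finset.sum_congr rfl fun i _ => ?_)
    (Finset.sum_congr rfl fun i _ => ?_)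
  · rw [map_smul, map_smul, LinearMap.smul_apply, dualPairing_linDual, smul_eq_mul, smul_eq_mul,
      mul_neg, neg_neg, mul_comm]
  · rw [map_smul, map_smul, LinearMap.smul_apply, dualPairing_vertDual, smul_eq_mul, smul_eq_mul,
      mul_comm]

theorem dualPairing_surjective (φ : 𝔻.flip.dualSec →ₗ[FnDual I FC C] FnDual I FC C) :
    ∃ f, 𝔻.dualPairing S f = φ := by
  choose χ x hχ hx using 𝔻.exists_local_dual S φ
  -- Uniqueness makes the local solutions agree wherever both cutoffs equal 1. The global solution
  -- takes over each `m` the value of the local one at `m`, so no partition of unity is required.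
  have hχx : ∀ m m', (pull (χ m) : FnDual I FC C) • x m' = (pull (χ m') : FnDual I FC C) • x m := by
    refine fun m m' => 𝔻.dualPairing_injective S (LinearMap.ext fun g => ?_)
    rw [map_smul, map_smul, LinearMap.smul_apply, LinearMap.smul_apply, hx, hx, smul_eq_mul,
      smul_eq_mul]
    ring
  have hsm : ContMDiff ((I.prod 𝓘(ℝ, FA)).prod 𝓘(ℝ, GA →L[ℝ] ℝ)) 𝓘(ℝ, ℝ) ∞
      (fun Φ : DualTot GA (Over FA D) => (x Φ.proj.proj).1 Φ) := by
    intro Φ₀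
    refine (x Φ₀.proj.proj).1.contMDiff.contMDiffAt.congr_of_eventuallyEq ?_
    have hc : ContinuousAt (fun Φ : DualTot GA (Over FA D) => Φ.proj.proj) Φ₀ :=
      ContinuousAt.comp (g := fun p : TotalSpace FA A => p.proj)
        (contMDiffAt_proj (IB := I) (n := ∞) A).continuousAt
        (contMDiffAt_proj (IB := I.prod 𝓘(ℝ, FA)) (n := ∞) (DualFibre (Over FA D))).continuousAt
    filter_upwards [hc.eventually (hχ Φ₀.proj.proj)] with Φ hΦ
    have h1 := congrArg (fun f : 𝔻.dualSec => f.1 Φ) (hχx Φ₀.proj.proj Φ.proj.proj)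
    have h2 : χ Φ₀.proj.proj Φ.proj.proj * (x Φ.proj.proj).1 Φ
      = χ Φ.proj.proj Φ.proj.proj * (x Φ₀.proj.proj).1 Φ := h1
    rwa [hΦ, (hχ Φ.proj.proj).self_of_nhds, one_mul, one_mul] at h2
  refine ⟨⟨⟨_, hsm⟩, ⟨fun {m} _ _ _ _ _ _ h => (x m).2.1 h, fun {m} _ _ _ _ _ h =>
    (x m).2.2 h⟩⟩, LinearMap.ext fun g => ContMDiffMap.ext fun κ => ?_⟩
  have h1 := congrArg (fun k : FnDual I FC C => k κ) (hx κ.proj g)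
  refine Eq.trans h1 ?_
  change χ κ.proj κ.proj * φ g κ = φ g κ
  rw [(hχ κ.proj).self_of_nhds, one_mul]

theorem isPerfPair_dualPairing : (𝔻.dualPairing S).IsPerfPair where
  bijective_left := ⟨𝔻.dualPairing_injective S, 𝔻.dualPairing_surjective S⟩
  bijective_right := by
    have h : (𝔻.dualPairing S).flip = -𝔻.flip.dualPairing (S.flip 𝔻) :=
      LinearMap.ext fun g => LinearMap.ext fun f => ContMDiffMap.ext fun κ =>
        (neg_eq_iff_eq_neg.2 (𝔻.fibrePair_flip S f g κ)).symm
    rw [h]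
    refine ⟨fun f g hfg => 𝔻.flip.dualPairing_injective (S.flip 𝔻) (neg_injective hfg), fun φ => ?_⟩
    obtain ⟨g, hg⟩ := 𝔻.flip.dualPairing_surjective (S.flip 𝔻) (-φ)
    exact ⟨g, (congrArg Neg.neg hg).trans (neg_neg φ)⟩

end DoubleVectorBundle

/-! ### The Lie algebroid `D^*A^*C^*` on generators. -/

namespace DoubleVectorBundle

variable (𝔻 : DoubleVectorBundle I FA FB FC GA GB C D) (S : LinearSplitting I FA FB GA D)

theorem pullCore_injective (S : LinearSplitting I FA FB GA D) :
    Function.Injective 𝔻.pullCore := by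
  intro h k hk
  refine ContMDiffMap.ext fun κ => ?_
  have := congrArg (fun G : FnDual (I.prod 𝓘(ℝ, FA)) GA (Over FA D) =>
    G ⟨⟨κ.proj, 0⟩, 𝔻.dualPt S ⟨κ.proj, 0⟩ 0 κ.snd⟩) hk
  change h (𝔻.toCoreDual _) = k (𝔻.toCoreDual _) at this
  rwa [toCoreDual_dualPt] at this

/-- The projection to `C^*` is the evaluation on core sections. This is what brings brackets and
anchors of core sections into the Lie algebroid over `C^*`. -/
theorem pullCore_ell (c : Sec I FC C) : 𝔻.pullCore (ell c) = ell (𝔻.coreSection c) := rfl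

variable {LD : LieAlgebroid (Fn (I.prod 𝓘(ℝ, FA)) (TotalSpace FA A))
      (Sec (I.prod 𝓘(ℝ, FA)) GA (Over FA D))} {LB : LieAlgebroid (Fn I M) (Sec I FB B)}
  {T : TwoRep LB (Sec I FC C) (Sec I FA A)}
  {P : PoissonBracket (FnDual (I.prod 𝓘(ℝ, FA)) GA (Over FA D))}

theorem poisson_linDual_pull (hP : IsLiePoisson LD P) (hT : 𝔻.IsInducedTwoRep S LD T)
    (b : Sec I FB B) (f : Fn I M) :
    P.bracket (𝔻.linDual S b).1 (𝔻.pullCore (pull f)) = 𝔻.pullCore (pull (LB.anchor b f)) :=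
  (hP.ell_pull _ _).trans (congrArg pull ((hT.anchor_lift b).pull f))

theorem poisson_linDual_ell (hP : IsLiePoisson LD P) (hT : 𝔻.IsInducedTwoRep S LD T)
    (b : Sec I FB B) (c : Sec I FC C) :
    P.bracket (𝔻.linDual S b).1 (𝔻.pullCore (ell c))
      = 𝔻.pullCore (ell (T.nabla₀.nabla b c)) :=
  (hP.ell_ell _ _).trans (congrArg ell (hT.bracket_core b c))

theorem poisson_vertDual_pull (hP : IsLiePoisson LD P) (G : LinFn I FA A) (f : Fn I M) :
    P.bracket (𝔻.vertDual G).1 (𝔻.pullCore (pull f)) = 0 :=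
  hP.pull_pull G.1 (pull f)

theorem poisson_vertDual_ell (hP : IsLiePoisson LD P) (hT : 𝔻.IsInducedTwoRep S LD T)
    (G : LinFn I FA A) (c : Sec I FC C) :
    P.bracket (𝔻.vertDual G).1 (𝔻.pullCore (ell c))
      = 𝔻.pullCore (-pull (compSec G.1 (T.bd c))) := by
  rw [P.skew, pullCore_ell]
  refine (congrArg Neg.neg (hP.ell_pull _ _)).trans ?_
  exact (congrArg (fun H => -pull H) ((hT.anchor_core c).fibreLinear G.2)).trans rfl

theorem dualPt_coreAt (p : TotalSpace FA A) (β : B p.proj →ₗ[ℝ] ℝ) (κ : DualFibre C p.proj)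
    (c : C p.proj) : 𝔻.dualPt S p β κ (𝔻.coreAt p c) = κ c := by
  rw [dualPt_apply, coreAt_base, corePart_coreAt, map_zero, zero_add]

theorem ell_bracket_lift (hT : 𝔻.IsInducedTwoRep S LD T) (b₁ b₂ : Sec I FB B) (a : Sec I FA A)
    (κ : DualTot FC C) (β : B κ.proj →ₗ[ℝ] ℝ) :
    (ell (LD.bracket (S.lift b₁) (S.lift b₂)) :
        FnDual (I.prod 𝓘(ℝ, FA)) GA (Over FA D))
      ⟨⟨κ.proj, a κ.proj⟩, 𝔻.dualPt S ⟨κ.proj, a κ.proj⟩ β κ.snd⟩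
      = β (LB.bracket b₁ b₂ κ.proj) - κ.snd (T.curv b₁ b₂ a κ.proj) := by
  change 𝔻.dualPt S ⟨κ.proj, a κ.proj⟩ β κ.snd
    (LD.bracket (S.lift b₁) (S.lift b₂) ⟨κ.proj, a κ.proj⟩) = _
  rw [hT.bracket_lift]
  erw [map_sub]
  exact congrArg₂ (· - ·) (𝔻.dualPt_atL S _ _ β κ.snd) (𝔻.dualPt_coreAt S ⟨κ.proj, a κ.proj⟩ β κ.snd _)

theorem apply_eq_zero_of_pull_smul {m : M} {κ : DualTot FC C} (hκ : κ.proj = m)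
    {φ : 𝔻.dualSec →ₗ[FnDual I FC C] FnDual I FC C} {x : 𝔻.dualSec} {χ : Fn I M}
    (hχ : ∀ᶠ y in 𝓝 m, χ y = 1) (h : φ ((pull χ : FnDual I FC C) • x) = 0) : φ x κ = 0 := by
  subst hκ
  rw [map_smul] at h
  have h1 : χ κ.proj * φ x κ = 0 := congrArg (fun k : FnDual I FC C => k κ) h
  rwa [hχ.self_of_nhds, one_mul] at h1

/-- In the local expansion of `x` the coefficients of the generators `linDual` are, up to sign, the
pairings with the sections `vertDual` of the other side, hence they vanish. -/
theorem eq_zero_of_vertical (φ : 𝔻.dualSec →ₗ[FnDual I FC C] FnDual I FC C)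
    (hφ : ∀ α, φ (𝔻.vertDual α) = 0) (x : 𝔻.dualSec)
    (hx : ∀ β, 𝔻.dualPairing S x (𝔻.flip.vertDual β) = 0) : φ x = 0 := by
  refine ContMDiffMap.ext fun κ => ?_
  obtain ⟨n, n', s, ε, t, η, χ, hχ, hs, ht⟩ :=
    exists_common_frames (I := I) FA FB (A := A) (B := B) κ.proj
  refine 𝔻.apply_eq_zero_of_pull_smul rfl hχ ?_
  rw [𝔻.pull_smul_eq_sum S hs ht, map_add, map_sum, map_sum]
  refine (congrArg₂ (· + ·) (Finset.sum_eq_zero fun i _ => ?_)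
    (Finset.sum_eq_zero fun i _ => ?_)).trans (add_zero 0)
  · rw [map_smul, hφ, smul_zero]
  · have := hx (η i)
    rw [dualPairing_vertDual_right, neg_eq_zero] at this
    rw [this, zero_smul, map_zero]

theorem eq_zero_of_generators (S : LinearSplitting I FA FB GA D)
    (φ : 𝔻.dualSec →ₗ[FnDual I FC C] FnDual I FC C)
    (hφ : ∀ α, φ (𝔻.vertDual α) = 0) (hφ' : ∀ b, φ (𝔻.linDual S b) = 0) : φ = 0 := by
  refine LinearMap.ext fun x => ContMDiffMap.ext fun κ => ?_
  obtain ⟨n, n', s, ε, t, η, χ, hχ, hs, ht⟩ :=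
    exists_common_frames (I := I) FA FB (A := A) (B := B) κ.proj
  refine 𝔻.apply_eq_zero_of_pull_smul rfl hχ ?_
  rw [𝔻.pull_smul_eq_sum S hs ht, map_add, map_sum, map_sum]
  refine (congrArg₂ (· + ·) (Finset.sum_eq_zero fun i _ => ?_)
    (Finset.sum_eq_zero fun i _ => ?_)).trans (add_zero 0)
  · rw [map_smul, hφ, smul_zero]
  · rw [map_smul, hφ', smul_zero]

variable {L : LieAlgebroid (FnDual I FC C) 𝔻.dualSec}

/-- The Lie algebroid structure of `D^*A^*C^*` on generators. -/
theorem dualRelations (hL : 𝔻.IsDualLieAlgebroid LD L) (hT : 𝔻.IsInducedTwoRep S LD T) :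
    DualRelations T L (𝔻.dualPairing S) (pullHom I (FC →L[ℝ] ℝ) (DualFibre C)) ellHom
      (LinFn.ev (I := I) (FA := FA) (A := A)) (LinFn.ev (I := I) (FA := FB) (A := B))
      (𝔻.linDual S) 𝔻.vertDual
      (𝔻.flip.linDual (S.flip 𝔻)) 𝔻.flip.vertDual := by
  obtain ⟨P, hP, hbr, hanc⟩ := hL
  refine
    { pair_s_s := fun b a => ?_
      pair_s_i := fun b β => ?_
      pair_i_s := fun α a => ?_
      pair_i_i := fun α β => ?_
      anchor_s_pull := fun b f => ?_
      anchor_s_ell := fun b c => ?_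
      anchor_i_pull := fun α f => ?_
      anchor_i_ell := fun α c => ?_
      bracket_s_i := fun b α => ?_
      bracket_i_i := fun α α' => ?_
      pair_bracket_s := fun b₁ b₂ a => ?_
      pair_bracket_i := fun b₁ b₂ β => ?_
      eq_zero_of_vertical := 𝔻.eq_zero_of_vertical S
      eq_zero := 𝔻.eq_zero_of_generators S }
  · rw [dualPairing_linDual_right]
    exact ContMDiffMap.ext fun κ => 𝔻.fibreVal_linDual S b κ _ _
  · rw [dualPairing_vertDual_right]
    exact congrArg Neg.neg (ContMDiffMap.ext fun κ => 𝔻.fibreVal_linDual S b κ _ _)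
  · rw [dualPairing_linDual_right]
    rfl
  · rw [dualPairing_vertDual_right]
    exact (congrArg Neg.neg (ContMDiffMap.ext fun κ => (α.2 κ.proj).map_zero)).trans neg_zero
  · exact 𝔻.pullCore_injective S ((hanc _ _).symm.trans (𝔻.poisson_linDual_pull S hP hT b f))
  · exact 𝔻.pullCore_injective S ((hanc _ _).symm.trans (𝔻.poisson_linDual_ell S hP hT b c))
  · exact 𝔻.pullCore_injective S ((hanc _ _).symm.trans (𝔻.poisson_vertDual_pull hP α f))
  · exact 𝔻.pullCore_injective S ((hanc _ _).symm.trans (𝔻.poisson_vertDual_ell S hP hT α c))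
  · have h := (hT.anchor_lift b).fibreLinear α.1 α.2
    refine ⟨⟨_, h⟩, Subtype.ext ((hbr _ _).trans (hP.ell_pull _ _)), fun a => ?_⟩
    exact (hT.anchor_lift b).apply α.1 α.2 a
  · exact Subtype.ext ((hbr _ _).trans (hP.pull_pull _ _))
  · rw [dualPairing_linDual_right]
    refine ContMDiffMap.ext fun κ => ?_
    have h := congrArg (fun G : FnDual (I.prod 𝓘(ℝ, FA)) GA (Over FA D) =>
      G ⟨⟨κ.proj, a κ.proj⟩, 𝔻.dualPt S ⟨κ.proj, a κ.proj⟩ 0 κ.snd⟩)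
      ((hbr (𝔻.linDual S b₁) (𝔻.linDual S b₂)).trans (hP.ell_ell _ _))
    exact (h.trans (𝔻.ell_bracket_lift S hT b₁ b₂ a κ 0)).trans (zero_sub _)
  · rw [dualPairing_vertDual_right]
    refine congrArg Neg.neg (ContMDiffMap.ext fun κ => ?_)
    -- The pairing with a vertical section is an evaluation over the zero section of `A`, where the
    -- curvature term vanishes by linearity.
    have h := congrArg (fun G : FnDual (I.prod 𝓘(ℝ, FA)) GA (Over FA D) =>
      G ⟨⟨κ.proj, (0 : Sec I FA A) κ.proj⟩,
        𝔻.dualPt S ⟨κ.proj, (0 : Sec I FA A) κ.proj⟩ (β.2.at_ κ.proj) κ.snd⟩)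
      ((hbr (𝔻.linDual S b₁) (𝔻.linDual S b₂)).trans (hP.ell_ell _ _))
    refine (h.trans (𝔻.ell_bracket_lift S hT b₁ b₂ 0 κ (β.2.at_ κ.proj))).trans ?_
    rw [map_zero]
    exact (congrArg (_ - ·) (map_zero κ.snd)).trans (sub_zero _)

end DoubleVectorBundle

/-! ### Existence of the Lie algebroid `D^*A^*C^*`. -/

namespace DoubleVectorBundle

variable (𝔻 : DoubleVectorBundle I FA FB FC GA GB C D) (S : LinearSplitting I FA FB GA D)

/-- The generators generate only locally, so membership is obtained for cut-off sections; the
locality of Poisson brackets then removes the cutoff. -/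
theorem exists_pull_smul_mem (N : Submodule (FnDual I FC C) 𝔻.dualSec)
    (hv : ∀ G, 𝔻.vertDual G ∈ N) (hl : ∀ b, 𝔻.linDual S b ∈ N) (m : M) :
    ∃ χ : Fn I M, (∀ᶠ y in 𝓝 m, χ y = 1) ∧ ∀ f, (pull χ : FnDual I FC C) • f ∈ N := by
  obtain ⟨n, n', s, ε, t, η, χ, hχ, hs, ht⟩ :=
    exists_common_frames (I := I) FA FB (A := A) (B := B) m
  refine ⟨χ, hχ, fun f => ?_⟩
  rw [𝔻.pull_smul_eq_sum S hs ht]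
  exact N.add_mem (N.sum_mem fun i _ => N.smul_mem _ (hv _))
    (N.sum_mem fun i _ => N.smul_mem _ (hl _))

theorem continuous_proj_proj :
    Continuous (fun Φ : DualTot GA (Over FA D) => Φ.proj.proj) :=
  (FiberBundle.continuous_proj FA A).comp (FiberBundle.continuous_proj _ (DualFibre (Over FA D)))

variable {LD : LieAlgebroid (Fn (I.prod 𝓘(ℝ, FA)) (TotalSpace FA A))
      (Sec (I.prod 𝓘(ℝ, FA)) GA (Over FA D))} {LB : LieAlgebroid (Fn I M) (Sec I FB B)}
  {T : TwoRep LB (Sec I FC C) (Sec I FA A)}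
  (P : PoissonBracket (FnDual (I.prod 𝓘(ℝ, FA)) GA (Over FA D)))

/-- The value of `{G, ·}` at a point. -/
def poissonAt (G : FnDual (I.prod 𝓘(ℝ, FA)) GA (Over FA D)) (Φ : DualTot GA (Over FA D)) :
    FnDual (I.prod 𝓘(ℝ, FA)) GA (Over FA D) →ₗ[ℝ] ℝ where
  toFun H := P.bracket G H Φ
  map_add' H H' := by rw [map_add]; rfl
  map_smul' r H := by rw [map_smul]; rfl

theorem isPointDerivation_poissonAt (G : FnDual (I.prod 𝓘(ℝ, FA)) GA (Over FA D))
    (Φ : DualTot GA (Over FA D)) : IsPointDerivation Φ (poissonAt P G Φ) := by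
  intro H H'
  have := congrArg (fun K : FnDual (I.prod 𝓘(ℝ, FA)) GA (Over FA D) => K Φ) (P.leibniz G H H')
  refine this.trans ?_
  change P.bracket G H Φ * H' Φ + H Φ * P.bracket G H' Φ
    = H Φ * P.bracket G H' Φ + H' Φ * P.bracket G H Φ
  ring

theorem poisson_congr_right (G : FnDual (I.prod 𝓘(ℝ, FA)) GA (Over FA D))
    {f : 𝔻.dualSec} {χ : Fn I M} {Φ : DualTot GA (Over FA D)}
    (hχ : ∀ᶠ y in 𝓝 Φ.proj.proj, χ y = 1) :
    P.bracket G f.1 Φ = P.bracket G ((pull χ : FnDual I FC C) • f).1 Φ := by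
  have : T2Space (TotalSpace FA A) := t2Space_totalSpace
  have : T2Space (DualTot GA (Over FA D)) := t2Space_totalSpace
  refine (isPointDerivation_poissonAt P G Φ).congr ?_
  filter_upwards [(continuous_proj_proj (D := D)).continuousAt.eventually hχ] with Ψ hΨ
  have h1 : ((pull χ : FnDual I FC C) • f).1 Ψ = χ Ψ.proj.proj * f.1 Ψ := rfl
  rw [h1, hΨ, one_mul]

theorem poisson_congr_left (G : FnDual (I.prod 𝓘(ℝ, FA)) GA (Over FA D))
    {f : 𝔻.dualSec} {χ : Fn I M} {Φ : DualTot GA (Over FA D)}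
    (hχ : ∀ᶠ y in 𝓝 Φ.proj.proj, χ y = 1) :
    P.bracket f.1 G Φ = P.bracket ((pull χ : FnDual I FC C) • f).1 G Φ := by
  rw [P.skew, P.skew _ G]
  exact congrArg Neg.neg (𝔻.poisson_congr_right P G hχ)

/-- The value of `{G, ·}` at a point, on functions pulled back from `C^*`. -/
def poissonCoreAt (G : FnDual (I.prod 𝓘(ℝ, FA)) GA (Over FA D)) (Φ : DualTot GA (Over FA D)) :
    FnDual I FC C →ₗ[ℝ] ℝ where
  toFun h := P.bracket G (𝔻.pullCore h) Φ
  map_add' h k := (poissonAt P G Φ).map_add (𝔻.pullCore h) (𝔻.pullCore k)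
  map_smul' r h := (poissonAt P G Φ).map_smul r (𝔻.pullCore h)

theorem isPointDerivation_poissonCoreAt (G : FnDual (I.prod 𝓘(ℝ, FA)) GA (Over FA D))
    (Φ : DualTot GA (Over FA D)) :
    IsPointDerivation (𝔻.toCoreDual Φ) (𝔻.poissonCoreAt P G Φ) := fun h k =>
  isPointDerivation_poissonAt P G Φ (𝔻.pullCore h) (𝔻.pullCore k)

variable {P}

/-- Each side, as a function of `h`, is a derivation at the same point of `C^*`, hence is determined
by pullbacks and functions `ℓ_c`. -/
theorem poisson_pullCore_congr {G G' : FnDual (I.prod 𝓘(ℝ, FA)) GA (Over FA D)}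
    {Φ Φ' : DualTot GA (Over FA D)} (hΦ : 𝔻.toCoreDual Φ = 𝔻.toCoreDual Φ')
    (h₁ : ∀ f : Fn I M, P.bracket G (𝔻.pullCore (pull f)) Φ = P.bracket G' (𝔻.pullCore (pull f)) Φ')
    (h₂ : ∀ c, P.bracket G (𝔻.pullCore (ell c)) Φ = P.bracket G' (𝔻.pullCore (ell c)) Φ')
    (h : FnDual I FC C) : P.bracket G (𝔻.pullCore h) Φ = P.bracket G' (𝔻.pullCore h) Φ' := by
  have h' := 𝔻.isPointDerivation_poissonCoreAt P G' Φ'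
  rw [← hΦ] at h'
  exact (𝔻.isPointDerivation_poissonCoreAt P G Φ).dual_ext h' h₁ h₂ h

theorem poisson_pullCore_eq_zero {G : FnDual (I.prod 𝓘(ℝ, FA)) GA (Over FA D)}
    (h₁ : ∀ f : Fn I M, P.bracket G (𝔻.pullCore (pull f)) = 0)
    (h₂ : ∀ c, P.bracket G (𝔻.pullCore (ell c)) = 0)
    (h : FnDual I FC C) : P.bracket G (𝔻.pullCore h) = 0 := by
  refine ContMDiffMap.ext fun Φ => ?_
  have h0 : ∀ H, P.bracket 0 H Φ = 0 := fun H => by rw [map_zero]; rfl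
  refine (𝔻.poisson_pullCore_congr (P := P) (G := G) (G' := 0) (Φ := Φ) rfl (fun f => ?_)
    (fun c => ?_) h).trans (h0 _)
  · rw [h0, h₁]; rfl
  · rw [h0, h₂]; rfl

/-- Core sections commute and their anchors annihilate pullbacks, so the generators of `C^∞(C^*)`
commute; the general case follows one argument at a time. -/
theorem poisson_pullCore_pullCore (hP : IsLiePoisson LD P) (hD : 𝔻.IsVBAlgebroid LD LB)
    (h k : FnDual I FC C) : P.bracket (𝔻.pullCore h) (𝔻.pullCore k) = 0 := by
  have h1 : ∀ (c : Sec I FC C) (f : Fn I M),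
      P.bracket (𝔻.pullCore (ell c)) (𝔻.pullCore (pull f)) = 0 := by
    intro c f
    obtain ⟨a, ha⟩ := hD.anchor_core c
    exact (hP.ell_pull (𝔻.coreSection c) (pull f)).trans (congrArg pull (ha.pull f))
  have h2 : ∀ (f : Fn I M) (c : Sec I FC C),
      P.bracket (𝔻.pullCore (pull f)) (𝔻.pullCore (ell c)) = 0 := fun f c => by
    rw [P.skew, h1, neg_zero]
  have h3 : ∀ (f : Fn I M) k, P.bracket (𝔻.pullCore (pull f)) (𝔻.pullCore k) = 0 := fun f =>
    𝔻.poisson_pullCore_eq_zero (fun g => hP.pull_pull (pull f) (pull g)) (h2 f)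
  have h4 : ∀ c k, P.bracket (𝔻.pullCore (ell c)) (𝔻.pullCore k) = 0 := fun c =>
    𝔻.poisson_pullCore_eq_zero (h1 c) fun c' =>
      (hP.ell_ell (𝔻.coreSection c) (𝔻.coreSection c')).trans
        ((congrArg ell (hD.core_core c c')).trans ell_zero)
  refine 𝔻.poisson_pullCore_eq_zero (fun f => ?_) (fun c => ?_) k
  · rw [P.skew, h3, neg_zero]
  · rw [P.skew, h4, neg_zero]

/-- The sections `f` of `D^*A^*C^*` for which `{f, ·}` preserves the functions pulled back from
`C^*`. -/
def basicSubmodule (hP : IsLiePoisson LD P) (hD : 𝔻.IsVBAlgebroid LD LB) :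
    Submodule (FnDual I FC C) 𝔻.dualSec where
  carrier := {f | ∀ (h : FnDual I FC C) (Φ Φ' : DualTot GA (Over FA D)),
    𝔻.toCoreDual Φ = 𝔻.toCoreDual Φ' →
      P.bracket f.1 (𝔻.pullCore h) Φ = P.bracket f.1 (𝔻.pullCore h) Φ'}
  add_mem' := by
    intro f g hf hg h Φ Φ' hΦ
    have h1 : ∀ Ψ, P.bracket (f + g).1 (𝔻.pullCore h) Ψ
        = P.bracket f.1 (𝔻.pullCore h) Ψ + P.bracket g.1 (𝔻.pullCore h) Ψ := by
      intro Ψ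
      rw [Submodule.coe_add, map_add]
      rfl
    rw [h1, h1, hf h Φ Φ' hΦ, hg h Φ Φ' hΦ]
  zero_mem' := by
    intro h Φ Φ' hΦ
    rw [Submodule.coe_zero, map_zero]
    rfl
  smul_mem' := by
    intro k f hf h Φ Φ' hΦ
    have h1 : ∀ Ψ, P.bracket (k • f).1 (𝔻.pullCore h) Ψ
        = k (𝔻.toCoreDual Ψ) * P.bracket f.1 (𝔻.pullCore h) Ψ := by
      intro Ψ
      -- Expanding the product, the term with the bracket of two pulled-back functions drops out, so
      -- the condition is stable under `C^∞(C^*)`.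
      have h2 : (k • f).1 = 𝔻.pullCore k * f.1 := rfl
      rw [P.skew, h2, P.leibniz, P.skew _ (𝔻.pullCore k),
        𝔻.poisson_pullCore_pullCore hP hD, neg_zero, zero_mul, zero_add, ← mul_neg, ← P.skew]
      rfl
    rw [h1, h1, hf h Φ Φ' hΦ, hΦ]

/-- The Hamiltonian vector field of a section of the dual projects to `C^*`. For generators this is
seen from the 2-representation, in general from local generation. -/
theorem poisson_pullCore_eq (hP : IsLiePoisson LD P) (hD : 𝔻.IsVBAlgebroid LD LB)
    (hT : 𝔻.IsInducedTwoRep S LD T) (f : 𝔻.dualSec) (h : FnDual I FC C)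
    (Φ Φ' : DualTot GA (Over FA D)) (hΦ : 𝔻.toCoreDual Φ = 𝔻.toCoreDual Φ') :
    P.bracket f.1 (𝔻.pullCore h) Φ = P.bracket f.1 (𝔻.pullCore h) Φ' := by
  have hm : Φ'.proj.proj = Φ.proj.proj := congrArg (fun κ : DualTot FC C => κ.proj) hΦ.symm
  have hv : ∀ G, 𝔻.vertDual G ∈ 𝔻.basicSubmodule hP hD := by
    refine fun G k Ψ Ψ' hΨ => 𝔻.poisson_pullCore_congr hΨ (fun g => ?_) (fun c => ?_) k
    · rw [𝔻.poisson_vertDual_pull hP]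
      rfl
    · rw [𝔻.poisson_vertDual_ell S hP hT]
      exact congrArg (fun κ => (-pull (compSec G.1 (T.bd c)) : FnDual I FC C) κ) hΨ
  have hl : ∀ b, 𝔻.linDual S b ∈ 𝔻.basicSubmodule hP hD := by
    refine fun b k Ψ Ψ' hΨ => 𝔻.poisson_pullCore_congr hΨ (fun g => ?_) (fun c => ?_) k
    · rw [𝔻.poisson_linDual_pull S hP hT]
      exact congrArg (fun κ => (pull (LB.anchor b g) : FnDual I FC C) κ) hΨ
    · rw [𝔻.poisson_linDual_ell S hP hT]
      exact congrArg (fun κ => (ell (T.nabla₀.nabla b c) : FnDual I FC C) κ) hΨ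
  obtain ⟨χ, hχ, hf⟩ := 𝔻.exists_pull_smul_mem S _ hv hl Φ.proj.proj
  rw [𝔻.poisson_congr_left P _ hχ, 𝔻.poisson_congr_left P (Φ := Φ') _ (by rw [hm]; exact hχ)]
  exact hf f h Φ Φ' hΦ

theorem exists_poisson_eq_pullCore (hP : IsLiePoisson LD P) (hD : 𝔻.IsVBAlgebroid LD LB)
    (hT : 𝔻.IsInducedTwoRep S LD T) (f : 𝔻.dualSec) (h : FnDual I FC C) :
    ∃ k, P.bracket f.1 (𝔻.pullCore h) = 𝔻.pullCore k := by
  -- A function constant on the fibres over `C^*` descends; its smoothness is checked along the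
  -- section of `D^*A → C^*` with zero components in `A` and `B^*`.
  refine ⟨⟨_, (P.bracket f.1 (𝔻.pullCore h)).contMDiff.comp
    (𝔻.contMDiff_dualPt S 0 FibreLinear.zero)⟩, ContMDiffMap.ext fun Φ => ?_⟩
  exact 𝔻.poisson_pullCore_eq S hP hD hT f h _ _ 
    (𝔻.toCoreDual_dualPt S ⟨Φ.proj.proj, (0 : Sec I FA A) Φ.proj.proj⟩
      (FibreLinear.zero.at_ _) (𝔻.toCoreDual Φ).snd).symm

/-- The sections `g` of `D^*A^*C^*` for which `{G, g}` is a section of `D^*A^*C^*`. -/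
def bracketSubmodule (P : PoissonBracket (FnDual (I.prod 𝓘(ℝ, FA)) GA (Over FA D)))
    (f : FnDual (I.prod 𝓘(ℝ, FA)) GA (Over FA D))
    (hf : ∀ h : FnDual I FC C, ∃ k, P.bracket f (𝔻.pullCore h) = 𝔻.pullCore k) :
    Submodule (FnDual I FC C) 𝔻.dualSec where
  carrier := {g | P.bracket f g.1 ∈ 𝔻.dualSec}
  add_mem' := by
    intro g g' hg hg'
    rw [Set.mem_setOf_eq, Submodule.coe_add, map_add]
    exact 𝔻.dualSec.add_mem hg hg'
  zero_mem' := by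
    rw [Set.mem_setOf_eq, Submodule.coe_zero, map_zero]
    exact 𝔻.dualSec.zero_mem
  smul_mem' := by
    intro h g hg
    obtain ⟨k, hk⟩ := hf h
    have h1 : (h • g).1 = 𝔻.pullCore h * g.1 := rfl
    rw [Set.mem_setOf_eq, h1, P.leibniz, hk]
    exact 𝔻.dualSec.add_mem (k • g).2 (h • (⟨_, hg⟩ : 𝔻.dualSec)).2

theorem mem_dualSec_of_local {f : FnDual (I.prod 𝓘(ℝ, FA)) GA (Over FA D)}
    (h : ∀ m : M, ∃ g : 𝔻.dualSec, ∀ Φ : DualTot GA (Over FA D), Φ.proj.proj = m → f Φ = g.1 Φ) :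
    f ∈ 𝔻.dualSec := by
  choose g hg using h
  constructor
  · intro m a₁ a₂ a₃ Φ₁ Φ₂ Φ₃ hΦ
    rw [hg m _ rfl, hg m _ rfl, hg m _ rfl]
    exact (g m).2.1 hΦ
  · intro m a₁ a₂ r Φ₁ Φ₂ hΦ
    rw [hg m _ rfl, hg m _ rfl]
    exact (g m).2.2 hΦ

/-- Linearity over `C^*` is a condition on each fibre over `M`, where the cutoff is invisible. The
hypothesis `hf` handles multiplication by functions on `C^*`. -/
theorem poisson_mem_of_generators (S : LinearSplitting I FA FB GA D)
    {f : FnDual (I.prod 𝓘(ℝ, FA)) GA (Over FA D)}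
    (hf : ∀ h : FnDual I FC C, ∃ k, P.bracket f (𝔻.pullCore h) = 𝔻.pullCore k)
    (hv : ∀ G, P.bracket f (𝔻.vertDual G).1 ∈ 𝔻.dualSec)
    (hl : ∀ b, P.bracket f (𝔻.linDual S b).1 ∈ 𝔻.dualSec) (g : 𝔻.dualSec) :
    P.bracket f g.1 ∈ 𝔻.dualSec := by
  refine 𝔻.mem_dualSec_of_local fun m => ?_
  obtain ⟨χ, hχ, hg⟩ := 𝔻.exists_pull_smul_mem S (𝔻.bracketSubmodule P f hf) hv hl m
  refine ⟨⟨_, hg g⟩, fun Φ hΦ => ?_⟩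
  subst hΦ
  exact 𝔻.poisson_congr_right P f hχ

theorem poisson_mem_dualSec (hP : IsLiePoisson LD P) (hD : 𝔻.IsVBAlgebroid LD LB)
    (hT : 𝔻.IsInducedTwoRep S LD T) (f g : 𝔻.dualSec) : P.bracket f.1 g.1 ∈ 𝔻.dualSec := by
  have hb := 𝔻.exists_poisson_eq_pullCore S hP hD hT
  have hll : ∀ b b', P.bracket (𝔻.linDual S b).1 (𝔻.linDual S b').1 ∈ 𝔻.dualSec := by
    intro b b'
    have h1 := hP.ell_ell (S.lift b) (S.lift b')
    have h2 := 𝔻.ell_mem_dualSec (hD.linear_linear _ _ _ _ (S.isLinearSection_lift 𝔻 b)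
      (S.isLinearSection_lift 𝔻 b'))
    rw [← h1] at h2
    exact h2
  have hlv : ∀ b G, P.bracket (𝔻.linDual S b).1 (𝔻.vertDual G).1 ∈ 𝔻.dualSec := by
    intro b G
    have h1 := hP.ell_pull (S.lift b) G.1
    have h2 := (𝔻.vertDual ⟨_, (hT.anchor_lift b).fibreLinear G.1 G.2⟩).2
    have h3 : pull (LD.anchor (S.lift b) G.1) ∈ 𝔻.dualSec := h2
    rw [← h1] at h3
    exact h3
  have hvv : ∀ G G', P.bracket (𝔻.vertDual G).1 (𝔻.vertDual G').1 ∈ 𝔻.dualSec := by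
    intro G G'
    have h1 : P.bracket (𝔻.vertDual G).1 (𝔻.vertDual G').1 = 0 := hP.pull_pull G.1 G'.1
    rw [h1]
    exact 𝔻.dualSec.zero_mem
  have hvl : ∀ G b, P.bracket (𝔻.vertDual G).1 (𝔻.linDual S b).1 ∈ 𝔻.dualSec := by
    intro G b
    rw [P.skew]
    exact 𝔻.dualSec.neg_mem (hlv b G)
  -- The reduction to generators is applied to `g` and then, after skew-symmetry, to `f`.
  refine 𝔻.poisson_mem_of_generators S (hb f) (fun G => ?_) (fun b => ?_) g
  · rw [P.skew]
    exact 𝔻.dualSec.neg_mem (𝔻.poisson_mem_of_generators S (hb _) (hvv G) (hvl G) f)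
  · rw [P.skew]
    exact 𝔻.dualSec.neg_mem (𝔻.poisson_mem_of_generators S (hb _) (hlv b) (hll b) f)

theorem exists_anchor (hP : IsLiePoisson LD P) (hD : 𝔻.IsVBAlgebroid LD LB)
    (hT : 𝔻.IsInducedTwoRep S LD T) (f : 𝔻.dualSec) :
    ∃ δ : Derivation ℝ (FnDual I FC C) (FnDual I FC C),
      ∀ h, P.bracket f.1 (𝔻.pullCore h) = 𝔻.pullCore (δ h) := by
  choose an han using 𝔻.exists_poisson_eq_pullCore S hP hD hT f
  have inj := 𝔻.pullCore_injective S
  let l : FnDual I FC C →ₗ[ℝ] FnDual I FC C :=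
    { toFun := an
      map_add' := fun h k => inj <| by
        have e : 𝔻.pullCore (h + k) = 𝔻.pullCore h + 𝔻.pullCore k := rfl
        rw [← han, e, map_add, han, han]
        rfl
      map_smul' := fun r h => inj <| by
        have e : 𝔻.pullCore (r • h) = r • 𝔻.pullCore h := rfl
        rw [← han, e, map_smul, han]
        rfl }
  refine ⟨Derivation.mk' l fun h k => inj ?_, han⟩
  refine (han (h * k)).symm.trans ((P.leibniz f.1 (𝔻.pullCore h) (𝔻.pullCore k)).trans ?_)
  rw [han, han]
  change _ = 𝔻.pullCore h * 𝔻.pullCore (an k) + 𝔻.pullCore k * 𝔻.pullCore (an h)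
  rw [add_comm, mul_comm (𝔻.pullCore (an h))]

/-- Sections of the dual are closed under the Lie–Poisson bracket, and their Hamiltonian vector
fields project to `C^*`. The axioms are then identities of the Poisson bracket, those of the anchor
being checked after the injective pullback to `D^*A`. -/
theorem exists_isDualLieAlgebroid (hD : 𝔻.IsVBAlgebroid LD LB)
    (hT : 𝔻.IsInducedTwoRep S LD T) :
    ∃ L : LieAlgebroid (FnDual I FC C) 𝔻.dualSec, 𝔻.IsDualLieAlgebroid LD L := by
  have : T2Space (TotalSpace FA A) := t2Space_totalSpace
  obtain ⟨P, hP⟩ := exists_isLiePoisson LD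
  have inj := 𝔻.pullCore_injective S
  choose δ hδ using 𝔻.exists_anchor S hP hD hT
  have hbr : ∀ f g h, P.bracket (P.bracket f.1 g.1) (𝔻.pullCore h)
      = 𝔻.pullCore (δ f (δ g h) - δ g (δ f h)) := by
    intro f g h
    rw [P.bracket_bracket, hδ, hδ, hδ, hδ]
    rfl
  have hl : ∀ (f : 𝔻.dualSec) (h : FnDual I FC C) (g : 𝔻.dualSec), P.bracket f.1 (𝔻.pullCore h * g.1)
      = 𝔻.pullCore h * P.bracket f.1 g.1 + 𝔻.pullCore (δ f h) * g.1 := by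
    intro f h g
    rw [P.leibniz, hδ, add_comm]
  let anc : 𝔻.dualSec →ₗ[FnDual I FC C] Derivation ℝ (FnDual I FC C) (FnDual I FC C) :=
    { toFun := δ
      map_add' := fun f g => Derivation.ext fun h => inj <| by
        rw [← hδ, Submodule.coe_add, map_add, LinearMap.add_apply, hδ, hδ]
        rfl
      map_smul' := fun k f => Derivation.ext fun h => inj <| by
        have e : (k • f).1 = 𝔻.pullCore k * f.1 := rfl
        rw [← hδ, e, P.skew, P.leibniz, P.skew _ (𝔻.pullCore k),
          𝔻.poisson_pullCore_pullCore hP hD, neg_zero, zero_mul, zero_add, ← mul_neg,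
          ← P.skew, hδ]
        rfl }
  let L : LieAlgebroid (FnDual I FC C) 𝔻.dualSec :=
    { anchor := anc
      bracket := fun f g => ⟨P.bracket f.1 g.1, 𝔻.poisson_mem_dualSec S hP hD hT f g⟩
      bracket_add := fun f g h => Subtype.ext (map_add (P.bracket f.1) g.1 h.1)
      add_bracket := fun f g h => Subtype.ext (LinearMap.map_add₂ P.bracket f.1 g.1 h.1)
      bracket_self := fun f => Subtype.ext (P.bracket_self f.1)
      jacobi := fun f g h => Subtype.ext (P.jacobi f.1 g.1 h.1)
      leibniz := fun f h g => Subtype.ext (hl f h g)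
      anchor_bracket := fun f g h => inj <|
        (hδ _ h).symm.trans (hbr f g h) }
  exact ⟨L, P, hP, fun _ _ => rfl, hδ⟩

end DoubleVectorBundle

/-! ### Rank conditions and the equivalence. -/

theorem ellHom_injective :
    Function.Injective (ellHom : Sec I FC C →+ FnDual I FC C) := by
  intro s t h
  refine Sec.ext_of_fibreLinear fun G hG => ContMDiffMap.ext fun x => ?_
  exact congrArg (fun k : FnDual I FC C => k ⟨x, ⟨hG.at_ x, continuous_of_fibre FC _⟩⟩) h

theorem LinFn.eq_zero_of_ev {a : Sec I FA A} (h : ∀ G : LinFn I FA A, G.ev a = 0) : a = 0 :=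
  Sec.ext_of_fibreLinear fun G hG => (h ⟨G, hG⟩).trans hG.compSec_zero.symm

namespace DoubleVectorBundle

variable (𝔻 : DoubleVectorBundle I FA FB FC GA GB C D) (S : LinearSplitting I FA FB GA D)

/-- The fibre `B_m ⊕ A_m^*` has dimension at least 2, so the linear form given by `y` at `κ` has a
non-zero vector in its kernel. Extending this vector to a section `x` supplies what
`mixedDefect_eq_zero` needs, and the case `y = 0` what `functionDefect_eq_zero` needs. -/
theorem exists_pairing_ne_zero (hrank : 2 ≤ Module.finrank ℝ FA + Module.finrank ℝ FB)
    (y : 𝔻.flip.dualSec) (κ : DualTot FC C) : ∃ (x : 𝔻.dualSec) (y' : 𝔻.flip.dualSec),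
      𝔻.dualPairing S x y κ = 0 ∧ 𝔻.dualPairing S x y' κ ≠ 0 := by
  let eA := ((trivializationAt FA A κ.proj).continuousLinearEquivAt ℝ κ.proj
    (FiberBundle.mem_baseSet_trivializationAt' κ.proj)).toLinearEquiv
  let eB := ((trivializationAt FB B κ.proj).continuousLinearEquivAt ℝ κ.proj
    (FiberBundle.mem_baseSet_trivializationAt' κ.proj)).toLinearEquiv
  have : Module.Finite ℝ (A κ.proj) := Module.Finite.equiv eA.symm
  have : Module.Finite ℝ (B κ.proj) := Module.Finite.equiv eB.symm
  have hdim : Module.finrank ℝ ℝ < Module.finrank ℝ (B κ.proj × (A κ.proj →ₗ[ℝ] ℝ)) := by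
    rw [Module.finrank_prod, Module.finrank_self, eB.finrank_eq]
    have : Module.finrank ℝ (A κ.proj →ₗ[ℝ] ℝ) = Module.finrank ℝ FA :=
      (Subspace.dual_finrank_eq (K := ℝ) (V := A κ.proj)).trans eA.finrank_eq
    omega
  obtain ⟨⟨b, α⟩, hker, hne⟩ := Submodule.exists_mem_ne_zero_of_ne_bot
    (LinearMap.ker_ne_bot_of_finrank_lt (f := 𝔻.flip.fibreVal (S.flip 𝔻) y κ) hdim)
  obtain ⟨s, hs⟩ := exists_section_through I FB b
  obtain ⟨G, hG, hα⟩ := exists_fibreLinear_through I FA α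
  -- The chosen section pairs with any `z` as the value of `z` at the kernel vector `(b, α)`; the
  -- minus sign compensates that of the pairing with `linDual`.
  have hval : ∀ z : 𝔻.flip.dualSec,
      𝔻.dualPairing S (𝔻.vertDual ⟨G, hG⟩ - 𝔻.linDual S s) z κ
        = 𝔻.flip.fibreVal (S.flip 𝔻) z κ (b, α) := by
    intro z
    have h1 : (b, α) = (0, α) + (b, (0 : A κ.proj →ₗ[ℝ] ℝ)) := by simp
    have h2 : hG.at_ κ.proj = α := LinearMap.ext hα
    rw [map_sub, LinearMap.sub_apply, dualPairing_vertDual, dualPairing_linDual, sub_neg_eq_add, h1,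
      ← h2, ← hs]
    erw [map_add]
    rfl
  refine ⟨𝔻.vertDual ⟨G, hG⟩ - 𝔻.linDual S s, ?_⟩
  by_cases hb : b = 0
  · have hα0 : ∃ a, α a ≠ 0 := by
      by_contra! h
      exact hne (Prod.ext hb (LinearMap.ext h))
    obtain ⟨a, ha⟩ := hα0
    obtain ⟨t, ht⟩ := exists_section_through I FA a
    refine ⟨𝔻.flip.linDual (S.flip 𝔻) t, (hval y).trans hker, ?_⟩
    rw [hval, 𝔻.flip.fibreVal_linDual, ht]
    exact ha
  · have hH : ∃ H : LinFn I FB B, H.1 ⟨κ.proj, b⟩ ≠ 0 := by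
      by_contra! h
      exact hb (eq_of_fibreLinear I FB fun H hH => (h ⟨H, hH⟩).trans (hH κ.proj).map_zero.symm)
    obtain ⟨H, hH⟩ := hH
    refine ⟨𝔻.flip.vertDual H, (hval y).trans hker, ?_⟩
    rw [hval, 𝔻.flip.fibreVal_vertDual]
    exact hH

variable {LA : LieAlgebroid (Fn I M) (Sec I FA A)} {LB : LieAlgebroid (Fn I M) (Sec I FB B)}
  {LDA : LieAlgebroid (Fn (I.prod 𝓘(ℝ, FA)) (TotalSpace FA A))
      (Sec (I.prod 𝓘(ℝ, FA)) GA (Over FA D))}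
  {LDB : LieAlgebroid (Fn (I.prod 𝓘(ℝ, FB)) (TotalSpace FB B))
      (Sec (I.prod 𝓘(ℝ, FB)) GB (Over FB (flipD D)))}
  {SA : TwoRep LA (Sec I FC C) (Sec I FB B)} {TB : TwoRep LB (Sec I FC C) (Sec I FA A)}

/-- The relations of `DoubleVectorBundle.dualRelations` for `D^*B^*C^*`. -/
theorem dualRelations_flip {L' : LieAlgebroid (FnDual I FC C) 𝔻.flip.dualSec}
    (hL' : 𝔻.flip.IsDualLieAlgebroid LDB L') (hS : 𝔻.flip.IsInducedTwoRep (S.flip 𝔻) LDB SA) :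
    DualRelations SA L' (-(𝔻.dualPairing S).flip) (pullHom I (FC →L[ℝ] ℝ) (DualFibre C)) ellHom
      (LinFn.ev (I := I) (FA := FB) (A := B)) (LinFn.ev (I := I) (FA := FA) (A := A))
      (𝔻.flip.linDual (S.flip 𝔻)) 𝔻.flip.vertDual (𝔻.linDual S) 𝔻.vertDual := by
  rw [← dualPairing_flip]
  exact 𝔻.flip.dualRelations (S.flip 𝔻) hL' hS

theorem isMatchedPair_of_isDoubleLieAlgebroid
    (hrank : Module.finrank ℝ FA + Module.finrank ℝ FB ≠ 1)
    (hS : 𝔻.flip.IsInducedTwoRep (S.flip 𝔻) LDB SA) (hT : 𝔻.IsInducedTwoRep S LDA TB)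
    (h : 𝔻.IsDoubleLieAlgebroid LA LB LDA LDB) : IsMatchedPair SA TB := by
  -- The rank is 0 or at least 2. In rank 0 the conditions hold without using the bialgebroid, and
  -- the remaining case meets the rank hypotheses of the algebraic statement.
  by_cases h0 : Module.finrank ℝ FA + Module.finrank ℝ FB = 0
  · have hFA : Subsingleton FA := Module.finrank_zero_iff.1 (by omega : Module.finrank ℝ FA = 0)
    have hFB : Subsingleton FB := Module.finrank_zero_iff.1 (by omega : Module.finrank ℝ FB = 0)
    have hsA : ∀ m, Subsingleton (A m) := fun m =>
      ((trivializationAt FA A m).continuousLinearEquivAt ℝ m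
        (FiberBundle.mem_baseSet_trivializationAt' m)).toEquiv.subsingleton
    have hsB : ∀ m, Subsingleton (B m) := fun m =>
      ((trivializationAt FB B m).continuousLinearEquivAt ℝ m
        (FiberBundle.mem_baseSet_trivializationAt' m)).toEquiv.subsingleton
    have : Subsingleton (Sec I FA A) := ⟨fun s t => ContMDiffSection.ext fun m =>
      Subsingleton.elim _ _⟩
    have : Subsingleton (Sec I FB B) := ⟨fun s t => ContMDiffSection.ext fun m =>
      Subsingleton.elim _ _⟩
    exact IsMatchedPair.of_subsingleton SA TB
  · have h2 : 2 ≤ Module.finrank ℝ FA + Module.finrank ℝ FB := by omega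
    obtain ⟨L, L', p, hL, hL', hp, hbi⟩ := h.bialgebroid
    -- Uniqueness of the duality allows the given pairing to be replaced by the one computed from
    -- the splitting.
    obtain rfl := (𝔻.isDuality_iff S p).1 hp
    refine (𝔻.dualRelations S hL hT).isMatchedPair_of_isLieBialgebroid
      (𝔻.dualRelations_flip S hL' hS) pull_injective ellHom_injective
      (fun a => LinFn.eq_zero_of_ev) (fun b => LinFn.eq_zero_of_ev) (fun k hk => ?_)
      (fun t ht => ?_) hbi
    · refine ContMDiffMap.ext fun κ => ?_
      obtain ⟨x, y, -, hxy⟩ := 𝔻.exists_pairing_ne_zero S h2 0 κ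
      have h3 := congrArg (fun f : FnDual I FC C => f κ) (hk x y)
      exact (mul_eq_zero.1 h3).resolve_left hxy
    · refine LinearMap.ext fun y => ContMDiffMap.ext fun κ => ?_
      obtain ⟨x, y', hy, hxy⟩ := 𝔻.exists_pairing_ne_zero S h2 y κ
      have h3 : t y κ * 𝔻.dualPairing S x y' κ = t y' κ * 𝔻.dualPairing S x y κ :=
        congrArg (fun f : FnDual I FC C => f κ) (ht x y y')
      rw [hy, mul_zero] at h3
      exact (mul_eq_zero.1 h3).resolve_right hxy

theorem isDoubleLieAlgebroid_of_isMatchedPair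
    (hA : 𝔻.IsVBAlgebroid LDA LB) (hB : 𝔻.flip.IsVBAlgebroid LDB LA)
    (hS : 𝔻.flip.IsInducedTwoRep (S.flip 𝔻) LDB SA) (hT : 𝔻.IsInducedTwoRep S LDA TB)
    (hm : IsMatchedPair SA TB) : 𝔻.IsDoubleLieAlgebroid LA LB LDA LDB := by
  obtain ⟨L, hL⟩ := 𝔻.exists_isDualLieAlgebroid S hA hT
  obtain ⟨L', hL'⟩ := 𝔻.flip.exists_isDualLieAlgebroid (S.flip 𝔻) hB hS
  refine ⟨hA, hB, L, L', 𝔻.dualPairing S, hL, hL', 𝔻.isDuality_dualPairing S, ?_⟩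
  exact (𝔻.dualRelations S hL hT).isLieBialgebroid_of_isMatchedPair
    (𝔻.dualRelations_flip S hL' hS) (𝔻.isPerfPair_dualPairing S)
    (fun δ h₁ h₂ => derivation_dual_ext h₁ h₂) hm

end DoubleVectorBundle

end DoubleVectorBundle

end DoubleLie

end

open Bundle DoubleLie
open scoped Manifold ContDiff

theorem theorem3p3
    {E H M : Type*} [NormedAddCommGroup E] [NormedSpace ℝ E] [FiniteDimensional ℝ E]
    [TopologicalSpace H] (I : ModelWithCorners ℝ E H) [I.Boundaryless]
    [TopologicalSpace M] [ChartedSpace H M] [IsManifold I ∞ M] [T2Space M] [SigmaCompactSpace M]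
    {FA : Type*} [NormedAddCommGroup FA] [NormedSpace ℝ FA] [FiniteDimensional ℝ FA]
    {FB : Type*} [NormedAddCommGroup FB] [NormedSpace ℝ FB] [FiniteDimensional ℝ FB]
    {FC : Type*} [NormedAddCommGroup FC] [NormedSpace ℝ FC] [FiniteDimensional ℝ FC]
    {GA : Type*} [NormedAddCommGroup GA] [NormedSpace ℝ GA] [FiniteDimensional ℝ GA]
    {GB : Type*} [NormedAddCommGroup GB] [NormedSpace ℝ GB] [FiniteDimensional ℝ GB]
    -- the vector bundles `A`, `B`, `C` over `M`
    {A : M → Type*} [TopologicalSpace (TotalSpace FA A)] [∀ m, TopologicalSpace (A m)]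
    [∀ m, AddCommGroup (A m)] [∀ m, Module ℝ (A m)] [FiberBundle FA A] [VectorBundle ℝ FA A]
    [ContMDiffVectorBundle ∞ FA A I]
    {B : M → Type*} [TopologicalSpace (TotalSpace FB B)] [∀ m, TopologicalSpace (B m)]
    [∀ m, AddCommGroup (B m)] [∀ m, Module ℝ (B m)] [FiberBundle FB B] [VectorBundle ℝ FB B]
    [ContMDiffVectorBundle ∞ FB B I]
    {C : M → Type*} [TopologicalSpace (TotalSpace FC C)] [∀ m, TopologicalSpace (C m)]
    [∀ m, AddCommGroup (C m)] [∀ m, Module ℝ (C m)] [FiberBundle FC C] [VectorBundle ℝ FC C]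
    [ContMDiffVectorBundle ∞ FC C I]
    -- the vector bundles `D → A` and `D → B`
    {D : ∀ m, A m → B m → Type*}
    [TopologicalSpace (TotalSpace GA (Over FA D))] [∀ p, TopologicalSpace (Over FA D p)]
    [∀ p, AddCommGroup (Over FA D p)] [∀ p, Module ℝ (Over FA D p)]
    [FiberBundle GA (Over FA D)] [VectorBundle ℝ GA (Over FA D)]
    [ContMDiffVectorBundle ∞ GA (Over FA D) (I.prod 𝓘(ℝ, FA))]
    [TopologicalSpace (TotalSpace GB (Over FB (flipD D)))]
    [∀ p, TopologicalSpace (Over FB (flipD D) p)]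
    [∀ p, AddCommGroup (Over FB (flipD D) p)] [∀ p, Module ℝ (Over FB (flipD D) p)]
    [FiberBundle GB (Over FB (flipD D))] [VectorBundle ℝ GB (Over FB (flipD D))]
    [ContMDiffVectorBundle ∞ GB (Over FB (flipD D)) (I.prod 𝓘(ℝ, FB))]
    -- the double vector bundle, its VB-algebroid structures, and a linear splitting
    (𝔻 : DoubleVectorBundle I FA FB FC GA GB C D)
    (LA : LieAlgebroid (Fn I M) (Sec I FA A)) (LB : LieAlgebroid (Fn I M) (Sec I FB B))
    (LDA : LieAlgebroid (Fn (I.prod 𝓘(ℝ, FA)) (TotalSpace FA A))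
      (Sec (I.prod 𝓘(ℝ, FA)) GA (Over FA D)))
    (LDB : LieAlgebroid (Fn (I.prod 𝓘(ℝ, FB)) (TotalSpace FB B))
      (Sec (I.prod 𝓘(ℝ, FB)) GB (Over FB (flipD D))))
    (hA : 𝔻.IsVBAlgebroid LDA LB) (hB : 𝔻.flip.IsVBAlgebroid LDB LA)
    (S : LinearSplitting I FA FB GA D)
    (hrank : Module.finrank ℝ FA + Module.finrank ℝ FB ≠ 1) :
    (∃! SA : TwoRep LA (Sec I FC C) (Sec I FB B),
      𝔻.flip.IsInducedTwoRep (S.flip 𝔻) LDB SA) ∧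
    (∃! TB : TwoRep LB (Sec I FC C) (Sec I FA A), 𝔻.IsInducedTwoRep S LDA TB) ∧
    ∀ (SA : TwoRep LA (Sec I FC C) (Sec I FB B)) (TB : TwoRep LB (Sec I FC C) (Sec I FA A)),
      𝔻.flip.IsInducedTwoRep (S.flip 𝔻) LDB SA → 𝔻.IsInducedTwoRep S LDA TB →
        (𝔻.IsDoubleLieAlgebroid LA LB LDA LDB ↔ IsMatchedPair SA TB) := by
  refine ⟨hB.existsUnique_twoRep (S.flip 𝔻), hA.existsUnique_twoRep S, fun SA TB hS hT => ⟨?_, ?_⟩⟩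
  · exact 𝔻.isMatchedPair_of_isDoubleLieAlgebroid S hrank hS hT
  · exact 𝔻.isDoubleLieAlgebroid_of_isMatchedPair S hA hB hS hT
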